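/- Let $k\in\mathbb C$, $k\neq 0,-2$, and let $\hbar$ be a formal variable. Let $\alpha_n,\beta_n,\gamma_n$ ($n\in\mathbb Z\setminus\{0\}$) and $P_X,Q_X$ ($X=\alpha,\beta,\gamma$) satisfy $[X_m,X_n]=\kappa_X m\,\delta_{m+n,0}$, $[P_X,Q_X]=\kappa_X$ with $\kappa_\alpha=\frac{k+2}{2}$, $\kappa_\beta=-\frac k2$, $\kappa_\gamma=\frac k2$, all other commutators being zero; put $X_0=P_X$. For $l,s,t\in\mathbb C$ let $F_{l,s,t}$ be the Fock space generated by the creation operators $X_{-n}$, $n>0$, from the vacuum $|l;s,t\rangle=e^{\frac{l}{k+2}Q_\alpha-\frac sk Q_\beta+\frac tk Q_\gamma}|0\rangle$, where $X_n|0\rangle=P_X|0\rangle=0$ for $n>0$. Put $$X(u;A,B)=\sum_{n>0}\tfrac{X_{-n}}{n}(u+A\hbar)^n-\sum_{n>0}\tfrac{X_n}{n}(u+B\hbar)^{-n}+\log(u+B\hbar)P_X+Q_X ,$$ where negative powers and logarithms are expanded in $\hbar/u$, and let $:\ :$ denote normal ordering ($X_n$, $n>0$, and $P_X$ to the right of $X_{-n}$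 and $Q_X$). Define $$e(u)=-\tfrac1\hbar:\Bigl[e^{\sum_{n>0}\frac{\alpha_n+\beta_n}{n}[(u-(k+1)\hbar)^{-n}-(u-(k+2)\hbar)^{-n}]}\Bigl(\tfrac{u-(k+2)\hbar}{u-(k+1)\hbar}\Bigr)^{P_\alpha+P_\beta}-e^{\sum_{n>0}\frac{\alpha_{-n}+\beta_{-n}}{n}[(u-(k+1)\hbar)^{n}-(u-(k+2)\hbar)^{n}]}\Bigr]e^{\frac2k(\beta+\gamma)(u;-(k+1),-(k+2))}:,$$ $$f(u)=\tfrac1\hbar:\Bigl[e^{\sum_{n>0}\frac{\alpha_n+\beta_n}{n}[(u-2\hbar)^{-n}-(u-\hbar)^{-n}]}\Bigl(\tfrac{u-\hbar}{u-2\hbar}\Bigr)^{P_\alpha+P_\beta}e^{\sum_{n>0}\frac{\gamma_n}{n}[(u-2\hbar)^{-n}-u^{-n}]}\Bigl(\tfrac{u}{u-2\hbar}\Bigr)^{P_\gamma}e^{-\frac2k(\beta+\gamma)(u;-1,-2)}$$ $$\qquad-e^{\sum_{n>0}\frac{\alpha_{-n}+\beta_{-n}}{n}[(u-(k+2)\hbar)^{n}-(u-(k+3)\hbar)^{n}]}e^{\sum_{n>0}\frac{2\alpha_{-n}}{(k+2)n}[(u-(k+3)\hbar)^{n}-(u-\hbar)^{n}]}e^{-\frac2k(\beta+\gamma)(u;-1,-(k+2))}\Bigr]:,$$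 $$h^+(u)=e^{\sum_{n>0}\frac{\gamma_n}{n}[(u-(k+2)\hbar)^{-n}-(u-k\hbar)^{-n}]}\Bigl(\tfrac{u-k\hbar}{u-(k+2)\hbar}\Bigr)^{P_\gamma},$$ $$h^-(u)=e^{\sum_{n>0}\frac{2}{nk}(\beta_{-n}+\gamma_{-n})[(u-(k+1)\hbar)^n-(u-\hbar)^n]}e^{-\sum_{n>0}\frac{\alpha_{-n}+\beta_{-n}}{n}[(u-(k+3)\hbar)^n-(u-(k+1)\hbar)^n]}e^{\sum_{n>0}\frac{2\alpha_{-n}}{(k+2)n}[(u-(k+3)\hbar)^n-(u-\hbar)^n]},$$ $d=\frac2{k+2}d_\alpha-\frac2kd_\beta+\frac2kd_\gamma$ with $d_X=X_{-1}P_X+\sum_{n>0}X_{-n-1}X_n$. Then these are well-defined formal fields in $u$ whose coefficients are formal power series in $\hbar$ with coefficients in the operators on the direct sum of the Fock spaces (in particular the two brackets above are divisible by $\hbar$). Coefficientwise, $e(u)$ maps $F_{l,s,t}$ to $F_{l,s-2,t+2}$, $f(u)$ maps it to $F_{l,s+2,t-2}$, and $h^\pm(u)$, $d$ preserve it. On $F_{l,s,t}$,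 with $\lambda=(s+t)/k$, the exponents of $e(u)$ lie in $\lambda+\mathbb Z$ and those of $f(u)$ in $-\lambda+\mathbb Z$; $h^+(u)\in 1+\hbar u^{-1}(\cdots)$ contains only powers $u^{-m}$, $m\ge 0$, and $h^-(u)\in1+\hbar(\cdots)$ only powers $u^m$, $m\ge0$. For all $l,s,t\in\mathbb C$ they satisfy on $F_{l,s,t}$ the defining relations of the centrally extended Yangian double $DY_\hbar(sl_2)$ with central charge $c=k$: $$[d,\chi(u)]=\tfrac{d}{du}\chi(u)\quad(\chi=e,f,h^\pm),\qquad e(u)e(v)=\tfrac{u-v+\hbar}{u-v-\hbar}e(v)e(u),\qquad f(u)f(v)=\tfrac{u-v-\hbar}{u-v+\hbar}f(v)f(u),$$ $$h^\pm(u)e(v)=\tfrac{u-v+\hbar}{u-v-\hbar}e(v)h^\pm(u),\qquad h^+(u)f(v)=\tfrac{u-v-(1+c)\hbar}{u-v+(1-c)\hbar}f(v)h^+(u),\qquad h^-(u)f(v)=\tfrac{u-v-\hbar}{u-v+\hbar}f(v)h^-(u),$$ $$[h^\pm(u),h^\pm(v)]=0,\qquad h^+(u)h^-(v)=\tfrac{u-v+\hbar}{u-v-\hbar}\,\tfrac{u-v-(1+c)\hbar}{u-v+(1-c)\hbar}h^-(v)h^+(u),$$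 $$[e(u),f(v)]=\tfrac1\hbar\bigl(\delta(u-(v+\hbar c))h^+(u)-\delta(u-v)h^-(v)\bigr),\qquad \delta(u-w)=\sum_{n\in\lambda+\mathbb Z}u^nw^{-n-1}$$ (for $\lambda\in\mathbb Z$, in particular for $s=-t$, this is the usual delta function; $(v+\hbar c)^{-n-1}$ is expanded in $\hbar$). The exchange relations hold in the sense of analytic continuation: after multiplication by the denominator on the left and the numerator on the right the two sides are the same formal series in $u,v,\hbar$, and, applied to a vector, at each order in $\hbar$ this series has exponents of $u$ and of $v$ bounded below. Moreover, as $\hbar\to0$ (i.e. modulo $\hbar$), $$e(u)\to E(u)=\,:\partial(\alpha+\beta)(u)\,e^{\frac2k(\beta+\gamma)(u)}:,\qquad f(u)\to F(u)=\,:\partial(\alpha-\beta)(u)\,e^{-\frac2k(\beta+\gamma)(u)}:,\qquad \tfrac1\hbar(h^+(u)-h^-(u))\to H(u)=2\,\partial\gamma(u),$$ where $X(u)=\sum_{n>0}\frac{X_{-n}}{n}u^n-\sum_{n>0}\frac{X_n}{n}u^{-n}+\log(u)P_X+Q_X$ and $\partial X(u)=\sum_{n\in\mathbb Z}X_nu^{-n-1}$.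 These are the Feigin–Fuchs currents of affine $sl(2)_k$: on every $F_{l,s,t}$, the coefficients $E_m,F_m,H_m$ of $u^{-m-1}$ ($m\in-\lambda+\mathbb Z$ for $E$, $m\in\lambda+\mathbb Z$ for $F$, $m\in\mathbb Z$ for $H$) satisfy $[H_m,H_n]=2km\,\delta_{m+n,0}$, $[H_m,E_n]=2E_{m+n}$, $[H_m,F_n]=-2F_{m+n}$, $[E_m,E_n]=[F_m,F_n]=0$, $[E_m,F_n]=H_{m+n}+km\,\delta_{m+n,0}$. -/

import Mathlib

/-! Free bosons, the Drinfeld currents built from them, and the relations of the centrally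
extended Yangian double over `ℂ[[ħ]]`.  The deformation parameter `ħ` is a formal variable. -/

namespace YangianFF

noncomputable section

/-! ### Formal series of operators -/

/-- Sum of a family of operators that is locally finite, i.e. such that every vector is killed by
all but finitely many members of the family (and `0` if the family is not locally finite). -/
def locSum {ι M : Type} [AddCommGroup M] [Module ℂ M] (T : ι → Module.End ℂ M) :
    Module.End ℂ M := by
  classical
  exact if h : ∀ x : M, (Function.support fun i => T i x).Finite then
    { toFun := fun x => ∑ᶠ i, T i x
      map_add' := fun x y => by
        simp only [map_add]
        exact finsum_add_distrib (h x) (h y)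
      map_smul' := fun c x => by
        simp only [map_smul, RingHom.id_apply]
        exact (smul_finsum' c (h x)).symm }
  else 0

/-- A formal field `a(u) = ∑_i a_i u^i`, with exponents `i ∈ ℂ` and coefficients
`a_i ∈ End(M)[[ħ]]`; `a i` is the coefficient of `u^i`. -/
abbrev Field1 (M : Type) [AddCommGroup M] [Module ℂ M] : Type :=
  ℂ → PowerSeries (Module.End ℂ M)

/-- A formal series `G(u,v) = ∑_{i,j} G_{i,j} u^i v^j`, with coefficients in `End(M)[[ħ]]`. -/
abbrev Field2 (M : Type) [AddCommGroup M] [Module ℂ M] : Type :=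
  ℂ → ℂ → PowerSeries (Module.End ℂ M)

section Relations

variable {M : Type} [AddCommGroup M] [Module ℂ M]

/-- The product `a(u) b(v)`. -/
def prodUV (a b : Field1 M) : Field2 M := fun i j => a i * b j

/-- The product `b(v) a(u)`. -/
def prodVU (a b : Field1 M) : Field2 M := fun i j => b j * a i

/-- `(u - v + r ħ) G(u,v)`. -/
def mulLin (r : ℂ) (G : Field2 M) : Field2 M :=
  fun i j => G (i - 1) j - G i (j - 1) + r • (PowerSeries.X * G i j)

/-- `∏_r (u - v + r ħ) · G(u,v)`, the product over the entries of the list. -/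
def mulLins (l : List ℂ) (G : Field2 M) : Field2 M := l.foldr mulLin G

/-- `G(u,v) x = G'(u,v) x` for all `x ∈ V`, coefficient by coefficient in `u`, `v`, `ħ`. -/
def EqOn2 (V : Submodule ℂ M) (G G' : Field2 M) : Prop :=
  ∀ (i j : ℂ) (N : ℕ), ∀ x ∈ V,
    PowerSeries.coeff N (G i j) x = PowerSeries.coeff N (G' i j) x

/-- At every order in `ħ`, the powers of `u` occurring in `a(u) x`, `x ∈ V`, are bounded below. -/
def IsFieldOn (V : Submodule ℂ M) (a : Field1 M) : Prop :=
  ∀ x ∈ V, ∀ N : ℕ, ∃ B : ℝ, ∀ i : ℂ, i.re < B → PowerSeries.coeff N (a i) x = 0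

/-- At every order in `ħ`, the powers of `u` and the powers of `v` occurring in `G(u,v) x`,
`x ∈ V`, are both bounded below: `G(u,v) x` has no singularity outside `u = 0` and `v = 0`. -/
def IsRegularOn (V : Submodule ℂ M) (G : Field2 M) : Prop :=
  ∀ x ∈ V, ∀ N : ℕ, ∃ B : ℝ, ∀ i j : ℂ, (i.re < B ∨ j.re < B) →
    PowerSeries.coeff N (G i j) x = 0

/-- The relation
`a(u) b(v) = (∏_{p ∈ num} (u-v+pħ) / ∏_{q ∈ den} (u-v+qħ)) b(v) a(u)` on `V`,
in the sense of analytic continuation: `G := ∏_{q ∈ den}(u-v+qħ) a(u)b(v)` and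
`∏_{p ∈ num}(u-v+pħ) b(v)a(u)` are the same series and `G` is regular away from `u = 0`, `v = 0`,
so that `a(u)b(v)` (a series for `|u| > |v|`) and `b(v)a(u)` (a series for `|v| > |u|`) are the
expansions of `G / ∏_{q}(u-v+qħ)` and `G / ∏_{p}(u-v+pħ)`. -/
def Exchange (V : Submodule ℂ M) (a b : Field1 M) (num den : List ℂ) : Prop :=
  EqOn2 V (mulLins den (prodUV a b)) (mulLins num (prodVU a b)) ∧
    IsRegularOn V (mulLins den (prodUV a b))

open Classical in
/-- The coefficient of `u^i v^j ħ^N` in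
`δ(u - (v + r ħ)) = ∑_{n} u^n (v + r ħ)^{-n-1}`, where `n` runs over `lam + ℤ` and where
`(v + r ħ)^{-n-1}` is expanded in powers of `ħ`. For `lam ∈ ℤ` this is the usual delta function
`∑_{n+m=-1} u^n w^m` at `w = v + r ħ`. -/
def deltaCoeff (lam r i j : ℂ) (N : ℕ) : ℂ :=
  if (∃ n : ℤ, i = lam + n) ∧ j = -i - 1 - N then Ring.choose (-i - 1) N * r ^ N else 0

/-- `δ(u - (v + r ħ)) a(u)`. -/
def deltaMulU (lam r : ℂ) (a : Field1 M) : Field2 M := fun i j =>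
  PowerSeries.mk fun N => ∑ n ∈ Finset.HasAntidiagonal.antidiagonal N,
    ∑ᶠ p : ℂ, deltaCoeff lam r (i - p) j n.1 • PowerSeries.coeff n.2 (a p)

/-- `δ(u - (v + r ħ)) a(v)`. -/
def deltaMulV (lam r : ℂ) (a : Field1 M) : Field2 M := fun i j =>
  PowerSeries.mk fun N => ∑ n ∈ Finset.HasAntidiagonal.antidiagonal N,
    ∑ᶠ p : ℂ, deltaCoeff lam r i (j - p) n.1 • PowerSeries.coeff n.2 (a p)

/-- `[d, a(u)] = (d/du) a(u)` on `V`. -/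
def TranslationOn (V : Submodule ℂ M) (d : Module.End ℂ M) (a : Field1 M) : Prop :=
  ∀ (i : ℂ) (N : ℕ), ∀ x ∈ V,
    (d * PowerSeries.coeff N (a i) - PowerSeries.coeff N (a i) * d) x =
      (i + 1) • PowerSeries.coeff N (a (i + 1)) x

/-- The currents `e(u), f(u), h^±(u)` and the operator `d` satisfy, on `V`, the defining relations
of the centrally extended Yangian double of `sl₂`, the central element acting by `c`.
The exponents of `e(u)` lie in `lam + ℤ` and those of `f(u)` in `-lam + ℤ`; the case `lam ∈ ℤ` is
the single valued one, where `e(u) = ∑_{m ∈ ℤ} e_m u^{-m-1}` and `f(u) = ∑_{m ∈ ℤ} f_m u^{-m-1}`. -/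
structure IsYangianDouble (c lam : ℂ) (V : Submodule ℂ M) (e f hp hm : Field1 M)
    (d : Module.End ℂ M) : Prop where
  field_e : IsFieldOn V e
  field_f : IsFieldOn V f
  field_hp : IsFieldOn V hp
  field_hm : IsFieldOn V hm
  /-- the powers of `u` occurring in `e(u)` and `f(u)` -/
  modes_e : ∀ (i : ℂ) (N : ℕ), (¬ ∃ n : ℤ, i = lam + n) →
    ∀ x ∈ V, PowerSeries.coeff N (e i) x = 0
  modes_f : ∀ (i : ℂ) (N : ℕ), (¬ ∃ n : ℤ, i = -lam + n) →
    ∀ x ∈ V, PowerSeries.coeff N (f i) x = 0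
  /-- `h⁺(u) = 1 + ħ ∑_{m ≥ 0} h_m u^{-m-1}` -/
  modes_hp : ∀ (i : ℂ) (N : ℕ), (¬ ∃ m : ℕ, i = -(m : ℂ) - 1) ∨ N = 0 →
    ∀ x ∈ V, PowerSeries.coeff N (hp i) x = if i = 0 ∧ N = 0 then x else 0
  /-- `h⁻(u) = 1 - ħ ∑_{m < 0} h_m u^{-m-1}` -/
  modes_hm : ∀ (i : ℂ) (N : ℕ), (¬ ∃ m : ℕ, i = (m : ℂ)) ∨ N = 0 →
    ∀ x ∈ V, PowerSeries.coeff N (hm i) x = if i = 0 ∧ N = 0 then x else 0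
  d_e : TranslationOn V d e
  d_f : TranslationOn V d f
  d_hp : TranslationOn V d hp
  d_hm : TranslationOn V d hm
  e_e : Exchange V e e [1] [-1]
  f_f : Exchange V f f [-1] [1]
  hp_e : Exchange V hp e [1] [-1]
  hm_e : Exchange V hm e [1] [-1]
  hp_f : Exchange V hp f [-(1 + c)] [1 - c]
  hm_f : Exchange V hm f [-1] [1]
  hp_hp : Exchange V hp hp [] []
  hm_hm : Exchange V hm hm [] []
  hp_hm : Exchange V hp hm [1, -(1 + c)] [-1, 1 - c]
  /-- `ħ [e(u), f(v)] = δ(u - (v + ħ c)) h⁺(u) - δ(u - v) h⁻(v)` -/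
  e_f : EqOn2 V (fun i j => PowerSeries.X * (prodUV e f i j - prodVU e f i j))
    (fun i j => deltaMulU lam c hp i j - deltaMulV lam 0 hm i j)

/-- The currents `E(u) = ∑ E_i u^i`, `F(u) = ∑ F_i u^i` (exponents in `lam + ℤ`, `-lam + ℤ`) and
`H(u) = ∑_{m ∈ ℤ} H_m u^{-m-1}` satisfy, on `V`, the relations of the affine Lie algebra of `sl₂`
at level `k`. In terms of the modes `E_{(m)} = E_{-m-1}`, `F_{(n)} = F_{-n-1}` these are
`[H_m, H_n] = 2 k m δ_{m+n,0}`, `[H_m, E_{(n)}] = 2 E_{(m+n)}`, `[H_m, F_{(n)}] = -2 F_{(m+n)}`,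
`[E_{(m)}, F_{(n)}] = H_{m+n} + k m δ_{m+n,0}`. -/
structure IsAffineSl2 (k lam : ℂ) (V : Submodule ℂ M) (E F : ℂ → Module.End ℂ M)
    (H : ℤ → Module.End ℂ M) : Prop where
  modes_E : ∀ i : ℂ, (¬ ∃ n : ℤ, i = lam + n) → ∀ x ∈ V, E i x = 0
  modes_F : ∀ i : ℂ, (¬ ∃ n : ℤ, i = -lam + n) → ∀ x ∈ V, F i x = 0
  H_H : ∀ m n : ℤ, ∀ x ∈ V,
    (H m * H n - H n * H m) x = if m + n = 0 then (2 * k * m) • x else 0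
  H_E : ∀ (m : ℤ) (i : ℂ), ∀ x ∈ V, (H m * E i - E i * H m) x = (2 : ℂ) • E (i - m) x
  H_F : ∀ (m : ℤ) (i : ℂ), ∀ x ∈ V, (H m * F i - F i * H m) x = (-2 : ℂ) • F (i - m) x
  E_E : ∀ i j : ℂ, ∀ x ∈ V, (E i * E j - E j * E i) x = 0
  F_F : ∀ i j : ℂ, ∀ x ∈ V, (F i * F j - F j * F i) x = 0
  E_F : ∀ i j : ℤ, ∀ x ∈ V,
    (E (lam + i) * F (-lam + j) - F (-lam + j) * E (lam + i)) x =
      H (-i - j - 2) x + if i + j = -2 then (k * (-(lam + i) - 1)) • x else 0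

end Relations

/-! ### The three free bosons and their Fock spaces -/

/-- The three bosons. -/
inductive Boson : Type
  | alpha
  | beta
  | gamma
  deriving DecidableEq

open Boson

/-- The constant in `[X_m, X_n] = κ_X m δ_{m+n,0}`, `[P_X, Q_X] = κ_X`. -/
def kappa (k : ℂ) : Boson → ℂ
  | alpha => (k + 2) / 2
  | beta => -k / 2
  | gamma => k / 2

/-- Polynomials in the creation operators; the variable `(X, n)` stands for `X_{-(n+1)}`. -/
abbrev Osc : Type := MvPolynomial (Boson × ℕ) ℂ

/-- The direct sum of the Fock spaces over all charges; a charge `p : Boson → ℂ` records the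
eigenvalues of `P_α`, `P_β`, `P_γ`. -/
abbrev Fk : Type := (Boson → ℂ) →₀ Osc

/-- Operators on the Fock space. -/
abbrev Op : Type := Module.End ℂ Fk

/-- The momentum `P_X`. -/
def momentum (X : Boson) : Op := Finsupp.lsum ℂ fun p => p X • Finsupp.lsingle p

/-- The modes `X_n`, `n ∈ ℤ`, with `X_0 = P_X`: `X_{-(n+1)}` is a multiplication operator, and
`X_{n+1}` is `κ_X (n+1)` times the derivative with respect to `X_{-(n+1)}`. -/
def mode (k : ℂ) (X : Boson) : ℤ → Op
  | Int.ofNat 0 => momentum X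
  | Int.ofNat (n + 1) => (kappa k X * (n + 1)) •
      Finsupp.mapRange.linearMap (MvPolynomial.pderiv (R := ℂ) (X, n)).toLinearMap
  | Int.negSucc n => Finsupp.mapRange.linearMap (LinearMap.mulLeft ℂ (MvPolynomial.X (X, n)))

/-- `exp(∑_X r_X Q_X)`, which shifts the eigenvalue of `P_X` by `κ_X r_X`. -/
def expQ (k : ℂ) (r : Boson → ℂ) : Op :=
  Finsupp.lmapDomain Osc ℂ fun p X => p X + kappa k X * r X

/-- The Fock space `F_{l,s,t}`, built on the vacuum
`|l;s,t⟩ = exp(l/(k+2) Q_α - s/k Q_β + t/k Q_γ)|0⟩`. -/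
def fock (k l s t : ℂ) : Submodule ℂ Fk :=
  LinearMap.range (Finsupp.lsingle (R := ℂ) (M := Osc) (fun X : Boson =>
    kappa k X * (match X with
      | alpha => l / (k + 2)
      | beta => -s / k
      | gamma => t / k)))

/-- Projection to the charges on which `∑_X r_X P_X` takes the value `ν`, i.e. the coefficient of
`u^ν` in `u^{∑_X r_X P_X}`. -/
def powP (r : Boson → ℂ) (ν : ℂ) : Op := by
  classical
  exact Finsupp.lsum ℂ fun p =>
    if r alpha * p alpha + r beta * p beta + r gamma * p gamma = ν then Finsupp.lsingle p else 0

/-! ### Normal ordered exponentials -/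

/-- Operator valued formal power series in two variables. The variable `1` is `ħ`. The variable
`0` is `u` in series of creation operators and `w = u⁻¹` in series of annihilation operators. -/
abbrev Ser : Type := MvPowerSeries (Fin 2) Op

/-- The exponent of the monomial `u^i ħ^n` (or `w^i ħ^n`). -/
def expo (i n : ℕ) : Fin 2 →₀ ℕ := Finsupp.single 0 i + Finsupp.single 1 n

/-- The series `1 + B ħ w`. -/
def oneAdd (B : ℂ) : MvPowerSeries (Fin 2) ℂ :=
  1 + MvPowerSeries.C B * (MvPowerSeries.X 1 * MvPowerSeries.X 0)

/-- The series `log(1 + B ħ w) = ∑_{m > 0} (-1)^{m+1} B^m ħ^m w^m / m`. -/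
def logOneAdd (B : ℂ) : MvPowerSeries (Fin 2) ℂ := fun d =>
  if d 0 = d 1 ∧ 0 < d 0 then (-1) ^ (d 0 + 1) * B ^ d 0 / (d 0 : ℂ) else 0

/-- `∑_{n>0} (X_{-n}/n) (u + A ħ)^n`. In the degree `d` only `n ≤ d 0 + d 1` contributes. -/
def posPart (k : ℂ) (X : Boson) (A : ℂ) : Ser := fun d =>
  ∑ n ∈ Finset.Icc 1 (d 0 + d 1),
    (MvPowerSeries.coeff d
      ((MvPowerSeries.X 0 + MvPowerSeries.C A * MvPowerSeries.X 1) ^ n) / (n : ℂ)) •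
        mode k X (-(n : ℤ))

/-- `-∑_{n>0} (X_n/n) (u + B ħ)^{-n} + log((u + B ħ)/u) P_X`, expanded in `w = u⁻¹`, so that
`(u + B ħ)^{-n} = w^n (1 + B ħ w)^{-n}`. In the degree `d` only `n ≤ d 0 + d 1` contributes.
Together with `u^{P_X}`, which is kept apart (see `vertex`), this is the part of `X(u; A, B)` that
is moved to the right by normal ordering. -/
def negPart (k : ℂ) (X : Boson) (B : ℂ) : Ser := fun d =>
  MvPowerSeries.coeff d (logOneAdd B) • momentum X -
    ∑ n ∈ Finset.Icc 1 (d 0 + d 1),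
      (MvPowerSeries.coeff d (MvPowerSeries.X 0 ^ n * (oneAdd B)⁻¹ ^ n) / (n : ℂ)) •
        mode k X (n : ℤ)

/-- `exp T = ∑_m T^m / m!` for a series `T` without constant term, so that in the degree `d` only
`m ≤ d 0 + d 1` contributes. -/
def expSer (T : Ser) : Ser := fun d =>
  ∑ m ∈ Finset.range (d 0 + d 1 + 1), ((m.factorial : ℂ)⁻¹) • MvPowerSeries.coeff d (T ^ m)

/-- The normal ordered exponential
`: exp(C(u)) exp(∑_X r_X (log(u) P_X + Q_X)) exp(A(u⁻¹)) :
  = exp(C(u)) e^{∑ r_X Q_X} u^{∑ r_X P_X} exp(A(u⁻¹))`,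
where `C` involves creation operators, and `A` involves annihilation operators and the `P_X`. -/
def vertex (k : ℂ) (C : Ser) (r : Boson → ℂ) (A : Ser) : Field1 Fk := fun a =>
  PowerSeries.mk fun N => locSum fun ij : ℕ × ℕ => ∑ n ∈ Finset.HasAntidiagonal.antidiagonal N,
    MvPowerSeries.coeff (expo ij.1 n.1) (expSer C) * expQ k r *
      powP r (a - ij.1 + ij.2) * MvPowerSeries.coeff (expo ij.2 n.2) (expSer A)

/-- Division by `ħ` of a field that is divisible by `ħ`. -/
def divHbar (a : Field1 Fk) : Field1 Fk := fun i =>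
  PowerSeries.mk fun N => PowerSeries.coeff (N + 1) (a i)

/-! ### The currents -/

/-- The coefficients of `Q_X` in `r (Q_β + Q_γ)`. -/
def zeroBG (r : ℂ) : Boson → ℂ
  | alpha => 0
  | beta => r
  | gamma => r

/-- creation part of `(X + Y)(u; A, B)` -/
def pos2 (k : ℂ) (X Y : Boson) (A : ℂ) : Ser := posPart k X A + posPart k Y A

/-- annihilation part of `(X + Y)(u; A, B)` without `log(u) (P_X + P_Y)` -/
def neg2 (k : ℂ) (X Y : Boson) (B : ℂ) : Ser := negPart k X B + negPart k Y B

/-- The first term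
`:exp{∑_{n>0} (α_n+β_n)/n [(u-(k+1)ħ)^{-n} - (u-(k+2)ħ)^{-n}]}
  ((u-(k+2)ħ)/(u-(k+1)ħ))^{P_α+P_β} exp{(2/k)(β+γ)(u;-(k+1),-(k+2))}:` of `-ħ e(u)`. -/
def eFirst (k : ℂ) : Field1 Fk :=
  vertex k ((2 / k) • pos2 k beta gamma (-(k + 1))) (zeroBG (2 / k))
    ((neg2 k alpha beta (-(k + 2)) - neg2 k alpha beta (-(k + 1)))
      + (2 / k) • neg2 k beta gamma (-(k + 2)))

/-- The second term
`:exp{∑_{n>0} (α_{-n}+β_{-n})/n [(u-(k+1)ħ)^n - (u-(k+2)ħ)^n]}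
  exp{(2/k)(β+γ)(u;-(k+1),-(k+2))}:` of `-ħ e(u)`. -/
def eSecond (k : ℂ) : Field1 Fk :=
  vertex k ((pos2 k alpha beta (-(k + 1)) - pos2 k alpha beta (-(k + 2)))
      + (2 / k) • pos2 k beta gamma (-(k + 1))) (zeroBG (2 / k))
    ((2 / k) • neg2 k beta gamma (-(k + 2)))

/-- The current `e(u)`. -/
def currentE (k : ℂ) : Field1 Fk := divHbar (-(eFirst k - eSecond k))

/-- The first term
`:exp{∑_{n>0} (α_n+β_n)/n [(u-2ħ)^{-n} - (u-ħ)^{-n}]} ((u-ħ)/(u-2ħ))^{P_α+P_β}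
  exp{∑_{n>0} γ_n/n [(u-2ħ)^{-n} - u^{-n}]} (u/(u-2ħ))^{P_γ}
  exp{-(2/k)(β+γ)(u;-1,-2)}:` of `ħ f(u)`. -/
def fFirst (k : ℂ) : Field1 Fk :=
  vertex k ((-(2 / k)) • pos2 k beta gamma (-1)) (zeroBG (-(2 / k)))
    ((neg2 k alpha beta (-1) - neg2 k alpha beta (-2))
      + (negPart k gamma 0 - negPart k gamma (-2))
      + (-(2 / k)) • neg2 k beta gamma (-2))

/-- The second term
`:exp{∑_{n>0} (α_{-n}+β_{-n})/n [(u-(k+2)ħ)^n - (u-(k+3)ħ)^n]}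
  exp{∑_{n>0} 2α_{-n}/((k+2)n) [(u-(k+3)ħ)^n - (u-ħ)^n]}
  exp{-(2/k)(β+γ)(u;-1,-(k+2))}:` of `ħ f(u)`. -/
def fSecond (k : ℂ) : Field1 Fk :=
  vertex k ((pos2 k alpha beta (-(k + 2)) - pos2 k alpha beta (-(k + 3)))
      + (2 / (k + 2)) • (posPart k alpha (-(k + 3)) - posPart k alpha (-1))
      + (-(2 / k)) • pos2 k beta gamma (-1)) (zeroBG (-(2 / k)))
    ((-(2 / k)) • neg2 k beta gamma (-(k + 2)))

/-- The current `f(u)`. -/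
def currentF (k : ℂ) : Field1 Fk := divHbar (fFirst k - fSecond k)

/-- `h⁺(u) = exp{∑_{n>0} γ_n/n [(u-(k+2)ħ)^{-n} - (u-kħ)^{-n}]} ((u-kħ)/(u-(k+2)ħ))^{P_γ}`. -/
def hPlus (k : ℂ) : Field1 Fk :=
  vertex k 0 0 (negPart k gamma (-k) - negPart k gamma (-(k + 2)))

/-- `h⁻(u) = exp{∑_{n>0} 2/(nk) (β_{-n}+γ_{-n}) [(u-(k+1)ħ)^n - (u-ħ)^n]}
  exp{-∑_{n>0} (α_{-n}+β_{-n})/n [(u-(k+3)ħ)^n - (u-(k+1)ħ)^n]}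
  exp{∑_{n>0} 2α_{-n}/((k+2)n) [(u-(k+3)ħ)^n - (u-ħ)^n]}`. -/
def hMinus (k : ℂ) : Field1 Fk :=
  vertex k ((2 / k) • (pos2 k beta gamma (-(k + 1)) - pos2 k beta gamma (-1))
      - (pos2 k alpha beta (-(k + 3)) - pos2 k alpha beta (-(k + 1)))
      + (2 / (k + 2)) • (posPart k alpha (-(k + 3)) - posPart k alpha (-1))) 0 0

/-- `d_X = X_{-1} P_X + ∑_{n>0} X_{-n-1} X_n`. -/
def dBoson (k : ℂ) (X : Boson) : Op :=
  mode k X (-1) * momentum X +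
    locSum fun n : ℕ => mode k X (-(n + 1 : ℤ) - 1) * mode k X (n + 1 : ℤ)

/-- `d = 2/(k+2) d_α - 2/k d_β + 2/k d_γ`. -/
def dOp (k : ℂ) : Op :=
  (2 / (k + 2)) • dBoson k alpha - (2 / k) • dBoson k beta + (2 / k) • dBoson k gamma

/-! ### The Feigin–Fuchs currents -/

/-- The undeformed vertex operator `:exp{r (β+γ)(u)}:`, where
`X(u) = ∑_{n>0} (X_{-n}/n) u^n - ∑_{n>0} (X_n/n) u^{-n} + log(u) P_X + Q_X`. -/
def vertex0 (k r : ℂ) (i : ℂ) : Op :=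
  PowerSeries.coeff 0
    (vertex k (r • pos2 k beta gamma 0) (zeroBG r) (r • neg2 k beta gamma 0) i)

/-- The coefficient of `u^i` in `:∂(α + σβ)(u) exp{r (β+γ)(u)}:`, where
`∂X(u) = ∑_{n ∈ ℤ} X_n u^{-n-1}`. -/
def ffCurrent (k σ r : ℂ) (i : ℂ) : Op :=
  locSum fun n : ℕ =>
    (mode k alpha (-(n : ℤ) - 1) + σ • mode k beta (-(n : ℤ) - 1)) * vertex0 k r (i - n) +
      vertex0 k r (i + n + 1) * (mode k alpha n + σ • mode k beta n)

end

end YangianFF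

/-!
The proof rests on one principle. The Fock space of the free bosons is irreducible: an operator is
determined by its commutators with the modes `X_n` and by its matrix coefficients between vacuum
vectors (`Covariant.eq_zero`, `Covariant.eq`). All operators here are coefficients of formal series,
so the principle is stated for formal distributions (`Dist`), on which power series in `ħ` with
coefficients in the group algebra of the exponents act (`Mult`). In particular the powers
`(u + Bħ)^x` with complex `x`, expanded in `ħ`, are multipliers (`pw`), and the commutator of a
normal ordered exponential `V(u)` with a mode is a multiple of `V(u)` by a sum of such powers
(`field_covariant`).

Exchange relations. The products `a(u) b(v)` and `b(v) a(u)` of two normal ordered exponentials have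
the same commutators with the modes, so only the vacuum matrix coefficients have to be compared. They
are products of powers of `u + Bħ` and `v + Bħ` with a contraction, a power series in `v` and `ħ`
over the Laurent polynomials in `u`. The logarithmic Euler derivative of the contraction is a
sum over pairs of terms in the two exponents (`euler_contraction`), and since a power series is
determined by such a differential equation, the contraction is the rational function in
`u - v + rħ` predicted by the pairing of the exponents (`contraction_mul_prod`). This gives all
exchange relations of the four pieces of `e` and `f` and of `h^±` (`commutes_field`). The regularity
that is part of an exchange relation is automatic for fields (`Commutes.exchange`).

The commutator `[e(u), f(v)]`. Of the four pairs of pieces of `e` and `f` two commute, and each of the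
other two has a contraction with a single pole, so that the difference of the two expansions is a
delta function (`ofLaurent_add_swap`). On its support `v` may be replaced by `u - rħ`
(`inV_pw_smul_deltaU`, which is the Chu–Vandermonde identity), and the product of the two
exponentials becomes `h^+` or `h^-` (`comm_field`, `comm_currentE_currentF`).

Translation covariance. The operator `[d, V(u)] - V'(u)` has the same commutators with the modes as
`V(u)` itself and vanishing vacuum matrix coefficients (`translation_field`).

The limit. At order `ħ⁰` an exponential depends only on its charges (`ord_zero_eq`), which gives the
divisibility by `ħ` of the brackets in `e` and `f`. At order `ħ¹` the difference of the two pieces has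
the same commutators with the modes and the same vacuum matrix coefficients as a Feigin–Fuchs
current (`Descendant.eq`, `coeff_zero_currentE`, `coeff_zero_currentF`). The relations of the affine
Lie algebra are then the leading terms in `ħ` of the relations of the Yangian double, except for those
with `H`, which are commutators with the modes of `γ` (`isAffineSl2_ffCurrent`).
-/

namespace YangianFF

noncomputable section

set_option linter.unusedSectionVars false

open Finset.HasAntidiagonal

-- The definitions `Fk` and `Op` unfold to large terms; these instances shorten the search.
local instance instAddCommGroupFk : AddCommGroup Fk := Finsupp.instAddCommGroup

local instance instAddCommGroupOp : AddCommGroup Op := LinearMap.addCommGroup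

/-! ### Distributions and the ring acting on them -/

section Dist

variable {A : Type} [CommRing A] {Γ : Type} [AddCommGroup Γ] {W : Type} [AddCommGroup W] [Module A W]

/-- Translation of functions on `Γ`, i.e. multiplication of the formal sum `∑_x g(x) u^x` by the
monomial `u^s`. -/
def shiftHom (A Γ W : Type) [CommRing A] [AddCommGroup Γ] [AddCommGroup W] [Module A W] :
    Multiplicative Γ →* Module.End A (Γ → W) where
  toFun s :=
    { toFun := fun g x => g (x - s.toAdd)
      map_add' := fun _ _ => rfl
      map_smul' := fun _ _ => rfl }
  map_one' := by ext g x; simp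
  map_mul' s t := by
    ext g x
    simp only [LinearMap.coe_mk, AddHom.coe_mk, Module.End.mul_apply, toAdd_mul]
    congr 1; abel

/-- The action of the group algebra `A[Γ]` on functions on `Γ` by convolution. -/
def conv (A : Type) {Γ W : Type} [CommRing A] [AddCommGroup Γ] [AddCommGroup W] [Module A W] :
    AddMonoidAlgebra A Γ →ₐ[A] Module.End A (Γ → W) :=
  AddMonoidAlgebra.lift A _ Γ (shiftHom A Γ W)

@[simp] lemma conv_single (s : Γ) (z : A) (g : Γ → W) (x : Γ) :
    conv A (AddMonoidAlgebra.single s z) g x = z • g (x - s) := by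
  simp [conv, shiftHom, AddMonoidAlgebra.lift_single]

/-- Formal distributions: `G N x` is the coefficient of `ħ^N u^x`. -/
def Dist (Γ W : Type) : Type := ℕ → Γ → W

instance : AddCommGroup (Dist Γ W) := inferInstanceAs (AddCommGroup (ℕ → Γ → W))

/-- The multipliers of formal distributions: power series in `ħ` whose coefficients are finite sums
of monomials `u^x`, `x ∈ Γ`. -/
abbrev Mult (A Γ : Type) [CommRing A] [AddCommGroup Γ] : Type := PowerSeries (AddMonoidAlgebra A Γ)

instance : SMul (Mult A Γ) (Dist Γ W) :=
  ⟨fun κ G N => ∑ n ∈ antidiagonal N, conv A (PowerSeries.coeff n.1 κ) (G n.2)⟩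

lemma Dist.smul_apply (κ : Mult A Γ) (G : Dist Γ W) (N : ℕ) :
    (κ • G) N = ∑ n ∈ antidiagonal N, conv A (PowerSeries.coeff n.1 κ) (G n.2) := rfl

@[ext] lemma Dist.ext {G G' : Dist Γ W} (h : ∀ N x, G N x = G' N x) : G = G' :=
  funext fun N => funext fun x => h N x

@[simp] lemma Dist.add_apply (G G' : Dist Γ W) (N : ℕ) : (G + G') N = G N + G' N := rfl
@[simp] lemma Dist.neg_apply (G : Dist Γ W) (N : ℕ) : (-G) N = -G N := rfl
@[simp] lemma Dist.sub_apply (G G' : Dist Γ W) (N : ℕ) : (G - G') N = G N - G' N := rfl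
@[simp] lemma Dist.zero_apply (N : ℕ) : (0 : Dist Γ W) N = 0 := rfl

lemma sum_antidiagonal_assoc {B : Type} [AddCommMonoid B] (f : ℕ → ℕ → ℕ → B) (N : ℕ) :
    ∑ n ∈ antidiagonal N, ∑ m ∈ antidiagonal n.1, f m.1 m.2 n.2 =
      ∑ n ∈ antidiagonal N, ∑ m ∈ antidiagonal n.2, f n.1 m.1 m.2 := by
  rw [Finset.sum_sigma', Finset.sum_sigma']
  refine Finset.sum_nbij' (fun x => ⟨(x.2.1, x.2.2 + x.1.2), (x.2.2, x.1.2)⟩)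
    (fun x => ⟨(x.1.1 + x.2.1, x.2.2), (x.1.1, x.2.1)⟩) ?_ ?_ ?_ ?_ ?_ <;>
  rintro ⟨⟨a, b⟩, ⟨c, d⟩⟩ h <;>
  simp only [Finset.mem_sigma, mem_antidiagonal] at h ⊢ <;>
  obtain ⟨h1, h2⟩ := h
  · exact ⟨by rw [← h1, ← h2, add_assoc], trivial⟩
  · exact ⟨by rw [← h1, ← h2, add_assoc], trivial⟩
  · subst h2; rfl
  · subst h2; rfl

instance : Module (Mult A Γ) (Dist Γ W) where
  one_smul G := by
    funext N
    rw [Dist.smul_apply, Finset.sum_eq_single (0, N)]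
    · simp
    · rintro ⟨a, b⟩ h hne
      have : a ≠ 0 := by
        rintro rfl
        simp at h; simp [h] at hne
      simp [PowerSeries.coeff_one, this]
    · simp
  mul_smul κ κ' G := by
    funext N
    simp only [Dist.smul_apply, PowerSeries.coeff_mul, map_sum, map_mul, LinearMap.sum_apply,
      Module.End.mul_apply]
    exact sum_antidiagonal_assoc
      (fun a b c => conv A (PowerSeries.coeff a κ) (conv A (PowerSeries.coeff b κ') (G c))) N
  smul_zero κ := by funext N; simp [Dist.smul_apply]
  smul_add κ G G' := by funext N; simp [Dist.smul_apply, Finset.sum_add_distrib]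
  add_smul κ κ' G := by funext N; simp [Dist.smul_apply, Finset.sum_add_distrib]
  zero_smul G := by funext N; simp [Dist.smul_apply]

lemma Dist.C_smul_apply (a : AddMonoidAlgebra A Γ) (G : Dist Γ W) (N : ℕ) :
    ((PowerSeries.C a : Mult A Γ) • G) N = conv A a (G N) := by
  rw [Dist.smul_apply, Finset.sum_eq_single (0, N)]
  · simp
  · rintro ⟨a, b⟩ h hne
    have : a ≠ 0 := by
      rintro rfl
      simp at h; simp [h] at hne
    simp [PowerSeries.coeff_C, this]
  · simp

lemma Dist.X_smul_zero (G : Dist Γ W) :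
    ((PowerSeries.X : Mult A Γ) • G) 0 = 0 := by
  simp [Dist.smul_apply]

lemma Dist.X_smul_succ (G : Dist Γ W) (N : ℕ) :
    ((PowerSeries.X : Mult A Γ) • G) (N + 1) = G N := by
  rw [Dist.smul_apply, Finset.sum_eq_single (1, N)]
  · simp
  · rintro ⟨a, b⟩ h hne
    have : a ≠ 1 := by
      rintro rfl
      simp at h; apply hne; simp; omega
    simp [PowerSeries.coeff_X, this]
  · simp [add_comm]

end Dist

section Semilinear

variable {A A' : Type} [CommRing A] [CommRing A'] {Γ Γ' : Type} [AddCommGroup Γ] [AddCommGroup Γ']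
  {W W' : Type} [AddCommGroup W] [Module A W] [AddCommGroup W'] [Module A' W']

/-- The map of distributions that acts as `T` at every order in `ħ`. -/
def Dist.orderwise (T : (Γ → W) →+ (Γ' → W')) : Dist Γ W →+ Dist Γ' W' where
  toFun G := fun N => T (G N)
  map_zero' := funext fun _ => map_zero T
  map_add' _ _ := funext fun _ => map_add T _ _

lemma Dist.orderwise_apply (T : (Γ → W) →+ (Γ' → W')) (G : Dist Γ W) (N : ℕ) :
    Dist.orderwise T G N = T (G N) := rfl

/-- A map of distributions that acts order by order in `ħ`, and that is semilinear for monomials, is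
semilinear for all multipliers. -/
lemma Dist.semilinear (φ : AddMonoidAlgebra A Γ →+* AddMonoidAlgebra A' Γ')
    (T : (Γ → W) →+ (Γ' → W'))
    (h : ∀ s z g, T (conv A (AddMonoidAlgebra.single s z) g) =
      conv A' (φ (AddMonoidAlgebra.single s z)) (T g))
    (κ : Mult A Γ) (G : Dist Γ W) :
    Dist.orderwise T (κ • G) = (PowerSeries.map φ κ : Mult A' Γ') • Dist.orderwise T G := by
  have key : ∀ a g, T (conv A a g) = conv A' (φ a) (T g) := by
    intro a g
    induction a using AddMonoidAlgebra.induction_linear with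
    | zero => simp
    | add a b ha hb => simp [ha, hb]
    | single s z => exact h s z g
  funext N
  simp [Dist.orderwise_apply, Dist.smul_apply, key]

end Semilinear

section Post

variable {A : Type} [CommRing A] {Γ : Type} [AddCommGroup Γ]
  {W W' : Type} [AddCommGroup W] [Module A W] [AddCommGroup W'] [Module A W']

/-- Composition of a distribution with a linear map. -/
def Dist.post (f : W →ₗ[A] W') : Dist Γ W →ₗ[Mult A Γ] Dist Γ W' where
  toFun G := fun N x => f (G N x)
  map_add' G G' := funext fun N => funext fun x => map_add f _ _
  map_smul' κ G := by
    have := Dist.semilinear (RingHom.id (AddMonoidAlgebra A Γ)) (f.toAddMonoidHom.compLeft Γ)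
      (by intro s z g; ext x; simp) κ G
    rw [PowerSeries.map_id] at this
    exact this

@[simp] lemma Dist.post_apply (f : W →ₗ[A] W') (G : Dist Γ W) (N : ℕ) (x : Γ) :
    Dist.post f G N x = f (G N x) := rfl

end Post

/-! ### Powers of `u + Bħ` -/

section Pw

variable {A : Type} [CommRing A] [Algebra ℂ A] {Γ : Type} [AddCommGroup Γ] [Module ℂ Γ]

/-- The homomorphism `ℂ[[t]] → A[Γ][[ħ]]` with `t ↦ Bħ/u`, where `u` is the monomial with
exponent `e`. -/
def substInv (A : Type) {Γ : Type} [CommRing A] [Algebra ℂ A] [AddCommGroup Γ] [Module ℂ Γ]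
    (e : Γ) (B : ℂ) : PowerSeries ℂ →+* Mult A Γ :=
  (PowerSeries.rescale (AddMonoidAlgebra.single (-e) (algebraMap ℂ A B))).comp
    (PowerSeries.map (algebraMap ℂ (AddMonoidAlgebra A Γ)))

/-- The monomial `u^x`. -/
def monom (A : Type) {Γ : Type} [CommRing A] [AddCommGroup Γ] (x : Γ) : Mult A Γ :=
  PowerSeries.C (AddMonoidAlgebra.single x 1)

/-- The power `(u + Bħ)^x`, expanded in `ħ`, where `u` is the monomial with exponent `e`. -/
def pw (A : Type) {Γ : Type} [CommRing A] [Algebra ℂ A] [AddCommGroup Γ] [Module ℂ Γ]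
    (e : Γ) (x B : ℂ) : Mult A Γ :=
  monom A (x • e) * substInv A e B (PowerSeries.binomialSeries ℂ x)

lemma monom_mul (x y : Γ) : monom A x * monom A y = monom A (x + y) := by
  simp [monom, ← map_mul, AddMonoidAlgebra.single_mul_single]

lemma monom_zero : monom A (0 : Γ) = 1 := by
  simp [monom, ← AddMonoidAlgebra.one_def]

lemma coeff_substInv (e : Γ) (B : ℂ) (s : PowerSeries ℂ) (n : ℕ) :
    PowerSeries.coeff n (substInv A e B s) =
      AddMonoidAlgebra.single (-(n : ℂ) • e) (algebraMap ℂ A (B ^ n * PowerSeries.coeff n s)) := by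
  simp [substInv, PowerSeries.coeff_rescale, AddMonoidAlgebra.single_pow,
    AddMonoidAlgebra.single_mul_single, Nat.cast_smul_eq_nsmul]

lemma coeff_pw (e : Γ) (x B : ℂ) (n : ℕ) :
    PowerSeries.coeff n (pw A e x B) =
      AddMonoidAlgebra.single ((x - n) • e) (algebraMap ℂ A (B ^ n * Ring.choose x n)) := by
  simp [pw, monom, coeff_substInv, AddMonoidAlgebra.single_mul_single, sub_eq_add_neg, add_smul]

lemma pw_add (e : Γ) (x y B : ℂ) : pw A e (x + y) B = pw A e x B * pw A e y B := by
  rw [pw, pw, pw, add_smul, ← monom_mul, PowerSeries.binomialSeries_add, map_mul]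
  ring

@[simp] lemma pw_zero (e : Γ) (B : ℂ) : pw A e 0 B = 1 := by
  simp [pw, monom_zero]

lemma pw_one (e : Γ) (B : ℂ) :
    pw A e 1 B = monom A e + algebraMap ℂ (Mult A Γ) B * PowerSeries.X := by
  ext n : 1
  rw [coeff_pw]
  rcases n with _ | _ | n
  · simp [monom]
  · simp [monom, PowerSeries.coeff_C, PowerSeries.algebraMap_apply]
  · have h : Ring.choose (1 : ℂ) (n + 1 + 1) = 0 := by
      have := Ring.choose_natCast (R := ℂ) 1 (n + 1 + 1)
      simpa [Nat.choose_eq_zero_of_lt] using this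
    simp [h, monom, PowerSeries.algebraMap_apply]

end Pw

/-! ### The Heisenberg algebra on the Fock space -/

open MvPolynomial (pderiv)

lemma op_ext {S T : Op} (h : ∀ p f, S (Finsupp.single p f) = T (Finsupp.single p f)) : S = T :=
  Finsupp.lhom_ext h

/-- Multiplication by a polynomial in the creation operators. -/
def mulOp : Osc →ₐ[ℂ] Op where
  toFun f := Finsupp.mapRange.linearMap (LinearMap.mulLeft ℂ f)
  map_one' := op_ext fun p f => by simp
  map_mul' f g := op_ext fun p h => by simp [-Finsupp.single_mul]
  map_zero' := op_ext fun p f => by simp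
  map_add' f g := op_ext fun p h => by simp [-Finsupp.single_mul, add_mul, Finsupp.single_add]
  commutes' r := op_ext fun p f => by
    simp [-Finsupp.single_mul, Algebra.algebraMap_eq_smul_one, ← MvPolynomial.smul_eq_C_mul]

@[simp] lemma mulOp_single (f g : Osc) (p : Boson → ℂ) :
    mulOp f (Finsupp.single p g) = Finsupp.single p (f * g) := by
  simp [mulOp]

/-- The derivative with respect to a creation operator. -/
def derOp (i : Boson × ℕ) : Op :=
  Finsupp.mapRange.linearMap (pderiv (R := ℂ) i).toLinearMap

@[simp] lemma derOp_single (i : Boson × ℕ) (g : Osc) (p : Boson → ℂ) :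
    derOp i (Finsupp.single p g) = Finsupp.single p (pderiv i g) := by
  simp [derOp]

@[simp] lemma momentum_single (X : Boson) (g : Osc) (p : Boson → ℂ) :
    momentum X (Finsupp.single p g) = Finsupp.single p (p X • g) := by
  simp [momentum]

lemma mode_neg_succ (k : ℂ) (X : Boson) (n : ℕ) :
    mode k X (-(n : ℤ) - 1) = mulOp (MvPolynomial.X (X, n)) := by
  have : (-(n : ℤ) - 1) = Int.negSucc n := by omega
  rw [this]; rfl

lemma mode_zero (k : ℂ) (X : Boson) : mode k X 0 = momentum X := rfl

lemma mode_succ (k : ℂ) (X : Boson) (n : ℕ) :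
    mode k X (n + 1) = (kappa k X * (n + 1)) • derOp (X, n) := rfl

lemma derOp_mul_mulOp_X (i j : Boson × ℕ) :
    derOp i * mulOp (MvPolynomial.X j) =
      mulOp (MvPolynomial.X j) * derOp i + if i = j then 1 else 0 := by
  classical
  refine op_ext fun p f => ?_
  by_cases h : i = j
  · subst h; simp [-Finsupp.single_mul, add_comm, Finsupp.single_add]
  · simp [-Finsupp.single_mul, h, MvPolynomial.pderiv_X_of_ne (Ne.symm h)]

lemma momentum_mul_mulOp (X : Boson) (f : Osc) :
    momentum X * mulOp f = mulOp f * momentum X := by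
  refine op_ext fun p g => ?_
  simp [-Finsupp.single_mul]

/-- A set of polynomials that is closed under partial derivatives and whose members have no constant
term contains only zero. -/
lemma eq_zero_of_pderiv_closed {σ : Type} (S : Set (MvPolynomial σ ℂ))
    (h0 : ∀ f ∈ S, MvPolynomial.constantCoeff f = 0) (hS : ∀ f ∈ S, ∀ i, pderiv i f ∈ S)
    (f : MvPolynomial σ ℂ) (hf : f ∈ S) : f = 0 := by
  ext m
  rw [MvPolynomial.coeff_zero]
  induction hm : m.degree generalizing m f with
  | zero =>
    rw [Finsupp.degree_eq_zero_iff] at hm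
    subst hm
    exact h0 f hf
  | succ d ih =>
    obtain ⟨i, hi⟩ : ∃ i, m i ≠ 0 := by
      by_contra! h
      have : m = 0 := Finsupp.ext h
      simp [this] at hm
    have hle : Finsupp.single i 1 ≤ m := by
      rw [Finsupp.single_le_iff]; omega
    obtain ⟨m', rfl⟩ := exists_add_of_le hle
    have h := ih _ (hS f hf i) m' (by simp at hm; omega)
    rw [MvPolynomial.coeff_pderiv, add_comm] at h
    have h1 : (m' i : ℂ) + 1 ≠ 0 := by exact_mod_cast Nat.succ_ne_zero (m' i)
    exact (mul_eq_zero.mp h).resolve_right h1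

section Uniqueness

variable {Γ : Type} [AddCommGroup Γ]

/-- Composition with an operator from the left. -/
def Dist.lmul (T : Op) : Dist Γ Op →ₗ[Mult ℂ Γ] Dist Γ Op :=
  Dist.post (A := ℂ) (LinearMap.mulLeft ℂ T)

/-- Composition with an operator from the right. -/
def Dist.rmul (T : Op) : Dist Γ Op →ₗ[Mult ℂ Γ] Dist Γ Op :=
  Dist.post (A := ℂ) (LinearMap.mulRight ℂ T)

@[simp] lemma Dist.lmul_apply (T : Op) (G : Dist Γ Op) (N : ℕ) (x : Γ) :
    Dist.lmul T G N x = T * G N x := rfl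

@[simp] lemma Dist.rmul_apply (T : Op) (G : Dist Γ Op) (N : ℕ) (x : Γ) :
    Dist.rmul T G N x = G N x * T := rfl

/-- `G` is a distribution of operators with `[G, X_{-n-1}] = c_{X,n} G` and
`[X_{n+1}, G] = b_{X,n} G`. -/
structure Covariant (k : ℂ) (c b : Boson → ℕ → Mult ℂ Γ) (G : Dist Γ Op) : Prop where
  creation : ∀ X (n : ℕ), Dist.rmul (mode k X (-(n : ℤ) - 1)) G =
    Dist.lmul (mode k X (-(n : ℤ) - 1)) G + c X n • G
  annihilation : ∀ X (n : ℕ), Dist.lmul (mode k X (n + 1)) G =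
    Dist.rmul (mode k X (n + 1)) G + b X n • G

/-- The matrix coefficient of an operator between the vacua of charges `p` and `q`. -/
def vev (p q : Boson → ℂ) : Op →ₗ[ℂ] ℂ :=
  (MvPolynomial.aeval (R := ℂ) (fun _ : Boson × ℕ => (0 : ℂ))).toLinearMap ∘ₗ Finsupp.lapply q ∘ₗ
    LinearMap.applyₗ (Finsupp.single p 1)

lemma vev_apply (p q : Boson → ℂ) (T : Op) :
    vev p q T = MvPolynomial.constantCoeff (T (Finsupp.single p 1) q) := by
  simp [vev]

/-- A distribution of operators with prescribed commutators with the creation operators is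
determined by its values on the vacuum. -/
theorem eq_zero_of_creation {k : ℂ} {c : Boson → ℕ → Mult ℂ Γ} {G : Dist Γ Op}
    (hG : ∀ X (n : ℕ), Dist.rmul (mode k X (-(n : ℤ) - 1)) G =
      Dist.lmul (mode k X (-(n : ℤ) - 1)) G + c X n • G) (p : Boson → ℂ)
    (vac : ∀ N x, G N x (Finsupp.single p 1) = 0) (N : ℕ) (x : Γ) (f : Osc) :
    G N x (Finsupp.single p f) = 0 := by
  let act : Osc → Op →ₗ[ℂ] Fk := fun f => LinearMap.applyₗ (Finsupp.single p f)
  suffices ∀ f : Osc, Dist.post (act f) G = 0 from congrFun (congrFun (this f) N) x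
  intro f
  induction f using MvPolynomial.induction_on with
  | C a =>
    ext1 N x
    have : (MvPolynomial.C a : Osc) = a • 1 := by
      rw [MvPolynomial.smul_eq_C_mul, mul_one]
    rw [Dist.post_apply]
    change G N x (Finsupp.single p (MvPolynomial.C a)) = 0
    rw [this, ← Finsupp.smul_single, map_smul, vac, smul_zero]
  | add f g hf hg =>
    have : act (f + g) = act f + act g := by ext T; simp [act, Finsupp.single_add]
    ext1 N x
    have hf' := congrFun (congrFun hf N) x
    have hg' := congrFun (congrFun hg N) x
    simp only [Dist.post_apply] at hf' hg' ⊢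
    rw [this, LinearMap.add_apply, hf', hg']
    simp
  | mul_X f i hf =>
    obtain ⟨X, n⟩ := i
    have h1 := congrArg (Dist.post (act f)) (hG X n)
    have h2 : Dist.post (act f) (Dist.rmul (mode k X (-(n : ℤ) - 1)) G) =
        Dist.post (act (f * MvPolynomial.X (X, n))) G := by
      ext1 N x
      simp [act, mode_neg_succ, -Finsupp.single_mul, mul_comm]
    have h3 : Dist.post (act f) (Dist.lmul (mode k X (-(n : ℤ) - 1)) G) =
        Dist.post (mode k X (-(n : ℤ) - 1)) (Dist.post (act f) G) := rfl
    rw [← h2, h1, map_add, h3, hf, map_smul, hf, map_zero, zero_add]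
    exact smul_zero (A := Dist Γ Fk) (c X n)

/-- The Fock spaces are irreducible: a distribution of operators with prescribed commutators with
the modes is determined by its vacuum matrix coefficients. -/
theorem Covariant.eq_zero {k : ℂ} (hk : ∀ X, kappa k X ≠ 0) {c b : Boson → ℕ → Mult ℂ Γ}
    {G : Dist Γ Op} (hG : Covariant k c b G) (p : Boson → ℂ)
    (h0 : ∀ q, Dist.post (vev p q) G = 0) (N : ℕ) (x : Γ) (f : Osc) :
    G N x (Finsupp.single p f) = 0 := by
  refine eq_zero_of_creation hG.creation p ?_ N x f
  clear N x f
  show ∀ N x, G N x (Finsupp.single p 1) = 0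
  · intro N x
    ext1 q
    let ev : Op →ₗ[ℂ] Osc := Finsupp.lapply q ∘ₗ LinearMap.applyₗ (Finsupp.single p 1)
    refine eq_zero_of_pderiv_closed
      {f | ∃ (κ : Mult ℂ Γ) (N : ℕ) (x : Γ), f = (κ • Dist.post ev G) N x} ?_ ?_ _
      ⟨1, N, x, by rw [one_smul]; rfl⟩
    · rintro _ ⟨κ, N, x, rfl⟩
      let ε : Osc →ₗ[ℂ] ℂ :=
        (MvPolynomial.aeval (R := ℂ) (fun _ : Boson × ℕ => (0 : ℂ))).toLinearMap
      have h1 : Dist.post ε (κ • Dist.post ev G) = κ • Dist.post (vev p q) G := by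
        rw [map_smul]; rfl
      rw [h0 q, smul_zero] at h1
      have h2 := congrFun (congrFun h1 N) x
      simpa [ε, MvPolynomial.aeval_zero'] using h2
    · rintro _ ⟨κ, N, x, rfl⟩ ⟨X, n⟩
      have h1 := congrArg (Dist.post ev) (hG.annihilation X n)
      have h2 : Dist.post ev (Dist.lmul (mode k X (n + 1)) G) =
          Dist.post ((kappa k X * (n + 1)) • (pderiv (R := ℂ) (X, n)).toLinearMap)
            (Dist.post ev G) := by
        ext N x : 2
        simp [ev, mode_succ, derOp]
      have h3 : Dist.post ev (Dist.rmul (mode k X (n + 1)) G) = 0 := by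
        ext N x : 2
        simp [ev, mode_succ]
      rw [h2, map_add, h3, zero_add, map_smul] at h1
      have hne : kappa k X * ((n : ℂ) + 1) ≠ 0 :=
        mul_ne_zero (hk X) (by exact_mod_cast Nat.succ_ne_zero n)
      have h4 := congrArg (fun G => κ • G) h1
      simp only [← mul_smul] at h4
      rw [← map_smul] at h4
      have h5 := congrFun (congrFun h4 N) x
      refine ⟨PowerSeries.C (AddMonoidAlgebra.single 0 (kappa k X * (n + 1))⁻¹) * (κ * b X n),
        N, x, ?_⟩
      rw [mul_smul, Dist.C_smul_apply, conv_single, sub_zero, ← h5]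
      simp only [Dist.post_apply, LinearMap.smul_apply, smul_smul, inv_mul_cancel₀ hne, one_smul]
      rfl

end Uniqueness

/-! ### Exponentials of formal power series -/

section Exp

open MvPowerSeries (coeff)

variable {B : Type} [Ring B] [Algebra ℂ B]

lemma coeff_csmul (c : ℂ) (F : MvPowerSeries (Fin 2) B) (d : Fin 2 →₀ ℕ) :
    coeff d (c • F) = c • coeff d F := rfl

/-- All monomials of total degree less than `m` have coefficient zero. -/
def OrdGE (m : ℕ) (F : MvPowerSeries (Fin 2) B) : Prop := ∀ d, d 0 + d 1 < m → coeff d F = 0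

lemma ordGE_one {F : MvPowerSeries (Fin 2) B} (h : MvPowerSeries.constantCoeff F = 0) :
    OrdGE 1 F := by
  intro d hd
  have : d = 0 := by ext i; fin_cases i <;> simp <;> omega
  subst this
  exact h

lemma OrdGE.mul {a b : ℕ} {F G : MvPowerSeries (Fin 2) B} (hF : OrdGE a F) (hG : OrdGE b G) :
    OrdGE (a + b) (F * G) := by
  classical
  intro d hd
  rw [MvPowerSeries.coeff_mul]
  refine Finset.sum_eq_zero fun x hx => ?_
  rw [mem_antidiagonal] at hx
  subst hx
  simp only [Finsupp.add_apply] at hd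
  by_cases h : x.1 0 + x.1 1 < a
  · rw [hF _ h, zero_mul]
  · rw [hG _ (by omega), mul_zero]

lemma OrdGE.pow {F : MvPowerSeries (Fin 2) B} (hF : OrdGE 1 F) (m : ℕ) : OrdGE m (F ^ m) := by
  induction m with
  | zero => intro d hd; omega
  | succ m ih => rw [pow_succ]; exact ih.mul hF

/-- The exponential of a power series without constant term. -/
def expS (T : MvPowerSeries (Fin 2) B) : MvPowerSeries (Fin 2) B := fun d =>
  ∑ m ∈ Finset.range (d 0 + d 1 + 1), ((m.factorial : ℂ)⁻¹) • coeff d (T ^ m)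

lemma expSer_eq (T : Ser) : expSer T = expS T := rfl

lemma coeff_expS {T : MvPowerSeries (Fin 2) B} (hT : OrdGE 1 T) (d : Fin 2 →₀ ℕ) {M : ℕ}
    (hM : d 0 + d 1 < M) :
    coeff d (expS T) = ∑ m ∈ Finset.range M, ((m.factorial : ℂ)⁻¹) • coeff d (T ^ m) := by
  change ∑ m ∈ Finset.range (d 0 + d 1 + 1), _ = _
  refine Finset.sum_subset (Finset.range_mono (by omega)) fun m _ hm => ?_
  rw [Finset.mem_range, not_lt] at hm
  rw [hT.pow m d (by omega), smul_zero]

lemma ordGE_expS_sub {T : MvPowerSeries (Fin 2) B} (hT : OrdGE 1 T) (M : ℕ) :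
    OrdGE M (expS T - ∑ m ∈ Finset.range M, ((m.factorial : ℂ)⁻¹) • T ^ m) := by
  intro d hd
  rw [map_sub, coeff_expS hT d hd]
  simp

lemma coeff_mul_expS {T F : MvPowerSeries (Fin 2) B} (hT : OrdGE 1 T) {a : ℕ} (hF : OrdGE a F)
    (d : Fin 2 →₀ ℕ) {M : ℕ} (hM : d 0 + d 1 < a + M) :
    coeff d (F * expS T) =
      ∑ m ∈ Finset.range M, ((m.factorial : ℂ)⁻¹) • coeff d (F * T ^ m) := by
  have h := (hF.mul (ordGE_expS_sub hT M)) d hM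
  rw [mul_sub, map_sub, sub_eq_zero] at h
  rw [h]
  simp [Finset.mul_sum]

lemma coeff_expS_mul {T F : MvPowerSeries (Fin 2) B} (hT : OrdGE 1 T)
    (d : Fin 2 →₀ ℕ) {M : ℕ} (hM : d 0 + d 1 < M) :
    coeff d (expS T * F) =
      ∑ m ∈ Finset.range M, ((m.factorial : ℂ)⁻¹) • coeff d (T ^ m * F) := by
  have hF : OrdGE 0 F := fun d hd => by omega
  have h := ((ordGE_expS_sub hT M).mul hF) d hM
  rw [sub_mul, map_sub, sub_eq_zero] at h
  rw [h]
  simp [Finset.sum_mul]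

lemma constantCoeff_expS (T : MvPowerSeries (Fin 2) B) :
    MvPowerSeries.constantCoeff (expS T) = 1 := by
  change ∑ m ∈ Finset.range 1, ((m.factorial : ℂ)⁻¹) • coeff 0 (T ^ m) = 1
  simp

lemma expS_zero : expS (0 : MvPowerSeries (Fin 2) B) = 1 := by
  ext d
  have h0 : OrdGE 1 (0 : MvPowerSeries (Fin 2) B) := fun _ _ => map_zero _
  rw [coeff_expS h0 d (Nat.lt_succ_self _), Finset.sum_range_succ']
  simp

/-- If the commutator `c` of `a` and `x` commutes with `a`, then `exp(a) x = (x + c) exp(a)`. -/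
lemma expS_mul_of_comm {a x c : MvPowerSeries (Fin 2) B} (ha : OrdGE 1 a) (hc : OrdGE 1 c)
    (h : a * x = x * a + c) (hac : Commute a c) :
    expS a * x = x * expS a + c * expS a := by
  have key : ∀ m : ℕ, a ^ (m + 1) * x = x * a ^ (m + 1) + ((m + 1 : ℕ) : ℂ) • (c * a ^ m) := by
    intro m
    induction m with
    | zero => simpa using h
    | succ m ih =>
      rw [pow_succ' a (m + 1), mul_assoc, ih, mul_add, ← mul_assoc, h, mul_smul_comm, ← mul_assoc,
        hac.eq, mul_assoc c a, ← pow_succ', add_mul, mul_assoc x, ← pow_succ']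
      push_cast
      module
  ext d
  rw [map_add, coeff_expS_mul ha d (M := d 0 + d 1 + 1) (by omega),
    coeff_mul_expS ha (a := 0) (fun d hd => by omega) d (M := d 0 + d 1 + 1) (by omega),
    coeff_mul_expS ha hc d (M := d 0 + d 1) (by omega), Finset.sum_range_succ',
    Finset.sum_range_succ' (fun m => ((m.factorial : ℂ)⁻¹) • coeff d (x * a ^ m))]
  simp only [key, map_add, smul_add, Finset.sum_add_distrib, coeff_csmul, smul_smul]
  have : ∀ m : ℕ, (((m + 1).factorial : ℂ)⁻¹) * ((m + 1 : ℕ) : ℂ) = ((m.factorial : ℂ)⁻¹) := by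
    intro m
    rw [Nat.factorial_succ]
    have : ((m + 1 : ℕ) : ℂ) ≠ 0 := by exact_mod_cast Nat.succ_ne_zero m
    have := Nat.factorial_ne_zero m
    push_cast at *
    field_simp
  simp only [this, pow_zero, one_mul, mul_one]
  abel

/-- Ring homomorphisms that respect the degree filtration commute with the exponential. -/
lemma map_expS {B' : Type} [Ring B'] [Algebra ℂ B']
    (ψ : MvPowerSeries (Fin 2) B →ₐ[ℂ] MvPowerSeries (Fin 2) B')
    (hψ : ∀ m F, OrdGE m F → OrdGE m (ψ F)) {T : MvPowerSeries (Fin 2) B} (hT : OrdGE 1 T) :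
    ψ (expS T) = expS (ψ T) := by
  ext d
  have h := hψ _ _ (ordGE_expS_sub hT (d 0 + d 1 + 1)) d (by omega)
  rw [map_sub, map_sub, sub_eq_zero] at h
  rw [h, coeff_expS (hψ _ _ hT) d (Nat.lt_succ_self _)]
  simp

/-- Application of a homomorphism to all coefficients. -/
def mapA {B' : Type} [Ring B'] [Algebra ℂ B'] (φ : B →ₐ[ℂ] B') :
    MvPowerSeries (Fin 2) B →ₐ[ℂ] MvPowerSeries (Fin 2) B' :=
  { MvPowerSeries.map (φ : B →+* B') with
    commutes' := fun r => by
      ext d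
      simp [MvPowerSeries.algebraMap_apply, MvPowerSeries.coeff_C] }

@[simp] lemma coeff_mapA {B' : Type} [Ring B'] [Algebra ℂ B'] (φ : B →ₐ[ℂ] B')
    (F : MvPowerSeries (Fin 2) B) (d : Fin 2 →₀ ℕ) : coeff d (mapA φ F) = φ (coeff d F) := rfl

lemma mapA_expS {B' : Type} [Ring B'] [Algebra ℂ B'] (φ : B →ₐ[ℂ] B')
    {T : MvPowerSeries (Fin 2) B} (hT : OrdGE 1 T) : mapA φ (expS T) = expS (mapA φ T) :=
  map_expS _ (fun m F hF d hd => by simp [hF d hd]) hT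

end Exp

/-! ### The Euler derivation -/

section Euler

open MvPowerSeries (coeff)

variable {A : Type} [CommRing A] [Algebra ℂ A]

/-- The Euler derivation, which multiplies a monomial by its total degree. -/
def euler : Derivation ℂ (MvPowerSeries (Fin 2) A) (MvPowerSeries (Fin 2) A) :=
  Derivation.mk'
    { toFun := fun F d => ((d 0 + d 1 : ℕ) : ℂ) • coeff d F
      map_add' := fun F G => funext fun d => by
        change ((d 0 + d 1 : ℕ) : ℂ) • coeff d (F + G) =
          ((d 0 + d 1 : ℕ) : ℂ) • coeff d F + ((d 0 + d 1 : ℕ) : ℂ) • coeff d G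
        rw [map_add, smul_add]
      map_smul' := fun c F => funext fun d => by
        change ((d 0 + d 1 : ℕ) : ℂ) • (c • coeff d F) = c • ((d 0 + d 1 : ℕ) : ℂ) • coeff d F
        rw [smul_comm] }
    (fun F G => by
      classical
      ext d
      change ((d 0 + d 1 : ℕ) : ℂ) • coeff d (F * G) = _
      rw [smul_eq_mul, smul_eq_mul, mul_comm G, map_add, MvPowerSeries.coeff_mul,
        MvPowerSeries.coeff_mul, MvPowerSeries.coeff_mul, ← Finset.sum_add_distrib,
        Finset.smul_sum]
      refine Finset.sum_congr rfl fun x hx => ?_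
      rw [mem_antidiagonal] at hx
      subst hx
      change _ = coeff x.1 F * (((x.2 0 + x.2 1 : ℕ) : ℂ) • coeff x.2 G) +
        (((x.1 0 + x.1 1 : ℕ) : ℂ) • coeff x.1 F) * coeff x.2 G
      rw [mul_smul_comm, smul_mul_assoc, ← add_smul]
      congr 1
      push_cast [Finsupp.add_apply]
      ring)

lemma coeff_euler (F : MvPowerSeries (Fin 2) A) (d : Fin 2 →₀ ℕ) :
    coeff d (euler F) = ((d 0 + d 1 : ℕ) : ℂ) • coeff d F := rfl

lemma ordGE_euler (F : MvPowerSeries (Fin 2) A) : OrdGE 1 (euler F) := by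
  intro d hd
  rw [coeff_euler, show d 0 + d 1 = 0 by omega]
  simp

/-- The equation `θ F = q F` determines `F` up to its constant coefficient. -/
lemma eq_of_euler_eq {q F G : MvPowerSeries (Fin 2) A} (hq : OrdGE 1 q) (hF : euler F = q * F)
    (hG : euler G = q * G) (h0 : MvPowerSeries.constantCoeff F = MvPowerSeries.constantCoeff G) :
    F = G := by
  classical
  rw [← sub_eq_zero]
  set H := F - G with hH
  have hE : euler H = q * H := by rw [hH, map_sub, hF, hG, mul_sub]
  have h0' : coeff 0 H = 0 := by
    rw [hH, map_sub, sub_eq_zero]; exact h0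
  ext d
  rw [map_zero]
  induction hn : d 0 + d 1 using Nat.strong_induction_on generalizing d with
  | _ n ih =>
    rcases Nat.eq_zero_or_pos n with hz | hz
    · have : d = 0 := by ext i; fin_cases i <;> simp <;> omega
      rw [this, h0']
    · have h1 := congrArg (coeff d) hE
      rw [coeff_euler, MvPowerSeries.coeff_mul, Finset.sum_eq_zero, hn] at h1
      · have h2 : (n : ℂ) ≠ 0 := by exact_mod_cast hz.ne'
        have := congrArg (fun z => (n : ℂ)⁻¹ • z) h1
        simpa [smul_smul, h2] using this
      · intro x hx
        rw [mem_antidiagonal] at hx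
        subst hx
        simp only [Finsupp.add_apply] at hn
        by_cases h : x.1 0 + x.1 1 < 1
        · rw [hq _ h, zero_mul]
        · rw [ih _ _ x.2 rfl, mul_zero]
          omega

/-- The chain rule for the exponential. -/
lemma derivation_expS (D : Derivation ℂ (MvPowerSeries (Fin 2) A) (MvPowerSeries (Fin 2) A))
    (hD : ∀ m F, OrdGE m F → OrdGE m (D F)) {T : MvPowerSeries (Fin 2) A} (hT : OrdGE 1 T) :
    D (expS T) = D T * expS T := by
  ext d
  have h := hD _ _ (ordGE_expS_sub hT (d 0 + d 1 + 2)) d (by omega)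
  rw [map_sub, map_sub, sub_eq_zero] at h
  rw [h, coeff_mul_expS hT (a := 0) (fun d hd => by omega) d (M := d 0 + d 1 + 1) (by omega),
    Finset.sum_range_succ', map_add, map_add, map_sum, map_sum, pow_zero, D.map_smul,
    D.map_one_eq_zero, smul_zero, (coeff d).map_zero, add_zero]
  refine Finset.sum_congr rfl fun m _ => ?_
  have h2 : (m.factorial : ℂ) ≠ 0 := by exact_mod_cast Nat.factorial_ne_zero m
  have h3 : (m : ℂ) + 1 ≠ 0 := by exact_mod_cast Nat.succ_ne_zero m
  rw [D.map_smul, Derivation.leibniz_pow, Nat.add_sub_cancel, ← Nat.cast_smul_eq_nsmul ℂ,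
    coeff_csmul, coeff_csmul, smul_smul, smul_eq_mul, mul_comm (T ^ m), Nat.factorial_succ]
  congr 1
  push_cast
  field_simp

lemma euler_expS {T : MvPowerSeries (Fin 2) A} (hT : OrdGE 1 T) :
    euler (expS T) = euler T * expS T :=
  derivation_expS euler (fun m F hF d hd => by rw [coeff_euler, hF d hd, smul_zero]) hT

/-- Application of a derivation to all coefficients. -/
def mapD (D : Derivation ℂ A A) :
    Derivation ℂ (MvPowerSeries (Fin 2) A) (MvPowerSeries (Fin 2) A) :=
  Derivation.mk'
    { toFun := fun F d => D (coeff d F)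
      map_add' := fun F G => funext fun d => by
        change D (coeff d (F + G)) = D (coeff d F) + D (coeff d G)
        rw [map_add, map_add]
      map_smul' := fun c F => funext fun d => by
        change D (c • coeff d F) = c • D (coeff d F)
        rw [D.map_smul] }
    (fun F G => by
      classical
      ext d
      change D (coeff d (F * G)) = _
      rw [smul_eq_mul, smul_eq_mul, mul_comm G, map_add, MvPowerSeries.coeff_mul,
        MvPowerSeries.coeff_mul, MvPowerSeries.coeff_mul, ← Finset.sum_add_distrib, map_sum]
      refine Finset.sum_congr rfl fun x hx => ?_
      rw [Derivation.leibniz, smul_eq_mul, smul_eq_mul, mul_comm (coeff x.2 G)]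
      rfl)

lemma coeff_mapD (D : Derivation ℂ A A) (F : MvPowerSeries (Fin 2) A) (d : Fin 2 →₀ ℕ) :
    coeff d (mapD D F) = D (coeff d F) := rfl

lemma mapD_expS (D : Derivation ℂ A A) {T : MvPowerSeries (Fin 2) A} (hT : OrdGE 1 T) :
    mapD D (expS T) = mapD D T * expS T :=
  derivation_expS (mapD D) (fun m F hF d hd => by rw [coeff_mapD, hF d hd, map_zero]) hT

end Euler

/-! ### Power series in `ħ/u` -/

section Diag

open MvPowerSeries (coeff)

lemma expo_apply_zero (i n : ℕ) : expo i n 0 = i := by simp [expo]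

lemma expo_apply_one (i n : ℕ) : expo i n 1 = n := by simp [expo]

lemma expo_eta (d : Fin 2 →₀ ℕ) : expo (d 0) (d 1) = d := by
  ext i; fin_cases i <;> simp [expo]

lemma expo_inj {i n j m : ℕ} : expo i n = expo j m ↔ i = j ∧ n = m := by
  constructor
  · intro h
    have h0 := DFunLike.congr_fun h 0
    have h1 := DFunLike.congr_fun h 1
    simp only [expo_apply_zero, expo_apply_one] at h0 h1
    exact ⟨h0, h1⟩
  · rintro ⟨rfl, rfl⟩; rfl

lemma expo_add (i n j m : ℕ) : expo (i + j) (n + m) = expo i n + expo j m := by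
  ext s; fin_cases s <;> simp [expo]

lemma sum_antidiagonal_expo {M : Type} [AddCommMonoid M] (i n : ℕ)
    (f : (Fin 2 →₀ ℕ) → (Fin 2 →₀ ℕ) → M) :
    ∑ x ∈ antidiagonal (expo i n), f x.1 x.2 =
      ∑ a ∈ antidiagonal i, ∑ b ∈ antidiagonal n, f (expo a.1 b.1) (expo a.2 b.2) := by
  rw [← Finset.sum_product']
  refine Finset.sum_nbij' (fun x => ((x.1 0, x.2 0), (x.1 1, x.2 1)))
    (fun y => (expo y.1.1 y.2.1, expo y.1.2 y.2.2)) ?_ ?_ ?_ ?_ ?_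
  · rintro ⟨x, y⟩ h
    rw [mem_antidiagonal] at h
    have h0 := DFunLike.congr_fun h 0
    have h1 := DFunLike.congr_fun h 1
    simp only [expo_apply_zero, expo_apply_one, Finsupp.add_apply] at h0 h1
    simp [mem_antidiagonal, h0, h1]
  · rintro ⟨⟨a, b⟩, ⟨c, d⟩⟩ h
    simp only [Finset.mem_product, mem_antidiagonal] at h ⊢
    rw [← expo_add, h.1, h.2]
  · rintro ⟨x, y⟩ _
    simp [expo_eta]
  · rintro ⟨⟨a, b⟩, ⟨c, d⟩⟩ _
    simp [expo_apply_zero, expo_apply_one]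
  · rintro ⟨x, y⟩ _
    simp [expo_eta]

lemma X_mul_X_pow (n : ℕ) :
    ((MvPowerSeries.X 1 * MvPowerSeries.X 0 : MvPowerSeries (Fin 2) ℂ)) ^ n =
      MvPowerSeries.monomial (expo n n) 1 := by
  rw [mul_pow, MvPowerSeries.X_pow_eq, MvPowerSeries.X_pow_eq, MvPowerSeries.monomial_mul_monomial,
    mul_one, expo, add_comm]

lemma hasSubst_diag :
    PowerSeries.HasSubst (MvPowerSeries.X 1 * MvPowerSeries.X 0 : MvPowerSeries (Fin 2) ℂ) :=
  PowerSeries.HasSubst.of_constantCoeff_zero (by simp)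

/-- The substitution `t ↦ ħw` in power series in `t`. -/
def diag : PowerSeries ℂ →ₐ[ℂ] MvPowerSeries (Fin 2) ℂ := PowerSeries.substAlgHom hasSubst_diag

lemma coeff_diag (s : PowerSeries ℂ) (i n : ℕ) :
    coeff (expo i n) (diag s) = if i = n then PowerSeries.coeff i s else 0 := by
  classical
  rw [diag, PowerSeries.coe_substAlgHom, PowerSeries.coeff_subst hasSubst_diag]
  simp only [X_mul_X_pow, MvPowerSeries.coeff_monomial, expo_inj]
  rw [finsum_eq_single _ i]
  · by_cases h : i = n
    · subst h; simp
    · simp [h, Ne.symm h]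
  · intro d hd
    simp [Ne.symm hd]

lemma diag_X : diag PowerSeries.X = MvPowerSeries.X 1 * MvPowerSeries.X 0 := by
  rw [diag, PowerSeries.substAlgHom_X]

/-- The binomial series `(1 + B t)^x`. -/
def binom (x B : ℂ) : PowerSeries ℂ := PowerSeries.rescale B (PowerSeries.binomialSeries ℂ x)

lemma coeff_binom (x B : ℂ) (n : ℕ) :
    PowerSeries.coeff n (binom x B) = B ^ n * Ring.choose x n := by
  simp [binom, PowerSeries.coeff_rescale]

lemma oneAdd_eq (B : ℂ) : oneAdd B = diag (binom 1 B) := by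
  have : binom 1 B = 1 + PowerSeries.C B * PowerSeries.X := by
    have h := PowerSeries.binomialSeries_nat (R := ℂ) (A := ℂ) 1
    rw [Nat.cast_one, pow_one] at h
    rw [binom, h, map_add, map_one, PowerSeries.rescale_X]
  rw [this, map_add, map_one, map_mul, diag_X, oneAdd]
  congr 2
  have : (PowerSeries.C B : PowerSeries ℂ) = algebraMap ℂ _ B := rfl
  rw [this, AlgHom.commutes]
  rfl

lemma binom_add (x y B : ℂ) : binom (x + y) B = binom x B * binom y B := by
  rw [binom, PowerSeries.binomialSeries_add, map_mul]; rfl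

lemma binom_zero (B : ℂ) : binom 0 B = 1 := by
  rw [binom, PowerSeries.binomialSeries_zero, map_one]

lemma binom_nat_mul (x B : ℂ) (n : ℕ) : binom (n * x) B = binom x B ^ n := by
  induction n with
  | zero => simp [binom_zero]
  | succ n ih => rw [Nat.cast_succ, add_mul, one_mul, binom_add, ih, pow_succ]

lemma oneAdd_inv_pow (B : ℂ) (n : ℕ) : (oneAdd B)⁻¹ ^ n = diag (binom (-n) B) := by
  have h : (oneAdd B)⁻¹ = diag (binom (-1) B) := by
    rw [MvPowerSeries.inv_eq_iff_mul_eq_one, oneAdd_eq, ← map_mul, ← binom_add]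
    · simp [binom_zero]
    · simp [oneAdd]
  rw [h, ← map_pow, ← binom_nat_mul]
  simp

lemma coeff_X_mul_diag (m : ℕ) (s : PowerSeries ℂ) (i n : ℕ) :
    coeff (expo i n) (MvPowerSeries.X 0 ^ m * diag s) =
      if i = m + n then PowerSeries.coeff n s else 0 := by
  rw [MvPowerSeries.X_pow_eq, MvPowerSeries.coeff_monomial_mul, one_mul]
  have hs : (Finsupp.single 0 m : Fin 2 →₀ ℕ) = expo m 0 := by simp [expo]
  rw [hs]
  by_cases h : m ≤ i
  · obtain ⟨j, rfl⟩ := Nat.exists_eq_add_of_le h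
    have h1 : expo (m + j) n = expo m 0 + expo j n := by rw [← expo_add, zero_add]
    rw [if_pos (by rw [h1]; exact le_self_add), h1, add_tsub_cancel_left, coeff_diag]
    by_cases h2 : j = n
    · simp [h2]
    · simp [h2]
  · rw [if_neg, if_neg (by omega)]
    intro h3
    have := h3 0
    simp only [expo_apply_zero] at this
    exact h this

lemma succ_mul_choose_succ (x : ℂ) (n : ℕ) :
    ((n : ℂ) + 1) * Ring.choose x (n + 1) = (x - n) * Ring.choose x n := by
  have h := Ring.choose_smul_choose x (Nat.le_succ n)
  rw [Nat.choose_succ_self_right, Nat.succ_sub (le_refl n), Nat.sub_self, Ring.choose_one_right,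
    nsmul_eq_mul] at h
  push_cast at h
  rw [h, mul_comm]

lemma succ_mul_choose_succ' (x : ℂ) (n : ℕ) :
    ((n : ℂ) + 1) * Ring.choose x (n + 1) = x * Ring.choose (x - 1) n := by
  have h := Ring.choose_smul_choose x (Nat.le_add_left 1 n)
  rw [Nat.choose_one_right, Nat.add_sub_cancel, Ring.choose_one_right, nsmul_eq_mul,
    Nat.cast_one] at h
  push_cast at h
  exact h

lemma choose_neg_one (n : ℕ) : Ring.choose (-1 : ℂ) n = (-1) ^ n := by
  induction n with
  | zero => simp
  | succ n ih =>
    have h := succ_mul_choose_succ (-1) n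
    have h2 : (n : ℂ) + 1 ≠ 0 := by exact_mod_cast Nat.succ_ne_zero n
    rw [ih] at h
    apply mul_left_cancel₀ h2
    rw [h]
    ring

lemma coeff_logOneAdd (B : ℂ) (i n : ℕ) :
    coeff (expo i n) (logOneAdd B) =
      if i = n ∧ 0 < i then (-1) ^ (i + 1) * B ^ i / (i : ℂ) else 0 := by
  change (if expo i n 0 = expo i n 1 ∧ 0 < expo i n 0 then _ else _) = _
  rw [expo_apply_zero, expo_apply_one]

lemma ordGE_logOneAdd (B : ℂ) : OrdGE 1 (logOneAdd B) := by
  intro d hd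
  rw [← expo_eta d, coeff_logOneAdd, if_neg (by omega)]

lemma euler_logOneAdd (B : ℂ) :
    euler (logOneAdd B) = diag (PowerSeries.C (2 * B) * PowerSeries.X * binom (-1) B) := by
  ext d
  rw [← expo_eta d, coeff_euler, coeff_logOneAdd, coeff_diag, expo_apply_zero, expo_apply_one]
  by_cases h : d 0 = d 1
  · rw [← h]
    rcases d 0 with _ | n
    · simp
    · have h2 : (n : ℂ) + 1 ≠ 0 := by exact_mod_cast Nat.succ_ne_zero n
      rw [mul_assoc, PowerSeries.coeff_C_mul, PowerSeries.coeff_succ_X_mul, coeff_binom,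
        choose_neg_one]
      simp
      field_simp
      ring
  · simp [h]

lemma euler_binom (x B : ℂ) :
    euler (diag (binom x B)) = (x • euler (logOneAdd B)) * diag (binom x B) := by
  have h : euler (diag (binom x B)) =
      diag (PowerSeries.C (2 * B * x) * PowerSeries.X * binom (x - 1) B) := by
    ext d
    rw [← expo_eta d, coeff_euler, coeff_diag, coeff_diag, expo_apply_zero, expo_apply_one]
    by_cases h : d 0 = d 1
    · rw [← h]
      rcases d 0 with _ | n
      · simp
      · rw [mul_assoc, PowerSeries.coeff_C_mul, PowerSeries.coeff_succ_X_mul, coeff_binom,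
          coeff_binom, if_pos rfl, if_pos rfl, smul_eq_mul]
        push_cast
        linear_combination 2 * B ^ (n + 1) * succ_mul_choose_succ' x n
    · simp [h]
  rw [h, euler_logOneAdd, ← map_smul, ← map_mul, sub_eq_neg_add, binom_add,
    PowerSeries.smul_eq_C_mul, map_mul PowerSeries.C _ x]
  congr 1
  ring

/-- The exponential of `∑ xᵢ log(1 + Bᵢ ħw)` is the product of the binomial series. -/
lemma expS_logOneAdd {ι : Type} (s : List ι) (x B : ι → ℂ) :
    expS ((s.map fun i => x i • logOneAdd (B i)).sum) =
      diag ((s.map fun i => binom (x i) (B i)).prod) := by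
  have hord : OrdGE 1 ((s.map fun i => x i • logOneAdd (B i)).sum) := by
    intro d hd
    induction s with
    | nil => simp
    | cons i s ih =>
      rw [List.map_cons, List.sum_cons, map_add, ih, coeff_csmul, ordGE_logOneAdd _ d hd,
        smul_zero, zero_add]
  refine eq_of_euler_eq (ordGE_euler _) (euler_expS hord) ?_ ?_
  · clear hord
    induction s with
    | nil => simp
    | cons i s ih =>
      rw [List.map_cons, List.prod_cons, map_mul, Derivation.leibniz, ih, euler_binom,
        List.map_cons, List.sum_cons, map_add, euler.map_smul, smul_eq_mul, smul_eq_mul]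
      ring
  · rw [constantCoeff_expS]
    have h := coeff_diag ((s.map fun i => binom (x i) (B i)).prod) 0 0
    have h0 : expo 0 0 = 0 := by simp [expo]
    rw [h0, if_pos rfl] at h
    rw [← MvPowerSeries.coeff_zero_eq_constantCoeff_apply, h, PowerSeries.coeff_zero_eq_constantCoeff_apply, map_list_prod, List.map_map]
    symm
    apply List.prod_eq_one
    intro y hy
    simp only [List.mem_map, Function.comp_apply] at hy
    obtain ⟨i, _, rfl⟩ := hy
    rw [← PowerSeries.coeff_zero_eq_constantCoeff_apply, coeff_binom]
    simp

end Diag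

/-! ### Vertex operators in exponential form -/

section Terms

open MvPowerSeries (coeff)
open MvPolynomial (pderiv)

/-- A term `c X(u + Aħ)` of the exponent of a vertex operator: the coefficient `c`, the boson `X`
and the shift `A`. -/
abbrev Term : Type := ℂ × Boson × ℂ

/-- The creation part of a sum of terms. -/
def crea (k : ℂ) (L : List Term) : Ser := (L.map fun t => t.1 • posPart k t.2.1 t.2.2).sum

/-- The annihilation part of a sum of terms, without `log(u)`. -/
def anni (k : ℂ) (L : List Term) : Ser := (L.map fun t => t.1 • negPart k t.2.1 t.2.2).sum

/-- The creation part of `X(u + Aħ)` as a series of polynomials. -/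
def posSer (X : Boson) (A : ℂ) : MvPowerSeries (Fin 2) Osc := fun d =>
  ∑ n ∈ Finset.Icc 1 (d 0 + d 1),
    (coeff d ((MvPowerSeries.X 0 + MvPowerSeries.C A * MvPowerSeries.X 1) ^ n) / (n : ℂ)) •
      (MvPolynomial.X (X, n - 1) : Osc)

/-- The creation part of a sum of terms as a series of polynomials. -/
def creaSer (L : List Term) : MvPowerSeries (Fin 2) Osc :=
  (L.map fun t => t.1 • posSer t.2.1 t.2.2).sum

lemma ordGE_list_sum {B : Type} [Ring B] [Algebra ℂ B] {ι : Type} (L : List ι) (m : ℕ) (c : ι → ℂ)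
    (F : ι → MvPowerSeries (Fin 2) B) (h : ∀ i, OrdGE m (F i)) :
    OrdGE m ((L.map fun i => c i • F i).sum) := by
  intro d hd
  induction L with
  | nil => simp
  | cons i s ih =>
    rw [List.map_cons, List.sum_cons, map_add, ih, coeff_csmul, h i d hd, smul_zero, zero_add]

lemma ordGE_posSer (X : Boson) (A : ℂ) : OrdGE 1 (posSer X A) := by
  intro d hd
  change ∑ n ∈ Finset.Icc 1 (d 0 + d 1), _ = _
  rw [show d 0 + d 1 = 0 by omega]
  rfl

lemma ordGE_creaSer (L : List Term) : OrdGE 1 (creaSer L) :=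
  ordGE_list_sum L 1 (fun t => t.1) _ fun t => ordGE_posSer t.2.1 t.2.2

lemma ordGE_negPart (k : ℂ) (X : Boson) (B : ℂ) : OrdGE 1 (negPart k X B) := by
  intro d hd
  change coeff d (logOneAdd B) • momentum X - ∑ n ∈ Finset.Icc 1 (d 0 + d 1), _ = _
  rw [show d 0 + d 1 = 0 by omega, ordGE_logOneAdd B d hd, zero_smul]
  exact sub_zero (0 : Op)

lemma ordGE_anni (k : ℂ) (L : List Term) : OrdGE 1 (anni k L) :=
  ordGE_list_sum L 1 (fun t => t.1) _ fun t => ordGE_negPart k t.2.1 t.2.2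

lemma mapA_creaSer (k : ℂ) (L : List Term) : mapA mulOp (creaSer L) = crea k L := by
  rw [creaSer, crea, map_list_sum, List.map_map]
  congr 1
  refine List.map_congr_left fun t _ => ?_
  rw [Function.comp_apply, map_smul]
  congr 1
  ext d : 1
  change mulOp (∑ n ∈ Finset.Icc 1 (d 0 + d 1), _) = ∑ n ∈ Finset.Icc 1 (d 0 + d 1), _
  rw [map_sum]
  refine Finset.sum_congr rfl fun n hn => ?_
  rw [map_smul]
  obtain ⟨m, rfl⟩ : ∃ m, n = m + 1 := ⟨n - 1, by simp at hn; omega⟩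
  rw [Nat.add_sub_cancel, ← mode_neg_succ k]
  congr 2
  push_cast; ring

lemma coeff_expSer_crea (k : ℂ) (L : List Term) (d : Fin 2 →₀ ℕ) :
    coeff d (expSer (crea k L)) = mulOp (coeff d (expS (creaSer L))) := by
  rw [expSer_eq, ← mapA_creaSer, ← mapA_expS _ (ordGE_creaSer L)]
  rfl

/-- The commutator of the annihilation part of a sum of terms with the creation operator
`Y_{-m-1}`. -/
def commSer (k : ℂ) (L : List Term) (Y : Boson) (m : ℕ) : MvPowerSeries (Fin 2) ℂ :=
  (L.map fun t => t.1 • ((if t.2.1 = Y then -kappa k Y else 0 : ℂ) •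
    (MvPowerSeries.X 0 ^ (m + 1) * (oneAdd t.2.2)⁻¹ ^ (m + 1)))).sum

lemma ordGE_X_pow_mul (m : ℕ) (F : MvPowerSeries (Fin 2) ℂ) :
    OrdGE m (MvPowerSeries.X 0 ^ m * F) := by
  have h : OrdGE 1 (MvPowerSeries.X 0 : MvPowerSeries (Fin 2) ℂ) := ordGE_one (by simp)
  exact (h.pow m).mul (b := 0) fun d hd => by omega

lemma ordGE_commSer (k : ℂ) (L : List Term) (Y : Boson) (m : ℕ) : OrdGE 1 (commSer k L Y m) :=
  ordGE_list_sum L 1 (fun t => t.1) _ fun t d hd => by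
    rw [coeff_csmul, ordGE_X_pow_mul (m + 1) _ d (by omega), smul_zero]

/-- Scalars as operators. -/
def scal : ℂ →ₐ[ℂ] Op := Algebra.ofId ℂ Op

lemma commute_mapA_scal (F : MvPowerSeries (Fin 2) ℂ) (G : Ser) : Commute (mapA scal F) G := by
  classical
  ext d : 1
  rw [MvPowerSeries.coeff_mul, MvPowerSeries.coeff_mul]
  refine Finset.sum_nbij' Prod.swap Prod.swap ?_ ?_ ?_ ?_ ?_
  · intro x hx; simpa [mem_antidiagonal, add_comm] using hx
  · intro x hx; simpa [mem_antidiagonal, add_comm] using hx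
  · intro x _; rfl
  · intro x _; rfl
  · intro x _
    exact Algebra.commutes (coeff x.1 F) (coeff x.2 G)

lemma op_sub_eq (S T : Op) : S - T = S + (-1 : ℂ) • T := by
  refine LinearMap.ext fun x => ?_
  rw [LinearMap.sub_apply, LinearMap.add_apply, LinearMap.smul_apply, neg_one_smul, sub_eq_add_neg]

lemma mode_mul_mulOp (k : ℂ) (X Y : Boson) (n m : ℕ) :
    mode k X (n + 1) * mulOp (MvPolynomial.X (Y, m)) =
      mulOp (MvPolynomial.X (Y, m)) * mode k X (n + 1) +
        (if X = Y ∧ n = m then kappa k Y * (m + 1) else 0 : ℂ) • (1 : Op) := by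
  rw [mode_succ, smul_mul_assoc, derOp_mul_mulOp_X, smul_add, mul_smul_comm]
  congr 1
  by_cases h : X = Y ∧ n = m
  · obtain ⟨rfl, rfl⟩ := h; simp
  · rw [if_neg h, if_neg (by simpa [Prod.ext_iff] using h), smul_zero, zero_smul]

lemma negPart_mul_C (k : ℂ) (X Y : Boson) (B : ℂ) (m : ℕ) :
    negPart k X B * MvPowerSeries.C (mulOp (MvPolynomial.X (Y, m))) =
      MvPowerSeries.C (mulOp (MvPolynomial.X (Y, m))) * negPart k X B +
        mapA scal ((if X = Y then -kappa k Y else 0 : ℂ) •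
          (MvPowerSeries.X 0 ^ (m + 1) * (oneAdd B)⁻¹ ^ (m + 1))) := by
  ext d : 1
  rw [MvPowerSeries.coeff_mul_C, map_add, MvPowerSeries.coeff_C_mul]
  set c : ℂ := if X = Y then -kappa k Y else 0 with hc
  set g : ℕ → ℂ := fun n => coeff d (MvPowerSeries.X 0 ^ n * (oneAdd B)⁻¹ ^ n) with hg
  have hsum : ∑ n ∈ Finset.Icc 1 (d 0 + d 1), (g n / (n : ℂ)) •
        (mode k X (n : ℤ) * mulOp (MvPolynomial.X (Y, m))) =
      ∑ n ∈ Finset.Icc 1 (d 0 + d 1), (g n / (n : ℂ)) •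
        (mulOp (MvPolynomial.X (Y, m)) * mode k X (n : ℤ)) + (-(c * g (m + 1))) • (1 : Op) := by
    have h1 : ∀ n ∈ Finset.Icc 1 (d 0 + d 1), (g n / (n : ℂ)) •
        (mode k X (n : ℤ) * mulOp (MvPolynomial.X (Y, m))) = (g n / (n : ℂ)) •
        (mulOp (MvPolynomial.X (Y, m)) * mode k X (n : ℤ)) +
          (if n = m + 1 then (-(c * g (m + 1))) • (1 : Op) else 0) := by
      intro n hn
      obtain ⟨j, rfl⟩ : ∃ j, n = j + 1 := ⟨n - 1, by simp at hn; omega⟩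
      have h := mode_mul_mulOp k X Y j m
      push_cast
      rw [h, smul_add, smul_smul]
      congr 1
      by_cases hj : j = m
      · subst hj
        have h2 : (j : ℂ) + 1 ≠ 0 := by exact_mod_cast Nat.succ_ne_zero j
        rw [if_pos rfl, hc]
        congr 1
        by_cases hX : X = Y
        · simp only [hX, and_self, if_true]; field_simp
        · simp [hX]
      · rw [if_neg (by simp [hj]), if_neg (by omega)]
        simp
    rw [Finset.sum_congr rfl h1, Finset.sum_add_distrib, Finset.sum_ite_eq']
    congr 1
    by_cases hm : m + 1 ∈ Finset.Icc 1 (d 0 + d 1)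
    · rw [if_pos hm]
    · have h0 : g (m + 1) = 0 := ordGE_X_pow_mul (m + 1) _ d (by simp at hm; omega)
      rw [if_neg hm, h0, mul_zero, neg_zero, zero_smul]
  have hcoeff : coeff d (negPart k X B) = coeff d (logOneAdd B) • momentum X -
      ∑ n ∈ Finset.Icc 1 (d 0 + d 1), (g n / (n : ℂ)) • mode k X (n : ℤ) := rfl
  have hscal : coeff d (mapA scal (c • (MvPowerSeries.X 0 ^ (m + 1) * (oneAdd B)⁻¹ ^ (m + 1)))) =
      (c * g (m + 1)) • (1 : Op) :=
    Algebra.algebraMap_eq_smul_one (R := ℂ) (A := Op) (c * g (m + 1))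
  rw [hcoeff, hscal, op_sub_eq, add_mul, mul_add, smul_mul_assoc, mul_smul_comm,
    momentum_mul_mulOp, smul_mul_assoc, mul_smul_comm, Finset.sum_mul, Finset.mul_sum]
  simp only [smul_mul_assoc, mul_smul_comm]
  rw [hsum, smul_add, smul_smul, neg_one_mul, neg_neg, add_assoc]

lemma anni_mul_C (k : ℂ) (L : List Term) (Y : Boson) (m : ℕ) :
    anni k L * MvPowerSeries.C (mulOp (MvPolynomial.X (Y, m))) =
      MvPowerSeries.C (mulOp (MvPolynomial.X (Y, m))) * anni k L +
        mapA scal (commSer k L Y m) := by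
  rw [anni, commSer]
  induction L with
  | nil => simp
  | cons t L ih =>
    simp only [List.map_cons, List.sum_cons, add_mul, mul_add, ih, smul_mul_assoc,
      negPart_mul_C, map_add, mul_smul_comm, map_smul, smul_add]
    abel

/-- The exponential of the annihilation part, applied to a product. -/
lemma coeff_expSer_anni_X_mul (k : ℂ) (L : List Term) (Y : Boson) (m : ℕ) (d : Fin 2 →₀ ℕ)
    (p : Boson → ℂ) (f : Osc) :
    coeff d (expSer (anni k L)) (Finsupp.single p (MvPolynomial.X (Y, m) * f)) =
      mulOp (MvPolynomial.X (Y, m)) (coeff d (expSer (anni k L)) (Finsupp.single p f)) +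
        ∑ x ∈ antidiagonal d, coeff x.1 (commSer k L Y m) •
          coeff x.2 (expSer (anni k L)) (Finsupp.single p f) := by
  have hc : OrdGE (B := Op) 1 (mapA scal (commSer k L Y m)) := fun d hd => by
    change scal (coeff d (commSer k L Y m)) = 0
    rw [ordGE_commSer k L Y m d hd, map_zero]
  have hE := expS_mul_of_comm (ordGE_anni k L) hc (anni_mul_C k L Y m)
    (commute_mapA_scal _ _).symm
  have h := congrArg (coeff d) hE
  rw [MvPowerSeries.coeff_mul_C, map_add, MvPowerSeries.coeff_C_mul, MvPowerSeries.coeff_mul,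
    ← expSer_eq] at h
  have h2 := LinearMap.congr_fun h (Finsupp.single p f)
  rw [Module.End.mul_apply, mulOp_single] at h2
  rw [h2, LinearMap.add_apply, Module.End.mul_apply, LinearMap.sum_apply]
  rfl

lemma negPart_vac (k : ℂ) (X : Boson) (B : ℂ) (d : Fin 2 →₀ ℕ) (p : Boson → ℂ) :
    (coeff d (negPart k X B) : Op) (Finsupp.single p 1) =
      (p X * coeff d (logOneAdd B)) • (Finsupp.single p 1 : Fk) := by
  have hcoeff : coeff d (negPart k X B) = coeff d (logOneAdd B) • momentum X -
      ∑ n ∈ Finset.Icc 1 (d 0 + d 1),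
        (coeff d (MvPowerSeries.X 0 ^ n * (oneAdd B)⁻¹ ^ n) / (n : ℂ)) • mode k X (n : ℤ) := rfl
  rw [hcoeff, LinearMap.sub_apply, LinearMap.sum_apply, Finset.sum_eq_zero, sub_zero,
    LinearMap.smul_apply, momentum_single, ← Finsupp.smul_single, smul_smul, mul_comm]
  intro n hn
  obtain ⟨j, rfl⟩ : ∃ j, n = j + 1 := ⟨n - 1, by simp at hn; omega⟩
  push_cast
  rw [mode_succ]
  simp

/-- The exponential of the annihilation part, applied to a vacuum. -/
lemma coeff_expSer_anni_vac (k : ℂ) (L : List Term) (p : Boson → ℂ) (i n : ℕ) :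
    coeff (expo i n) (expSer (anni k L)) (Finsupp.single p 1) =
      Finsupp.single p (MvPolynomial.C (if i = n then
        PowerSeries.coeff i (L.map fun t => binom (t.1 * p t.2.1) t.2.2).prod else 0)) := by
  rw [← coeff_diag, ← expS_logOneAdd]
  set S := (L.map fun t => (t.1 * p t.2.1) • logOneAdd t.2.2).sum with hS
  have hord : OrdGE 1 S := ordGE_list_sum L 1 _ _ fun t => ordGE_logOneAdd t.2.2
  have h1 : ∀ d, (coeff d (anni k L) : Op) (Finsupp.single p 1) =
      coeff d S • (Finsupp.single p 1 : Fk) := by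
    intro d
    rw [anni, hS]
    clear hS hord S
    induction L with
    | nil => simp
    | cons t L ih =>
      rw [List.map_cons, List.sum_cons, List.map_cons, List.sum_cons, map_add, map_add,
        LinearMap.add_apply, ih, add_smul]
      congr 1
      change t.1 • ((coeff d (negPart k t.2.1 t.2.2) : Op) (Finsupp.single p 1)) = _
      rw [negPart_vac, smul_smul, coeff_csmul, smul_eq_mul, mul_assoc]
  have h2 : ∀ m d, (coeff d (anni k L ^ m) : Op) (Finsupp.single p 1) =
      coeff d (S ^ m) • (Finsupp.single p 1 : Fk) := by
    classical
    intro m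
    induction m with
    | zero =>
      intro d
      rw [pow_zero, pow_zero, MvPowerSeries.coeff_one, MvPowerSeries.coeff_one]
      by_cases h : d = 0 <;> simp [h]
    | succ m ih =>
      intro d
      rw [pow_succ, pow_succ, MvPowerSeries.coeff_mul, MvPowerSeries.coeff_mul,
        LinearMap.sum_apply, Finset.sum_smul]
      refine Finset.sum_congr rfl fun x _ => ?_
      rw [Module.End.mul_apply, h1, map_smul, ih, smul_smul, mul_comm]
  rw [expSer_eq, coeff_expS (ordGE_anni k L) _ (Nat.lt_succ_self _),
    coeff_expS hord _ (Nat.lt_succ_self _), LinearMap.sum_apply]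
  simp only [LinearMap.smul_apply, h2, smul_smul, ← Finset.sum_smul]
  rw [Finsupp.smul_single, MvPolynomial.smul_eq_C_mul, mul_one]
  rfl

end Terms

/-! ### Series in `u` and `ħ` as distributions -/

section OfSer

open MvPowerSeries (coeff)

variable {A : Type} [CommRing A]

open Classical in
/-- A power series in `u` and `ħ` as a distribution. -/
def ofSer (E : MvPowerSeries (Fin 2) A) : Dist ℂ A := fun N x =>
  if h : ∃ j : ℕ, x = j then coeff (expo h.choose N) E else 0

lemma ofSer_nat (E : MvPowerSeries (Fin 2) A) (N j : ℕ) : ofSer E N (j : ℂ) = coeff (expo j N) E := by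
  have h : ∃ i : ℕ, (j : ℂ) = i := ⟨j, rfl⟩
  rw [ofSer, dif_pos h]
  have hj : h.choose = j := by exact_mod_cast h.choose_spec.symm
  rw [hj]

lemma ofSer_eq_zero (E : MvPowerSeries (Fin 2) A) (N : ℕ) {x : ℂ} (h : ¬ ∃ j : ℕ, x = j) :
    ofSer E N x = 0 := by
  rw [ofSer, dif_neg h]

lemma ofSer_add (E F : MvPowerSeries (Fin 2) A) : ofSer (E + F) = ofSer E + ofSer F := by
  ext N x
  rw [Dist.add_apply, Pi.add_apply]
  by_cases h : ∃ j : ℕ, x = j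
  · obtain ⟨j, rfl⟩ := h
    simp only [ofSer_nat, map_add]
  · simp only [ofSer_eq_zero _ _ h, add_zero]

lemma ofSer_zero : ofSer (0 : MvPowerSeries (Fin 2) A) = 0 := by
  ext N x
  by_cases h : ∃ j : ℕ, x = j
  · obtain ⟨j, rfl⟩ := h
    rw [ofSer_nat]; rfl
  · rw [ofSer_eq_zero _ _ h]; rfl

lemma ofSer_C_mul (a : A) (E : MvPowerSeries (Fin 2) A) :
    ofSer (MvPowerSeries.C a * E) =
      (PowerSeries.C (AddMonoidAlgebra.single 0 a) : Mult A ℂ) • ofSer E := by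
  ext N x
  rw [Dist.C_smul_apply, conv_single, sub_zero]
  by_cases h : ∃ j : ℕ, x = j
  · obtain ⟨j, rfl⟩ := h
    rw [ofSer_nat, ofSer_nat, MvPowerSeries.coeff_C_mul, smul_eq_mul]
  · rw [ofSer_eq_zero _ _ h, ofSer_eq_zero _ _ h, smul_zero]

lemma coeff_X0_mul_succ (E : MvPowerSeries (Fin 2) A) (j N : ℕ) :
    coeff (expo (j + 1) N) (MvPowerSeries.X 0 * E) = coeff (expo j N) E := by
  have h : expo (j + 1) N = Finsupp.single 0 1 + expo j N := by
    ext s; fin_cases s <;> simp [expo, add_comm]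
  rw [h, MvPowerSeries.X, MvPowerSeries.coeff_add_monomial_mul, one_mul]

lemma coeff_X0_mul_zero (E : MvPowerSeries (Fin 2) A) (N : ℕ) :
    coeff (expo 0 N) (MvPowerSeries.X 0 * E) = 0 := by
  rw [MvPowerSeries.X, MvPowerSeries.coeff_monomial_mul, if_neg]
  intro h
  have := h 0
  simp [expo] at this

lemma coeff_X1_mul_succ (E : MvPowerSeries (Fin 2) A) (j N : ℕ) :
    coeff (expo j (N + 1)) (MvPowerSeries.X 1 * E) = coeff (expo j N) E := by
  have h : expo j (N + 1) = Finsupp.single 1 1 + expo j N := by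
    ext s; fin_cases s <;> simp [expo, add_comm]
  rw [h, MvPowerSeries.X, MvPowerSeries.coeff_add_monomial_mul, one_mul]

lemma coeff_X1_mul_zero (E : MvPowerSeries (Fin 2) A) (j : ℕ) :
    coeff (expo j 0) (MvPowerSeries.X 1 * E) = 0 := by
  rw [MvPowerSeries.X, MvPowerSeries.coeff_monomial_mul, if_neg]
  intro h
  have := h 1
  simp [expo] at this

lemma ofSer_X0_mul (E : MvPowerSeries (Fin 2) A) :
    ofSer (MvPowerSeries.X 0 * E) = monom A (1 : ℂ) • ofSer E := by
  ext N x
  rw [monom, Dist.C_smul_apply, conv_single, one_smul]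
  by_cases h : ∃ j : ℕ, x = j
  · obtain ⟨j, rfl⟩ := h
    rcases j with _ | j
    · rw [ofSer_nat, coeff_X0_mul_zero, ofSer_eq_zero]
      rintro ⟨i, hi⟩
      have : (0 : ℂ) = ((i + 1 : ℕ) : ℂ) := by push_cast at hi ⊢; linear_combination hi
      have := Nat.cast_injective (R := ℂ) ((Nat.cast_zero).trans this)
      omega
    · rw [ofSer_nat, coeff_X0_mul_succ]
      push_cast
      rw [add_sub_cancel_right, ofSer_nat]
  · rw [ofSer_eq_zero _ _ h, ofSer_eq_zero]
    rintro ⟨i, hi⟩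
    exact h ⟨i + 1, by push_cast; linear_combination hi⟩

lemma ofSer_X1_mul (E : MvPowerSeries (Fin 2) A) :
    ofSer (MvPowerSeries.X 1 * E) = (PowerSeries.X : Mult A ℂ) • ofSer E := by
  ext N x
  rcases N with _ | N
  · rw [Dist.X_smul_zero]
    by_cases h : ∃ j : ℕ, x = j
    · obtain ⟨j, rfl⟩ := h
      rw [ofSer_nat, coeff_X1_mul_zero]; rfl
    · rw [ofSer_eq_zero _ _ h]; rfl
  · rw [Dist.X_smul_succ]
    by_cases h : ∃ j : ℕ, x = j
    · obtain ⟨j, rfl⟩ := h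
      rw [ofSer_nat, ofSer_nat, coeff_X1_mul_succ]
    · rw [ofSer_eq_zero _ _ h, ofSer_eq_zero _ _ h]

lemma algebraMap_eq_single [Algebra ℂ A] {Γ : Type} [AddCommGroup Γ] (c : ℂ) :
    algebraMap ℂ (AddMonoidAlgebra A Γ) c = AddMonoidAlgebra.single 0 (algebraMap ℂ A c) := by
  simp

/-- Multiplication by `u + Bħ`. -/
lemma ofSer_linear_mul [Algebra ℂ A] (B : ℂ) (n : ℕ) (E : MvPowerSeries (Fin 2) A) :
    ofSer ((MvPowerSeries.X 0 + MvPowerSeries.C (algebraMap ℂ A B) * MvPowerSeries.X 1) ^ n * E) =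
      pw A (1 : ℂ) n B • ofSer E := by
  induction n with
  | zero => simp
  | succ n ih =>
    have h : algebraMap ℂ (Mult A ℂ) B =
        PowerSeries.C (AddMonoidAlgebra.single 0 (algebraMap ℂ A B)) := by
      rw [PowerSeries.algebraMap_apply, algebraMap_eq_single]
    rw [pow_succ', mul_assoc, add_mul, ofSer_add, ofSer_X0_mul, mul_assoc, ofSer_C_mul,
      ofSer_X1_mul, ih, Nat.cast_succ, add_comm (n : ℂ), pw_add, pw_one, mul_smul, add_smul,
      mul_smul, h]

lemma conv_apply {Γ W : Type} [AddCommGroup Γ] [AddCommGroup W] [Module A W]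
    (a : AddMonoidAlgebra A Γ) (g : Γ → W) (x : Γ) :
    conv A a g x = a.coeff.sum fun s z => z • g (x - s) := by
  induction a using AddMonoidAlgebra.induction_linear with
  | zero => simp
  | add a b ha hb =>
    rw [map_add, LinearMap.add_apply, Pi.add_apply, ha, hb, AddMonoidAlgebra.coeff_add,
      Finsupp.sum_add_index']
    · intro; rw [zero_smul]
    · intro s z z'; rw [add_smul]
  | single s z => rw [conv_single]; simp

end OfSer

section Extend

variable (A : Type) [CommRing A] [Algebra ℂ A] {Γ : Type} [AddCommGroup Γ] [Module ℂ Γ]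

/-- Extension of scalars for multipliers. -/
def extend : Mult ℂ Γ →+* Mult A Γ :=
  PowerSeries.map (AddMonoidAlgebra.mapRingHom Γ (algebraMap ℂ A))

lemma extend_pw (e : Γ) (x B : ℂ) : extend A (pw ℂ e x B) = pw A e x B := by
  ext n : 1
  rw [extend, PowerSeries.coeff_map, coeff_pw, coeff_pw, AddMonoidAlgebra.mapRingHom_single]
  rfl

lemma extend_algebraMap (c : ℂ) :
    extend A (algebraMap ℂ (Mult ℂ Γ) c) = algebraMap ℂ (Mult A Γ) c := by
  ext n : 1
  rw [extend, PowerSeries.coeff_map, PowerSeries.algebraMap_apply, PowerSeries.algebraMap_apply,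
    PowerSeries.coeff_C, PowerSeries.coeff_C]
  split_ifs
  · rw [algebraMap_eq_single, algebraMap_eq_single, AddMonoidAlgebra.mapRingHom_single]
    rfl
  · simp

lemma extend_smul {W : Type} [AddCommGroup W] [Module ℂ W] [Module A W] [IsScalarTower ℂ A W]
    (κ : Mult ℂ Γ) (G : Dist Γ W) : (extend A κ) • G = κ • G := by
  have := Dist.semilinear (AddMonoidAlgebra.mapRingHom Γ (algebraMap ℂ A))
    (AddMonoidHom.id (Γ → W)) (by intro s z g; ext x; simp) κ G
  exact this.symm

end Extend

/-! ### The action of vertex operators on the Fock space -/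

section Vertex

open MvPowerSeries (coeff)

variable {A : Type} [CommRing A] [Algebra ℂ A] {Γ : Type} [AddCommGroup Γ] [Module ℂ Γ]

/-- `∑ c κ_X (u + Bħ)^x`, the sum over the terms `c X(u + Bħ)` of the list. -/
def pwSum (A : Type) [CommRing A] [Algebra ℂ A] (e : Γ) (k : ℂ) (L : List Term) (X : Boson)
    (x : ℂ) : Mult A Γ :=
  (L.map fun t => if t.2.1 = X then algebraMap ℂ (Mult A Γ) (t.1 * kappa k X) * pw A e x t.2.2
    else 0).sum

/-- `∏ (u + Bħ)^{c p_X}`, the product over the terms `c X(u + Bħ)` of the list. -/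
def pref (A : Type) [CommRing A] [Algebra ℂ A] (e : Γ) (L : List Term) (p : Boson → ℂ) :
    Mult A Γ :=
  (L.map fun t => pw A e (t.1 * p t.2.1) t.2.2).prod

/-- The homomorphism `X_{-n-1} ↦ X_{-n-1} - ∑ c κ_X (u + Bħ)^{-n-1}` that describes the conjugation
of creation operators by the annihilation part of a vertex operator. -/
def tau (k : ℂ) (L : List Term) : Osc →ₐ[ℂ] Mult Osc ℂ :=
  MvPolynomial.aeval fun i => PowerSeries.C (AddMonoidAlgebra.single 0 (MvPolynomial.X i)) -
    pwSum Osc (1 : ℂ) k L i.1 (-(i.2 + 1 : ℂ))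

/-- The coefficients of `-∑ c κ_X (u + Bħ)^{-n-1}`. -/
def pwSumCoeff (k : ℂ) (L : List Term) (X : Boson) (n b : ℕ) : ℂ :=
  (L.map fun t => t.1 * ((if t.2.1 = X then -kappa k X else 0) *
    (t.2.2 ^ b * Ring.choose (-(n + 1 : ℂ)) b))).sum

lemma coeff_neg_pwSum (e : Γ) (k : ℂ) (L : List Term) (X : Boson) (n b : ℕ) :
    PowerSeries.coeff b (-pwSum A e k L X (-(n + 1 : ℂ))) =
      AddMonoidAlgebra.single ((-(n + 1 : ℂ) - b) • e)
        (algebraMap ℂ A (pwSumCoeff k L X n b)) := by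
  rw [pwSum, pwSumCoeff]
  induction L with
  | nil => simp
  | cons t L ih =>
    rw [List.map_cons, List.map_cons, List.sum_cons, List.sum_cons, neg_add, map_add, ih, map_add,
      AddMonoidAlgebra.single_add]
    congr 1
    split_ifs with h
    · rw [map_neg, PowerSeries.algebraMap_apply, PowerSeries.coeff_C_mul, coeff_pw,
        algebraMap_eq_single, AddMonoidAlgebra.single_mul_single, zero_add,
        ← AddMonoidAlgebra.single_neg, ← map_mul, ← map_neg]
      congr 2
      ring
    · simp

lemma coeff_commSer (k : ℂ) (L : List Term) (X : Boson) (m a b : ℕ) :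
    coeff (expo a b) (commSer k L X m) = if a = m + 1 + b then pwSumCoeff k L X m b else 0 := by
  rw [commSer, pwSumCoeff]
  induction L with
  | nil => simp
  | cons t L ih =>
    rw [List.map_cons, List.map_cons, List.sum_cons, List.sum_cons, map_add, ih, coeff_csmul,
      coeff_csmul, oneAdd_inv_pow, coeff_X_mul_diag, coeff_binom]
    split_ifs <;> push_cast <;> simp

lemma coeff_tau_X (k : ℂ) (L : List Term) (X : Boson) (m : ℕ) :
    tau k L (MvPolynomial.X (X, m)) = PowerSeries.C (AddMonoidAlgebra.single 0
      (MvPolynomial.X (X, m))) + -pwSum Osc (1 : ℂ) k L X (-(m + 1 : ℂ)) := by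
  rw [tau, MvPolynomial.aeval_X, sub_eq_add_neg]

/-- The eigenvalue of `∑ c P_X` on the vacuum of charge `p`. -/
def nu (L : List Term) (p : Boson → ℂ) : ℂ := (L.map fun t => t.1 * p t.2.1).sum

lemma pref_eq (L : List Term) (p : Boson → ℂ) :
    pref A (1 : ℂ) L p = monom A (nu L p) *
      substInv A (1 : ℂ) 1 (L.map fun t => binom (t.1 * p t.2.1) t.2.2).prod := by
  have h : ∀ x B, pw A (1 : ℂ) x B = monom A x * substInv A (1 : ℂ) 1 (binom x B) := by
    intro x B
    rw [pw, smul_eq_mul, mul_one]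
    congr 1
    ext n : 1
    rw [coeff_substInv, coeff_substInv, coeff_binom, PowerSeries.binomialSeries_coeff]
    simp
  rw [pref, nu]
  induction L with
  | nil => simp [monom_zero]
  | cons t L ih =>
    rw [List.map_cons, List.map_cons, List.map_cons, List.prod_cons, List.prod_cons, List.sum_cons,
      ih, map_mul, ← monom_mul, h]
    ring

/-- The annihilation part of a vertex operator on an arbitrary vector. -/
lemma coeff_expSer_anni (k : ℂ) (L : List Term) (p : Boson → ℂ) (f : Osc) :
    (∀ j n : ℕ, (coeff (expo j n) (expSer (anni k L)) : Op) (Finsupp.single p f) =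
      Finsupp.single p ((PowerSeries.coeff n (pref Osc (1 : ℂ) L p * tau k L f)).coeff
        (nu L p - j))) ∧
    ∀ n x, (∀ j : ℕ, x ≠ nu L p - j) →
      (PowerSeries.coeff n (pref Osc (1 : ℂ) L p * tau k L f)).coeff x = 0 := by
  induction f using MvPolynomial.induction_on with
  | C a =>
    have h0 : ∀ n, PowerSeries.coeff n (pref Osc (1 : ℂ) L p * tau k L (MvPolynomial.C a)) =
        AddMonoidAlgebra.single (nu L p - n) (MvPolynomial.C (a * PowerSeries.coeff n
          (L.map fun t => binom (t.1 * p t.2.1) t.2.2).prod)) := by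
      intro n
      have h1 : tau k L (MvPolynomial.C a) =
          PowerSeries.C (AddMonoidAlgebra.single 0 (MvPolynomial.C a)) := by
        rw [← MvPolynomial.algebraMap_eq, AlgHom.commutes, PowerSeries.algebraMap_apply,
          algebraMap_eq_single]
      rw [h1, pref_eq, mul_assoc, monom, PowerSeries.coeff_C_mul, PowerSeries.coeff_mul_C,
        coeff_substInv, AddMonoidAlgebra.single_mul_single, AddMonoidAlgebra.single_mul_single,
        one_mul, one_pow, one_mul, MvPolynomial.algebraMap_eq, ← map_mul, mul_comm a]
      congr 1
      simp [sub_eq_add_neg]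
    refine ⟨fun j n => ?_, fun n x hx => ?_⟩
    · have h2 : (Finsupp.single p (MvPolynomial.C a : Osc) : Fk) = a • Finsupp.single p 1 := by
        rw [Finsupp.smul_single, MvPolynomial.smul_eq_C_mul, mul_one]
      rw [h2, map_smul, coeff_expSer_anni_vac, h0, AddMonoidAlgebra.coeff_single,
        Finsupp.smul_single, MvPolynomial.smul_eq_C_mul, ← map_mul]
      congr 1
      by_cases h : j = n
      · subst h; simp
      · rw [if_neg h, Finsupp.single_eq_of_ne]
        · simp
        · intro h3
          apply h
          have : (j : ℂ) = n := by linear_combination -h3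
          exact_mod_cast this
    · rw [h0, AddMonoidAlgebra.coeff_single, Finsupp.single_eq_of_ne]
      exact hx n
  | add f g hf hg =>
    refine ⟨fun j n => ?_, fun n x hx => ?_⟩
    · rw [Finsupp.single_add, map_add, hf.1, hg.1, map_add, mul_add, map_add,
        AddMonoidAlgebra.coeff_add, Finsupp.add_apply, Finsupp.single_add]
    · rw [map_add, mul_add, map_add, AddMonoidAlgebra.coeff_add, Finsupp.add_apply, hf.2 n x hx,
        hg.2 n x hx, add_zero]
  | mul_X f i hf =>
    obtain ⟨X, m⟩ := i
    generalize hg : pref Osc (1 : ℂ) L p * tau k L f = g at hf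
    have h0 : ∀ n x, (PowerSeries.coeff n (pref Osc (1 : ℂ) L p *
        tau k L (f * MvPolynomial.X (X, m)))).coeff x =
        MvPolynomial.X (X, m) * (PowerSeries.coeff n g).coeff x +
          ∑ b ∈ antidiagonal n, pwSumCoeff k L X m b.1 •
            (PowerSeries.coeff b.2 g).coeff (x + (m + 1 + b.1)) := by
      intro n x
      rw [map_mul (tau k L), coeff_tau_X, ← mul_assoc, hg, mul_comm, add_mul, map_add,
        PowerSeries.coeff_C_mul, AddMonoidAlgebra.coeff_add, Finsupp.add_apply,
        AddMonoidAlgebra.coeff_single_mul_apply, neg_zero, zero_add, PowerSeries.coeff_mul,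
        AddMonoidAlgebra.coeff_sum, Finsupp.finsetSum_apply]
      refine congrArg _ (Finset.sum_congr rfl fun b _ => ?_)
      rw [coeff_neg_pwSum, AddMonoidAlgebra.coeff_single_mul_apply, MvPolynomial.algebraMap_eq,
        MvPolynomial.smul_eq_C_mul, smul_eq_mul]
      congr 2
      ring
    refine ⟨fun j n => ?_, fun n x hx => ?_⟩
    · rw [mul_comm f, coeff_expSer_anni_X_mul, sum_antidiagonal_expo (f := fun x y =>
        coeff x (commSer k L X m) • (coeff y (expSer (anni k L)) : Op) (Finsupp.single p f)),
        mul_comm _ f, h0, Finsupp.single_add, hf.1, mulOp_single, Finset.sum_comm,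
        Finsupp.single_finsetSum]
      congr 1
      refine Finset.sum_congr rfl fun b _ => ?_
      simp only [coeff_commSer, hf.1]
      by_cases hj : m + 1 + b.1 ≤ j
      · obtain ⟨i, rfl⟩ := Nat.exists_eq_add_of_le hj
        rw [Finset.sum_eq_single (m + 1 + b.1, i)]
        · rw [if_pos rfl, Finsupp.smul_single]
          congr 3
          push_cast
          ring
        · rintro ⟨c, d⟩ hcd hne
          rw [if_neg, zero_smul]
          rintro rfl
          rw [mem_antidiagonal] at hcd
          apply hne
          simp at hcd ⊢
          exact hcd
        · intro h; exact absurd (by rw [mem_antidiagonal]) h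
      · rw [Finset.sum_eq_zero, hf.2 _ _ fun i hi => hj ?_, smul_zero, Finsupp.single_zero]
        · have : ((m + 1 + b.1 + i : ℕ) : ℂ) = j := by push_cast; linear_combination hi
          have := Nat.cast_injective this
          omega
        · rintro ⟨c, d⟩ hcd
          rw [mem_antidiagonal] at hcd
          simp only at hcd
          rw [if_neg (by simp only; omega), zero_smul]
    · rw [h0, hf.2 n x hx, mul_zero, zero_add]
      refine Finset.sum_eq_zero fun b _ => ?_
      rw [hf.2, smul_zero]
      intro j hj
      exact hx (j + (m + 1 + b.1)) (by push_cast; linear_combination hj)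

end Vertex

section LocSum

lemma locSum_apply {ι M : Type} [AddCommGroup M] [Module ℂ M] {T : ι → Module.End ℂ M}
    (h : ∀ x : M, (Function.support fun i => T i x).Finite) (x : M) :
    locSum T x = ∑ᶠ i, T i x := by
  rw [locSum, dif_pos h]
  rfl

lemma finite_support_of_single {ι : Type} {T : ι → Op}
    (h : ∀ p f, (Function.support fun i => T i (Finsupp.single p f)).Finite) (x : Fk) :
    (Function.support fun i => T i x).Finite := by
  induction x using Finsupp.induction_linear with
  | zero => simp
  | add x y hx hy =>
    refine (hx.union hy).subset fun i hi => ?_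
    by_contra hc
    rw [Set.mem_union, Function.mem_support, Function.mem_support, not_or, not_not, not_not] at hc
    exact hi (by simp only; rw [map_add, hc.1, hc.2, add_zero])
  | single p f => exact h p f

end LocSum

section Vertex

open MvPowerSeries (coeff)

/-- The data of a normal ordered exponential: the terms of the creation part, the terms of the
annihilation part, and the coefficients of the operators `Q_X`. -/
structure VertexData where
  lc : List Term
  la : List Term
  r : Boson → ℂ

/-- The sum of the coefficients of the boson `X`. -/
def charge (L : List Term) (X : Boson) : ℂ :=
  (L.map fun t => if t.2.1 = X then t.1 else 0).sum

/-- The coefficients of `X_n`, `n ≠ 0`, and of `Q_X`, `P_X` have the same sum. -/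
structure VertexData.Neutral (d : VertexData) : Prop where
  lc : ∀ X, charge d.lc X = d.r X
  la : ∀ X, charge d.la X = d.r X

/-- A formal field as a distribution. -/
def toDist (a : Field1 Fk) : Dist ℂ Op := fun N i => PowerSeries.coeff N (a i)

/-- The normal ordered exponential with the given data. -/
def VertexData.field (k : ℂ) (d : VertexData) : Field1 Fk :=
  vertex k (crea k d.lc) d.r (anni k d.la)

lemma nu_eq (L : List Term) (p : Boson → ℂ) :
    nu L p = charge L Boson.alpha * p Boson.alpha + charge L Boson.beta * p Boson.beta +
      charge L Boson.gamma * p Boson.gamma := by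
  rw [nu, charge, charge, charge]
  induction L with
  | nil => simp
  | cons t L ih =>
    obtain ⟨c, X, B⟩ := t
    simp only [List.map_cons, List.sum_cons, ih]
    cases X <;> simp <;> ring

lemma powP_single (r : Boson → ℂ) (ν : ℂ) (p : Boson → ℂ) (f : Osc) :
    powP r ν (Finsupp.single p f) =
      if r Boson.alpha * p Boson.alpha + r Boson.beta * p Boson.beta +
        r Boson.gamma * p Boson.gamma = ν then Finsupp.single p f else 0 := by
  rw [powP, Finsupp.lsum_single]
  split_ifs <;> simp

lemma expQ_single (k : ℂ) (r : Boson → ℂ) (p : Boson → ℂ) (f : Osc) :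
    expQ k r (Finsupp.single p f) = Finsupp.single (fun X => p X + kappa k X * r X) f := by
  simp [expQ, Finsupp.lmapDomain_apply]

lemma field_summand (k : ℂ) {d : VertexData} (hd : d.Neutral) (N : ℕ) (a : ℂ) (p : Boson → ℂ)
    (f : Osc) (i j : ℕ) :
    (∑ n ∈ antidiagonal N, (coeff (expo i n.1) (expSer (crea k d.lc)) : Op) * expQ k d.r *
      powP d.r (a - i + j) * coeff (expo j n.2) (expSer (anni k d.la))) (Finsupp.single p f) =
    Finsupp.single (fun X => p X + kappa k X * d.r X) (if nu d.la p = a - i + j then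
      ∑ n ∈ antidiagonal N, coeff (expo i n.1) (expS (creaSer d.lc)) *
        (PowerSeries.coeff n.2 (pref Osc (1 : ℂ) d.la p * tau k d.la f)).coeff (nu d.la p - j)
      else 0) := by
  have hν : d.r Boson.alpha * p Boson.alpha + d.r Boson.beta * p Boson.beta +
      d.r Boson.gamma * p Boson.gamma = nu d.la p := by
    rw [nu_eq, hd.la, hd.la, hd.la]
  rw [LinearMap.sum_apply]
  simp only [Module.End.mul_apply, (coeff_expSer_anni k d.la p f).1, powP_single, hν]
  by_cases h : nu d.la p = a - i + j
  · rw [if_pos h, Finsupp.single_finsetSum]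
    refine Finset.sum_congr rfl fun n _ => ?_
    rw [if_pos h, expQ_single, coeff_expSer_crea, mulOp_single]
  · rw [if_neg h, Finsupp.single_zero]
    refine Finset.sum_eq_zero fun n _ => ?_
    rw [if_neg h, map_zero, map_zero]

/-- The product of a distribution with finite support in a shifted lattice and a power series,
summed over the pairs of exponents. -/
lemma finsum_mul_ofSer {A : Type} [CommRing A] (E : MvPowerSeries (Fin 2) A) (g : Mult A ℂ)
    (ν a : ℂ) (N : ℕ)
    (hg : ∀ n x, (∀ j : ℕ, x ≠ ν - j) → (PowerSeries.coeff n g).coeff x = 0)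
    (T : ℕ × ℕ → A) (hT : ∀ ij : ℕ × ℕ, T ij = if ν = a - ij.1 + ij.2 then
      ∑ n ∈ antidiagonal N, coeff (expo ij.1 n.1) E * (PowerSeries.coeff n.2 g).coeff (ν - ij.2)
      else 0) :
    (Function.support T).Finite ∧ ∑ᶠ ij, T ij = (g • ofSer E) N a := by
  classical
  obtain ⟨S, hS⟩ : ∃ S : Finset ℂ, ∀ n ≤ N, (PowerSeries.coeff n g).coeff.support ⊆ S :=
    ⟨(Finset.range (N + 1)).biUnion fun n => (PowerSeries.coeff n g).coeff.support, fun n hn =>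
      Finset.subset_biUnion_of_mem (fun n => (PowerSeries.coeff n g).coeff.support)
        (by simpa using by omega)⟩
  have hcond : ∀ ij : ℕ × ℕ, T ij ≠ 0 → ν = a - ij.1 + ij.2 := by
    intro ij h
    by_contra hc
    exact h (by rw [hT, if_neg hc])
  have hmem : ∀ ij : ℕ × ℕ, T ij ≠ 0 → ν - ij.2 ∈ S := by
    intro ij h'
    have h := h'
    rw [hT, if_pos (hcond ij h')] at h
    obtain ⟨n, hn, h1⟩ := Finset.exists_ne_zero_of_sum_ne_zero h
    rw [mem_antidiagonal] at hn
    exact hS n.2 (by omega) (Finsupp.mem_support_iff.mpr (right_ne_zero_of_mul h1))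
  have hinj : ∀ ij ij' : ℕ × ℕ, T ij ≠ 0 → T ij' ≠ 0 → ν - (ij.2 : ℂ) = ν - ij'.2 →
      ij = ij' := by
    rintro ⟨i, j⟩ ⟨i', j'⟩ h h' he
    have h1 := hcond _ h
    have h2 := hcond _ h'
    simp only at h1 h2 he
    have h3 : (j : ℂ) = j' := by linear_combination -he
    have h4 : (i : ℂ) = i' := by linear_combination h1 - h2 + h3
    exact Prod.ext (Nat.cast_injective h4) (Nat.cast_injective h3)
  have hfin : (Function.support T).Finite := by
    refine Set.Finite.of_finite_image (f := fun ij : ℕ × ℕ => ν - (ij.2 : ℂ))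
      (S.finite_toSet.subset ?_) fun ij h ij' h' he => hinj ij ij' h h' he
    rintro _ ⟨ij, h, rfl⟩
    exact hmem ij h
  refine ⟨hfin, ?_⟩
  obtain ⟨R, hR⟩ : ∃ R : ℂ → A, ∀ s, R s = ∑ n ∈ antidiagonal N,
    (PowerSeries.coeff n.1 g).coeff s * ofSer E n.2 (a - s) := ⟨_, fun _ => rfl⟩
  have hRT : ∀ ij : ℕ × ℕ, ν = a - ij.1 + ij.2 → T ij = R (ν - ij.2) := by
    intro ij h
    rw [hT, if_pos h, hR, show a - (ν - ij.2) = (ij.1 : ℂ) by linear_combination -h,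
      ← Finset.Nat.sum_antidiagonal_swap]
    refine Finset.sum_congr rfl fun n _ => ?_
    rw [Prod.fst_swap, Prod.snd_swap, ofSer_nat, mul_comm]
  have hrhs : (g • ofSer E) N a = ∑ s ∈ S, R s := by
    simp only [hR]
    rw [Dist.smul_apply, Finset.sum_apply, Finset.sum_comm]
    refine Finset.sum_congr rfl fun n hn => ?_
    rw [mem_antidiagonal] at hn
    rw [conv_apply, Finsupp.sum_of_support_subset _ (hS n.1 (by omega)) _ (by simp)]
    rfl
  rw [hrhs, finsum_eq_sum_of_support_subset _ (s := hfin.toFinset) (by simp)]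
  refine Finset.sum_bij_ne_zero (fun ij _ _ => ν - ij.2) (fun ij _ h => hmem ij h)
    (fun ij _ h ij' _ h' he => hinj ij ij' h h' he) ?_ fun ij _ h => hRT ij (hcond ij h)
  intro s _ h
  have h1 := h
  rw [hR] at h1
  obtain ⟨n, -, hn⟩ := Finset.exists_ne_zero_of_sum_ne_zero h1
  obtain ⟨j, hj⟩ : ∃ j : ℕ, s = ν - j := by
    by_contra! hc
    exact hn (by rw [hg n.1 s hc, zero_mul])
  obtain ⟨i, hi⟩ : ∃ i : ℕ, a - s = i := by
    by_contra hc
    exact hn (by rw [ofSer_eq_zero _ _ hc, mul_zero])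
  have h2 : T (i, j) ≠ 0 := by
    rwa [hRT (i, j) (by simp only; linear_combination -hi - hj), ← hj]
  exact ⟨(i, j), by simpa using h2, h2, hj.symm⟩

/-- The vectors obtained by applying a vertex operator. -/
theorem field_single (k : ℂ) {d : VertexData} (hd : d.Neutral) (N : ℕ) (a : ℂ) (p : Boson → ℂ)
    (f : Osc) :
    toDist (d.field k) N a (Finsupp.single p f) =
      Finsupp.single (fun X => p X + kappa k X * d.r X)
        (((pref Osc (1 : ℂ) d.la p * tau k d.la f) • ofSer (expS (creaSer d.lc))) N a) := by
  have key : ∀ p f, (Function.support _).Finite ∧ _ := fun p f =>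
    finsum_mul_ofSer (expS (creaSer d.lc)) (pref Osc (1 : ℂ) d.la p * tau k d.la f) (nu d.la p) a N
      (coeff_expSer_anni k d.la p f).2 _ fun ij => rfl
  rw [toDist, VertexData.field, vertex, PowerSeries.coeff_mk, locSum_apply]
  · simp only [field_summand k hd]
    rw [← (key p f).2]
    exact ((Finsupp.singleAddHom _).map_finsum (key p f).1).symm
  · refine finite_support_of_single fun p f => (key p f).1.subset fun ij h hc => h ?_
    simp only [field_summand k hd]
    exact (congrArg (Finsupp.single fun X => p X + kappa k X * d.r X) hc).trans
      (Finsupp.single_zero _)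

end Vertex

/-! ### Commutators of vertex operators with the modes -/

section Calculus

variable {Γ : Type} [AddCommGroup Γ]

lemma Dist.lmul_lmul (S T : Op) (G : Dist Γ Op) :
    Dist.lmul S (Dist.lmul T G) = Dist.lmul (S * T) G := by
  ext1 N x; exact (mul_assoc S T (G N x)).symm

lemma Dist.rmul_rmul (S T : Op) (G : Dist Γ Op) :
    Dist.rmul S (Dist.rmul T G) = Dist.rmul (T * S) G := by
  ext1 N x; exact mul_assoc (G N x) T S

lemma Dist.rmul_lmul (S T : Op) (G : Dist Γ Op) :
    Dist.rmul S (Dist.lmul T G) = Dist.lmul T (Dist.rmul S G) := by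
  ext1 N x; exact mul_assoc T (G N x) S

/-- Multiplication of distributions by a complex number. -/
abbrev cst (Γ : Type) [AddCommGroup Γ] (z : ℂ) : Mult ℂ Γ :=
  PowerSeries.C (AddMonoidAlgebra.single 0 z)

lemma cst_smul_apply {W : Type} [AddCommGroup W] [Module ℂ W] (z : ℂ) (G : Dist Γ W) (N : ℕ)
    (x : Γ) : (cst Γ z • G) N x = z • G N x := by
  rw [Dist.C_smul_apply, conv_single, sub_zero]

lemma algebraMap_eq_cst (z : ℂ) : algebraMap ℂ (Mult ℂ Γ) z = cst Γ z := by
  rw [PowerSeries.algebraMap_apply, algebraMap_eq_single]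
  rfl

lemma Dist.lmul_add_smul (T : Op) (z : ℂ) (G : Dist Γ Op) :
    Dist.lmul (T + z • 1) G = Dist.lmul T G + cst Γ z • G := by
  ext1 N x
  rw [Dist.add_apply, Pi.add_apply, cst_smul_apply, Dist.lmul_apply, Dist.lmul_apply, add_mul,
    smul_mul_assoc, one_mul]

lemma Dist.rmul_add_smul (T : Op) (z : ℂ) (G : Dist Γ Op) :
    Dist.rmul (T + z • 1) G = Dist.rmul T G + cst Γ z • G := by
  ext1 N x
  rw [Dist.add_apply, Pi.add_apply, cst_smul_apply, Dist.rmul_apply, Dist.rmul_apply, mul_add,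
    mul_smul_comm, mul_one]

lemma eq_add_of_sub_sub_eq_zero {M : Type} [AddCommGroup M] {a b c : M} (h : a - b - c = 0) :
    a = b + c := by
  rwa [sub_sub, sub_eq_zero] at h

/-- Evaluation of operators on a vector. -/
def evalAt (p : Boson → ℂ) (f : Osc) : Op →ₗ[ℂ] Fk := LinearMap.applyₗ (Finsupp.single p f)

@[simp] lemma evalAt_apply (p : Boson → ℂ) (f : Osc) (T : Op) :
    evalAt p f T = T (Finsupp.single p f) := rfl

lemma Dist.op_ext {G H : Dist Γ Op}
    (h : ∀ p f, Dist.post (evalAt p f) G = Dist.post (evalAt p f) H) : G = H := by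
  ext1 N x
  exact YangianFF.op_ext fun p f => congrFun (congrFun (h p f) N) x

end Calculus

section VertexCovariant

open MvPowerSeries (coeff)
open MvPolynomial (pderiv)

lemma extend_pwSum (k : ℂ) (L : List Term) (X : Boson) (x : ℂ) :
    extend Osc (pwSum ℂ (1 : ℂ) k L X x) = pwSum Osc (1 : ℂ) k L X x := by
  rw [pwSum, pwSum, map_list_sum, List.map_map]
  congr 1
  refine List.map_congr_left fun t _ => ?_
  rw [Function.comp_apply]
  split_ifs
  · rw [map_mul, extend_algebraMap, extend_pw]
  · rw [map_zero]

lemma extend_pref (L : List Term) (p : Boson → ℂ) :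
    extend Osc (pref ℂ (1 : ℂ) L p) = pref Osc (1 : ℂ) L p := by
  rw [pref, pref, map_list_prod, List.map_map]
  congr 1
  refine List.map_congr_left fun t _ => ?_
  rw [Function.comp_apply, extend_pw]

/-- The charge of the image of the Fock space of charge `p` under a vertex operator. -/
def VertexData.shift (k : ℂ) (d : VertexData) (p : Boson → ℂ) : Boson → ℂ :=
  fun X => p X + kappa k X * d.r X

/-- The inclusion of the Fock space of charge `p`. -/
def inc (p : Boson → ℂ) : Osc →ₗ[ℂ] Fk := Finsupp.lsingle p

@[simp] lemma inc_apply (p : Boson → ℂ) (f : Osc) : inc p f = Finsupp.single p f := rfl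

lemma post_evalAt_field (k : ℂ) {d : VertexData} (hd : d.Neutral) (p : Boson → ℂ) (f : Osc) :
    Dist.post (evalAt p f) (toDist (d.field k)) = Dist.post (inc (d.shift k p))
      ((pref Osc (1 : ℂ) d.la p * tau k d.la f) • ofSer (expS (creaSer d.lc))) := by
  ext1 N x
  exact field_single k hd N x p f

/-- The values of a vertex operator on the vacuum vectors. -/
lemma post_evalAt_field_one (k : ℂ) {d : VertexData} (hd : d.Neutral) (p : Boson → ℂ) :
    Dist.post (evalAt p 1) (toDist (d.field k)) = pref ℂ (1 : ℂ) d.la p •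
      Dist.post (inc (d.shift k p)) (ofSer (expS (creaSer d.lc))) := by
  rw [post_evalAt_field k hd, map_one, mul_one, ← extend_pref, extend_smul, map_smul]

/-- The commutators of a vertex operator with the creation operators. -/
lemma field_creation (k : ℂ) {d : VertexData} (hd : d.Neutral) (X : Boson) (n : ℕ) :
    Dist.rmul (mode k X (-(n : ℤ) - 1)) (toDist (d.field k)) =
      Dist.lmul (mode k X (-(n : ℤ) - 1)) (toDist (d.field k)) +
        (-pwSum ℂ (1 : ℂ) k d.la X (-(n + 1 : ℂ))) • toDist (d.field k) := by
  refine Dist.op_ext fun p f => ?_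
  have h1 : Dist.post (evalAt p f) (Dist.rmul (mode k X (-(n : ℤ) - 1)) (toDist (d.field k))) =
      Dist.post (evalAt p (f * MvPolynomial.X (X, n))) (toDist (d.field k)) := by
    ext1 N x
    simp only [Dist.post_apply, evalAt_apply, Dist.rmul_apply, Module.End.mul_apply,
      mode_neg_succ, mulOp_single]
    rw [mul_comm]
  have h2 : Dist.post (evalAt p f) (Dist.lmul (mode k X (-(n : ℤ) - 1)) (toDist (d.field k))) =
      Dist.post (mode k X (-(n : ℤ) - 1)) (Dist.post (evalAt p f) (toDist (d.field k))) := rfl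
  rw [map_add, map_smul, h1, h2, post_evalAt_field k hd, post_evalAt_field k hd,
    map_mul (tau k d.la), coeff_tau_X, ← mul_assoc, mul_comm, mul_smul, add_smul, map_add,
    ← extend_pwSum, ← map_neg, extend_smul,
    map_smul (Dist.post (A := ℂ) (Γ := ℂ) (inc (d.shift k p)))]
  refine congrArg₂ (· + ·) ?_ rfl
  ext1 N x
  rw [Dist.post_apply, Dist.C_smul_apply, conv_single, sub_zero, Dist.post_apply, Dist.post_apply,
    mode_neg_succ, inc_apply, inc_apply, mulOp_single, smul_eq_mul]

/-- The commutator of `X_{n+1}` with the creation part of a sum of terms is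
`∑ c κ_X (u + Aħ)^{n+1}`. -/
lemma mapD_creaSer (k : ℂ) (L : List Term) (X : Boson) (n : ℕ) (E : MvPowerSeries (Fin 2) Osc) :
    ofSer (((kappa k X * (n + 1)) • mapD (pderiv (R := ℂ) (X, n)) (creaSer L)) * E) =
      pwSum Osc (1 : ℂ) k L X (n + 1) • ofSer E := by
  have h : ∀ Y A, mapD (pderiv (R := ℂ) (X, n)) (posSer Y A) = if Y = X then
      ((n + 1 : ℂ)⁻¹) • (MvPowerSeries.X 0 + MvPowerSeries.C (algebraMap ℂ Osc A) *
        MvPowerSeries.X 1) ^ (n + 1) else 0 := by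
    intro Y A
    have hmap : ∀ (m : ℕ) (d : Fin 2 →₀ ℕ), coeff d ((MvPowerSeries.X 0 + MvPowerSeries.C (algebraMap ℂ Osc A) *
        MvPowerSeries.X 1) ^ m) = algebraMap ℂ Osc (coeff d
          ((MvPowerSeries.X 0 + MvPowerSeries.C A * MvPowerSeries.X 1) ^ m)) := by
      intro m d
      rw [← MvPowerSeries.coeff_map]
      simp
    ext1 d
    rw [coeff_mapD]
    change pderiv (X, n) (∑ m ∈ Finset.Icc 1 (d 0 + d 1), _) = _
    rw [map_sum]
    simp only [Derivation.map_smul]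
    by_cases hY : Y = X
    · subst hY
      rw [if_pos rfl, coeff_csmul, hmap, Algebra.algebraMap_eq_smul_one, smul_smul]
      have hz : ∀ m ∈ Finset.Icc 1 (d 0 + d 1), m ≠ n + 1 →
          (coeff d ((MvPowerSeries.X 0 + MvPowerSeries.C A * MvPowerSeries.X 1) ^ m) / (m : ℂ)) •
            pderiv (Y, n) (MvPolynomial.X (Y, m - 1) : Osc) = 0 := by
        intro m hm hne
        rw [Finset.mem_Icc] at hm
        rw [MvPolynomial.pderiv_X_of_ne, smul_zero]
        intro h
        have := (Prod.ext_iff.mp h).2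
        simp only at this
        omega
      rw [Finset.sum_eq_single (n + 1) hz]
      · rw [Nat.add_sub_cancel, MvPolynomial.pderiv_X_self]
        congr 1
        push_cast
        field_simp
      · intro hm
        have h1 : OrdGE 1 (MvPowerSeries.X 0 + MvPowerSeries.C A * MvPowerSeries.X 1 :
            MvPowerSeries (Fin 2) ℂ) := ordGE_one (by simp)
        rw [h1.pow (n + 1) d (by simp at hm; omega)]
        simp
    · rw [if_neg hY, (coeff d).map_zero]
      refine Finset.sum_eq_zero fun m _ => ?_
      rw [MvPolynomial.pderiv_X_of_ne, smul_zero]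
      intro h
      exact hY (Prod.ext_iff.mp h).1
  rw [creaSer, pwSum]
  induction L with
  | nil => simp [ofSer_zero]
  | cons t L ih =>
    rw [List.map_cons, List.sum_cons, List.map_cons, List.sum_cons, Derivation.map_add, smul_add,
      add_mul, ofSer_add, add_smul, ih, Derivation.map_smul, h]
    refine congrArg₂ (· + ·) ?_ rfl
    split_ifs with hX
    · have h2 : (n : ℂ) + 1 ≠ 0 := by exact_mod_cast Nat.succ_ne_zero n
      rw [smul_smul, smul_smul, show kappa k X * (n + 1) * t.1 * (n + 1 : ℂ)⁻¹ =
        t.1 * kappa k X by field_simp]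
      have h3 : ∀ (z : ℂ) (F : MvPowerSeries (Fin 2) Osc),
          z • F = MvPowerSeries.C (algebraMap ℂ Osc z) * F := by
        intro z F
        ext1 d
        rw [coeff_csmul, MvPowerSeries.coeff_C_mul, Algebra.smul_def]
      have h4 := ofSer_linear_mul (A := Osc) t.2.2 (n + 1) E
      rw [Nat.cast_succ] at h4
      rw [h3, mul_assoc, ofSer_C_mul, h4, mul_smul, PowerSeries.algebraMap_apply,
        algebraMap_eq_single]
    · simp [ofSer_zero]

lemma mode_mul_mode_neg (k : ℂ) (X Y : Boson) (n m : ℕ) :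
    mode k X (n + 1) * mode k Y (-(m : ℤ) - 1) =
      mode k Y (-(m : ℤ) - 1) * mode k X (n + 1) +
        (if X = Y ∧ n = m then kappa k Y * (m + 1) else 0 : ℂ) • (1 : Op) := by
  rw [mode_neg_succ, mode_mul_mulOp]

/-- The commutators of a vertex operator with the modes are multiples of it. Those with creation
operators come from the annihilation part, those with annihilation operators from the creation part.
-/
theorem field_covariant (k : ℂ) {d : VertexData} (hd : d.Neutral) :
    Covariant k (fun X n => -pwSum ℂ (1 : ℂ) k d.la X (-(n + 1 : ℂ)))
      (fun X n => pwSum ℂ (1 : ℂ) k d.lc X (n + 1)) (toDist (d.field k)) where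
  creation := field_creation k hd
  annihilation X n := by
    set V := toDist (d.field k) with hV
    set T := mode k X (n + 1)
    refine eq_add_of_sub_sub_eq_zero ?_
    -- The defect has the same commutators with creation operators as `V`, so that it suffices to
    -- compute it on vacuum vectors.
    have key : ∀ Y (m : ℕ), Dist.rmul (mode k Y (-(m : ℤ) - 1))
        (Dist.lmul T V - Dist.rmul T V - pwSum ℂ (1 : ℂ) k d.lc X (n + 1) • V) =
        Dist.lmul (mode k Y (-(m : ℤ) - 1))
          (Dist.lmul T V - Dist.rmul T V - pwSum ℂ (1 : ℂ) k d.lc X (n + 1) • V) +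
          (-pwSum ℂ (1 : ℂ) k d.la Y (-(m + 1 : ℂ))) •
            (Dist.lmul T V - Dist.rmul T V - pwSum ℂ (1 : ℂ) k d.lc X (n + 1) • V) := by
      intro Y m
      have hc := field_creation k hd Y m
      have hcomm := mode_mul_mode_neg k X Y n m
      rw [map_sub, map_sub, map_smul, Dist.rmul_lmul, hc, Dist.rmul_rmul, hcomm,
        Dist.rmul_add_smul, ← Dist.rmul_rmul _ _ V, hc, map_add, Dist.lmul_lmul, hcomm,
        Dist.lmul_add_smul, ← Dist.lmul_lmul, map_add, map_smul, map_smul, Dist.rmul_lmul, map_sub,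
        map_sub, map_smul]
      rw [smul_add, smul_sub, smul_sub, smul_comm (-pwSum ℂ (1 : ℂ) k d.la Y (-(m + 1 : ℂ)))]
      abel
    refine Dist.op_ext fun p f => ?_
    ext1 N x
    refine (eq_zero_of_creation key p ?_ N x f).trans rfl
    suffices h : Dist.post (evalAt p 1)
        (Dist.lmul T V - Dist.rmul T V - pwSum ℂ (1 : ℂ) k d.lc X (n + 1) • V) = 0 from
      fun N x => congrFun (congrFun h N) x
    have h1 : Dist.post (evalAt p 1) (Dist.rmul T V) = 0 := by
      ext1 N x
      simp only [Dist.post_apply, evalAt_apply, Dist.rmul_apply, Module.End.mul_apply, T,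
        mode_succ, LinearMap.smul_apply, derOp_single, MvPolynomial.pderiv_one,
        Finsupp.single_zero, smul_zero, map_zero]
      rfl
    have h2 : Dist.post (evalAt p 1) (Dist.lmul T V) =
      Dist.post T (Dist.post (evalAt p 1) V) := rfl
    have h3 : Dist.post T (Dist.post (inc (d.shift k p)) (ofSer (expS (creaSer d.lc)))) =
        pwSum ℂ (1 : ℂ) k d.lc X (n + 1) •
          Dist.post (inc (d.shift k p)) (ofSer (expS (creaSer d.lc))) := by
      rw [← map_smul, ← extend_smul Osc, extend_pwSum, ← mapD_creaSer, smul_mul_assoc,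
        ← mapD_expS _ (ordGE_creaSer d.lc)]
      ext1 N x
      simp only [Dist.post_apply, T, mode_succ, LinearMap.smul_apply, inc_apply, derOp_single]
      rw [Finsupp.smul_single]
      congr 1
      by_cases hx : ∃ j : ℕ, x = j
      · obtain ⟨j, rfl⟩ := hx
        rw [ofSer_nat, ofSer_nat]
        rfl
      · rw [ofSer_eq_zero _ _ hx, ofSer_eq_zero _ _ hx, map_zero, smul_zero]
    rw [map_sub, map_sub, h1, h2, map_smul, hV, post_evalAt_field_one k hd, map_smul, h3,
      smul_comm, sub_zero, sub_self]

end VertexCovariant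

/-! ### Products of fields in two variables -/

section TwoVar

/-- Change of the variables of multipliers. -/
def mapVar {Γ Γ' : Type} [AddCommGroup Γ] [AddCommGroup Γ'] (i : Γ →+ Γ') :
    Mult ℂ Γ →+* Mult ℂ Γ' :=
  PowerSeries.map (AddMonoidAlgebra.mapDomainRingHom ℂ i)

/-- Multipliers in `u` as multipliers in `u` and `v`. -/
abbrev inU : Mult ℂ ℂ →+* Mult ℂ (ℂ × ℂ) := mapVar (AddMonoidHom.inl ℂ ℂ)

/-- Multipliers in one variable, renamed to `v`, as multipliers in `u` and `v`. -/
abbrev inV : Mult ℂ ℂ →+* Mult ℂ (ℂ × ℂ) := mapVar (AddMonoidHom.inr ℂ ℂ)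

/-- The exchange of `u` and `v`. -/
abbrev swapVar : Mult ℂ (ℂ × ℂ) →+* Mult ℂ (ℂ × ℂ) :=
  mapVar (AddEquiv.prodComm (M := ℂ) (N := ℂ)).toAddMonoidHom

lemma mapVar_monom {Γ Γ' : Type} [AddCommGroup Γ] [AddCommGroup Γ'] (i : Γ →+ Γ') (x : Γ) :
    mapVar i (monom ℂ x) = monom ℂ (i x) := by
  simp [mapVar, monom]

lemma mapVar_cst {Γ Γ' : Type} [AddCommGroup Γ] [AddCommGroup Γ'] (i : Γ →+ Γ') (z : ℂ) :
    mapVar i (cst Γ z) = cst Γ' z := by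
  simp [mapVar, cst]

lemma mapVar_X {Γ Γ' : Type} [AddCommGroup Γ] [AddCommGroup Γ'] (i : Γ →+ Γ') :
    mapVar i (PowerSeries.X : Mult ℂ Γ) = PowerSeries.X := by
  simp [mapVar]

lemma mapVar_pw {Γ Γ' : Type} [AddCommGroup Γ] [AddCommGroup Γ'] [Module ℂ Γ] [Module ℂ Γ']
    (i : Γ →ₗ[ℂ] Γ') (e : Γ) (x B : ℂ) :
    mapVar (i : Γ →+ Γ') (pw ℂ e x B) = pw ℂ (i e) x B := by
  ext n : 1
  simp [mapVar, coeff_pw]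

lemma inU_pw (x B : ℂ) : inU (pw ℂ (1 : ℂ) x B) = pw ℂ ((1, 0) : ℂ × ℂ) x B :=
  mapVar_pw (LinearMap.inl ℂ ℂ ℂ) 1 x B

lemma inV_pw (x B : ℂ) : inV (pw ℂ (1 : ℂ) x B) = pw ℂ ((0, 1) : ℂ × ℂ) x B :=
  mapVar_pw (LinearMap.inr ℂ ℂ ℂ) 1 x B

lemma mapVar_comp {Γ Γ' Γ'' : Type} [AddCommGroup Γ] [AddCommGroup Γ'] [AddCommGroup Γ'']
    (i : Γ →+ Γ') (j : Γ' →+ Γ'') (κ : Mult ℂ Γ) : mapVar j (mapVar i κ) = mapVar (j.comp i) κ := by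
  ext n : 1
  simp only [mapVar, PowerSeries.coeff_map]
  generalize PowerSeries.coeff n κ = a
  induction a using AddMonoidAlgebra.induction_linear with
  | zero => simp
  | add a b ha hb => simp only [map_add, ha, hb]
  | single s z => simp

lemma swapVar_inU (κ : Mult ℂ ℂ) : swapVar (inU κ) = inV κ := mapVar_comp _ _ κ

lemma swapVar_inV (κ : Mult ℂ ℂ) : swapVar (inV κ) = inU κ := mapVar_comp _ _ κ

/-- The polynomial `u - v + rħ`. -/
def lin (r : ℂ) : Mult ℂ (ℂ × ℂ) :=
  monom ℂ (1, 0) - monom ℂ (0, 1) + cst (ℂ × ℂ) r * PowerSeries.X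

lemma swapVar_lin (r : ℂ) : swapVar (lin r) = -lin (-r) := by
  have h1 : cst (ℂ × ℂ) (-r) = -cst (ℂ × ℂ) r := by
    rw [cst, AddMonoidAlgebra.single_neg, map_neg]
  rw [lin, lin, map_add, map_sub, map_mul, mapVar_cst, mapVar_X, mapVar_monom, mapVar_monom, h1]
  change monom ℂ (0, 1) - monom ℂ (1, 0) + _ = _
  ring

variable {W₁ W₂ W₃ : Type} [AddCommGroup W₁] [Module ℂ W₁] [AddCommGroup W₂] [Module ℂ W₂]
  [AddCommGroup W₃] [Module ℂ W₃]

/-- The product `G(u) H(v)`. -/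
def Dist.prod (β : W₁ →ₗ[ℂ] W₂ →ₗ[ℂ] W₃) (G : Dist ℂ W₁) : Dist ℂ W₂ →+ Dist (ℂ × ℂ) W₃ :=
  AddMonoidHom.mk' (fun H N x => ∑ n ∈ antidiagonal N, β (G n.1 x.1) (H n.2 x.2)) fun H H' => by
    ext N x
    change ∑ n ∈ antidiagonal N, β (G n.1 x.1) (H n.2 x.2 + H' n.2 x.2) =
      ∑ n ∈ antidiagonal N, β (G n.1 x.1) (H n.2 x.2) +
        ∑ n ∈ antidiagonal N, β (G n.1 x.1) (H' n.2 x.2)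
    simp only [map_add, Finset.sum_add_distrib]

lemma Dist.prod_apply (β : W₁ →ₗ[ℂ] W₂ →ₗ[ℂ] W₃) (G : Dist ℂ W₁) (H : Dist ℂ W₂) (N : ℕ)
    (x : ℂ × ℂ) :
    Dist.prod β G H N x = ∑ n ∈ antidiagonal N, β (G n.1 x.1) (H n.2 x.2) := rfl

lemma Dist.prod_add_left (β : W₁ →ₗ[ℂ] W₂ →ₗ[ℂ] W₃) (G G' : Dist ℂ W₁) (H : Dist ℂ W₂) :
    Dist.prod β (G + G') H = Dist.prod β G H + Dist.prod β G' H := by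
  ext N x
  simp [Dist.prod_apply, Finset.sum_add_distrib]

lemma Dist.prod_smul_left (β : W₁ →ₗ[ℂ] W₂ →ₗ[ℂ] W₃) (κ : Mult ℂ ℂ) (G : Dist ℂ W₁)
    (H : Dist ℂ W₂) : Dist.prod β (κ • G) H = inU κ • Dist.prod β G H := by
  have key : ∀ (a : AddMonoidAlgebra ℂ ℂ) (g : ℂ → W₁) (h : ℂ → W₂) (x : ℂ × ℂ),
      β (conv ℂ a g x.1) (h x.2) = conv ℂ (AddMonoidAlgebra.mapDomainRingHom ℂ
        (AddMonoidHom.inl ℂ ℂ) a) (fun x : ℂ × ℂ => β (g x.1) (h x.2)) x := by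
    intro a g h x
    induction a using AddMonoidAlgebra.induction_linear with
    | zero => simp
    | add a b ha hb =>
      rw [map_add, map_add, map_add, LinearMap.add_apply, LinearMap.add_apply, Pi.add_apply,
        Pi.add_apply, map_add, LinearMap.add_apply, ha, hb]
    | single s z => simp
  have key2 : ∀ (a : AddMonoidAlgebra ℂ ℂ) (n : ℕ) (x : ℂ × ℂ),
      conv ℂ (AddMonoidAlgebra.mapDomainRingHom ℂ (AddMonoidHom.inl ℂ ℂ) a)
        (Dist.prod β G H n) x = ∑ m ∈ antidiagonal n, β (conv ℂ a (G m.1) x.1) (H m.2 x.2) := by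
    intro a n x
    simp only [key]
    rw [← Finset.sum_apply, ← map_sum]
    refine congrFun (congrArg _ (funext fun y => ?_)) x
    rw [Dist.prod_apply, Finset.sum_apply]
  ext N x
  rw [Dist.prod_apply, Dist.smul_apply, Finset.sum_apply]
  simp only [mapVar, PowerSeries.coeff_map, key2, Dist.smul_apply, Finset.sum_apply, map_sum,
    LinearMap.sum_apply]
  exact sum_antidiagonal_assoc (fun a b c => β (conv ℂ (PowerSeries.coeff a κ) (G b) x.1)
    (H c x.2)) N

/-- The exchange of the variables. -/
def Dist.swap : Dist (ℂ × ℂ) W₁ →+ Dist (ℂ × ℂ) W₁ :=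
  Dist.orderwise
    { toFun := fun g x => g x.swap
      map_zero' := rfl
      map_add' := fun _ _ => rfl }

@[simp] lemma Dist.swap_apply (G : Dist (ℂ × ℂ) W₁) (N : ℕ) (x : ℂ × ℂ) :
    Dist.swap G N x = G N x.swap := rfl

lemma Dist.swap_smul (κ : Mult ℂ (ℂ × ℂ)) (G : Dist (ℂ × ℂ) W₁) :
    Dist.swap (κ • G) = swapVar κ • Dist.swap G :=
  Dist.semilinear _ _ (by intro s z g; ext x; simp) κ G

lemma Dist.prod_swap (β : W₁ →ₗ[ℂ] W₂ →ₗ[ℂ] W₃) (G : Dist ℂ W₁) (H : Dist ℂ W₂) :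
    Dist.swap (Dist.prod β G H) = Dist.prod β.flip H G := by
  ext N x
  rw [Dist.swap_apply, Dist.prod_apply, Dist.prod_apply, ← Finset.Nat.sum_antidiagonal_swap]
  rfl

lemma Dist.swap_swap (G : Dist (ℂ × ℂ) W₁) : Dist.swap (Dist.swap G) = G := rfl

lemma Dist.prod_smul_right (β : W₁ →ₗ[ℂ] W₂ →ₗ[ℂ] W₃) (κ : Mult ℂ ℂ) (G : Dist ℂ W₁)
    (H : Dist ℂ W₂) : Dist.prod β G (κ • H) = inV κ • Dist.prod β G H := by
  rw [← Dist.swap_swap (Dist.prod β G (κ • H)), Dist.prod_swap, Dist.prod_smul_left,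
    Dist.swap_smul, Dist.prod_swap, swapVar_inU]
  rfl

end TwoVar

section OpProduct

/-- The product of two operator valued fields. -/
def Dist.opProd (G H : Dist ℂ Op) : Dist (ℂ × ℂ) Op := Dist.prod (LinearMap.mul ℂ Op) G H

lemma Dist.opProd_apply (G H : Dist ℂ Op) (N : ℕ) (x : ℂ × ℂ) :
    Dist.opProd G H N x = ∑ n ∈ antidiagonal N, G n.1 x.1 * H n.2 x.2 := rfl

lemma Dist.opProd_add_left (G G' H : Dist ℂ Op) :
    Dist.opProd (G + G') H = Dist.opProd G H + Dist.opProd G' H := Dist.prod_add_left _ _ _ _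

lemma Dist.opProd_add_right (G H H' : Dist ℂ Op) :
    Dist.opProd G (H + H') = Dist.opProd G H + Dist.opProd G H' := map_add _ _ _

lemma Dist.opProd_smul_left (κ : Mult ℂ ℂ) (G H : Dist ℂ Op) :
    Dist.opProd (κ • G) H = inU κ • Dist.opProd G H := Dist.prod_smul_left _ _ _ _

lemma Dist.opProd_smul_right (κ : Mult ℂ ℂ) (G H : Dist ℂ Op) :
    Dist.opProd G (κ • H) = inV κ • Dist.opProd G H := Dist.prod_smul_right _ _ _ _

variable {Γ : Type} [AddCommGroup Γ] {k : ℂ}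

lemma Covariant.add {c b : Boson → ℕ → Mult ℂ Γ} {G H : Dist Γ Op} (hG : Covariant k c b G)
    (hH : Covariant k c b H) : Covariant k c b (G + H) where
  creation X n := by
    rw [map_add, map_add, hG.creation, hH.creation, smul_add]; abel
  annihilation X n := by
    rw [map_add, map_add, hG.annihilation, hH.annihilation, smul_add]; abel

lemma Covariant.smul {c b : Boson → ℕ → Mult ℂ Γ} {G : Dist Γ Op} (hG : Covariant k c b G)
    (κ : Mult ℂ Γ) : Covariant k c b (κ • G) where
  creation X n := by
    rw [map_smul, map_smul, hG.creation, smul_add, smul_comm]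
  annihilation X n := by
    rw [map_smul, map_smul, hG.annihilation, smul_add, smul_comm]

lemma Covariant.neg {c b : Boson → ℕ → Mult ℂ Γ} {G : Dist Γ Op} (hG : Covariant k c b G) :
    Covariant k c b (-G) := by
  have := hG.smul (-1)
  rwa [neg_one_smul] at this

lemma Covariant.sub {c b : Boson → ℕ → Mult ℂ Γ} {G H : Dist Γ Op} (hG : Covariant k c b G)
    (hH : Covariant k c b H) : Covariant k c b (G - H) := by
  rw [sub_eq_add_neg]
  exact hG.add hH.neg

lemma Covariant.congr {c b c' b' : Boson → ℕ → Mult ℂ Γ} {G : Dist Γ Op}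
    (hG : Covariant k c b G) (hc : ∀ X n, c X n = c' X n) (hb : ∀ X n, b X n = b' X n) :
    Covariant k c' b' G where
  creation X n := by rw [← hc]; exact hG.creation X n
  annihilation X n := by rw [← hb]; exact hG.annihilation X n

lemma Covariant.opProd {c b c' b' : Boson → ℕ → Mult ℂ ℂ} {G H : Dist ℂ Op}
    (hG : Covariant k c b G) (hH : Covariant k c' b' H) :
    Covariant k (fun X n => inU (c X n) + inV (c' X n)) (fun X n => inU (b X n) + inV (b' X n))
      (Dist.opProd G H) := by
  have h1 : ∀ T (G H : Dist ℂ Op), Dist.lmul T (Dist.opProd G H) =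
      Dist.opProd (Dist.lmul T G) H := by
    intro T G H
    ext1 N x
    simp only [Dist.lmul_apply, Dist.opProd_apply, Finset.mul_sum, mul_assoc]
  have h2 : ∀ T (G H : Dist ℂ Op), Dist.rmul T (Dist.opProd G H) =
      Dist.opProd G (Dist.rmul T H) := by
    intro T G H
    ext1 N x
    simp only [Dist.rmul_apply, Dist.opProd_apply, Finset.sum_mul, mul_assoc]
  have h3 : ∀ T (G H : Dist ℂ Op), Dist.opProd G (Dist.lmul T H) =
      Dist.opProd (Dist.rmul T G) H := by
    intro T G H
    ext1 N x
    simp only [Dist.rmul_apply, Dist.lmul_apply, Dist.opProd_apply, mul_assoc]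
  constructor
  · intro X n
    rw [h2, hH.creation, Dist.opProd_add_right, h3, hG.creation, Dist.opProd_add_left, h1,
      Dist.opProd_smul_left, Dist.opProd_smul_right, add_smul, add_assoc]
  · intro X n
    rw [h1, hG.annihilation, Dist.opProd_add_left, ← h3, hH.annihilation, Dist.opProd_add_right,
      ← h2, Dist.opProd_smul_left, Dist.opProd_smul_right, add_smul, add_assoc,
      add_comm (inV (b' X n) • _)]

lemma Covariant.swap {c b : Boson → ℕ → Mult ℂ (ℂ × ℂ)} {G : Dist (ℂ × ℂ) Op}
    (hG : Covariant k c b G) :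
    Covariant k (fun X n => swapVar (c X n)) (fun X n => swapVar (b X n)) (Dist.swap G) where
  creation X n := by
    have := congrArg Dist.swap (hG.creation X n)
    rw [map_add, Dist.swap_smul] at this
    exact this
  annihilation X n := by
    have := congrArg Dist.swap (hG.annihilation X n)
    rw [map_add, Dist.swap_smul] at this
    exact this

/-- Distributions of operators with the same commutators with the modes and the same vacuum matrix
coefficients agree. -/
theorem Covariant.eq_on (hk : ∀ X, kappa k X ≠ 0) {c b : Boson → ℕ → Mult ℂ Γ} {G H : Dist Γ Op}
    (hG : Covariant k c b G) (hH : Covariant k c b H) (p : Boson → ℂ)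
    (h0 : ∀ q, Dist.post (vev p q) G = Dist.post (vev p q) H) (N : ℕ) (x : Γ) (f : Osc) :
    G N x (Finsupp.single p f) = H N x (Finsupp.single p f) := by
  have h := (hG.sub hH).eq_zero hk p (fun q => by rw [map_sub, h0, sub_self]) N x f
  rw [Dist.sub_apply, Pi.sub_apply, LinearMap.sub_apply, sub_eq_zero] at h
  exact h

theorem Covariant.eq (hk : ∀ X, kappa k X ≠ 0) {c b : Boson → ℕ → Mult ℂ Γ} {G H : Dist Γ Op}
    (hG : Covariant k c b G) (hH : Covariant k c b H)
    (h0 : ∀ p q, Dist.post (vev p q) G = Dist.post (vev p q) H) : G = H := by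
  ext1 N x
  exact YangianFF.op_ext fun p f => hG.eq_on hk hH p (h0 p) N x f

end OpProduct

section Field2

/-- A formal field in two variables as a distribution. -/
def toDist₂ (G : Field2 Fk) : Dist (ℂ × ℂ) Op := fun N x => PowerSeries.coeff N (G x.1 x.2)

lemma toDist₂_prodUV (a b : Field1 Fk) :
    toDist₂ (prodUV a b) = Dist.opProd (toDist a) (toDist b) := by
  ext1 N x
  simp only [toDist₂, prodUV, PowerSeries.coeff_mul]
  rfl

lemma toDist₂_prodVU (a b : Field1 Fk) :
    toDist₂ (prodVU a b) = Dist.swap (Dist.opProd (toDist b) (toDist a)) := by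
  ext1 N x
  simp only [toDist₂, prodVU, PowerSeries.coeff_mul]
  rfl

lemma toDist₂_mulLin (r : ℂ) (G : Field2 Fk) : toDist₂ (mulLin r G) = lin r • toDist₂ G := by
  ext1 N x
  rw [lin, add_smul, sub_smul, mul_smul, Dist.add_apply, Dist.sub_apply, Pi.add_apply,
    Pi.sub_apply, monom, monom, Dist.C_smul_apply, Dist.C_smul_apply, conv_single, conv_single,
    cst_smul_apply, one_smul, one_smul]
  change PowerSeries.coeff N (mulLin r G x.1 x.2) = _
  rw [mulLin, map_add, map_sub]
  have h1 : ∀ s : ℂ × ℂ, toDist₂ G N (x - s) = PowerSeries.coeff N (G (x.1 - s.1) (x.2 - s.2)) :=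
    fun s => rfl
  rw [h1, h1, sub_zero, sub_zero]
  refine congrArg₂ (· + ·) rfl ?_
  rcases N with _ | N
  · rw [Dist.X_smul_zero]
    simp
  · rw [Dist.X_smul_succ]
    change r • PowerSeries.coeff (N + 1) (PowerSeries.X * G x.1 x.2) = _
    rw [PowerSeries.coeff_succ_X_mul]
    rfl

lemma toDist₂_mulLins (l : List ℂ) (G : Field2 Fk) :
    toDist₂ (mulLins l G) = (l.map lin).prod • toDist₂ G := by
  induction l with
  | nil => simp [mulLins]
  | cons r l ih =>
    rw [List.map_cons, List.prod_cons, mul_smul, ← ih, ← toDist₂_mulLin]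
    rfl

end Field2

/-! ### Vacuum matrix coefficients of products of two vertex operators -/

section Collapse

open MvPowerSeries (coeff)

variable {A : Type} [CommRing A] [Algebra ℂ A]

lemma sum_antidiagonal_swap_four {M : Type} [AddCommMonoid M] (f : ℕ → ℕ → ℕ → ℕ → M) (N : ℕ) :
    ∑ n ∈ antidiagonal N, ∑ b ∈ antidiagonal n.1, ∑ c ∈ antidiagonal n.2, f b.1 b.2 c.1 c.2 =
      ∑ n ∈ antidiagonal N, ∑ b ∈ antidiagonal n.1, ∑ c ∈ antidiagonal n.2, f b.1 c.1 b.2 c.2 := by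
  simp only [← Finset.sum_product']
  rw [Finset.sum_sigma', Finset.sum_sigma']
  refine Finset.sum_nbij' (fun x => ⟨(x.2.1.1 + x.2.2.1, x.2.1.2 + x.2.2.2),
      ((x.2.1.1, x.2.2.1), (x.2.1.2, x.2.2.2))⟩)
    (fun x => ⟨(x.2.1.1 + x.2.2.1, x.2.1.2 + x.2.2.2),
      ((x.2.1.1, x.2.2.1), (x.2.1.2, x.2.2.2))⟩) ?_ ?_ ?_ ?_ ?_ <;>
  rintro ⟨⟨n, m⟩, ⟨⟨a, b⟩, ⟨c, d⟩⟩⟩ h <;>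
  simp only [Finset.mem_sigma, Finset.mem_product, mem_antidiagonal] at h ⊢ <;>
  obtain ⟨h1, h2, h3⟩ := h
  · exact ⟨by omega, trivial, trivial⟩
  · exact ⟨by omega, trivial, trivial⟩
  · subst h2 h3; rfl
  · subst h2 h3; rfl

/-- The linear map underlying `collapse`. -/
def collapseLin (A : Type) [CommRing A] [Algebra ℂ A] :
    MvPowerSeries (Fin 2) (PowerSeries A) →ₗ[ℂ] MvPowerSeries (Fin 2) A where
  toFun F := fun d => ∑ n ∈ antidiagonal (d 1),
    PowerSeries.coeff n.2 (coeff (expo (d 0) n.1) F)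
  map_add' F G := funext fun d => by
    change ∑ n ∈ antidiagonal (d 1), PowerSeries.coeff n.2 (coeff (expo (d 0) n.1) (F + G)) =
      ∑ n ∈ antidiagonal (d 1), PowerSeries.coeff n.2 (coeff (expo (d 0) n.1) F) +
      ∑ n ∈ antidiagonal (d 1), PowerSeries.coeff n.2 (coeff (expo (d 0) n.1) G)
    simp only [map_add, Finset.sum_add_distrib]
  map_smul' c F := funext fun d => by
    change ∑ n ∈ antidiagonal (d 1), PowerSeries.coeff n.2 (c • coeff (expo (d 0) n.1) F) =
      c • ∑ n ∈ antidiagonal (d 1), PowerSeries.coeff n.2 (coeff (expo (d 0) n.1) F)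
    rw [Finset.smul_sum]
    rfl

lemma coeff_collapseLin (F : MvPowerSeries (Fin 2) (PowerSeries A)) (l N : ℕ) :
    coeff (expo l N) (collapseLin A F) =
      ∑ n ∈ antidiagonal N, PowerSeries.coeff n.2 (coeff (expo l n.1) F) := by
  change ∑ n ∈ antidiagonal (expo l N 1), PowerSeries.coeff n.2
    (coeff (expo (expo l N 0) n.1) F) = _
  rw [expo_apply_zero, expo_apply_one]

lemma collapseLin_C (κ : PowerSeries A) (l N : ℕ) :
    coeff (expo l N) (collapseLin A (MvPowerSeries.C κ)) =
      if l = 0 then PowerSeries.coeff N κ else 0 := by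
  classical
  rw [coeff_collapseLin, Finset.sum_eq_single (0, N)]
  · rw [MvPowerSeries.coeff_C]
    have : expo l 0 = 0 ↔ l = 0 := by
      rw [show (0 : Fin 2 →₀ ℕ) = expo 0 0 by simp [expo], expo_inj]
      simp
    simp only [this]
    split_ifs <;> simp
  · rintro ⟨a, b⟩ hab hne
    rw [MvPowerSeries.coeff_C, if_neg, map_zero]
    rw [show (0 : Fin 2 →₀ ℕ) = expo 0 0 by simp [expo], expo_inj]
    rintro ⟨-, h⟩
    simp only at h
    subst h
    rw [mem_antidiagonal] at hab
    simp only [zero_add] at hab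
    exact hne (by rw [hab])
  · intro h
    exact absurd (by rw [mem_antidiagonal, zero_add]) h

lemma collapseLin_mul (F G : MvPowerSeries (Fin 2) (PowerSeries A)) :
    collapseLin A (F * G) = collapseLin A F * collapseLin A G := by
  classical
  ext1 d
  rw [← expo_eta d, MvPowerSeries.coeff_mul, sum_antidiagonal_expo (f := fun x y =>
    coeff x (collapseLin A F) * coeff y (collapseLin A G))]
  simp only [coeff_collapseLin, Finset.sum_mul_sum, MvPowerSeries.coeff_mul]
  simp only [sum_antidiagonal_expo (f := fun x y => coeff x F * coeff y G), map_sum,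
    PowerSeries.coeff_mul]
  rw [Finset.sum_comm]
  refine Finset.sum_congr rfl fun a _ => ?_
  exact sum_antidiagonal_swap_four (fun b c b' c' => PowerSeries.coeff b'
    (coeff (expo a.1 b) F) * PowerSeries.coeff c' (coeff (expo a.2 c) G)) (d 1)

/-- The homomorphism `A[[ħ]][[v, ħ]] → A[[v, ħ]]` that identifies the two copies of `ħ`. -/
def collapse (A : Type) [CommRing A] [Algebra ℂ A] :
    MvPowerSeries (Fin 2) (PowerSeries A) →ₐ[ℂ] MvPowerSeries (Fin 2) A :=
  AlgHom.ofLinearMap (collapseLin A)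
    (by
      classical
      ext1 d
      rw [← expo_eta d, ← map_one MvPowerSeries.C, collapseLin_C, MvPowerSeries.coeff_one,
        PowerSeries.coeff_one, show (0 : Fin 2 →₀ ℕ) = expo 0 0 by simp [expo]]
      simp only [expo_inj]
      split_ifs <;> simp_all)
    collapseLin_mul

lemma coeff_collapse (F : MvPowerSeries (Fin 2) (PowerSeries A)) (l N : ℕ) :
    coeff (expo l N) (collapse A F) =
      ∑ n ∈ antidiagonal N, PowerSeries.coeff n.2 (coeff (expo l n.1) F) :=
  coeff_collapseLin F l N

/-- The inclusion `A[[ħ]] → A[[v, ħ]]`. -/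
def inHbar (A : Type) [CommRing A] [Algebra ℂ A] : PowerSeries A →+* MvPowerSeries (Fin 2) A :=
  ((collapse A : MvPowerSeries (Fin 2) (PowerSeries A) →+* MvPowerSeries (Fin 2) A)).comp
    MvPowerSeries.C

lemma coeff_inHbar (κ : PowerSeries A) (l N : ℕ) :
    coeff (expo l N) (inHbar A κ) = if l = 0 then PowerSeries.coeff N κ else 0 :=
  collapseLin_C κ l N

lemma collapse_C (κ : PowerSeries A) : collapse A (MvPowerSeries.C κ) = inHbar A κ := rfl

lemma inHbar_X : inHbar A PowerSeries.X = MvPowerSeries.X 1 := by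
  classical
  ext1 d
  rw [← expo_eta d, coeff_inHbar, PowerSeries.coeff_X, MvPowerSeries.coeff_X,
    show (Finsupp.single 1 1 : Fin 2 →₀ ℕ) = expo 0 1 by simp [expo]]
  simp only [expo_inj]
  split_ifs <;> simp_all

lemma inHbar_C (a : A) : inHbar A (PowerSeries.C a) = MvPowerSeries.C a := by
  classical
  ext1 d
  rw [← expo_eta d, coeff_inHbar, PowerSeries.coeff_C, MvPowerSeries.coeff_C,
    show (0 : Fin 2 →₀ ℕ) = expo 0 0 by simp [expo]]
  simp only [expo_inj]
  split_ifs <;> simp_all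

lemma ordGE_collapse (m : ℕ) (F : MvPowerSeries (Fin 2) (PowerSeries A)) (hF : OrdGE m F) :
    OrdGE m (collapse A F) := by
  intro d hd
  rw [← expo_eta d, coeff_collapse]
  refine Finset.sum_eq_zero fun n hn => ?_
  rw [mem_antidiagonal] at hn
  rw [hF _ (by rw [expo_apply_zero, expo_apply_one]; omega), map_zero]

end Collapse

section Vev

open MvPowerSeries (coeff)

/-- The scalars by which creation operators are shifted upon conjugation by the annihilation part of
a vertex operator. -/
def tau0 (k : ℂ) (L : List Term) : Osc →ₐ[ℂ] Mult ℂ ℂ :=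
  MvPolynomial.aeval fun i => -pwSum ℂ (1 : ℂ) k L i.1 (-(i.2 + 1 : ℂ))

/-- The projection to the vacuum. -/
def vacCoeff : Osc →ₐ[ℂ] ℂ := MvPolynomial.aeval fun _ => (0 : ℂ)

/-- The projection to the vacuum, applied to the coefficients of a multiplier. -/
def vacMult : Mult Osc ℂ →+* Mult ℂ ℂ :=
  PowerSeries.map (AddMonoidAlgebra.mapRingHom ℂ (vacCoeff : Osc →+* ℂ))

lemma vacMult_extend (κ : Mult ℂ ℂ) : vacMult (extend Osc κ) = κ := by
  ext n : 1
  simp only [vacMult, extend, PowerSeries.coeff_map]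
  generalize PowerSeries.coeff n κ = a
  induction a using AddMonoidAlgebra.induction_linear with
  | zero => simp
  | add a b ha hb => rw [map_add, map_add, ha, hb]
  | single s z =>
    rw [AddMonoidAlgebra.mapRingHom_single, AddMonoidAlgebra.mapRingHom_single]
    congr 1
    exact vacCoeff.commutes z

lemma vacMult_tau (k : ℂ) (L : List Term) (f : Osc) : vacMult (tau k L f) = tau0 k L f := by
  have hC : ∀ a : Osc, vacMult (PowerSeries.C (AddMonoidAlgebra.single 0 a)) =
      cst ℂ (vacCoeff a) := by
    intro a
    rw [vacMult, PowerSeries.map_C, AddMonoidAlgebra.mapRingHom_single]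
    rfl
  induction f using MvPolynomial.induction_on with
  | C a =>
    have h1 : tau k L (MvPolynomial.C a) =
        PowerSeries.C (AddMonoidAlgebra.single 0 (MvPolynomial.C a)) := by
      rw [← MvPolynomial.algebraMap_eq, AlgHom.commutes, PowerSeries.algebraMap_apply,
        algebraMap_eq_single]
    rw [h1, hC, ← MvPolynomial.algebraMap_eq, AlgHom.commutes, AlgHom.commutes, algebraMap_eq_cst]
    rfl
  | add f g hf hg => rw [map_add, map_add, map_add, hf, hg]
  | mul_X f i hf =>
    obtain ⟨X, n⟩ := i
    rw [map_mul, map_mul, map_mul, hf, coeff_tau_X, map_add, hC, ← extend_pwSum, map_neg,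
      vacMult_extend, show vacCoeff (MvPolynomial.X (X, n)) = 0 by simp [vacCoeff],
      show cst ℂ (0 : ℂ) = 0 by simp [cst], zero_add]
    simp [tau0]

lemma post_vacCoeff_smul (κ : Mult Osc ℂ) (G : Dist ℂ Osc) :
    Dist.post vacCoeff.toLinearMap (κ • G) = vacMult κ • Dist.post vacCoeff.toLinearMap G :=
  Dist.semilinear (AddMonoidAlgebra.mapRingHom ℂ (vacCoeff : Osc →+* ℂ))
    (vacCoeff.toLinearMap.toAddMonoidHom.compLeft ℂ) (by
      intro s z g
      ext x
      simp) κ G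

lemma post_vacCoeff_ofSer (E : MvPowerSeries (Fin 2) Osc) :
    Dist.post vacCoeff.toLinearMap (ofSer E) = ofSer (mapA vacCoeff E) := by
  ext1 N x
  rw [Dist.post_apply]
  by_cases h : ∃ j : ℕ, x = j
  · obtain ⟨j, rfl⟩ := h
    rw [ofSer_nat, ofSer_nat]
    rfl
  · rw [ofSer_eq_zero _ _ h, ofSer_eq_zero _ _ h, map_zero]

lemma mapA_vacCoeff_expS (L : List Term) : mapA vacCoeff (expS (creaSer L)) = 1 := by
  rw [mapA_expS _ (ordGE_creaSer L)]
  have h : mapA vacCoeff (creaSer L) = 0 := by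
    rw [creaSer]
    induction L with
    | nil => simp
    | cons t L ih =>
      rw [List.map_cons, List.sum_cons, map_add, ih, add_zero, map_smul]
      have : mapA vacCoeff (posSer t.2.1 t.2.2) = 0 := by
        ext1 d
        change vacCoeff (∑ n ∈ Finset.Icc 1 (d 0 + d 1), _) = 0
        rw [map_sum]
        refine Finset.sum_eq_zero fun n _ => ?_
        rw [map_smul]
        simp [vacCoeff]
      rw [this, smul_zero]
  rw [h, expS_zero]

lemma smul_ofSer_one (κ : Mult ℂ ℂ) (N : ℕ) (x : ℂ) :
    (κ • ofSer (1 : MvPowerSeries (Fin 2) ℂ)) N x = (PowerSeries.coeff N κ).coeff x := by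
  classical
  have h : ∀ (n : ℕ) (y : ℂ), ofSer (1 : MvPowerSeries (Fin 2) ℂ) n y =
      if n = 0 ∧ y = 0 then 1 else 0 := by
    intro n y
    by_cases h : ∃ j : ℕ, y = j
    · obtain ⟨j, rfl⟩ := h
      rw [ofSer_nat, MvPowerSeries.coeff_one, show (0 : Fin 2 →₀ ℕ) = expo 0 0 by simp [expo]]
      simp only [expo_inj, Nat.cast_eq_zero, and_comm]
    · rw [ofSer_eq_zero _ _ h, if_neg]
      rintro ⟨-, rfl⟩
      exact h ⟨0, by simp⟩
  rw [Dist.smul_apply, Finset.sum_apply, Finset.sum_eq_single (N, 0)]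
  · rw [conv_apply]
    simp only [h, true_and, sub_eq_zero, smul_eq_mul, mul_ite, mul_one, mul_zero]
    simp
    try (intro h; exact h.symm)
  · rintro ⟨a, b⟩ hab hne
    have hb : b ≠ 0 := by
      rintro rfl
      rw [mem_antidiagonal] at hab
      simp only [add_zero] at hab
      exact hne (by rw [hab])
    rw [conv_apply]
    simp [h, hb]
  · intro h
    exact absurd (by rw [mem_antidiagonal, add_zero]) h

/-- The vacuum component in charge `q` of `T` applied to a vector of charge `p`. -/
def vacForm (p q : Boson → ℂ) : Op →ₗ[ℂ] Osc →ₗ[ℂ] ℂ :=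
  LinearMap.mk₂ ℂ (fun T g => vacCoeff (T (Finsupp.single p g) q))
    (fun S T g => by rw [LinearMap.add_apply, Finsupp.add_apply, map_add])
    (fun c T g => by rw [LinearMap.smul_apply, Finsupp.smul_apply, map_smul])
    (fun T g h => by rw [Finsupp.single_add, map_add, Finsupp.add_apply, map_add])
    (fun c T g => by rw [← Finsupp.smul_single, map_smul, Finsupp.smul_apply, map_smul])

lemma vacForm_apply (p q : Boson → ℂ) (T : Op) (g : Osc) :
    vacForm p q T g = vacCoeff (T (Finsupp.single p g) q) := rfl

lemma vev_eq_vacForm (p q : Boson → ℂ) (T : Op) : vev p q T = vacForm p q T 1 := rfl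

lemma post_vacForm_field (k : ℂ) {d : VertexData} (hd : d.Neutral) (p : Boson → ℂ) (g : Osc) :
    Dist.post ((vacForm p (d.shift k p)).flip g) (toDist (d.field k)) =
      (pref ℂ (1 : ℂ) d.la p * tau0 k d.la g) • ofSer (1 : MvPowerSeries (Fin 2) ℂ) := by
  have h : Dist.post ((vacForm p (d.shift k p)).flip g) (toDist (d.field k)) =
      Dist.post vacCoeff.toLinearMap ((pref Osc (1 : ℂ) d.la p * tau k d.la g) •
        ofSer (expS (creaSer d.lc))) := by
    ext1 N x
    rw [Dist.post_apply, LinearMap.flip_apply, vacForm_apply, field_single k hd]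
    change vacCoeff ((Finsupp.single (d.shift k p) _ : Fk) (d.shift k p)) = _
    rw [Finsupp.single_eq_same]
    rfl
  rw [h, post_vacCoeff_smul, post_vacCoeff_ofSer, mapA_vacCoeff_expS, map_mul, ← extend_pref,
    vacMult_extend, vacMult_tau]

lemma vacForm_field (k : ℂ) {d : VertexData} (hd : d.Neutral) (p : Boson → ℂ) (g : Osc) (N : ℕ)
    (x : ℂ) : vacForm p (d.shift k p) (toDist (d.field k) N x) g =
      (PowerSeries.coeff N (pref ℂ (1 : ℂ) d.la p * tau0 k d.la g)).coeff x := by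
  rw [← smul_ofSer_one, ← post_vacForm_field k hd]
  rfl

lemma vacForm_field_of_ne (k : ℂ) {d : VertexData} (hd : d.Neutral) (p q : Boson → ℂ) (g : Osc)
    (N : ℕ) (x : ℂ) (hq : q ≠ d.shift k p) :
    vacForm p q (toDist (d.field k) N x) g = 0 := by
  rw [vacForm_apply, field_single k hd]
  change vacCoeff ((Finsupp.single (d.shift k p) _ : Fk) q) = _
  rw [Finsupp.single_eq_of_ne hq, map_zero]

/-- The vacuum matrix coefficients of a vertex operator. -/
lemma post_vev_field (k : ℂ) {d : VertexData} (hd : d.Neutral) (p : Boson → ℂ) :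
    Dist.post (vev p (d.shift k p)) (toDist (d.field k)) =
      pref ℂ (1 : ℂ) d.la p • ofSer (1 : MvPowerSeries (Fin 2) ℂ) := by
  have := post_vacForm_field k hd p 1
  rw [map_one (tau0 k d.la), mul_one] at this
  exact this

lemma post_vev_field_of_ne (k : ℂ) {d : VertexData} (hd : d.Neutral) (p q : Boson → ℂ)
    (hq : q ≠ d.shift k p) : Dist.post (vev p q) (toDist (d.field k)) = 0 := by
  ext1 N x
  exact vacForm_field_of_ne k hd p q 1 N x hq

/-- A power series in `v` and `ħ`, the coefficients of which are Laurent polynomials in `u` with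
complex exponents, as a distribution. -/
def ofLaurent : MvPowerSeries (Fin 2) (AddMonoidAlgebra ℂ ℂ) →+ Dist (ℂ × ℂ) ℂ where
  toFun F N x := (ofSer F N x.2).coeff x.1
  map_zero' := by
    ext1 N x
    rw [ofSer_zero]; rfl
  map_add' F G := by
    ext1 N x
    rw [ofSer_add]; rfl

lemma ofLaurent_apply (F : MvPowerSeries (Fin 2) (AddMonoidAlgebra ℂ ℂ)) (N : ℕ) (x : ℂ × ℂ) :
    ofLaurent F N x = (ofSer F N x.2).coeff x.1 := rfl

lemma coeff_inHbar_mul {A : Type} [CommRing A] [Algebra ℂ A] (κ : PowerSeries A)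
    (F : MvPowerSeries (Fin 2) A) (j N : ℕ) : coeff (expo j N) (inHbar A κ * F) =
      ∑ b ∈ antidiagonal N, PowerSeries.coeff b.1 κ * coeff (expo j b.2) F := by
  classical
  rw [MvPowerSeries.coeff_mul, sum_antidiagonal_expo (f := fun x y =>
    coeff x (inHbar A κ) * coeff y F), Finset.sum_eq_single (0, j)]
  · simp [coeff_inHbar]
  · rintro ⟨a, b⟩ hab hne
    have ha : a ≠ 0 := by
      rintro rfl
      rw [mem_antidiagonal] at hab
      simp only [zero_add] at hab
      exact hne (by rw [hab])
    simp [coeff_inHbar, ha]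
  · intro h
    exact absurd (by rw [mem_antidiagonal, zero_add]) h

lemma ofLaurent_inHbar_mul (κ : Mult ℂ ℂ) (F : MvPowerSeries (Fin 2) (AddMonoidAlgebra ℂ ℂ)) :
    ofLaurent (inHbar _ κ * F) = inU κ • ofLaurent F := by
  have key : ∀ (a : AddMonoidAlgebra ℂ ℂ) (g : ℂ → AddMonoidAlgebra ℂ ℂ) (x : ℂ × ℂ),
      conv ℂ (AddMonoidAlgebra.mapDomainRingHom ℂ (AddMonoidHom.inl ℂ ℂ) a)
        (fun x : ℂ × ℂ => (g x.2).coeff x.1) x = (a * g x.2).coeff x.1 := by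
    intro a g x
    induction a using AddMonoidAlgebra.induction_linear with
    | zero => simp
    | add a b ha hb =>
      rw [map_add, map_add, LinearMap.add_apply, Pi.add_apply, ha, hb, add_mul,
        AddMonoidAlgebra.coeff_add, Finsupp.add_apply]
    | single s z =>
      rw [AddMonoidAlgebra.coeff_single_mul_apply]
      simp [sub_eq_neg_add]
  ext1 N x
  rw [ofLaurent_apply, Dist.smul_apply, Finset.sum_apply]
  have h2 : ∀ n : ℕ × ℕ, conv ℂ (PowerSeries.coeff n.1 (inU κ)) (ofLaurent F n.2) x =
      (PowerSeries.coeff n.1 κ * ofSer F n.2 x.2).coeff x.1 := by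
    intro n
    simp only [mapVar, PowerSeries.coeff_map]
    exact key _ (fun y => ofSer F n.2 y) x
  simp only [h2]
  by_cases h : ∃ j : ℕ, x.2 = j
  · obtain ⟨j, hj⟩ := h
    rw [hj]
    simp only [ofSer_nat]
    rw [coeff_inHbar_mul, AddMonoidAlgebra.coeff_sum, Finsupp.finsetSum_apply]
  · rw [ofSer_eq_zero _ _ h]
    simp only [ofSer_eq_zero _ _ h, mul_zero]
    simp

lemma ofLaurent_X0_mul (F : MvPowerSeries (Fin 2) (AddMonoidAlgebra ℂ ℂ)) :
    ofLaurent (MvPowerSeries.X 0 * F) = monom ℂ ((0, 1) : ℂ × ℂ) • ofLaurent F := by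
  ext1 N x
  have h1 : (monom ℂ ((0, 1) : ℂ × ℂ) • ofLaurent F) N x = ofLaurent F N (x - (0, 1)) := by
    rw [monom, Dist.C_smul_apply, conv_single, one_smul]
  rw [h1, ofLaurent_apply, ofSer_X0_mul, monom, Dist.C_smul_apply, conv_single, one_smul,
    ofLaurent_apply]
  simp

/-- The polynomial `u - v + rħ` as a series in `v` and `ħ`. -/
def linSer (r : ℂ) : MvPowerSeries (Fin 2) (AddMonoidAlgebra ℂ ℂ) :=
  inHbar _ (pw ℂ (1 : ℂ) 1 r) - MvPowerSeries.X 0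

lemma ofLaurent_linSer_mul (r : ℂ) (F : MvPowerSeries (Fin 2) (AddMonoidAlgebra ℂ ℂ)) :
    ofLaurent (linSer r * F) = lin r • ofLaurent F := by
  rw [linSer, sub_mul, map_sub, ofLaurent_inHbar_mul, ofLaurent_X0_mul, ← sub_smul, pw_one,
    map_add, map_mul, mapVar_X, mapVar_monom, algebraMap_eq_cst, mapVar_cst]
  congr 1
  rw [lin]
  change monom ℂ (1, 0) + _ - _ = _
  ring

lemma ofLaurent_linSer_prod_mul (l : List ℂ) (F : MvPowerSeries (Fin 2) (AddMonoidAlgebra ℂ ℂ)) :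
    ofLaurent ((l.map linSer).prod * F) = (l.map lin).prod • ofLaurent F := by
  induction l with
  | nil => simp
  | cons r l ih =>
    rw [List.map_cons, List.map_cons, List.prod_cons, List.prod_cons, mul_assoc,
      ofLaurent_linSer_mul, ih, mul_smul]

/-- The ratio of the vacuum matrix coefficient of a product of two vertex operators and the product
of their vacuum matrix coefficients. -/
def contraction (k : ℂ) (d d' : VertexData) : MvPowerSeries (Fin 2) (AddMonoidAlgebra ℂ ℂ) :=
  inHbar _ (pref ℂ (1 : ℂ) d.la fun X => kappa k X * d'.r X) *
    collapse _ (mapA (tau0 k d.la) (expS (creaSer d'.lc)))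

lemma pref_nil {A : Type} [CommRing A] [Algebra ℂ A] {Γ : Type} [AddCommGroup Γ] [Module ℂ Γ] (e : Γ)
    (p : Boson → ℂ) : pref A e [] p = 1 := rfl

lemma pref_cons {A : Type} [CommRing A] [Algebra ℂ A] {Γ : Type} [AddCommGroup Γ] [Module ℂ Γ] (e : Γ)
    (t : Term) (L : List Term) (p : Boson → ℂ) :
    pref A e (t :: L) p = pw A e (t.1 * p t.2.1) t.2.2 * pref A e L p := by
  rw [pref, List.map_cons, List.prod_cons]
  rfl

lemma pref_add (L : List Term) (p q : Boson → ℂ) :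
    pref ℂ (1 : ℂ) L (fun X => p X + q X) = pref ℂ (1 : ℂ) L p * pref ℂ (1 : ℂ) L q := by
  induction L with
  | nil => rw [pref_nil, pref_nil, pref_nil, one_mul]
  | cons t L ih =>
    rw [pref_cons, pref_cons, pref_cons, ih, mul_add, pw_add]
    exact mul_mul_mul_comm _ _ _ _

lemma post_vev_opProd (p q : Boson → ℂ) (k : ℂ) {d' : VertexData} (hd' : d'.Neutral)
    (G : Dist ℂ Op) : Dist.post (vev p q) (Dist.opProd G (toDist (d'.field k))) =
      inV (pref ℂ (1 : ℂ) d'.la p) •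
        Dist.prod (vacForm (d'.shift k p) q) G (ofSer (expS (creaSer d'.lc))) := by
  rw [← Dist.prod_smul_right]
  ext1 N x
  rw [Dist.post_apply, Dist.opProd_apply, Dist.prod_apply, map_sum]
  refine Finset.sum_congr rfl fun n _ => ?_
  rw [vev_eq_vacForm, vacForm_apply, vacForm_apply, Module.End.mul_apply, field_single k hd',
    map_one, mul_one, ← extend_pref, extend_smul]
  rfl

/-- The vacuum matrix coefficients of a product of two vertex operators. -/
theorem post_vev_opProd_field (k : ℂ) {d d' : VertexData} (hd : d.Neutral) (hd' : d'.Neutral)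
    (p : Boson → ℂ) : Dist.post (vev p (d.shift k (d'.shift k p)))
      (Dist.opProd (toDist (d.field k)) (toDist (d'.field k))) =
      (inU (pref ℂ (1 : ℂ) d.la p) * inV (pref ℂ (1 : ℂ) d'.la p)) •
        ofLaurent (contraction k d d') := by
  have h : Dist.prod (vacForm (d'.shift k p) (d.shift k (d'.shift k p))) (toDist (d.field k))
      (ofSer (expS (creaSer d'.lc))) = ofLaurent (inHbar _ (pref ℂ (1 : ℂ) d.la (d'.shift k p)) *
        collapse _ (mapA (tau0 k d.la) (expS (creaSer d'.lc)))) := by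
    ext1 N x
    rw [Dist.prod_apply, ofLaurent_apply, ← collapse_C, ← map_mul (collapse _)]
    simp only [vacForm_field k hd]
    by_cases h : ∃ j : ℕ, x.2 = j
    · obtain ⟨j, hj⟩ := h
      rw [hj, ofSer_nat, coeff_collapse, AddMonoidAlgebra.coeff_sum, Finsupp.finsetSum_apply,
        ← Finset.Nat.sum_antidiagonal_swap]
      refine Finset.sum_congr rfl fun n _ => ?_
      rw [ofSer_nat, MvPowerSeries.coeff_C_mul]
      rfl
    · simp only [ofSer_eq_zero _ _ h, map_zero, mul_zero]
      simp
  rw [post_vev_opProd p _ k hd', h]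
  change inV _ • ofLaurent (inHbar _ (pref ℂ (1 : ℂ) d.la fun X => p X + kappa k X * d'.r X) *
    _) = _
  rw [pref_add, map_mul (inHbar _), mul_assoc, ofLaurent_inHbar_mul, ← mul_smul, mul_comm]
  rfl

lemma post_vev_opProd_field_of_ne (k : ℂ) {d d' : VertexData} (hd : d.Neutral) (hd' : d'.Neutral)
    (p q : Boson → ℂ) (hq : q ≠ d.shift k (d'.shift k p)) :
    Dist.post (vev p q) (Dist.opProd (toDist (d.field k)) (toDist (d'.field k))) = 0 := by
  have h : Dist.prod (vacForm (d'.shift k p) q) (toDist (d.field k))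
      (ofSer (expS (creaSer d'.lc))) = 0 := by
    ext1 N x
    rw [Dist.prod_apply]
    simp only [vacForm_field_of_ne k hd _ _ _ _ _ hq, Finset.sum_const_zero]
    rfl
  rw [post_vev_opProd p _ k hd', h, smul_zero]

end Vev

/-! ### The contraction of two vertex operators as a rational function -/

section LogSeries

open MvPowerSeries (coeff)

variable {A : Type} [CommRing A] [Algebra ℂ A]

/-- The series `-log(1 - w) = ∑_{n>0} wⁿ / n` for a series `w` without constant term. -/
def logS (w : MvPowerSeries (Fin 2) A) : MvPowerSeries (Fin 2) A := fun d =>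
  ∑ n ∈ Finset.Icc 1 (d 0 + d 1), ((n : ℂ)⁻¹) • coeff d (w ^ n)

lemma coeff_logS {w : MvPowerSeries (Fin 2) A} (hw : OrdGE 1 w) (d : Fin 2 →₀ ℕ) {M : ℕ}
    (hM : d 0 + d 1 ≤ M) :
    coeff d (logS w) = ∑ n ∈ Finset.Icc 1 M, ((n : ℂ)⁻¹) • coeff d (w ^ n) := by
  change ∑ n ∈ Finset.Icc 1 (d 0 + d 1), _ = _
  refine Finset.sum_subset (Finset.Icc_subset_Icc le_rfl hM) fun n _ hn => ?_
  rw [Finset.mem_Icc] at hn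
  rw [hw.pow n d (by rw [Finset.mem_Icc] at *; omega), smul_zero]

lemma one_sub_mul_euler_logS {w : MvPowerSeries (Fin 2) A} (hw : OrdGE 1 w) :
    (1 - w) * euler (logS w) = euler w := by
  have key : ∀ M : ℕ, (1 - w) * euler (∑ n ∈ Finset.Icc 1 M, ((n : ℂ)⁻¹) • w ^ n) =
      (1 - w ^ M) * euler w := by
    intro M
    induction M with
    | zero => simp
    | succ M ih =>
      rw [← Finset.insert_Icc_right_eq_Icc_add_one (by omega), Finset.sum_insert (by simp),
        map_add, mul_add, ih, Derivation.map_smul, Derivation.leibniz_pow, Nat.add_sub_cancel,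
        ← Nat.cast_smul_eq_nsmul ℂ, smul_smul, inv_mul_cancel₀ (by exact_mod_cast M.succ_ne_zero),
        one_smul, smul_eq_mul]
      ring
  ext1 d
  have h1 : OrdGE (d 0 + d 1 + 1)
      (euler (logS w - ∑ n ∈ Finset.Icc 1 (d 0 + d 1), ((n : ℂ)⁻¹) • w ^ n)) := by
    intro e he
    rw [coeff_euler, map_sub, coeff_logS hw e (Nat.lt_succ_iff.1 he)]
    simp
  have h2 := (show OrdGE 0 (1 - w) from fun _ h => absurd h (by omega)).mul h1 d (by omega)
  have h3 := (hw.pow (d 0 + d 1)).mul (ordGE_euler w) d (by omega)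
  rw [map_sub euler, mul_sub, map_sub, sub_eq_zero, key] at h2
  rw [h2, sub_mul, map_sub, h3, one_mul, sub_zero]

end LogSeries

section Contraction

open MvPowerSeries (coeff)

/-- Laurent polynomials in `u` with complex exponents. -/
abbrev Lau : Type := AddMonoidAlgebra ℂ ℂ

/-- The power `(u + Bħ)^x` as a series in `v` and `ħ`. -/
def inPw (x B : ℂ) : MvPowerSeries (Fin 2) Lau := inHbar Lau (pw ℂ (1 : ℂ) x B)

lemma coeff_inPw (x B : ℂ) (l N : ℕ) : coeff (expo l N) (inPw x B) =
    if l = 0 then PowerSeries.coeff N (pw ℂ (1 : ℂ) x B) else 0 := coeff_inHbar _ l N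

lemma inPw_zero (B : ℂ) : inPw 0 B = 1 := by rw [inPw, pw_zero, map_one]

lemma inPw_add (x y B : ℂ) : inPw (x + y) B = inPw x B * inPw y B := by
  rw [inPw, pw_add, map_mul]; rfl

lemma inPw_one_sub (B C : ℂ) :
    inPw 1 (B - C) = inPw 1 B - C • (MvPowerSeries.X 1 : MvPowerSeries (Fin 2) Lau) := by
  have h : ∀ z : ℂ, inHbar Lau (algebraMap ℂ (Mult ℂ ℂ) z * PowerSeries.X) =
      z • (MvPowerSeries.X 1 : MvPowerSeries (Fin 2) Lau) := by
    intro z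
    rw [map_mul, inHbar_X, Algebra.smul_def]
    congr 1
    rw [PowerSeries.algebraMap_apply, inHbar_C, MvPowerSeries.algebraMap_apply]
  rw [inPw, inPw, pw_one, pw_one, map_add, map_add, h, h, sub_smul]
  ring

lemma euler_inPw (x B : ℂ) : euler (inPw x B) =
    (x * B) • (MvPowerSeries.X 1 * inPw (x - 1) B) := by
  ext1 d
  rw [← expo_eta d, coeff_euler, coeff_csmul, coeff_inPw, expo_apply_zero, expo_apply_one]
  rcases d 1 with _ | n
  · rw [coeff_X1_mul_zero, smul_zero]
    rcases d 0 with _ | l <;> simp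
  · rw [coeff_X1_mul_succ, coeff_inPw]
    split_ifs with h
    · rw [h, zero_add, coeff_pw, coeff_pw, AddMonoidAlgebra.smul_single,
        AddMonoidAlgebra.smul_single]
      congr 1
      · push_cast; ring_nf
      · have := succ_mul_choose_succ' x n
        simp only [Algebra.algebraMap_self, RingHom.id_apply, smul_eq_mul]
        push_cast
        linear_combination B ^ (n + 1) * this
    · simp

lemma euler_X (i : Fin 2) : euler (MvPowerSeries.X i : MvPowerSeries (Fin 2) Lau) =
    MvPowerSeries.X i := by
  classical
  ext1 d
  rw [coeff_euler, MvPowerSeries.coeff_X]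
  split_ifs with h
  · subst h
    fin_cases i <;> simp
  · simp

lemma linSer_eq (r : ℂ) : linSer r = inPw 1 r - MvPowerSeries.X 0 := rfl

lemma euler_linSer (r : ℂ) : euler (linSer r) =
    r • (MvPowerSeries.X 1 : MvPowerSeries (Fin 2) Lau) - MvPowerSeries.X 0 := by
  rw [linSer_eq, map_sub, euler_inPw, euler_X, sub_self, inPw_zero, mul_one, one_mul]

/-- The expansion of `(u - v + rħ)⁻¹` in powers of `v` and `ħ`. -/
def linInv (r : ℂ) : MvPowerSeries (Fin 2) Lau := fun d =>
  PowerSeries.coeff (d 1) (pw ℂ (1 : ℂ) (-(d 0 : ℂ) - 1) r)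

lemma coeff_linInv (r : ℂ) (l N : ℕ) : coeff (expo l N) (linInv r) =
    PowerSeries.coeff N (pw ℂ (1 : ℂ) (-(l : ℂ) - 1) r) := by
  change PowerSeries.coeff (expo l N 1) (pw ℂ (1 : ℂ) (-(expo l N 0 : ℂ) - 1) r) = _
  rw [expo_apply_zero, expo_apply_one]

lemma linSer_mul_linInv (r : ℂ) : linSer r * linInv r = 1 := by
  classical
  ext1 d
  rw [← expo_eta d, linSer_eq, sub_mul, map_sub, inPw, coeff_inHbar_mul]
  simp only [coeff_linInv]
  rw [← PowerSeries.coeff_mul, ← pw_add, MvPowerSeries.coeff_one,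
    show (0 : Fin 2 →₀ ℕ) = expo 0 0 by simp [expo]]
  simp only [expo_inj]
  rcases d 0 with _ | l
  · rw [coeff_X0_mul_zero, Nat.cast_zero, show (1 : ℂ) + (-0 - 1) = 0 by ring, pw_zero,
      PowerSeries.coeff_one]
    simp
  · rw [coeff_X0_mul_succ, coeff_linInv, Nat.cast_succ,
      show (1 : ℂ) + (-(l + 1) - 1) = -l - 1 by ring, sub_self, if_neg (by omega)]

/-- The series `u - v + rħ` is invertible, hence can be cancelled. -/
lemma linSer_mul_cancel {r : ℂ} {F G : MvPowerSeries (Fin 2) Lau}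
    (h : linSer r * F = linSer r * G) : F = G := by
  have := congrArg (linInv r * ·) h
  simp only [← mul_assoc] at this
  rwa [mul_comm (linInv r), linSer_mul_linInv, one_mul, one_mul] at this

/-- The logarithmic derivative of `u - v + rħ` with respect to the Euler derivation. -/
def lamSer (r : ℂ) : MvPowerSeries (Fin 2) Lau := euler (linSer r) * linInv r

lemma linSer_mul_lamSer (r : ℂ) : linSer r * lamSer r = euler (linSer r) := by
  rw [lamSer, mul_left_comm, linSer_mul_linInv, mul_one]

/-- The series `(v + Aħ) / (u + Bħ)`. -/
def ratio (A B : ℂ) : MvPowerSeries (Fin 2) Lau :=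
  (MvPowerSeries.X 0 + A • MvPowerSeries.X 1) * inPw (-1) B

lemma ordGE_ratio (A B : ℂ) : OrdGE 1 (ratio A B) := by
  refine ordGE_one ?_
  rw [ratio, map_mul, map_add, MvPowerSeries.constantCoeff_X]
  have : MvPowerSeries.constantCoeff (A • (MvPowerSeries.X 1 : MvPowerSeries (Fin 2) Lau)) = 0 := by
    change coeff 0 (A • (MvPowerSeries.X 1 : MvPowerSeries (Fin 2) Lau)) = 0
    rw [coeff_csmul]
    simp
  rw [this, add_zero, zero_mul]

lemma euler_logS_ratio (A B : ℂ) : euler (logS (ratio A B)) =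
    B • (MvPowerSeries.X 1 * inPw (-1) B) - lamSer (B - A) := by
  have h1 : inPw 1 B * inPw (-1) B = 1 := by rw [← inPw_add, add_neg_cancel, inPw_zero]
  have h2 : linSer (B - A) = inPw 1 B * (1 - ratio A B) := by
    rw [linSer_eq, inPw_one_sub, ratio]
    linear_combination (MvPowerSeries.X 0 + A • MvPowerSeries.X 1) * h1
  refine linSer_mul_cancel (r := B - A) ?_
  rw [mul_sub, linSer_mul_lamSer, euler_linSer]
  nth_rewrite 1 [h2]
  rw [mul_assoc, one_sub_mul_euler_logS (ordGE_ratio A B), ratio, Derivation.leibniz, euler_inPw,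
    map_add euler, Derivation.map_smul, euler_X, euler_X, linSer_eq, inPw_one_sub,
    show (-1 : ℂ) - 1 = -1 + -1 by ring, inPw_add (-1) (-1)]
  generalize inPw 1 B = p at h1 ⊢
  generalize inPw (-1) B = q at h1 ⊢
  simp only [smul_eq_mul]
  simp only [Algebra.smul_def, map_mul, map_neg, map_one, map_sub]
  generalize algebraMap ℂ (MvPowerSeries (Fin 2) Lau) A = a
  generalize algebraMap ℂ (MvPowerSeries (Fin 2) Lau) B = b
  generalize (MvPowerSeries.X 0 : MvPowerSeries (Fin 2) Lau) = x
  generalize (MvPowerSeries.X 1 : MvPowerSeries (Fin 2) Lau) = y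
  linear_combination ((x + a * y) * (1 - b * y * q) - b * y) * h1

/-- The effect of the annihilation part of a vertex operator on the creation part of another one. -/
def conjSer (k : ℂ) (L : List Term) : MvPowerSeries (Fin 2) Osc →ₐ[ℂ] MvPowerSeries (Fin 2) Lau :=
  (collapse Lau).comp (mapA (tau0 k L))

lemma ordGE_conjSer (k : ℂ) (L : List Term) (m : ℕ) (F : MvPowerSeries (Fin 2) Osc)
    (hF : OrdGE m F) : OrdGE m (conjSer k L F) :=
  ordGE_collapse m _ fun d hd => by
    change tau0 k L (coeff d F) = 0
    rw [hF d hd, map_zero]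

lemma inHbar_algebraMap (z : ℂ) : inHbar Lau (algebraMap ℂ (Mult ℂ ℂ) z) =
    algebraMap ℂ (MvPowerSeries (Fin 2) Lau) z := by
  rw [PowerSeries.algebraMap_apply, inHbar_C, MvPowerSeries.algebraMap_apply]

lemma inPw_neg_nat (n : ℕ) (B : ℂ) : inPw (-n) B = inPw (-1) B ^ n := by
  induction n with
  | zero => rw [Nat.cast_zero, neg_zero, inPw_zero, pow_zero]
  | succ n ih => rw [Nat.cast_succ, neg_add, inPw_add, ih, pow_succ]

lemma inHbar_pwSum (k : ℂ) (L : List Term) (X : Boson) (n : ℕ) (F : MvPowerSeries (Fin 2) Lau)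
    (A : ℂ) (hF : F = (MvPowerSeries.X 0 + A • MvPowerSeries.X 1) ^ n) :
    F * inHbar Lau (pwSum ℂ (1 : ℂ) k L X (-n)) =
      (L.map fun s => if s.2.1 = X then (s.1 * kappa k X) • ratio A s.2.2 ^ n else 0).sum := by
  rw [pwSum]
  induction L with
  | nil => simp
  | cons s L ih =>
    rw [List.map_cons, List.map_cons, List.sum_cons, List.sum_cons, map_add, mul_add, ih]
    congr 1
    split_ifs
    · rw [map_mul, inHbar_algebraMap, ← Algebra.smul_def, mul_smul_comm, ratio, mul_pow,
        ← inPw_neg_nat, hF]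
      rfl
    · rw [map_zero, mul_zero]

lemma coeff_collapse_posSer {A : Type} [CommRing A] [Algebra ℂ A] (φ : Osc →ₐ[ℂ] PowerSeries A)
    (X : Boson) (z : ℂ) (l N : ℕ) :
    coeff (expo l N) (collapse A (mapA φ (posSer X z))) =
      ∑ n ∈ Finset.Icc 1 (l + N), ((n : ℂ)⁻¹) • coeff (expo l N)
        ((MvPowerSeries.X 0 + z • (MvPowerSeries.X 1 : MvPowerSeries (Fin 2) A)) ^ n *
          inHbar A (φ (MvPolynomial.X (X, n - 1)))) := by
  have hX : OrdGE 1 (MvPowerSeries.X 0 + MvPowerSeries.C z * MvPowerSeries.X 1 :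
      MvPowerSeries (Fin 2) ℂ) := ordGE_one (by simp)
  have hmap : ∀ n : ℕ, MvPowerSeries.map (algebraMap ℂ A)
      ((MvPowerSeries.X 0 + MvPowerSeries.C z * MvPowerSeries.X 1) ^ n) =
      (MvPowerSeries.X 0 + z • (MvPowerSeries.X 1 : MvPowerSeries (Fin 2) A)) ^ n := by
    intro n
    rw [map_pow, map_add, map_mul, MvPowerSeries.map_X, MvPowerSeries.map_X, MvPowerSeries.map_C,
      Algebra.smul_def, MvPowerSeries.algebraMap_apply]
  have h2 : ∀ a ∈ antidiagonal N, PowerSeries.coeff a.2 (φ (coeff (expo l a.1) (posSer X z))) =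
      ∑ n ∈ Finset.Icc 1 (l + N), ((n : ℂ)⁻¹) •
        (coeff (expo l a.1) ((MvPowerSeries.X 0 + MvPowerSeries.C z * MvPowerSeries.X 1) ^ n) •
          PowerSeries.coeff a.2 (φ (MvPolynomial.X (X, n - 1)))) := by
    intro a ha
    rw [mem_antidiagonal] at ha
    have h3 : coeff (expo l a.1) (posSer X z) = ∑ n ∈ Finset.Icc 1 (l + N),
        (coeff (expo l a.1) ((MvPowerSeries.X 0 + MvPowerSeries.C z * MvPowerSeries.X 1) ^ n) /
          (n : ℂ)) • (MvPolynomial.X (X, n - 1) : Osc) := by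
      change ∑ n ∈ Finset.Icc 1 (expo l a.1 0 + expo l a.1 1), _ = _
      refine Finset.sum_subset (Finset.Icc_subset_Icc le_rfl ?_) fun n _ hn => ?_
      · rw [expo_apply_zero, expo_apply_one]; omega
      · rw [Finset.mem_Icc] at hn
        rw [hX.pow n _ (by rw [Finset.mem_Icc] at *; omega), zero_div, zero_smul]
    rw [h3, map_sum, map_sum]
    refine Finset.sum_congr rfl fun n hn => ?_
    rw [map_smul, smul_smul, div_eq_inv_mul, PowerSeries.coeff_smul]
  rw [coeff_collapse]
  change ∑ a ∈ antidiagonal N, PowerSeries.coeff a.2 (φ (coeff (expo l a.1) (posSer X z))) = _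
  rw [Finset.sum_congr rfl h2, Finset.sum_comm]
  refine Finset.sum_congr rfl fun n _ => ?_
  rw [← Finset.smul_sum, mul_comm (_ ^ n) (inHbar A _)]
  congr 1
  rw [coeff_inHbar_mul, ← Finset.Nat.sum_antidiagonal_swap]
  refine Finset.sum_congr rfl fun a _ => ?_
  rw [← hmap, MvPowerSeries.coeff_map, mul_comm (PowerSeries.coeff a.1 _), ← Algebra.smul_def]
  rfl

lemma coeff_sum_logS (k : ℂ) (L : List Term) (X : Boson) (A : ℂ) (d : Fin 2 →₀ ℕ) :
    coeff d (L.map fun s => if s.2.1 = X then (s.1 * kappa k X) • logS (ratio A s.2.2) else 0).sum =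
      ∑ n ∈ Finset.Icc 1 (d 0 + d 1), ((n : ℂ)⁻¹) • coeff d
        (L.map fun s => if s.2.1 = X then (s.1 * kappa k X) • ratio A s.2.2 ^ n else 0).sum := by
  induction L with
  | nil => simp
  | cons s L ih =>
    simp only [List.map_cons, List.sum_cons, map_add, smul_add, Finset.sum_add_distrib, ih]
    congr 1
    split_ifs
    · rw [coeff_csmul]
      change (s.1 * kappa k X) • ∑ n ∈ Finset.Icc 1 (d 0 + d 1), ((n : ℂ)⁻¹) • _ = _
      rw [Finset.smul_sum]
      refine Finset.sum_congr rfl fun n _ => ?_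
      rw [coeff_csmul, smul_comm]
    · simp

lemma tau0_X (k : ℂ) (L : List Term) (X : Boson) {n : ℕ} (hn : 1 ≤ n) :
    tau0 k L (MvPolynomial.X (X, n - 1)) = -pwSum ℂ (1 : ℂ) k L X (-n) := by
  rw [tau0, MvPolynomial.aeval_X]
  change -pwSum ℂ (1 : ℂ) k L X (-(((n - 1 : ℕ) : ℂ) + 1)) = _
  rw [Nat.cast_sub hn, Nat.cast_one, sub_add_cancel]

/-- Annihilation parts turn the creation part of `X(u + Aħ)` into logarithms. -/
lemma conjSer_posSer (k : ℂ) (L : List Term) (X : Boson) (A : ℂ) :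
    conjSer k L (posSer X A) =
      -(L.map fun s => if s.2.1 = X then (s.1 * kappa k X) • logS (ratio A s.2.2) else 0).sum := by
  ext1 d
  have h : coeff d (conjSer k L (posSer X A)) = _ :=
    (congrArg (fun e => coeff e (conjSer k L (posSer X A))) (expo_eta d).symm).trans
      (coeff_collapse_posSer (tau0 k L) X A (d 0) (d 1))
  rw [h, map_neg, coeff_sum_logS, ← Finset.sum_neg_distrib]
  refine Finset.sum_congr rfl fun n hn => ?_
  rw [Finset.mem_Icc] at hn
  rw [tau0_X k L X hn.1, map_neg, mul_neg, map_neg, smul_neg, inHbar_pwSum k L X n _ A rfl,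
    expo_eta]

/-- `∑ c c' κ_X f(B - A)`, the sum over the terms `c X(u + Bħ)` of the first list and the terms
`c' X(u + Aħ)` of the second one. -/
def pairing {W : Type} [AddCommGroup W] [Module ℂ W] (k : ℂ) (LA LC : List Term) (f : ℂ → W) : W :=
  (LC.map fun t => (LA.map fun s => if s.2.1 = t.2.1 then
    (t.1 * (s.1 * kappa k t.2.1)) • f (s.2.2 - t.2.2) else 0).sum).sum

lemma map_pairing {W W' : Type} [AddCommGroup W] [Module ℂ W] [AddCommGroup W'] [Module ℂ W']
    (g : W →ₗ[ℂ] W') (k : ℂ) (LA LC : List Term) (f : ℂ → W) :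
    g (pairing k LA LC f) = pairing k LA LC fun x => g (f x) := by
  simp only [pairing, map_list_sum, List.map_map]
  congr 1
  refine List.map_congr_left fun t _ => ?_
  simp only [Function.comp_apply, map_list_sum, List.map_map]
  congr 1
  refine List.map_congr_left fun s _ => ?_
  simp only [Function.comp_apply]
  split_ifs
  · rw [map_smul]
  · rw [map_zero]

/-- A sum over the annihilation terms, weighted with the charges of the creation part, is a pairing of
the two lists. This is where neutrality enters the contractions. -/
lemma sum_mul_charge {W : Type} [AddCommGroup W] [Module ℂ W] (k : ℂ) (LA LC : List Term)
    (g : ℂ → W) : (LA.map fun s => (s.1 * (kappa k s.2.1 * charge LC s.2.1)) • g s.2.2).sum =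
      (LC.map fun t => (LA.map fun s => if s.2.1 = t.2.1 then
        (t.1 * (s.1 * kappa k t.2.1)) • g s.2.2 else 0).sum).sum := by
  induction LC with
  | nil => simp [charge]
  | cons t LC ih =>
    rw [List.map_cons, List.sum_cons, ← ih, ← List.sum_map_add]
    congr 1
    refine List.map_congr_left fun s _ => ?_
    rw [charge, List.map_cons, List.sum_cons, ← charge, mul_add, mul_add, add_smul]
    congr 1
    by_cases h : s.2.1 = t.2.1
    · rw [if_pos h, if_pos h.symm, h]
      congr 1; ring
    · rw [if_neg h, if_neg (Ne.symm h), mul_zero, mul_zero, zero_smul]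

lemma euler_inHbar_pref (L : List Term) (q : Boson → ℂ) : euler (inHbar Lau (pref ℂ (1 : ℂ) L q)) =
    (L.map fun s => (s.1 * q s.2.1) • (s.2.2 • (MvPowerSeries.X 1 * inPw (-1) s.2.2))).sum *
      inHbar Lau (pref ℂ (1 : ℂ) L q) := by
  induction L with
  | nil =>
    rw [pref_nil, map_one, Derivation.map_one_eq_zero]
    simp
  | cons s L ih =>
    rw [pref_cons, map_mul, Derivation.leibniz, ih, List.map_cons, List.sum_cons]
    change inPw (s.1 * q s.2.1) s.2.2 • _ + _ • euler (inPw (s.1 * q s.2.1) s.2.2) =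
      _ * (inPw (s.1 * q s.2.1) s.2.2 * _)
    rw [euler_inPw, sub_eq_add_neg, inPw_add]
    generalize inHbar Lau (pref ℂ (1 : ℂ) L q) = P
    generalize inPw (s.1 * q s.2.1) s.2.2 = Q
    generalize inPw (-1) s.2.2 = R
    generalize (List.sum _ : MvPowerSeries (Fin 2) Lau) = S
    simp only [smul_eq_mul]
    simp only [Algebra.smul_def, map_mul]
    ring

lemma contraction_eq (k : ℂ) (d d' : VertexData) : contraction k d d' =
    inHbar Lau (pref ℂ (1 : ℂ) d.la fun X => kappa k X * d'.r X) *
      expS (conjSer k d.la (creaSer d'.lc)) := by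
  rw [← map_expS _ (ordGE_conjSer k d.la) (ordGE_creaSer _)]
  rfl

lemma ordGE_conjSer_creaSer (k : ℂ) (LA LC : List Term) : OrdGE 1 (conjSer k LA (creaSer LC)) :=
  ordGE_conjSer k LA 1 _ (ordGE_creaSer _)

lemma euler_conjSer_creaSer (k : ℂ) (LA LC : List Term) : euler (conjSer k LA (creaSer LC)) =
    pairing k LA LC lamSer - (LC.map fun t => (LA.map fun s => if s.2.1 = t.2.1 then
      (t.1 * (s.1 * kappa k t.2.1)) • (s.2.2 • (MvPowerSeries.X 1 * inPw (-1) s.2.2))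
        else 0).sum).sum := by
  rw [creaSer, pairing]
  induction LC with
  | nil => simp
  | cons t LC ih =>
    rw [List.map_cons, List.map_cons, List.map_cons, List.sum_cons, List.sum_cons, List.sum_cons,
      map_add, map_add, ih, map_smul, Derivation.map_smul, conjSer_posSer, add_sub_add_comm]
    congr 1
    clear ih
    induction LA with
    | nil => simp
    | cons s LA ih =>
      rw [List.map_cons, List.map_cons, List.map_cons, List.sum_cons, List.sum_cons, List.sum_cons,
        neg_add, map_add, smul_add, ih, add_sub_add_comm]
      congr 1
      split_ifs
      · rw [Derivation.map_neg, Derivation.map_smul, euler_logS_ratio, mul_smul, mul_smul]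
        module
      · simp

/-- The differential equation satisfied by the contraction of two vertex operators. -/
lemma euler_contraction (k : ℂ) (d : VertexData) {d' : VertexData} (hd' : d'.Neutral) :
    euler (contraction k d d') = pairing k d.la d'.lc lamSer * contraction k d d' := by
  have h := sum_mul_charge k d.la d'.lc fun B => B • (MvPowerSeries.X 1 * inPw (-1) B)
  simp only [hd'.lc] at h
  rw [contraction_eq, Derivation.leibniz, euler_expS (ordGE_conjSer_creaSer k _ _),
    euler_conjSer_creaSer, euler_inHbar_pref, h, smul_eq_mul, smul_eq_mul]
  ring

lemma euler_linSer_prod (l : List ℂ) :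
    euler (l.map linSer).prod = (l.map lamSer).sum * (l.map linSer).prod := by
  induction l with
  | nil => simp
  | cons r l ih =>
    rw [List.map_cons, List.map_cons, List.prod_cons, List.sum_cons, Derivation.leibniz, ih,
      ← linSer_mul_lamSer, smul_eq_mul, smul_eq_mul]
    ring

lemma constantCoeff_linSer_prod (l : List ℂ) :
    MvPowerSeries.constantCoeff (l.map linSer).prod = AddMonoidAlgebra.single (l.length : ℂ) 1 := by
  induction l with
  | nil => simp [AddMonoidAlgebra.one_def]
  | cons r l ih =>
    have h : MvPowerSeries.constantCoeff (linSer r) = AddMonoidAlgebra.single (1 : ℂ) 1 := by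
      rw [linSer_eq, map_sub, MvPowerSeries.constantCoeff_X, sub_zero]
      change coeff 0 (inPw 1 r) = _
      rw [show (0 : Fin 2 →₀ ℕ) = expo 0 0 by simp [expo], coeff_inPw, if_pos rfl, coeff_pw]
      simp
    rw [List.map_cons, List.prod_cons, map_mul, ih, h, AddMonoidAlgebra.single_mul_single, mul_one,
      List.length_cons, Nat.cast_succ, add_comm]

lemma constantCoeff_contraction (k : ℂ) (d d' : VertexData) (hd' : d'.Neutral) :
    MvPowerSeries.constantCoeff (contraction k d d') =
      AddMonoidAlgebra.single (pairing k d.la d'.lc fun _ => (1 : ℂ)) 1 := by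
  rw [contraction_eq, map_mul, constantCoeff_expS, mul_one]
  change coeff 0 (inHbar Lau _) = _
  rw [show (0 : Fin 2 →₀ ℕ) = expo 0 0 by simp [expo], coeff_inHbar, if_pos rfl]
  have h := sum_mul_charge k d.la d'.lc fun _ => (1 : ℂ)
  simp only [hd'.lc] at h
  rw [pairing, ← h]
  clear h
  induction d.la with
  | nil => simp [pref_nil, AddMonoidAlgebra.one_def]
  | cons s L ih =>
    rw [pref_cons, PowerSeries.coeff_zero_eq_constantCoeff_apply, map_mul,
      ← PowerSeries.coeff_zero_eq_constantCoeff_apply, ← PowerSeries.coeff_zero_eq_constantCoeff_apply, ih, List.map_cons, List.sum_cons, coeff_pw,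
      AddMonoidAlgebra.single_mul_single]
    simp

/-- The contraction of two vertex operators is a product of linear factors if the pairing of their
exponents is a combination of the corresponding shifts. -/
theorem contraction_mul_prod (k : ℂ) (d : VertexData) {d' : VertexData} (hd' : d'.Neutral)
    (P Q : List ℂ)
    (h : ∀ f : ℂ → ℂ, pairing k d.la d'.lc f + (Q.map f).sum = (P.map f).sum) :
    contraction k d d' * (Q.map linSer).prod = (P.map linSer).prod := by
  -- The hypothesis concerns scalar functions of the shift; it is applied to each coefficient of
  -- `lamSer`.
  have hlam : pairing k d.la d'.lc lamSer + (Q.map lamSer).sum = (P.map lamSer).sum := by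
    ext e : 1
    ext x
    let g : MvPowerSeries (Fin 2) Lau →ₗ[ℂ] ℂ :=
      { toFun := fun F => (coeff e F).coeff x
        map_add' := fun F G => by rw [map_add, AddMonoidAlgebra.coeff_add, Finsupp.add_apply]
        map_smul' := fun z F => by
          rw [coeff_csmul, AddMonoidAlgebra.coeff_smul, Finsupp.smul_apply]; rfl }
    have h1 := h fun r => g (lamSer r)
    have h2 : ∀ l : List ℂ, (l.map fun r => g (lamSer r)).sum = g (l.map lamSer).sum := by
      intro l
      rw [map_list_sum, List.map_map]; rfl
    rw [← map_pairing, h2, h2, ← map_add] at h1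
    exact h1
  have hF : euler (contraction k d d' * (Q.map linSer).prod) =
      (P.map lamSer).sum * (contraction k d d' * (Q.map linSer).prod) := by
    rw [Derivation.leibniz, euler_contraction k d hd', euler_linSer_prod, ← hlam, smul_eq_mul,
      smul_eq_mul]
    ring
  have hord : OrdGE 1 (P.map lamSer).sum := by
    have := ordGE_list_sum P 1 (fun _ => 1) lamSer fun r => (ordGE_euler (linSer r)).mul (b := 0)
      (G := linInv r) fun _ h => absurd h (by omega)
    simpa using this
  refine eq_of_euler_eq hord hF (euler_linSer_prod P) ?_
  rw [map_mul, constantCoeff_contraction k d d' hd', constantCoeff_linSer_prod,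
    constantCoeff_linSer_prod, AddMonoidAlgebra.single_mul_single, mul_one]
  congr 1
  have := h fun _ => 1
  simpa using this

end Contraction

/-! ### Exchange relations -/

section Exchange

open MvPowerSeries (coeff)

/-- The exchange relation between two distributions, without the regularity condition. -/
def Commutes (num den : List ℂ) (G H : Dist ℂ Op) : Prop :=
  (den.map lin).prod • Dist.opProd G H = (num.map lin).prod • Dist.swap (Dist.opProd H G)

lemma ofLaurent_one_swap : Dist.swap (ofLaurent 1) = ofLaurent 1 := by
  have h : ∀ N (x : ℂ × ℂ), ofLaurent 1 N x = if N = 0 ∧ x.1 = 0 ∧ x.2 = 0 then 1 else 0 := by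
    classical
    intro N x
    rw [ofLaurent_apply]
    by_cases h : ∃ j : ℕ, x.2 = j
    · obtain ⟨j, hj⟩ := h
      rw [hj, ofSer_nat, MvPowerSeries.coeff_one, show (0 : Fin 2 →₀ ℕ) = expo 0 0 by simp [expo]]
      simp only [expo_inj, Nat.cast_eq_zero]
      by_cases h1 : j = 0 ∧ N = 0
      · rw [if_pos h1, AddMonoidAlgebra.one_def]
        simp [h1, Finsupp.single_apply, eq_comm]
      · rw [if_neg h1, if_neg (fun h2 => h1 ⟨h2.2.2, h2.1⟩)]
        rfl
    · rw [ofSer_eq_zero _ _ h, if_neg]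
      · rfl
      · rintro ⟨-, -, h0⟩
        exact h ⟨0, by simp [h0]⟩
  ext1 N x
  rw [Dist.swap_apply, h, h]
  simp only [Prod.fst_swap, Prod.snd_swap, and_comm (a := x.2 = 0)]

lemma swapVar_lin_prod (l : List ℂ) : swapVar (l.map lin).prod =
    (-1) ^ l.length * ((l.map fun r => -r).map lin).prod := by
  induction l with
  | nil => simp
  | cons r l ih =>
    rw [List.map_cons, List.prod_cons, map_mul, ih, swapVar_lin, List.map_cons, List.map_cons,
      List.prod_cons, List.length_cons, pow_succ]
    ring

lemma VertexData.shift_comm (k : ℂ) (a b : VertexData) (p : Boson → ℂ) :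
    a.shift k (b.shift k p) = b.shift k (a.shift k p) := by
  funext X
  simp only [VertexData.shift]
  ring

lemma kappa_ne_zero {k : ℂ} (hk0 : k ≠ 0) (hk2 : k ≠ -2) (X : Boson) : kappa k X ≠ 0 := by
  have h2 : k + 2 ≠ 0 := fun h => hk2 (by linear_combination h)
  cases X <;> simp [kappa, hk0, h2]

/-- The product `H(v) G(u)` has the same commutators with the modes as `G(u) H(v)`. -/
lemma covariant_swap_opProd (k : ℂ) {c b c' b' : Boson → ℕ → Mult ℂ ℂ} {G H : Dist ℂ Op}
    (hG : Covariant k c b G) (hH : Covariant k c' b' H) :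
    Covariant k (fun X n => inU (c X n) + inV (c' X n)) (fun X n => inU (b X n) + inV (b' X n))
      (Dist.swap (Dist.opProd H G)) :=
  (hH.opProd hG).swap.congr
    (fun X n => by rw [map_add, swapVar_inU, swapVar_inV, add_comm])
    (fun X n => by rw [map_add, swapVar_inU, swapVar_inV, add_comm])

/-- Two vertex operators satisfy an exchange relation if their contractions in both orders have the
same numerator: `a(u) b(v)` contracts to `∏_P (u - v + rħ) / ∏_den (u - v + rħ)`, and `b(v) a(u)` to
`∏_P (u - v + rħ) / ∏_num (u - v + rħ)`, up to signs. The signs cancel since `P` and `num` have the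
same length. -/
theorem commutes_field {k : ℂ} (hk : ∀ X, kappa k X ≠ 0) {a b : VertexData} (ha : a.Neutral)
    (hb : b.Neutral) (P num den : List ℂ) (hlen : P.length = num.length)
    (h1 : ∀ f : ℂ → ℂ, pairing k a.la b.lc f + (den.map f).sum = (P.map f).sum)
    (h2 : ∀ f : ℂ → ℂ, pairing k b.la a.lc f + (num.map fun r => f (-r)).sum =
      (P.map fun r => f (-r)).sum) :
    Commutes num den (toDist (a.field k)) (toDist (b.field k)) := by
  refine Covariant.eq hk (((field_covariant k ha).opProd (field_covariant k hb)).smul _)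
    ((covariant_swap_opProd k (field_covariant k ha) (field_covariant k hb)).smul _) fun p q => ?_
  rw [map_smul, map_smul]
  have hs : Dist.post (vev p q) (Dist.swap (Dist.opProd (toDist (b.field k)) (toDist (a.field k)))) =
      Dist.swap (Dist.post (vev p q) (Dist.opProd (toDist (b.field k)) (toDist (a.field k)))) := rfl
  rw [hs]
  by_cases hq : q = a.shift k (b.shift k p)
  · have hc1 := contraction_mul_prod k a hb P den h1
    have hc2 := contraction_mul_prod k b ha (P.map fun r => -r) (num.map fun r => -r)
      (fun f => by simpa [List.map_map, Function.comp_def] using h2 f)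
    have e1 : (den.map lin).prod • ofLaurent (contraction k a b) =
        (P.map lin).prod • ofLaurent 1 := by
      rw [← ofLaurent_linSer_prod_mul, mul_comm, hc1, ← ofLaurent_linSer_prod_mul, mul_one]
    have e2 : ((num.map fun r => -r).map lin).prod • ofLaurent (contraction k b a) =
        ((P.map fun r => -r).map lin).prod • ofLaurent 1 := by
      rw [← ofLaurent_linSer_prod_mul, mul_comm, hc2, ← ofLaurent_linSer_prod_mul, mul_one]
    have e3 : (num.map lin).prod • Dist.swap (ofLaurent (contraction k b a)) =
        (P.map lin).prod • ofLaurent 1 := by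
      have h3 : ∀ (l : List ℂ) (G : Dist (ℂ × ℂ) ℂ), (l.map lin).prod • Dist.swap G =
          ((-1) ^ l.length : Mult ℂ (ℂ × ℂ)) • Dist.swap (((l.map fun r => -r).map lin).prod • G) := by
        intro l G
        rw [Dist.swap_smul, swapVar_lin_prod, List.map_map, smul_smul, ← mul_assoc,
          List.length_map, ← mul_pow]
        simp [Function.comp_def]
      rw [h3, e2, ← hlen, ← h3, ofLaurent_one_swap]
    have hv := post_vev_opProd_field k hb ha p
    rw [← VertexData.shift_comm, ← hq] at hv
    have hv' := post_vev_opProd_field k ha hb p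
    rw [← hq] at hv'
    rw [hv, hv', Dist.swap_smul, map_mul swapVar, swapVar_inU, swapVar_inV, smul_comm, e1,
      mul_comm (inV _), smul_comm (num.map lin).prod, e3]
  · rw [post_vev_opProd_field_of_ne k ha hb p q hq,
      post_vev_opProd_field_of_ne k hb ha p q (by rwa [← VertexData.shift_comm]), map_zero,
      smul_zero, smul_zero]

variable {num den : List ℂ} {G G' H H' : Dist ℂ Op}

lemma Commutes.add_left (h : Commutes num den G H) (h' : Commutes num den G' H) :
    Commutes num den (G + G') H := by
  rw [Commutes, Dist.opProd_add_left, Dist.opProd_add_right, map_add, smul_add, smul_add, h, h']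

lemma Commutes.add_right (h : Commutes num den G H) (h' : Commutes num den G H') :
    Commutes num den G (H + H') := by
  rw [Commutes, Dist.opProd_add_left, Dist.opProd_add_right, map_add, smul_add, smul_add, h, h']

lemma Commutes.smul_left (h : Commutes num den G H) (κ : Mult ℂ ℂ) :
    Commutes num den (κ • G) H := by
  rw [Commutes, Dist.opProd_smul_left, Dist.opProd_smul_right, Dist.swap_smul, swapVar_inV,
    smul_comm, h, smul_comm]

lemma Commutes.smul_right (h : Commutes num den G H) (κ : Mult ℂ ℂ) :
    Commutes num den G (κ • H) := by
  rw [Commutes, Dist.opProd_smul_left, Dist.opProd_smul_right, Dist.swap_smul, swapVar_inU,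
    smul_comm, h, smul_comm]

lemma Commutes.sub_left (h : Commutes num den G H) (h' : Commutes num den G' H) :
    Commutes num den (G - G') H := by
  have := h.add_left (h'.smul_left (-1))
  rwa [neg_one_smul, ← sub_eq_add_neg] at this

lemma Commutes.sub_right (h : Commutes num den G H) (h' : Commutes num den G H') :
    Commutes num den G (H - H') := by
  have := h.add_right (h'.smul_right (-1))
  rwa [neg_one_smul, ← sub_eq_add_neg] at this

lemma Dist.X_smul_injective {Γ W : Type} [AddCommGroup Γ] [AddCommGroup W] [Module ℂ W]
    {G H : Dist Γ W} (h : (PowerSeries.X : Mult ℂ Γ) • G = (PowerSeries.X : Mult ℂ Γ) • H) :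
    G = H := by
  ext1 N x
  have := congrFun (congrFun h (N + 1)) x
  rwa [Dist.X_smul_succ, Dist.X_smul_succ] at this

lemma Commutes.of_X_smul_left (h : Commutes num den ((PowerSeries.X : Mult ℂ ℂ) • G) H) :
    Commutes num den G H := by
  rw [Commutes, Dist.opProd_smul_left, Dist.opProd_smul_right, Dist.swap_smul, swapVar_inV,
    mapVar_X, smul_comm, smul_comm _ PowerSeries.X] at h
  exact Dist.X_smul_injective h

lemma Commutes.of_X_smul_right (h : Commutes num den G ((PowerSeries.X : Mult ℂ ℂ) • H)) :
    Commutes num den G H := by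
  rw [Commutes, Dist.opProd_smul_left, Dist.opProd_smul_right, Dist.swap_smul, swapVar_inU,
    mapVar_X, smul_comm, smul_comm _ PowerSeries.X] at h
  exact Dist.X_smul_injective h

section MulLin

variable {M : Type} [AddCommGroup M] [Module ℂ M]

lemma coeff_mulLin_apply_eq_zero {r : ℂ} {G : Field2 M} {x : M} {i j : ℂ} {N : ℕ}
    (h1 : PowerSeries.coeff N (G (i - 1) j) x = 0) (h2 : PowerSeries.coeff N (G i (j - 1)) x = 0)
    (h3 : PowerSeries.coeff (N - 1) (G i j) x = 0) :
    PowerSeries.coeff N (mulLin r G i j) x = 0 := by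
  have h4 : PowerSeries.coeff N (mulLin r G i j) = PowerSeries.coeff N (G (i - 1) j) -
      PowerSeries.coeff N (G i (j - 1)) + r • PowerSeries.coeff N (PowerSeries.X * G i j) := by
    rw [mulLin, map_add, map_sub]
    rfl
  rw [h4, LinearMap.add_apply, LinearMap.sub_apply, LinearMap.smul_apply, h1, h2, sub_zero,
    zero_add]
  rcases N with _ | N
  · rw [PowerSeries.coeff_zero_X_mul, LinearMap.zero_apply, smul_zero]
  · rw [PowerSeries.coeff_succ_X_mul]
    rw [Nat.add_sub_cancel] at h3
    rw [h3, smul_zero]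

lemma mulLin_bounded_left (r : ℂ) {G : Field2 M} {x : M}
    (hG : ∀ N, ∃ B : ℝ, ∀ i j : ℂ, i.re < B → PowerSeries.coeff N (G i j) x = 0) (N : ℕ) :
    ∃ B : ℝ, ∀ i j : ℂ, i.re < B → PowerSeries.coeff N (mulLin r G i j) x = 0 := by
  obtain ⟨B, hB⟩ := hG N
  obtain ⟨B', hB'⟩ := hG (N - 1)
  refine ⟨min B B', fun i j h => coeff_mulLin_apply_eq_zero (hB _ _ ?_)
    (hB _ _ (h.trans_le (min_le_left B B'))) (hB' _ _ (h.trans_le (min_le_right B B')))⟩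
  rw [Complex.sub_re, Complex.one_re]
  linarith [min_le_left B B']

lemma mulLin_bounded_right (r : ℂ) {G : Field2 M} {x : M}
    (hG : ∀ N, ∃ B : ℝ, ∀ i j : ℂ, j.re < B → PowerSeries.coeff N (G i j) x = 0) (N : ℕ) :
    ∃ B : ℝ, ∀ i j : ℂ, j.re < B → PowerSeries.coeff N (mulLin r G i j) x = 0 := by
  obtain ⟨B, hB⟩ := hG N
  obtain ⟨B', hB'⟩ := hG (N - 1)
  refine ⟨min B B', fun i j h => coeff_mulLin_apply_eq_zero
    (hB _ _ (h.trans_le (min_le_left B B'))) (hB _ _ ?_)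
    (hB' _ _ (h.trans_le (min_le_right B B')))⟩
  rw [Complex.sub_re, Complex.one_re]
  linarith [min_le_left B B']

end MulLin

/-- A lower bound for the exponents that works for all orders up to `N`. -/
lemma IsFieldOn.exists_bound {V : Submodule ℂ Fk} {a : Field1 Fk} (ha : IsFieldOn V a) {x : Fk}
    (hx : x ∈ V) (N : ℕ) : ∃ B : ℝ, ∀ n ≤ N, ∀ i : ℂ, i.re < B → PowerSeries.coeff n (a i) x = 0 := by
  induction N with
  | zero =>
    obtain ⟨B, hB⟩ := ha x hx 0
    exact ⟨B, fun n hn => by rw [Nat.le_zero.1 hn]; exact hB⟩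
  | succ N ih =>
    obtain ⟨B, hB⟩ := ih
    obtain ⟨B', hB'⟩ := ha x hx (N + 1)
    refine ⟨min B B', fun n hn i hi => ?_⟩
    rcases Nat.le_succ_iff.1 hn with h | rfl
    · exact hB n h i (hi.trans_le (min_le_left _ _))
    · exact hB' i (hi.trans_le (min_le_right _ _))

/-- In an exchange relation between fields the regularity is automatic: the exponents of `v` are
bounded below on one side, and those of `u` on the other one. -/
theorem Commutes.exchange {V : Submodule ℂ Fk} {a b : Field1 Fk}
    (h : Commutes num den (toDist a) (toDist b)) (ha : IsFieldOn V a) (hb : IsFieldOn V b) :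
    Exchange V a b num den := by
  have h' : toDist₂ (mulLins den (prodUV a b)) = toDist₂ (mulLins num (prodVU a b)) := by
    rw [toDist₂_mulLins, toDist₂_mulLins, toDist₂_prodUV, toDist₂_prodVU]
    exact h
  have h'' : ∀ (i j : ℂ) (N : ℕ), PowerSeries.coeff N (mulLins den (prodUV a b) i j) =
      PowerSeries.coeff N (mulLins num (prodVU a b) i j) := fun i j N =>
    congrFun (congrFun h' N) (i, j)
  refine ⟨fun i j N x _ => by rw [h''], fun x hx N => ?_⟩
  have hl : ∀ l : List ℂ, ∀ N, ∃ B : ℝ, ∀ i j : ℂ, i.re < B →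
      PowerSeries.coeff N (mulLins l (prodVU a b) i j) x = 0 := by
    intro l
    induction l with
    | nil =>
      intro N
      obtain ⟨B, hB⟩ := ha.exists_bound hx N
      refine ⟨B, fun i j hi => ?_⟩
      change PowerSeries.coeff N (b j * a i) x = 0
      rw [PowerSeries.coeff_mul, LinearMap.sum_apply]
      refine Finset.sum_eq_zero fun n hn => ?_
      rw [mem_antidiagonal] at hn
      rw [Module.End.mul_apply, hB n.2 (by omega) i hi, map_zero]
    | cons r l ih => exact mulLin_bounded_left r ih
  have hr : ∀ l : List ℂ, ∀ N, ∃ B : ℝ, ∀ i j : ℂ, j.re < B →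
      PowerSeries.coeff N (mulLins l (prodUV a b) i j) x = 0 := by
    intro l
    induction l with
    | nil =>
      intro N
      obtain ⟨B, hB⟩ := hb.exists_bound hx N
      refine ⟨B, fun i j hi => ?_⟩
      change PowerSeries.coeff N (a i * b j) x = 0
      rw [PowerSeries.coeff_mul, LinearMap.sum_apply]
      refine Finset.sum_eq_zero fun n hn => ?_
      rw [mem_antidiagonal] at hn
      rw [Module.End.mul_apply, hB n.2 (by omega) j hi, map_zero]
    | cons r l ih => exact mulLin_bounded_right r ih
  obtain ⟨B, hB⟩ := hl num N
  obtain ⟨B', hB'⟩ := hr den N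
  refine ⟨min B B', fun i j hij => ?_⟩
  rcases hij with hi | hj
  · rw [h'']
    exact hB i j (hi.trans_le (min_le_left _ _))
  · exact hB' i j (hj.trans_le (min_le_right _ _))

/-- The powers of `u` in the values of a vertex operator. -/
lemma field_eq_zero (k : ℂ) {d : VertexData} (hd : d.Neutral) (p : Boson → ℂ) (f : Osc) (N : ℕ)
    (i : ℂ) (hi : ∀ n : ℤ, i ≠ nu d.la p + n) :
    PowerSeries.coeff N (d.field k i) (Finsupp.single p f) = 0 := by
  refine (field_single k hd N i p f).trans ?_
  rw [Dist.smul_apply, Finset.sum_apply, Finset.sum_eq_zero, Finsupp.single_zero]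
  intro n _
  rw [conv_apply]
  refine Finset.sum_eq_zero fun s hs => ?_
  dsimp only
  rw [ofSer_eq_zero, smul_zero]
  rintro ⟨j, hj⟩
  refine (Finsupp.mem_support_iff.1 hs) ((coeff_expSer_anni k d.la p f).2 n.1 s fun m hm => ?_)
  refine hi (j - m) ?_
  push_cast
  linear_combination hj + hm

lemma field_bounded (k : ℂ) {d : VertexData} (hd : d.Neutral) (p : Boson → ℂ) (f : Osc) (N : ℕ) :
    ∃ B : ℝ, ∀ i : ℂ, i.re < B →
      PowerSeries.coeff N (d.field k i) (Finsupp.single p f) = 0 := by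
  generalize hκ : pref Osc (1 : ℂ) d.la p * tau k d.la f = κ
  have h : ∀ M : ℕ, ∃ B : ℝ, ∀ n < M, ∀ s ∈ (PowerSeries.coeff n κ).coeff.support, B ≤ s.re := by
    intro M
    induction M with
    | zero => exact ⟨0, fun n hn => absurd hn (by omega)⟩
    | succ M ih =>
      obtain ⟨B, hB⟩ := ih
      have h2 : ∃ B' : ℝ, ∀ s ∈ (PowerSeries.coeff M κ).coeff.support, B' ≤ s.re := by
        obtain ⟨B', hB'⟩ := ((PowerSeries.coeff M κ).coeff.support.image Complex.re).bddBelow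
        exact ⟨B', fun s hs => hB' (by
          rw [Finset.coe_image]
          exact Set.mem_image_of_mem _ hs)⟩
      obtain ⟨B', hB'⟩ := h2
      refine ⟨min B B', fun n hn s hs => ?_⟩
      rcases Nat.lt_succ_iff_lt_or_eq.1 hn with h | rfl
      · exact (min_le_left _ _).trans (hB n h s hs)
      · exact (min_le_right _ _).trans (hB' s hs)
  obtain ⟨B, hB⟩ := h (N + 1)
  refine ⟨B, fun i hi => ?_⟩
  refine (field_single k hd N i p f).trans ?_
  rw [hκ, Dist.smul_apply, Finset.sum_apply, Finset.sum_eq_zero, Finsupp.single_zero]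
  intro n hn
  rw [mem_antidiagonal] at hn
  rw [conv_apply]
  refine Finset.sum_eq_zero fun s hs => ?_
  dsimp only
  rw [ofSer_eq_zero, smul_zero]
  rintro ⟨j, hj⟩
  have h1 := hB n.1 (by omega) s hs
  have h2 := congrArg Complex.re hj
  rw [Complex.sub_re, Complex.natCast_re] at h2
  have h3 : (0 : ℝ) ≤ j := Nat.cast_nonneg j
  linarith

end Exchange

/-! ### The vertex operators in the currents -/

section Data

open Boson

/-- The data of the first term of `-ħ e(u)`. -/
def dataE₁ (k : ℂ) : VertexData where
  lc := [(2 / k, beta, -(k + 1)), (2 / k, gamma, -(k + 1))]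
  la := [(1, alpha, -(k + 2)), (1, beta, -(k + 2)), (-1, alpha, -(k + 1)), (-1, beta, -(k + 1)),
    (2 / k, beta, -(k + 2)), (2 / k, gamma, -(k + 2))]
  r := zeroBG (2 / k)

/-- The data of the second term of `-ħ e(u)`. -/
def dataE₂ (k : ℂ) : VertexData where
  lc := [(1, alpha, -(k + 1)), (1, beta, -(k + 1)), (-1, alpha, -(k + 2)), (-1, beta, -(k + 2)),
    (2 / k, beta, -(k + 1)), (2 / k, gamma, -(k + 1))]
  la := [(2 / k, beta, -(k + 2)), (2 / k, gamma, -(k + 2))]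
  r := zeroBG (2 / k)

/-- The data of the first term of `ħ f(u)`. -/
def dataF₁ (k : ℂ) : VertexData where
  lc := [(-(2 / k), beta, -1), (-(2 / k), gamma, -1)]
  la := [(1, alpha, -1), (1, beta, -1), (-1, alpha, -2), (-1, beta, -2), (1, gamma, 0),
    (-1, gamma, -2), (-(2 / k), beta, -2), (-(2 / k), gamma, -2)]
  r := zeroBG (-(2 / k))

/-- The data of the second term of `ħ f(u)`. -/
def dataF₂ (k : ℂ) : VertexData where
  lc := [(1, alpha, -(k + 2)), (1, beta, -(k + 2)), (-1, alpha, -(k + 3)), (-1, beta, -(k + 3)),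
    (2 / (k + 2), alpha, -(k + 3)), (-(2 / (k + 2)), alpha, -1), (-(2 / k), beta, -1),
    (-(2 / k), gamma, -1)]
  la := [(-(2 / k), beta, -(k + 2)), (-(2 / k), gamma, -(k + 2))]
  r := zeroBG (-(2 / k))

/-- The data of `h⁺(u)`. -/
def dataHP (k : ℂ) : VertexData where
  lc := []
  la := [(1, gamma, -k), (-1, gamma, -(k + 2))]
  r := 0

/-- The data of `h⁻(u)`. -/
def dataHM (k : ℂ) : VertexData where
  lc := [(2 / k, beta, -(k + 1)), (2 / k, gamma, -(k + 1)), (-(2 / k), beta, -1),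
    (-(2 / k), gamma, -1), (-1, alpha, -(k + 3)), (-1, beta, -(k + 3)), (1, alpha, -(k + 1)),
    (1, beta, -(k + 1)), (2 / (k + 2), alpha, -(k + 3)), (-(2 / (k + 2)), alpha, -1)]
  la := []
  r := 0

lemma neutral_E₁ (k : ℂ) : (dataE₁ k).Neutral := by
  constructor <;> intro X <;> cases X <;> simp [dataE₁, charge, zeroBG]

lemma neutral_E₂ (k : ℂ) : (dataE₂ k).Neutral := by
  constructor <;> intro X <;> cases X <;> simp [dataE₂, charge, zeroBG]

lemma neutral_F₁ (k : ℂ) : (dataF₁ k).Neutral := by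
  constructor <;> intro X <;> cases X <;> simp [dataF₁, charge, zeroBG]

lemma neutral_F₂ (k : ℂ) : (dataF₂ k).Neutral := by
  constructor <;> intro X <;> cases X <;> simp [dataF₂, charge, zeroBG]

lemma neutral_HP (k : ℂ) : (dataHP k).Neutral := by
  constructor <;> intro X <;> cases X <;> simp [dataHP, charge]

lemma neutral_HM (k : ℂ) : (dataHM k).Neutral := by
  constructor <;> intro X <;> cases X <;> simp [dataHM, charge]

lemma eFirst_eq (k : ℂ) : eFirst k = (dataE₁ k).field k := by
  rw [eFirst, VertexData.field]
  congr 1 <;> simp only [dataE₁, crea, anni, pos2, neg2, List.map_cons, List.map_nil,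
    List.sum_cons, List.sum_nil] <;> module

lemma eSecond_eq (k : ℂ) : eSecond k = (dataE₂ k).field k := by
  rw [eSecond, VertexData.field]
  congr 1 <;> simp only [dataE₂, crea, anni, pos2, neg2, List.map_cons, List.map_nil,
    List.sum_cons, List.sum_nil] <;> module

lemma fFirst_eq (k : ℂ) : fFirst k = (dataF₁ k).field k := by
  rw [fFirst, VertexData.field]
  congr 1 <;> simp only [dataF₁, crea, anni, pos2, neg2, List.map_cons, List.map_nil,
    List.sum_cons, List.sum_nil] <;> module

lemma fSecond_eq (k : ℂ) : fSecond k = (dataF₂ k).field k := by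
  rw [fSecond, VertexData.field]
  congr 1 <;> simp only [dataF₂, crea, anni, pos2, neg2, List.map_cons, List.map_nil,
    List.sum_cons, List.sum_nil] <;> module

lemma hPlus_eq (k : ℂ) : hPlus k = (dataHP k).field k := by
  rw [hPlus, VertexData.field]
  congr 1 <;> simp only [dataHP, crea, anni, pos2, neg2, List.map_cons, List.map_nil,
    List.sum_cons, List.sum_nil] <;> module

lemma hMinus_eq (k : ℂ) : hMinus k = (dataHM k).field k := by
  rw [hMinus, VertexData.field]
  congr 1 <;> simp only [dataHM, crea, anni, pos2, neg2, List.map_cons, List.map_nil,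
    List.sum_cons, List.sum_nil] <;> module

/-! ### The contractions of the vertex operators in the currents -/

-- In the following lemmas `f(a) + ⋯ - f(b) - ⋯` stands for the contraction
-- `(u - v + aħ) ⋯ / (u - v + bħ) ⋯`.

variable {k : ℂ}

lemma pairing_E_E (hk0 : k ≠ 0) (hk2 : k ≠ -2) (f : ℂ → ℂ) :
    pairing k (dataE₁ k).la (dataE₁ k).lc f = f 0 - f (-1) ∧
    pairing k (dataE₁ k).la (dataE₂ k).lc f = f 1 - f (-1) ∧
    pairing k (dataE₂ k).la (dataE₁ k).lc f = 0 ∧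
    pairing k (dataE₂ k).la (dataE₂ k).lc f = f 0 - f (-1) := by
  have h2 : 2 + k ≠ 0 := fun h => hk2 (by linear_combination h)
  refine ⟨?_, ?_, ?_, ?_⟩ <;>
  · simp [pairing, dataE₁, dataE₂, kappa]
    ring_nf
    try field_simp
    try ring

lemma pairing_F_F (hk0 : k ≠ 0) (hk2 : k ≠ -2) (f : ℂ → ℂ) :
    pairing k (dataF₁ k).la (dataF₁ k).lc f = f 0 - f 1 ∧
    pairing k (dataF₁ k).la (dataF₂ k).lc f = f (-1) - f 1 ∧
    pairing k (dataF₂ k).la (dataF₁ k).lc f = 0 ∧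
    pairing k (dataF₂ k).la (dataF₂ k).lc f = f 0 - f 1 := by
  have h2 : 2 + k ≠ 0 := fun h => hk2 (by linear_combination h)
  refine ⟨?_, ?_, ?_, ?_⟩ <;>
  · simp [pairing, dataF₁, dataF₂, kappa]
    ring_nf
    try field_simp
    try ring

lemma pairing_E_F (hk0 : k ≠ 0) (hk2 : k ≠ -2) (f : ℂ → ℂ) :
    pairing k (dataE₁ k).la (dataF₁ k).lc f = f (-k - 1) - f (-k) ∧
    pairing k (dataE₁ k).la (dataF₂ k).lc f = 0 ∧
    pairing k (dataE₂ k).la (dataF₁ k).lc f = 0 ∧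
    pairing k (dataE₂ k).la (dataF₂ k).lc f = f 1 - f 0 := by
  have h2 : 2 + k ≠ 0 := fun h => hk2 (by linear_combination h)
  refine ⟨?_, ?_, ?_, ?_⟩ <;>
  · simp [pairing, dataE₁, dataE₂, dataF₁, dataF₂, kappa]
    ring_nf
    try field_simp
    try ring

lemma pairing_F_E (hk0 : k ≠ 0) (hk2 : k ≠ -2) (f : ℂ → ℂ) :
    pairing k (dataF₁ k).la (dataE₁ k).lc f = f (k + 1) - f k ∧
    pairing k (dataF₁ k).la (dataE₂ k).lc f = 0 ∧
    pairing k (dataF₂ k).la (dataE₁ k).lc f = 0 ∧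
    pairing k (dataF₂ k).la (dataE₂ k).lc f = f (-1) - f 0 := by
  have h2 : 2 + k ≠ 0 := fun h => hk2 (by linear_combination h)
  refine ⟨?_, ?_, ?_, ?_⟩ <;>
  · simp [pairing, dataE₁, dataE₂, dataF₁, dataF₂, kappa]
    ring_nf
    try field_simp
    try ring

lemma pairing_HP (hk0 : k ≠ 0) (hk2 : k ≠ -2) (f : ℂ → ℂ) :
    pairing k (dataHP k).la (dataE₁ k).lc f = f 1 - f (-1) ∧
    pairing k (dataHP k).la (dataE₂ k).lc f = f 1 - f (-1) ∧
    pairing k (dataHP k).la (dataF₁ k).lc f = f (-(1 + k)) - f (1 - k) ∧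
    pairing k (dataHP k).la (dataF₂ k).lc f = f (-(1 + k)) - f (1 - k) ∧
    pairing k (dataHP k).la (dataHM k).lc f = f 1 + f (-(1 + k)) - (f (-1) + f (1 - k)) := by
  have h2 : 2 + k ≠ 0 := fun h => hk2 (by linear_combination h)
  refine ⟨?_, ?_, ?_, ?_, ?_⟩ <;>
  · simp [pairing, dataHP, dataHM, dataE₁, dataE₂, dataF₁, dataF₂, kappa]
    ring_nf
    try field_simp
    try ring

lemma pairing_HM (hk0 : k ≠ 0) (hk2 : k ≠ -2) (f : ℂ → ℂ) :
    pairing k (dataE₁ k).la (dataHM k).lc f = f 1 - f (-1) ∧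
    pairing k (dataE₂ k).la (dataHM k).lc f = f 1 - f (-1) ∧
    pairing k (dataF₁ k).la (dataHM k).lc f = f (-1) - f 1 ∧
    pairing k (dataF₂ k).la (dataHM k).lc f = f (-1) - f 1 := by
  have h2 : 2 + k ≠ 0 := fun h => hk2 (by linear_combination h)
  refine ⟨?_, ?_, ?_, ?_⟩ <;>
  · simp [pairing, dataHM, dataE₁, dataE₂, dataF₁, dataF₂, kappa]
    ring_nf
    try field_simp
    try ring

/-! ### Exchange relations of the vertex operators in the currents -/

/-- The first term of `-ħ e(u)` as a distribution. -/
def distE₁ (k : ℂ) : Dist ℂ Op := toDist ((dataE₁ k).field k)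

/-- The second term of `-ħ e(u)` as a distribution. -/
def distE₂ (k : ℂ) : Dist ℂ Op := toDist ((dataE₂ k).field k)

/-- The first term of `ħ f(u)` as a distribution. -/
def distF₁ (k : ℂ) : Dist ℂ Op := toDist ((dataF₁ k).field k)

/-- The second term of `ħ f(u)` as a distribution. -/
def distF₂ (k : ℂ) : Dist ℂ Op := toDist ((dataF₂ k).field k)

/-- The current `h⁺(u)` as a distribution. -/
def distHP (k : ℂ) : Dist ℂ Op := toDist ((dataHP k).field k)

/-- The current `h⁻(u)` as a distribution. -/
def distHM (k : ℂ) : Dist ℂ Op := toDist ((dataHM k).field k)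

lemma pairing_nil_left {W : Type} [AddCommGroup W] [Module ℂ W] (k : ℂ) (L : List Term)
    (f : ℂ → W) : pairing k [] L f = 0 := by
  simp [pairing]

lemma pairing_nil_right {W : Type} [AddCommGroup W] [Module ℂ W] (k : ℂ) (L : List Term)
    (f : ℂ → W) : pairing k L [] f = 0 := rfl

lemma commutes_E (hk0 : k ≠ 0) (hk2 : k ≠ -2) :
    Commutes [1] [-1] (distE₁ k - distE₂ k) (distE₁ k - distE₂ k) := by
  have h := kappa_ne_zero hk0 hk2
  have h11 : Commutes [1] [-1] (distE₁ k) (distE₁ k) :=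
    -- The contraction is `(u - v) / (u - v - ħ)`, and the numerators in the other cases are read
    -- off from `pairing_E_E` in the same way.
    commutes_field h (neutral_E₁ k) (neutral_E₁ k) [0] _ _ rfl
      (fun f => by simp [pairing_E_E hk0 hk2 f]) (fun f => by simp [pairing_E_E hk0 hk2 f])
  have h12 : Commutes [1] [-1] (distE₁ k) (distE₂ k) :=
    commutes_field h (neutral_E₁ k) (neutral_E₂ k) [1] _ _ rfl
      (fun f => by simp [pairing_E_E hk0 hk2 f]) (fun f => by simp [pairing_E_E hk0 hk2 f])
  have h21 : Commutes [1] [-1] (distE₂ k) (distE₁ k) :=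
    commutes_field h (neutral_E₂ k) (neutral_E₁ k) [-1] _ _ rfl
      (fun f => by simp [pairing_E_E hk0 hk2 f]) (fun f => by simp [pairing_E_E hk0 hk2 f])
  have h22 : Commutes [1] [-1] (distE₂ k) (distE₂ k) :=
    commutes_field h (neutral_E₂ k) (neutral_E₂ k) [0] _ _ rfl
      (fun f => by simp [pairing_E_E hk0 hk2 f]) (fun f => by simp [pairing_E_E hk0 hk2 f])
  exact (h11.sub_right h12).sub_left (h21.sub_right h22)

lemma commutes_F (hk0 : k ≠ 0) (hk2 : k ≠ -2) :
    Commutes [-1] [1] (distF₁ k - distF₂ k) (distF₁ k - distF₂ k) := by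
  have h := kappa_ne_zero hk0 hk2
  have h11 : Commutes [-1] [1] (distF₁ k) (distF₁ k) :=
    commutes_field h (neutral_F₁ k) (neutral_F₁ k) [0] _ _ rfl
      (fun f => by simp [pairing_F_F hk0 hk2 f]) (fun f => by simp [pairing_F_F hk0 hk2 f])
  have h12 : Commutes [-1] [1] (distF₁ k) (distF₂ k) :=
    commutes_field h (neutral_F₁ k) (neutral_F₂ k) [-1] _ _ rfl
      (fun f => by simp [pairing_F_F hk0 hk2 f]) (fun f => by simp [pairing_F_F hk0 hk2 f])
  have h21 : Commutes [-1] [1] (distF₂ k) (distF₁ k) :=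
    commutes_field h (neutral_F₂ k) (neutral_F₁ k) [1] _ _ rfl
      (fun f => by simp [pairing_F_F hk0 hk2 f]) (fun f => by simp [pairing_F_F hk0 hk2 f])
  have h22 : Commutes [-1] [1] (distF₂ k) (distF₂ k) :=
    commutes_field h (neutral_F₂ k) (neutral_F₂ k) [0] _ _ rfl
      (fun f => by simp [pairing_F_F hk0 hk2 f]) (fun f => by simp [pairing_F_F hk0 hk2 f])
  exact (h11.sub_right h12).sub_left (h21.sub_right h22)

lemma commutes_HP_E (hk0 : k ≠ 0) (hk2 : k ≠ -2) :
    Commutes [1] [-1] (distHP k) (distE₁ k - distE₂ k) := by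
  have h := kappa_ne_zero hk0 hk2
  have h1 : Commutes [1] [-1] (distHP k) (distE₁ k) :=
    commutes_field h (neutral_HP k) (neutral_E₁ k) [1] _ _ rfl
      (fun f => by simp [pairing_HP hk0 hk2 f]) (fun f => by simp [dataHP, pairing_nil_right])
  have h2 : Commutes [1] [-1] (distHP k) (distE₂ k) :=
    commutes_field h (neutral_HP k) (neutral_E₂ k) [1] _ _ rfl
      (fun f => by simp [pairing_HP hk0 hk2 f]) (fun f => by simp [dataHP, pairing_nil_right])
  exact h1.sub_right h2

lemma commutes_HM_E (hk0 : k ≠ 0) (hk2 : k ≠ -2) :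
    Commutes [1] [-1] (distHM k) (distE₁ k - distE₂ k) := by
  have h := kappa_ne_zero hk0 hk2
  have h1 : Commutes [1] [-1] (distHM k) (distE₁ k) :=
    commutes_field h (neutral_HM k) (neutral_E₁ k) [-1] _ _ rfl
      (fun f => by simp [dataHM, pairing_nil_left]) (fun f => by simp [pairing_HM hk0 hk2 f])
  have h2 : Commutes [1] [-1] (distHM k) (distE₂ k) :=
    commutes_field h (neutral_HM k) (neutral_E₂ k) [-1] _ _ rfl
      (fun f => by simp [dataHM, pairing_nil_left]) (fun f => by simp [pairing_HM hk0 hk2 f])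
  exact h1.sub_right h2

lemma commutes_HP_F (hk0 : k ≠ 0) (hk2 : k ≠ -2) :
    Commutes [-(1 + k)] [1 - k] (distHP k) (distF₁ k - distF₂ k) := by
  have h := kappa_ne_zero hk0 hk2
  have h1 : Commutes [-(1 + k)] [1 - k] (distHP k) (distF₁ k) :=
    commutes_field h (neutral_HP k) (neutral_F₁ k) [-(1 + k)] _ _ rfl
      (fun f => by simp [pairing_HP hk0 hk2 f]) (fun f => by simp [dataHP, pairing_nil_right])
  have h2 : Commutes [-(1 + k)] [1 - k] (distHP k) (distF₂ k) :=
    commutes_field h (neutral_HP k) (neutral_F₂ k) [-(1 + k)] _ _ rfl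
      (fun f => by simp [pairing_HP hk0 hk2 f]) (fun f => by simp [dataHP, pairing_nil_right])
  exact h1.sub_right h2

lemma commutes_HM_F (hk0 : k ≠ 0) (hk2 : k ≠ -2) :
    Commutes [-1] [1] (distHM k) (distF₁ k - distF₂ k) := by
  have h := kappa_ne_zero hk0 hk2
  have h1 : Commutes [-1] [1] (distHM k) (distF₁ k) :=
    commutes_field h (neutral_HM k) (neutral_F₁ k) [1] _ _ rfl
      (fun f => by simp [dataHM, pairing_nil_left]) (fun f => by simp [pairing_HM hk0 hk2 f])
  have h2 : Commutes [-1] [1] (distHM k) (distF₂ k) :=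
    commutes_field h (neutral_HM k) (neutral_F₂ k) [1] _ _ rfl
      (fun f => by simp [dataHM, pairing_nil_left]) (fun f => by simp [pairing_HM hk0 hk2 f])
  exact h1.sub_right h2

lemma commutes_HP_HP (hk0 : k ≠ 0) (hk2 : k ≠ -2) :
    Commutes [] [] (distHP k) (distHP k) :=
  commutes_field (kappa_ne_zero hk0 hk2) (neutral_HP k) (neutral_HP k) [] _ _ rfl
    (fun f => by simp [dataHP, pairing_nil_right]) (fun f => by simp [dataHP, pairing_nil_right])

lemma commutes_HM_HM (hk0 : k ≠ 0) (hk2 : k ≠ -2) :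
    Commutes [] [] (distHM k) (distHM k) :=
  commutes_field (kappa_ne_zero hk0 hk2) (neutral_HM k) (neutral_HM k) [] _ _ rfl
    (fun f => by simp [dataHM, pairing_nil_left]) (fun f => by simp [dataHM, pairing_nil_left])

lemma commutes_HP_HM (hk0 : k ≠ 0) (hk2 : k ≠ -2) :
    Commutes [1, -(1 + k)] [-1, 1 - k] (distHP k) (distHM k) :=
  commutes_field (kappa_ne_zero hk0 hk2) (neutral_HP k) (neutral_HM k) [1, -(1 + k)] _ _ rfl
    (fun f => by simp [pairing_HP hk0 hk2 f]) (fun f => by simp [dataHM, pairing_nil_left])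

end Data

/-! ### The lowest orders in `ħ` of vertex operators -/

section LowOrder

/-- The field `g(u)` has the commutators of `: exp(∑_X r_X X(u)) :` with the modes. -/
structure Primary (k : ℂ) (r : Boson → ℂ) (g : ℂ → Op) : Prop where
  creation : ∀ X (n : ℕ) (i : ℂ), g i * mode k X (-(n : ℤ) - 1) =
    mode k X (-(n : ℤ) - 1) * g i + (-(kappa k X * r X)) • g (i + n + 1)
  annihilation : ∀ X (n : ℕ) (i : ℂ), mode k X (n + 1) * g i =
    g i * mode k X (n + 1) + (kappa k X * r X) • g (i - n - 1)

/-- A field without `ħ` as a distribution. -/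
def constDist (g : ℂ → Op) : Dist ℂ Op := fun N => if N = 0 then g else 0

lemma single_smul_constDist (s z : ℂ) (g : ℂ → Op) (N : ℕ) (i : ℂ) :
    ((PowerSeries.C (AddMonoidAlgebra.single s z) : Mult ℂ ℂ) • constDist g) N i =
      if N = 0 then z • g (i - s) else 0 := by
  rw [Dist.C_smul_apply, conv_single, constDist]
  split_ifs
  · rfl
  · exact smul_zero z

/-- A primary field is determined by its vacuum matrix coefficients. -/
theorem Primary.eq_zero {k : ℂ} (hk : ∀ X, kappa k X ≠ 0) {r : Boson → ℂ} {g : ℂ → Op}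
    (hg : Primary k r g) (h0 : ∀ p q i, vev p q (g i) = 0) (i : ℂ) : g i = 0 := by
  have hcov : Covariant k (fun X n => PowerSeries.C (AddMonoidAlgebra.single (-(n : ℂ) - 1)
      (-(kappa k X * r X)))) (fun X n => PowerSeries.C (AddMonoidAlgebra.single ((n : ℂ) + 1)
        (kappa k X * r X))) (constDist g) := by
    constructor
    · intro X n
      ext1 N i
      rw [Dist.add_apply, Pi.add_apply, single_smul_constDist, Dist.rmul_apply, Dist.lmul_apply,
        constDist]
      split_ifs
      · rw [hg.creation, show i - (-(n : ℂ) - 1) = i + n + 1 by ring]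
      · simp
    · intro X n
      ext1 N i
      rw [Dist.add_apply, Pi.add_apply, single_smul_constDist, Dist.rmul_apply, Dist.lmul_apply,
        constDist]
      split_ifs
      · rw [hg.annihilation, show i - ((n : ℂ) + 1) = i - n - 1 by ring]
      · simp
  refine op_ext fun p f => ?_
  have := hcov.eq_zero hk p (fun q => by
    ext1 N x
    rw [Dist.post_apply, constDist]
    split_ifs
    · exact h0 p q x
    · exact map_zero _) 0 i f
  exact this

lemma Primary.sub {k : ℂ} {r : Boson → ℂ} {g h : ℂ → Op} (hg : Primary k r g)
    (hh : Primary k r h) : Primary k r fun i => g i - h i where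
  creation X n i := by
    rw [sub_mul, mul_sub, hg.creation, hh.creation, smul_sub]; abel
  annihilation X n i := by
    rw [sub_mul, mul_sub, hg.annihilation, hh.annihilation, smul_sub]; abel

theorem Primary.eq {k : ℂ} (hk : ∀ X, kappa k X ≠ 0) {r : Boson → ℂ} {g h : ℂ → Op}
    (hg : Primary k r g) (hh : Primary k r h) (h0 : ∀ p q i, vev p q (g i) = vev p q (h i))
    (i : ℂ) : g i = h i :=
  sub_eq_zero.1 ((hg.sub hh).eq_zero hk (fun p q i => by
    rw [map_sub, h0, sub_self]) i)

/-- The sum of the coefficients of the boson `X`, weighted with the shifts. -/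
def moment (L : List Term) (X : Boson) : ℂ :=
  (L.map fun t => if t.2.1 = X then t.1 * t.2.2 else 0).sum

/-- The commutators of a vertex operator with the modes at order `ħ⁰` depend only on the charges. -/
lemma coeff_zero_pwSum (k : ℂ) (L : List Term) (X : Boson) (x : ℂ) :
    PowerSeries.coeff 0 (pwSum ℂ (1 : ℂ) k L X x) =
      AddMonoidAlgebra.single x (kappa k X * charge L X) := by
  rw [pwSum, charge]
  induction L with
  | nil => simp
  | cons t L ih =>
    rw [List.map_cons, List.map_cons, List.sum_cons, List.sum_cons, map_add, ih, mul_add,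
      AddMonoidAlgebra.single_add]
    congr 1
    split_ifs
    · rw [PowerSeries.algebraMap_apply, PowerSeries.coeff_C_mul, coeff_pw, algebraMap_eq_single,
        AddMonoidAlgebra.single_mul_single]
      simp [mul_comm]
    · simp

/-- At order `ħ¹` the commutators of a vertex operator with the modes depend on the moments. -/
lemma coeff_one_pwSum (k : ℂ) (L : List Term) (X : Boson) (x : ℂ) :
    PowerSeries.coeff 1 (pwSum ℂ (1 : ℂ) k L X x) =
      AddMonoidAlgebra.single (x - 1) (kappa k X * x * moment L X) := by
  rw [pwSum, moment]
  induction L with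
  | nil => simp
  | cons t L ih =>
    rw [List.map_cons, List.map_cons, List.sum_cons, List.sum_cons, map_add, ih, mul_add,
      AddMonoidAlgebra.single_add]
    congr 1
    split_ifs
    · rw [PowerSeries.algebraMap_apply, PowerSeries.coeff_C_mul, coeff_pw, algebraMap_eq_single,
        AddMonoidAlgebra.single_mul_single]
      simp only [Nat.cast_one, smul_eq_mul, mul_one, zero_add, pow_one, Ring.choose_one_right,
        Algebra.algebraMap_self, RingHom.id_apply]
      congr 1
      ring
    · simp

/-- The order `ħ^N` of a vertex operator. -/
def VertexData.ord (k : ℂ) (d : VertexData) (N : ℕ) (i : ℂ) : Op :=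
  PowerSeries.coeff N (d.field k i)

lemma toDist_field_apply (k : ℂ) (d : VertexData) (N : ℕ) (i : ℂ) :
    toDist (d.field k) N i = d.ord k N i := rfl

lemma Dist.smul_apply_zero {W : Type} [AddCommGroup W] [Module ℂ W] (κ : Mult ℂ ℂ) (G : Dist ℂ W)
    (i : ℂ) : (κ • G) 0 i = conv ℂ (PowerSeries.coeff 0 κ) (G 0) i := by
  rw [Dist.smul_apply, Finset.Nat.antidiagonal_zero, Finset.sum_singleton]

lemma Dist.smul_apply_one {W : Type} [AddCommGroup W] [Module ℂ W] (κ : Mult ℂ ℂ) (G : Dist ℂ W)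
    (i : ℂ) : (κ • G) 1 i = conv ℂ (PowerSeries.coeff 0 κ) (G 1) i +
      conv ℂ (PowerSeries.coeff 1 κ) (G 0) i := by
  rw [Dist.smul_apply, Finset.Nat.antidiagonal_succ, Finset.sum_cons, Finset.Nat.antidiagonal_zero,
    Finset.map_singleton, Finset.sum_singleton]
  rfl

variable {k : ℂ} {d : VertexData}

lemma primary_ord_zero (k : ℂ) (hd : d.Neutral) : Primary k d.r (d.ord k 0) where
  creation X n i := by
    have h := congrFun (congrFun ((field_covariant k hd).creation X n) 0) i
    rw [Dist.add_apply, Pi.add_apply, Dist.smul_apply_zero, map_neg, coeff_zero_pwSum,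
      ← AddMonoidAlgebra.single_neg, conv_single, hd.la, Dist.rmul_apply, Dist.lmul_apply] at h
    simp only [toDist_field_apply] at h
    rw [h, show i - -((n : ℂ) + 1) = i + n + 1 by ring]
  annihilation X n i := by
    have h := congrFun (congrFun ((field_covariant k hd).annihilation X n) 0) i
    rw [Dist.add_apply, Pi.add_apply, Dist.smul_apply_zero, coeff_zero_pwSum,
      conv_single, hd.lc, Dist.rmul_apply, Dist.lmul_apply] at h
    simp only [toDist_field_apply] at h
    rw [h, show i - ((n : ℂ) + 1) = i - n - 1 by ring]

lemma ord_one_creation (k : ℂ) (hd : d.Neutral) (X : Boson) (n : ℕ) (i : ℂ) :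
    d.ord k 1 i * mode k X (-(n : ℤ) - 1) = mode k X (-(n : ℤ) - 1) * d.ord k 1 i +
      (-(kappa k X * d.r X)) • d.ord k 1 (i + n + 1) +
        (kappa k X * (n + 1) * moment d.la X) • d.ord k 0 (i + n + 2) := by
  have h := congrFun (congrFun ((field_covariant k hd).creation X n) 1) i
  rw [Dist.add_apply, Pi.add_apply, Dist.smul_apply_one, map_neg (PowerSeries.coeff 0),
    map_neg (PowerSeries.coeff 1), coeff_zero_pwSum,
    coeff_one_pwSum, ← AddMonoidAlgebra.single_neg, ← AddMonoidAlgebra.single_neg, conv_single,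
    conv_single, hd.la, Dist.rmul_apply, Dist.lmul_apply] at h
  simp only [toDist_field_apply] at h
  rw [h, show i - -((n : ℂ) + 1) = i + n + 1 by ring,
    show i - (-((n : ℂ) + 1) - 1) = i + n + 2 by ring, ← add_assoc,
    show -(kappa k X * -((n : ℂ) + 1) * moment d.la X) =
      kappa k X * (n + 1) * moment d.la X by ring]

lemma ord_one_annihilation (k : ℂ) (hd : d.Neutral) (X : Boson) (n : ℕ) (i : ℂ) :
    mode k X (n + 1) * d.ord k 1 i = d.ord k 1 i * mode k X (n + 1) +
      (kappa k X * d.r X) • d.ord k 1 (i - n - 1) +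
        (kappa k X * (n + 1) * moment d.lc X) • d.ord k 0 (i - n) := by
  have h := congrFun (congrFun ((field_covariant k hd).annihilation X n) 1) i
  rw [Dist.add_apply, Pi.add_apply, Dist.smul_apply_one, coeff_zero_pwSum,
    coeff_one_pwSum, conv_single,
    conv_single, hd.lc, Dist.rmul_apply, Dist.lmul_apply] at h
  simp only [toDist_field_apply] at h
  rw [h, show i - ((n : ℂ) + 1) = i - n - 1 by ring,
    show i - ((n : ℂ) + 1 - 1) = i - n by ring, ← add_assoc]

/-- The exponent of `u` in the vacuum matrix coefficients at order `ħ⁰`. -/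
def VertexData.lowest (d : VertexData) (p : Boson → ℂ) : ℂ :=
  d.r Boson.alpha * p Boson.alpha + d.r Boson.beta * p Boson.beta + d.r Boson.gamma * p Boson.gamma

lemma nu_eq_lowest (hd : d.Neutral) (p : Boson → ℂ) : nu d.la p = d.lowest p := by
  rw [nu_eq, hd.la, hd.la, hd.la]
  rfl

lemma vev_field (k : ℂ) (hd : d.Neutral) (p : Boson → ℂ) (N : ℕ) (i : ℂ) :
    vev p (d.shift k p) (d.ord k N i) =
      (PowerSeries.coeff N (pref ℂ (1 : ℂ) d.la p)).coeff i := by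
  rw [← smul_ofSer_one, ← post_vev_field k hd]
  rfl

lemma vev_field_of_ne (k : ℂ) (hd : d.Neutral) {p q : Boson → ℂ} (hq : q ≠ d.shift k p) (N : ℕ)
    (i : ℂ) : vev p q (d.ord k N i) = 0 :=
  congrFun (congrFun (post_vev_field_of_ne k hd p q hq) N) i

lemma coeff_zero_pref (L : List Term) (p : Boson → ℂ) :
    PowerSeries.coeff 0 (pref ℂ (1 : ℂ) L p) = AddMonoidAlgebra.single (nu L p) 1 := by
  rw [nu]
  induction L with
  | nil => simp [pref_nil, AddMonoidAlgebra.one_def]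
  | cons t L ih =>
    rw [pref_cons, PowerSeries.coeff_zero_eq_constantCoeff_apply, map_mul,
      ← PowerSeries.coeff_zero_eq_constantCoeff_apply,
      ← PowerSeries.coeff_zero_eq_constantCoeff_apply, ih, coeff_pw,
      AddMonoidAlgebra.single_mul_single]
    simp

lemma coeff_one_pref (L : List Term) (p : Boson → ℂ) :
    PowerSeries.coeff 1 (pref ℂ (1 : ℂ) L p) = AddMonoidAlgebra.single (nu L p - 1)
      (L.map fun t => t.1 * p t.2.1 * t.2.2).sum := by
  induction L with
  | nil => simp [pref_nil, PowerSeries.coeff_one]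
  | cons t L ih =>
    rw [pref_cons, PowerSeries.coeff_mul, Finset.Nat.antidiagonal_succ, Finset.sum_cons,
      Finset.Nat.antidiagonal_zero, Finset.map_singleton, Finset.sum_singleton]
    change PowerSeries.coeff 0 _ * PowerSeries.coeff 1 _ +
      PowerSeries.coeff 1 _ * PowerSeries.coeff 0 _ = _
    rw [ih, coeff_zero_pref, coeff_pw, coeff_pw, AddMonoidAlgebra.single_mul_single,
      AddMonoidAlgebra.single_mul_single, List.map_cons, List.sum_cons, nu, nu, List.map_cons,
      List.sum_cons]
    simp only [Nat.cast_zero, sub_zero, smul_eq_mul, mul_one, pow_zero, Ring.choose_zero_right,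
      one_mul, Nat.cast_one, pow_one, Ring.choose_one_right, Algebra.algebraMap_self,
      RingHom.id_apply]
    rw [show t.1 * p t.2.1 - 1 + (List.map (fun t : Term => t.1 * p t.2.1) L).sum =
        t.1 * p t.2.1 + ((List.map (fun t : Term => t.1 * p t.2.1) L).sum - 1) by ring,
      ← AddMonoidAlgebra.single_add, ← add_sub_assoc]
    congr 1
    ring

lemma sum_eq_moment (L : List Term) (p : Boson → ℂ) :
    (L.map fun t => t.1 * p t.2.1 * t.2.2).sum = moment L Boson.alpha * p Boson.alpha +
      moment L Boson.beta * p Boson.beta + moment L Boson.gamma * p Boson.gamma := by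
  rw [moment, moment, moment]
  induction L with
  | nil => simp
  | cons t L ih =>
    obtain ⟨c, X, B⟩ := t
    simp only [List.map_cons, List.sum_cons, ih]
    cases X <;> simp <;> ring

open Classical in
lemma vev_ord_zero (k : ℂ) (hd : d.Neutral) (p q : Boson → ℂ) (i : ℂ) :
    vev p q (d.ord k 0 i) = if q = d.shift k p ∧ i = d.lowest p then 1 else 0 := by
  by_cases hq : q = d.shift k p
  · rw [hq, vev_field k hd, coeff_zero_pref, nu_eq_lowest hd]
    rw [AddMonoidAlgebra.coeff_single, Finsupp.single_apply]
    simp [eq_comm]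
  · rw [vev_field_of_ne k hd hq, if_neg (fun h => hq h.1)]

/-- At order `ħ¹` the vacuum matrix coefficients are given by the moments of the annihilation part. -/
lemma vev_ord_one (k : ℂ) (hd : d.Neutral) (p q : Boson → ℂ) (i : ℂ) :
    vev p q (d.ord k 1 i) = (moment d.la Boson.alpha * p Boson.alpha +
      moment d.la Boson.beta * p Boson.beta + moment d.la Boson.gamma * p Boson.gamma) *
        vev p q (d.ord k 0 (i + 1)) := by
  classical
  rw [vev_ord_zero k hd]
  by_cases hq : q = d.shift k p
  · rw [hq, vev_field k hd, coeff_one_pref, nu_eq_lowest hd, sum_eq_moment]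
    rw [AddMonoidAlgebra.coeff_single, Finsupp.single_apply]
    simp only [true_and, eq_comm (a := i + 1), ← sub_eq_iff_eq_add, mul_ite, mul_one, mul_zero]
  · rw [vev_field_of_ne k hd hq, if_neg (fun h => hq h.1), mul_zero]

/-- At order `ħ⁰` a vertex operator depends only on its charges. -/
theorem ord_zero_eq (hk : ∀ X, kappa k X ≠ 0) {d d' : VertexData} (hd : d.Neutral)
    (hd' : d'.Neutral) (h : d.r = d'.r) (i : ℂ) : d.ord k 0 i = d'.ord k 0 i := by
  refine Primary.eq hk (primary_ord_zero k hd) (h ▸ primary_ord_zero k hd') (fun p q i => ?_) i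
  have hs : d.shift k p = d'.shift k p := by
    funext X
    simp only [VertexData.shift, h]
  rw [vev_ord_zero k hd, vev_ord_zero k hd', hs, VertexData.lowest, VertexData.lowest, h]

/-- At order `ħ⁰` a vertex operator without charges is the identity. -/
theorem ord_zero_eq_one (hk : ∀ X, kappa k X ≠ 0) (hd : d.Neutral) (h : d.r = 0) (i : ℂ) :
    d.ord k 0 i = if i = 0 then 1 else 0 := by
  have hone : Primary k d.r (fun i : ℂ => if i = 0 then (1 : Op) else 0) := by
    constructor
    · intro X n i
      rw [h, Pi.zero_apply, mul_zero, neg_zero, zero_smul, add_zero]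
      split_ifs <;> simp
    · intro X n i
      rw [h, Pi.zero_apply, mul_zero, zero_smul, add_zero]
      split_ifs <;> simp
  refine Primary.eq hk (primary_ord_zero k hd) hone (fun p q i => ?_) i
  classical
  have hs : d.shift k p = p := by
    funext X
    rw [VertexData.shift, h, Pi.zero_apply, mul_zero, add_zero]
  have hl : d.lowest p = 0 := by
    rw [VertexData.lowest, h]
    simp
  rw [vev_ord_zero k hd, hs, hl]
  by_cases hi : i = 0
  · rw [if_pos hi, vev_apply, Module.End.one_apply, Finsupp.single_apply]
    by_cases hq : q = p
    · simp [hi, hq]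
    · rw [if_neg (fun h => hq h.1), if_neg (Ne.symm hq), map_zero]
  · rw [if_neg hi, if_neg (fun h => hi h.2), map_zero]

end LowOrder

/-! ### Divisibility of the brackets in `e(u)` and `f(u)` by `ħ` -/

section Divisible

variable {k : ℂ}

lemma X_mul_divHbar {a : Field1 Fk} {i : ℂ} (h : PowerSeries.coeff 0 (a i) = 0) :
    PowerSeries.X * divHbar a i = a i := by
  ext1 N
  rcases N with _ | N
  · rw [PowerSeries.coeff_zero_X_mul, h]
  · rw [PowerSeries.coeff_succ_X_mul, divHbar, PowerSeries.coeff_mk]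

lemma X_mul_currentE (hk0 : k ≠ 0) (hk2 : k ≠ -2) (i : ℂ) :
    PowerSeries.X * currentE k i = -(eFirst k i - eSecond k i) := by
  refine X_mul_divHbar ?_
  change PowerSeries.coeff 0 (-(eFirst k i - eSecond k i)) = 0
  have h := ord_zero_eq (kappa_ne_zero hk0 hk2) (neutral_E₁ k) (neutral_E₂ k) rfl i
  rw [VertexData.ord, VertexData.ord, ← eFirst_eq, ← eSecond_eq] at h
  rw [map_neg, map_sub, h, sub_self, neg_zero]

lemma X_mul_currentF (hk0 : k ≠ 0) (hk2 : k ≠ -2) (i : ℂ) :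
    PowerSeries.X * currentF k i = fFirst k i - fSecond k i := by
  refine X_mul_divHbar ?_
  change PowerSeries.coeff 0 (fFirst k i - fSecond k i) = 0
  have h := ord_zero_eq (kappa_ne_zero hk0 hk2) (neutral_F₁ k) (neutral_F₂ k) rfl i
  rw [VertexData.ord, VertexData.ord, ← fFirst_eq, ← fSecond_eq] at h
  rw [map_sub, h, sub_self]

lemma X_smul_toDist (a : Field1 Fk) :
    (PowerSeries.X : Mult ℂ ℂ) • toDist a = toDist fun i => PowerSeries.X * a i := by
  ext1 N i
  rcases N with _ | N
  · rw [Dist.X_smul_zero, toDist, PowerSeries.coeff_zero_X_mul]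
    rfl
  · rw [Dist.X_smul_succ, toDist, toDist, PowerSeries.coeff_succ_X_mul]

lemma X_smul_toDist_currentE (hk0 : k ≠ 0) (hk2 : k ≠ -2) :
    (PowerSeries.X : Mult ℂ ℂ) • toDist (currentE k) = -(distE₁ k - distE₂ k) := by
  rw [X_smul_toDist]
  ext1 N i
  rw [toDist, X_mul_currentE hk0 hk2, eFirst_eq, eSecond_eq, map_neg, map_sub]
  rfl

lemma X_smul_toDist_currentF (hk0 : k ≠ 0) (hk2 : k ≠ -2) :
    (PowerSeries.X : Mult ℂ ℂ) • toDist (currentF k) = distF₁ k - distF₂ k := by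
  rw [X_smul_toDist]
  ext1 N i
  rw [toDist, X_mul_currentF hk0 hk2, fFirst_eq, fSecond_eq, map_sub]
  rfl

end Divisible

/-! ### The currents on the Fock spaces -/

section Sectors

open Boson

/-- The charge of the Fock space `F_{l,s,t}`. -/
def fockCharge (l s t : ℂ) : Boson → ℂ
  | alpha => l / 2
  | beta => s / 2
  | gamma => t / 2

variable {k : ℂ}

lemma mem_fock_iff (hk0 : k ≠ 0) (hk2 : k ≠ -2) {l s t : ℂ} {x : Fk} :
    x ∈ fock k l s t ↔ ∃ f : Osc, x = Finsupp.single (fockCharge l s t) f := by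
  have h2 : k + 2 ≠ 0 := fun h => hk2 (by linear_combination h)
  have hf : fock k l s t =
      LinearMap.range (Finsupp.lsingle (R := ℂ) (M := Osc) (fockCharge l s t)) := by
    refine congrArg (fun p : Boson → ℂ => LinearMap.range (Finsupp.lsingle (R := ℂ) (M := Osc) p))
      (funext fun X => ?_)
    cases X <;> simp only [kappa, fockCharge] <;> field_simp
  rw [hf, LinearMap.mem_range]
  exact ⟨fun ⟨f, hf⟩ => ⟨f, hf.symm⟩, fun ⟨f, hf⟩ => ⟨f, hf.symm⟩⟩

lemma single_mem_fock (hk0 : k ≠ 0) (hk2 : k ≠ -2) (l s t : ℂ) (f : Osc) :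
    Finsupp.single (fockCharge l s t) f ∈ fock k l s t :=
  (mem_fock_iff hk0 hk2).2 ⟨f, rfl⟩

lemma field_single_eq (k : ℂ) {d : VertexData} (hd : d.Neutral) (N : ℕ) (i : ℂ) (p : Boson → ℂ)
    (f : Osc) : ∃ g : Osc, PowerSeries.coeff N (d.field k i) (Finsupp.single p f) =
      Finsupp.single (d.shift k p) g :=
  ⟨_, field_single k hd N i p f⟩

lemma shift_E (hk0 : k ≠ 0) (l s t : ℂ) {d : VertexData} (hd : d.r = zeroBG (2 / k)) :
    d.shift k (fockCharge l s t) = fockCharge l (s - 2) (t + 2) := by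
  funext X
  rw [VertexData.shift, hd]
  cases X <;> simp only [kappa, fockCharge, zeroBG] <;> field_simp <;> ring

lemma shift_F (hk0 : k ≠ 0) (l s t : ℂ) {d : VertexData} (hd : d.r = zeroBG (-(2 / k))) :
    d.shift k (fockCharge l s t) = fockCharge l (s + 2) (t - 2) := by
  funext X
  rw [VertexData.shift, hd]
  cases X <;> simp only [kappa, fockCharge, zeroBG] <;> field_simp <;> ring

lemma shift_zero (k : ℂ) (p : Boson → ℂ) {d : VertexData} (hd : d.r = 0) : d.shift k p = p := by
  funext X
  rw [VertexData.shift, hd, Pi.zero_apply, mul_zero, add_zero]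

lemma coeff_currentE (k : ℂ) (N : ℕ) (i : ℂ) : PowerSeries.coeff N (currentE k i) =
    -((dataE₁ k).ord k (N + 1) i - (dataE₂ k).ord k (N + 1) i) := by
  rw [currentE, divHbar, PowerSeries.coeff_mk, eFirst_eq, eSecond_eq]
  change PowerSeries.coeff (N + 1) (-((dataE₁ k).field k i - (dataE₂ k).field k i)) = _
  rw [map_neg, map_sub]
  rfl

lemma coeff_currentF (k : ℂ) (N : ℕ) (i : ℂ) : PowerSeries.coeff N (currentF k i) =
    (dataF₁ k).ord k (N + 1) i - (dataF₂ k).ord k (N + 1) i := by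
  rw [currentF, divHbar, PowerSeries.coeff_mk, fFirst_eq, fSecond_eq]
  change PowerSeries.coeff (N + 1) ((dataF₁ k).field k i - (dataF₂ k).field k i) = _
  rw [map_sub]
  rfl

lemma coeff_hPlus (k : ℂ) (N : ℕ) (i : ℂ) :
    PowerSeries.coeff N (hPlus k i) = (dataHP k).ord k N i := by
  rw [hPlus_eq]
  rfl

lemma coeff_hMinus (k : ℂ) (N : ℕ) (i : ℂ) :
    PowerSeries.coeff N (hMinus k i) = (dataHM k).ord k N i := by
  rw [hMinus_eq]
  rfl

variable {l s t : ℂ}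

lemma ord_mem_fock (hk0 : k ≠ 0) (hk2 : k ≠ -2) {d : VertexData} (hd : d.Neutral) {l' s' t' : ℂ}
    (h : d.shift k (fockCharge l s t) = fockCharge l' s' t') (N : ℕ) (i : ℂ) {x : Fk}
    (hx : x ∈ fock k l s t) : d.ord k N i x ∈ fock k l' s' t' := by
  obtain ⟨f, rfl⟩ := (mem_fock_iff hk0 hk2).1 hx
  obtain ⟨g, hg⟩ := field_single_eq k hd N i (fockCharge l s t) f
  rw [VertexData.ord, hg, h]
  exact single_mem_fock hk0 hk2 _ _ _ g

lemma currentE_mem (hk0 : k ≠ 0) (hk2 : k ≠ -2) (N : ℕ) (i : ℂ) {x : Fk}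
    (hx : x ∈ fock k l s t) :
    PowerSeries.coeff N (currentE k i) x ∈ fock k l (s - 2) (t + 2) := by
  rw [coeff_currentE, LinearMap.neg_apply, LinearMap.sub_apply]
  exact neg_mem (sub_mem (ord_mem_fock hk0 hk2 (neutral_E₁ k) (shift_E hk0 l s t rfl) _ _ hx)
    (ord_mem_fock hk0 hk2 (neutral_E₂ k) (shift_E hk0 l s t rfl) _ _ hx))

lemma currentF_mem (hk0 : k ≠ 0) (hk2 : k ≠ -2) (N : ℕ) (i : ℂ) {x : Fk}
    (hx : x ∈ fock k l s t) :
    PowerSeries.coeff N (currentF k i) x ∈ fock k l (s + 2) (t - 2) := by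
  rw [coeff_currentF, LinearMap.sub_apply]
  exact sub_mem (ord_mem_fock hk0 hk2 (neutral_F₁ k) (shift_F hk0 l s t rfl) _ _ hx)
    (ord_mem_fock hk0 hk2 (neutral_F₂ k) (shift_F hk0 l s t rfl) _ _ hx)

lemma hPlus_mem (hk0 : k ≠ 0) (hk2 : k ≠ -2) (N : ℕ) (i : ℂ) {x : Fk}
    (hx : x ∈ fock k l s t) : PowerSeries.coeff N (hPlus k i) x ∈ fock k l s t := by
  rw [coeff_hPlus]
  exact ord_mem_fock hk0 hk2 (neutral_HP k) (shift_zero k _ rfl) _ _ hx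

lemma hMinus_mem (hk0 : k ≠ 0) (hk2 : k ≠ -2) (N : ℕ) (i : ℂ) {x : Fk}
    (hx : x ∈ fock k l s t) : PowerSeries.coeff N (hMinus k i) x ∈ fock k l s t := by
  rw [coeff_hMinus]
  exact ord_mem_fock hk0 hk2 (neutral_HM k) (shift_zero k _ rfl) _ _ hx

lemma locSum_mem {ι M : Type} [AddCommGroup M] [Module ℂ M] {T : ι → Module.End ℂ M}
    {V : Submodule ℂ M} {x : M} (h : ∀ i, T i x ∈ V) : locSum T x ∈ V := by
  by_cases hT : ∀ x : M, (Function.support fun i => T i x).Finite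
  · rw [locSum_apply hT]
    exact finsum_induction (· ∈ V) V.zero_mem (fun _ _ => V.add_mem) h
  · rw [locSum, dif_neg hT]
    exact V.zero_mem

lemma mode_single (k : ℂ) (X : Boson) (n : ℤ) (p : Boson → ℂ) (f : Osc) :
    ∃ g : Osc, mode k X n (Finsupp.single p f) = Finsupp.single p g := by
  match n with
  | Int.ofNat 0 => exact ⟨_, momentum_single X f p⟩
  | Int.ofNat (n + 1) =>
    refine ⟨(kappa k X * (n + 1)) • MvPolynomial.pderiv (X, n) f, ?_⟩
    change mode k X (n + 1) (Finsupp.single p f) = _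
    rw [mode_succ, LinearMap.smul_apply, derOp_single, Finsupp.smul_single]
  | Int.negSucc n =>
    refine ⟨MvPolynomial.X (X, n) * f, ?_⟩
    have : Int.negSucc n = -(n : ℤ) - 1 := by omega
    rw [this, mode_neg_succ, mulOp_single]

lemma mode_mem_fock (hk0 : k ≠ 0) (hk2 : k ≠ -2) (X : Boson) (n : ℤ) {x : Fk}
    (hx : x ∈ fock k l s t) : mode k X n x ∈ fock k l s t := by
  obtain ⟨f, rfl⟩ := (mem_fock_iff hk0 hk2).1 hx
  obtain ⟨g, hg⟩ := mode_single k X n (fockCharge l s t) f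
  rw [hg]
  exact single_mem_fock hk0 hk2 _ _ _ g

lemma dBoson_mem (hk0 : k ≠ 0) (hk2 : k ≠ -2) (X : Boson) {x : Fk} (hx : x ∈ fock k l s t) :
    dBoson k X x ∈ fock k l s t := by
  rw [dBoson, LinearMap.add_apply]
  refine add_mem ?_ (locSum_mem fun n => ?_)
  · rw [Module.End.mul_apply]
    exact mode_mem_fock hk0 hk2 X (-1) (mode_mem_fock hk0 hk2 X 0 hx)
  · rw [Module.End.mul_apply]
    exact mode_mem_fock hk0 hk2 _ _ (mode_mem_fock hk0 hk2 _ _ hx)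

lemma dOp_mem (hk0 : k ≠ 0) (hk2 : k ≠ -2) {x : Fk} (hx : x ∈ fock k l s t) :
    dOp k x ∈ fock k l s t := by
  rw [dOp, LinearMap.add_apply, LinearMap.sub_apply, LinearMap.smul_apply, LinearMap.smul_apply,
    LinearMap.smul_apply]
  exact add_mem (sub_mem (Submodule.smul_mem _ _ (dBoson_mem hk0 hk2 _ hx))
    (Submodule.smul_mem _ _ (dBoson_mem hk0 hk2 _ hx)))
    (Submodule.smul_mem _ _ (dBoson_mem hk0 hk2 _ hx))

lemma exists_ord_bound (hk0 : k ≠ 0) (hk2 : k ≠ -2) {d : VertexData} (hd : d.Neutral) {x : Fk}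
    (hx : x ∈ fock k l s t) (N : ℕ) : ∃ B : ℝ, ∀ i : ℂ, i.re < B → d.ord k N i x = 0 := by
  obtain ⟨f, rfl⟩ := (mem_fock_iff hk0 hk2).1 hx
  exact field_bounded k hd (fockCharge l s t) f N

lemma field_currentE (hk0 : k ≠ 0) (hk2 : k ≠ -2) (l s t : ℂ) :
    IsFieldOn (fock k l s t) (currentE k) := by
  intro x hx N
  obtain ⟨B, hB⟩ := exists_ord_bound hk0 hk2 (neutral_E₁ k) hx (N + 1)
  obtain ⟨B', hB'⟩ := exists_ord_bound hk0 hk2 (neutral_E₂ k) hx (N + 1)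
  refine ⟨min B B', fun i hi => ?_⟩
  rw [coeff_currentE, LinearMap.neg_apply, LinearMap.sub_apply,
    hB i (hi.trans_le (min_le_left _ _)), hB' i (hi.trans_le (min_le_right _ _)), sub_zero,
    neg_zero]

lemma field_currentF (hk0 : k ≠ 0) (hk2 : k ≠ -2) (l s t : ℂ) :
    IsFieldOn (fock k l s t) (currentF k) := by
  intro x hx N
  obtain ⟨B, hB⟩ := exists_ord_bound hk0 hk2 (neutral_F₁ k) hx (N + 1)
  obtain ⟨B', hB'⟩ := exists_ord_bound hk0 hk2 (neutral_F₂ k) hx (N + 1)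
  refine ⟨min B B', fun i hi => ?_⟩
  rw [coeff_currentF, LinearMap.sub_apply,
    hB i (hi.trans_le (min_le_left _ _)), hB' i (hi.trans_le (min_le_right _ _)), sub_zero]

lemma field_hPlus (hk0 : k ≠ 0) (hk2 : k ≠ -2) (l s t : ℂ) :
    IsFieldOn (fock k l s t) (hPlus k) := by
  intro x hx N
  simp only [coeff_hPlus]
  exact exists_ord_bound hk0 hk2 (neutral_HP k) hx N

lemma field_hMinus (hk0 : k ≠ 0) (hk2 : k ≠ -2) (l s t : ℂ) :
    IsFieldOn (fock k l s t) (hMinus k) := by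
  intro x hx N
  simp only [coeff_hMinus]
  exact exists_ord_bound hk0 hk2 (neutral_HM k) hx N

lemma lowest_E (l s t : ℂ) {d : VertexData} (hd : d.r = zeroBG (2 / k)) :
    d.lowest (fockCharge l s t) = (s + t) / k := by
  rw [VertexData.lowest, hd]
  simp only [zeroBG, fockCharge]
  ring

lemma lowest_F (l s t : ℂ) {d : VertexData} (hd : d.r = zeroBG (-(2 / k))) :
    d.lowest (fockCharge l s t) = -((s + t) / k) := by
  rw [VertexData.lowest, hd]
  simp only [zeroBG, fockCharge]
  ring

lemma ord_eq_zero (hk0 : k ≠ 0) (hk2 : k ≠ -2) {d : VertexData} (hd : d.Neutral) {lam i : ℂ}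
    (hlam : d.lowest (fockCharge l s t) = lam) (hi : ¬ ∃ n : ℤ, i = lam + n) (N : ℕ) {x : Fk}
    (hx : x ∈ fock k l s t) : d.ord k N i x = 0 := by
  obtain ⟨f, rfl⟩ := (mem_fock_iff hk0 hk2).1 hx
  refine field_eq_zero k hd (fockCharge l s t) f N i fun n hn => hi ⟨n, ?_⟩
  rw [hn, nu_eq_lowest hd, hlam]

lemma modes_currentE (hk0 : k ≠ 0) (hk2 : k ≠ -2) {i : ℂ} (N : ℕ)
    (hi : ¬ ∃ n : ℤ, i = (s + t) / k + n) {x : Fk} (hx : x ∈ fock k l s t) :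
    PowerSeries.coeff N (currentE k i) x = 0 := by
  rw [coeff_currentE, LinearMap.neg_apply, LinearMap.sub_apply,
    ord_eq_zero hk0 hk2 (neutral_E₁ k) (lowest_E l s t rfl) hi _ hx,
    ord_eq_zero hk0 hk2 (neutral_E₂ k) (lowest_E l s t rfl) hi _ hx, sub_zero, neg_zero]

lemma modes_currentF (hk0 : k ≠ 0) (hk2 : k ≠ -2) {i : ℂ} (N : ℕ)
    (hi : ¬ ∃ n : ℤ, i = -((s + t) / k) + n) {x : Fk} (hx : x ∈ fock k l s t) :
    PowerSeries.coeff N (currentF k i) x = 0 := by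
  rw [coeff_currentF, LinearMap.sub_apply,
    ord_eq_zero hk0 hk2 (neutral_F₁ k) (lowest_F l s t rfl) hi _ hx,
    ord_eq_zero hk0 hk2 (neutral_F₂ k) (lowest_F l s t rfl) hi _ hx, sub_zero]

/-- The exponents of a vertex operator without creation part and without charges are nonpositive. -/
lemma ord_eq_zero_of_lc_nil (k : ℂ) {d : VertexData} (hd : d.Neutral) (hlc : d.lc = []) (N : ℕ)
    {i : ℂ} (hi : ¬ ∃ m : ℕ, i = -(m : ℂ)) : d.ord k N i = 0 := by
  have hr : ∀ X, d.r X = 0 := fun X => by rw [← hd.lc, hlc]; rfl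
  refine op_ext fun p f => ?_
  refine (field_single k hd N i p f).trans ?_
  rw [hlc, show creaSer [] = 0 from rfl, expS_zero, Dist.smul_apply, Finset.sum_apply,
    Finset.sum_eq_zero, Finsupp.single_zero, LinearMap.zero_apply]
  intro n _
  rw [conv_apply]
  refine Finset.sum_eq_zero fun s hs => ?_
  dsimp only
  by_cases hj : ∃ j : ℕ, i - s = j
  · obtain ⟨j, hj⟩ := hj
    rw [hj, ofSer_nat, MvPowerSeries.coeff_one, if_neg, smul_zero]
    intro h0
    have hj0 : j = 0 := by
      have := DFunLike.congr_fun h0 0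
      rwa [expo_apply_zero] at this
    refine (Finsupp.mem_support_iff.1 hs) ((coeff_expSer_anni k d.la p f).2 n.1 s fun m hm => ?_)
    refine hi ⟨m, ?_⟩
    rw [nu_eq_lowest hd, VertexData.lowest, hr, hr, hr] at hm
    rw [hj0] at hj
    push_cast at hj
    linear_combination hj + hm
  · rw [ofSer_eq_zero _ _ hj, smul_zero]

/-- The exponents of a vertex operator without annihilation part are nonnegative. -/
lemma ord_eq_zero_of_la_nil (k : ℂ) {d : VertexData} (hd : d.Neutral) (hla : d.la = []) (N : ℕ)
    {i : ℂ} (hi : ¬ ∃ m : ℕ, i = (m : ℂ)) : d.ord k N i = 0 := by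
  refine op_ext fun p f => ?_
  refine (field_single k hd N i p f).trans ?_
  have h : pref Osc (1 : ℂ) d.la p * tau k d.la f =
      PowerSeries.C (AddMonoidAlgebra.single 0 f) := by
    rw [hla, pref_nil, one_mul, tau]
    have : ∀ j : Boson × ℕ, (PowerSeries.C (AddMonoidAlgebra.single 0 (MvPolynomial.X j)) -
        pwSum Osc (1 : ℂ) k [] j.1 (-(j.2 + 1 : ℂ)) : Mult Osc ℂ) =
        PowerSeries.C (AddMonoidAlgebra.singleZeroRingHom (MvPolynomial.X j)) := fun j => by
      rw [pwSum, List.map_nil, List.sum_nil, sub_zero]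
      rfl
    simp only [this]
    induction f using MvPolynomial.induction_on with
    | C a =>
      rw [← MvPolynomial.algebraMap_eq, AlgHom.commutes, PowerSeries.algebraMap_apply,
        algebraMap_eq_single]
    | add f g hf hg => rw [map_add, hf, hg, ← map_add, AddMonoidAlgebra.single_add]
    | mul_X f j hf =>
      rw [map_mul, hf, MvPolynomial.aeval_X, ← map_mul]
      congr 1
      exact (AddMonoidAlgebra.single_mul_single _ _ _ _).trans (by rw [add_zero])
  rw [h, Dist.C_smul_apply, conv_single, sub_zero, ofSer_eq_zero _ _ hi, smul_zero,
    Finsupp.single_zero, LinearMap.zero_apply]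

/-- The constant term in `u` of a vertex operator without creation part and without charges commutes
with all modes, since the positive powers of `u` vanish, so that it is the identity. -/
lemma ord_apply_zero_of_lc_nil (hk : ∀ X, kappa k X ≠ 0) {d : VertexData} (hd : d.Neutral)
    (hlc : d.lc = []) {N : ℕ} (hN : N ≠ 0) : d.ord k N 0 = 0 := by
  have hr : d.r = 0 := funext fun X => by rw [← hd.lc, hlc]; rfl
  have hprim : Primary k 0 fun _ => d.ord k N 0 := by
    constructor
    · intro X n _
      have h := congrFun (congrFun ((field_covariant k hd).creation X n) N) 0
      rw [Dist.add_apply, Pi.add_apply, Dist.smul_apply, Finset.sum_apply, Finset.sum_eq_zero] at h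
      · simpa [toDist_field_apply] using h
      · intro m _
        rw [coeff_neg_pwSum, conv_single]
        refine (congrArg _ (ord_eq_zero_of_lc_nil k hd hlc m.2 ?_)).trans (smul_zero _)
        rintro ⟨j, hj⟩
        have h3 : ((n + 1 + m.1 + j : ℕ) : ℂ) = 0 := by
          push_cast
          simp only [smul_eq_mul, mul_one] at hj
          linear_combination hj
        have h4 : n + 1 + m.1 + j = 0 := by exact_mod_cast h3
        omega
    · intro X n _
      have h := congrFun (congrFun ((field_covariant k hd).annihilation X n) N) 0
      rw [hlc, pwSum, List.map_nil, List.sum_nil, zero_smul, add_zero] at h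
      simpa [toDist_field_apply] using h
  refine hprim.eq_zero hk (fun p q _ => ?_) 0
  by_cases hq : q = d.shift k p
  · rw [hq, vev_field k hd, pref_eq, nu_eq_lowest hd, VertexData.lowest, hr]
    have : monom ℂ ((0 : Boson → ℂ) alpha * p alpha + (0 : Boson → ℂ) beta * p beta +
        (0 : Boson → ℂ) gamma * p gamma) = 1 := by
      simp [monom_zero]
    rw [this, one_mul, coeff_substInv, AddMonoidAlgebra.coeff_single, Finsupp.single_apply,
      if_neg]
    simpa using hN
  · exact vev_field_of_ne k hd hq N 0

lemma modes_hPlus (hk0 : k ≠ 0) (hk2 : k ≠ -2) {i : ℂ} {N : ℕ}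
    (h : (¬ ∃ m : ℕ, i = -(m : ℂ) - 1) ∨ N = 0) (x : Fk) :
    PowerSeries.coeff N (hPlus k i) x = if i = 0 ∧ N = 0 then x else 0 := by
  have hk := kappa_ne_zero hk0 hk2
  rw [coeff_hPlus]
  by_cases hN : N = 0
  · subst hN
    rw [ord_zero_eq_one hk (neutral_HP k) rfl]
    by_cases hi : i = 0 <;> simp [hi]
  · have h1 := h.resolve_right hN
    rw [if_neg (fun h2 => hN h2.2)]
    by_cases hi : i = 0
    · rw [hi, ord_apply_zero_of_lc_nil hk (neutral_HP k) rfl hN, LinearMap.zero_apply]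
    · rw [ord_eq_zero_of_lc_nil k (neutral_HP k) rfl N, LinearMap.zero_apply]
      rintro ⟨m, hm⟩
      rcases m with _ | m
      · exact hi (by simpa using hm)
      · exact h1 ⟨m, by rw [hm]; push_cast; ring⟩

lemma modes_hMinus (hk0 : k ≠ 0) (hk2 : k ≠ -2) {i : ℂ} {N : ℕ}
    (h : (¬ ∃ m : ℕ, i = (m : ℂ)) ∨ N = 0) (x : Fk) :
    PowerSeries.coeff N (hMinus k i) x = if i = 0 ∧ N = 0 then x else 0 := by
  have hk := kappa_ne_zero hk0 hk2
  rw [coeff_hMinus]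
  by_cases hN : N = 0
  · subst hN
    rw [ord_zero_eq_one hk (neutral_HM k) rfl]
    by_cases hi : i = 0 <;> simp [hi]
  · rw [if_neg (fun h2 => hN h2.2), ord_eq_zero_of_la_nil k (neutral_HM k) rfl N
      (h.resolve_right hN), LinearMap.zero_apply]

end Sectors

/-! ### The exchange relations of the currents -/

section CurrentExchange

variable {k : ℂ}

lemma toDist_hPlus (k : ℂ) : toDist (hPlus k) = distHP k := by
  rw [hPlus_eq]; rfl

lemma toDist_hMinus (k : ℂ) : toDist (hMinus k) = distHM k := by
  rw [hMinus_eq]; rfl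

lemma Commutes.neg_left {num den : List ℂ} {G H : Dist ℂ Op} (h : Commutes num den G H) :
    Commutes num den (-G) H := by
  have := h.smul_left (-1)
  rwa [neg_one_smul] at this

lemma Commutes.neg_right {num den : List ℂ} {G H : Dist ℂ Op} (h : Commutes num den G H) :
    Commutes num den G (-H) := by
  have := h.smul_right (-1)
  rwa [neg_one_smul] at this

lemma commutes_currentE (hk0 : k ≠ 0) (hk2 : k ≠ -2) :
    Commutes [1] [-1] (toDist (currentE k)) (toDist (currentE k)) := by
  refine .of_X_smul_left (.of_X_smul_right ?_)
  rw [X_smul_toDist_currentE hk0 hk2]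
  exact (commutes_E hk0 hk2).neg_left.neg_right

lemma commutes_currentF (hk0 : k ≠ 0) (hk2 : k ≠ -2) :
    Commutes [-1] [1] (toDist (currentF k)) (toDist (currentF k)) := by
  refine .of_X_smul_left (.of_X_smul_right ?_)
  rw [X_smul_toDist_currentF hk0 hk2]
  exact commutes_F hk0 hk2

lemma commutes_hPlus_currentE (hk0 : k ≠ 0) (hk2 : k ≠ -2) :
    Commutes [1] [-1] (toDist (hPlus k)) (toDist (currentE k)) := by
  refine .of_X_smul_right ?_
  rw [X_smul_toDist_currentE hk0 hk2, toDist_hPlus]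
  exact (commutes_HP_E hk0 hk2).neg_right

lemma commutes_hMinus_currentE (hk0 : k ≠ 0) (hk2 : k ≠ -2) :
    Commutes [1] [-1] (toDist (hMinus k)) (toDist (currentE k)) := by
  refine .of_X_smul_right ?_
  rw [X_smul_toDist_currentE hk0 hk2, toDist_hMinus]
  exact (commutes_HM_E hk0 hk2).neg_right

lemma commutes_hPlus_currentF (hk0 : k ≠ 0) (hk2 : k ≠ -2) :
    Commutes [-(1 + k)] [1 - k] (toDist (hPlus k)) (toDist (currentF k)) := by
  refine .of_X_smul_right ?_
  rw [X_smul_toDist_currentF hk0 hk2, toDist_hPlus]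
  exact commutes_HP_F hk0 hk2

lemma commutes_hMinus_currentF (hk0 : k ≠ 0) (hk2 : k ≠ -2) :
    Commutes [-1] [1] (toDist (hMinus k)) (toDist (currentF k)) := by
  refine .of_X_smul_right ?_
  rw [X_smul_toDist_currentF hk0 hk2, toDist_hMinus]
  exact commutes_HM_F hk0 hk2

end CurrentExchange

/-! ### Locally finite sums of operators -/

section LocFin

variable {ι M : Type} [AddCommGroup M] [Module ℂ M]

/-- Every vector is killed by all but finitely many members of the family. -/
def LocFin (T : ι → Module.End ℂ M) : Prop :=
  ∀ x : M, (Function.support fun i => T i x).Finite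

variable {S T : ι → Module.End ℂ M}

lemma LocFin.mul_right (hT : LocFin T) (A : Module.End ℂ M) : LocFin fun i => T i * A :=
  fun x => hT (A x)

lemma LocFin.mul_left (hT : LocFin T) (A : ι → Module.End ℂ M) : LocFin fun i => A i * T i :=
  fun x => (hT x).subset fun i hi h => hi ((congrArg (A i) h).trans (map_zero _))

lemma LocFin.add (hS : LocFin S) (hT : LocFin T) : LocFin fun i => S i + T i :=
  fun x => ((hS x).union (hT x)).subset fun i hi => by
    by_contra h
    rw [Set.mem_union, Function.mem_support, Function.mem_support, not_or, not_not, not_not] at h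
    exact hi (by
      change S i x + T i x = 0
      rw [h.1, h.2, add_zero])

lemma LocFin.locSum_mul (hT : LocFin T) (A : Module.End ℂ M) :
    locSum T * A = locSum fun i => T i * A := by
  refine LinearMap.ext fun x => ?_
  rw [locSum_apply (hT.mul_right A), Module.End.mul_apply, locSum_apply hT]
  rfl

lemma LocFin.mul_locSum (hT : LocFin T) (A : Module.End ℂ M) :
    A * locSum T = locSum fun i => A * T i := by
  refine LinearMap.ext fun x => ?_
  rw [locSum_apply (hT.mul_left fun _ => A), Module.End.mul_apply, locSum_apply hT]
  exact AddMonoidHom.map_finsum (A : M →+ M) (hT x)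

lemma LocFin.locSum_add (hS : LocFin S) (hT : LocFin T) :
    (locSum fun i => S i + T i) = locSum S + locSum T := by
  refine LinearMap.ext fun x => ?_
  rw [LinearMap.add_apply, locSum_apply (hS.add hT), locSum_apply hS, locSum_apply hT]
  exact finsum_add_distrib (hS x) (hT x)

lemma LocFin.smul (hT : LocFin T) (c : ℂ) : LocFin fun i => c • T i :=
  fun x => (hT x).subset fun _ hi h => hi ((congrArg (c • ·) h).trans (smul_zero c))

lemma LocFin.locSum_smul (hT : LocFin T) (c : ℂ) : (locSum fun i => c • T i) = c • locSum T := by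
  refine LinearMap.ext fun x => ?_
  rw [LinearMap.smul_apply, locSum_apply (hT.smul c), locSum_apply hT]
  exact (smul_finsum' c (hT x)).symm

lemma locFin_of_ne {i₀ : ι} (h : ∀ i, i ≠ i₀ → T i = 0) : LocFin T :=
  fun x => (Set.finite_singleton i₀).subset fun i hi => by
    by_contra hne
    exact hi (by
      change T i x = 0
      rw [h i hne]
      rfl)

lemma locSum_of_ne {i₀ : ι} (h : ∀ i, i ≠ i₀ → T i = 0) : locSum T = T i₀ := by
  refine LinearMap.ext fun x => ?_
  rw [locSum_apply (locFin_of_ne h)]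
  exact finsum_eq_single _ _ fun i hi => by rw [h i hi]; rfl

end LocFin

/-! ### Commutators of the modes -/

section Modes

variable {k : ℂ}

lemma int_cases (n : ℤ) : (∃ m : ℕ, n = -(m : ℤ) - 1) ∨ n = 0 ∨ ∃ m : ℕ, n = m + 1 := by
  rcases lt_trichotomy n 0 with h | h | h
  · exact Or.inl ⟨(-n - 1).toNat, by omega⟩
  · exact Or.inr (Or.inl h)
  · exact Or.inr (Or.inr ⟨(n - 1).toNat, by omega⟩)

lemma momentum_mul_mode (k : ℂ) (X Y : Boson) (n : ℤ) :
    momentum X * mode k Y n = mode k Y n * momentum X := by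
  refine op_ext fun p f => ?_
  obtain ⟨g, hg⟩ := mode_single k Y n p f
  rw [Module.End.mul_apply, Module.End.mul_apply, hg, momentum_single, momentum_single,
    ← Finsupp.smul_single, ← Finsupp.smul_single, map_smul, hg]

lemma pderiv_comm {σ : Type} [DecidableEq σ] (i j : σ) (f : MvPolynomial σ ℂ) :
    MvPolynomial.pderiv i (MvPolynomial.pderiv j f) =
      MvPolynomial.pderiv j (MvPolynomial.pderiv i f) := by
  have : ⁅MvPolynomial.pderiv (R := ℂ) i, MvPolynomial.pderiv (R := ℂ) j⁆ = 0 := by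
    refine MvPolynomial.derivation_ext fun m => ?_
    rw [Derivation.commutator_apply, MvPolynomial.pderiv_X, MvPolynomial.pderiv_X]
    simp [Pi.single_apply, apply_ite]
  have h := DFunLike.congr_fun this f
  rw [Derivation.commutator_apply, Derivation.zero_apply, sub_eq_zero] at h
  exact h

lemma derOp_comm (i j : Boson × ℕ) : derOp i * derOp j = derOp j * derOp i := by
  refine op_ext fun p f => ?_
  rw [Module.End.mul_apply, Module.End.mul_apply, derOp_single, derOp_single, derOp_single,
    derOp_single]
  rw [pderiv_comm]

/-- The modes form three commuting Heisenberg algebras. -/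
theorem mode_mul_mode (k : ℂ) (X Y : Boson) (a b : ℤ) :
    mode k X a * mode k Y b = mode k Y b * mode k X a +
      (if X = Y ∧ a + b = 0 then kappa k X * a else 0 : ℂ) • (1 : Op) := by
  rcases int_cases a with ⟨n, rfl⟩ | rfl | ⟨n, rfl⟩
  · rcases int_cases b with ⟨m, rfl⟩ | rfl | ⟨m, rfl⟩
    · rw [if_neg (by omega), zero_smul, add_zero, mode_neg_succ, mode_neg_succ, ← map_mul,
        ← map_mul, mul_comm]
    · rw [if_neg (by omega), zero_smul, add_zero, mode_zero, momentum_mul_mode]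
    · rw [mode_mul_mode_neg, add_assoc, ← add_smul]
      have : (if Y = X ∧ m = n then kappa k X * (n + 1) else 0 : ℂ) +
          (if X = Y ∧ -(n : ℤ) - 1 + (m + 1) = 0 then kappa k X * ((-(n : ℤ) - 1 : ℤ) : ℂ)
            else 0) = 0 := by
        by_cases h : Y = X ∧ m = n
        · rw [if_pos h, if_pos ⟨h.1.symm, by omega⟩]
          push_cast
          ring
        · rw [if_neg h, if_neg (fun h2 => h ⟨h2.1.symm, by omega⟩), add_zero]
      rw [this, zero_smul, add_zero]
  · rw [mode_zero, momentum_mul_mode, Int.cast_zero, mul_zero, ite_self, zero_smul, add_zero]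
  · rcases int_cases b with ⟨m, rfl⟩ | rfl | ⟨m, rfl⟩
    · rw [mode_mul_mode_neg]
      congr 2
      by_cases h : X = Y ∧ n = m
      · obtain ⟨rfl, rfl⟩ := h
        rw [if_pos ⟨rfl, rfl⟩, if_pos ⟨rfl, by omega⟩]
        push_cast
        ring
      · rw [if_neg h, if_neg (fun h2 => h ⟨h2.1, by omega⟩)]
    · rw [if_neg (by omega), zero_smul, add_zero, mode_zero, momentum_mul_mode]
    · rw [if_neg (by omega), zero_smul, add_zero, mode_succ, mode_succ, smul_mul_smul_comm,
        smul_mul_smul_comm, derOp_comm, mul_comm (kappa k X * _)]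

lemma locFin_mode (k : ℂ) (X : Boson) : LocFin fun n : ℕ => mode k X (n + 1) := by
  refine finite_support_of_single fun p f => ?_
  refine ((f.vars.image Prod.snd).finite_toSet).subset fun n hn => ?_
  by_contra h
  refine hn ?_
  change mode k X (n + 1) (Finsupp.single p f) = 0
  rw [mode_succ, LinearMap.smul_apply, derOp_single,
    MvPolynomial.pderiv_eq_zero_of_notMem_vars, Finsupp.single_zero, smul_zero]
  intro h2
  exact h (Finset.mem_coe.2 (Finset.mem_image.2 ⟨(X, n), h2, rfl⟩))

end Modes

/-! ### The translation operator -/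

section Translation

variable {k : ℂ}

lemma locFin_dBoson (k : ℂ) (X : Boson) :
    LocFin fun n : ℕ => mode k X (-(n + 1 : ℤ) - 1) * mode k X (n + 1 : ℤ) :=
  (locFin_mode k X).mul_left _

lemma dBoson_mul_mode_neg (k : ℂ) (X Y : Boson) (m : ℕ) :
    dBoson k X * mode k Y (-(m : ℤ) - 1) = mode k Y (-(m : ℤ) - 1) * dBoson k X +
      (if X = Y then kappa k X * (m + 1) else 0 : ℂ) • mode k X (-((m + 1 : ℕ) : ℤ) - 1) := by
  have h1 : ∀ n : ℕ, mode k X (-(n + 1 : ℤ) - 1) * mode k X (n + 1 : ℤ) * mode k Y (-(m : ℤ) - 1) =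
      mode k Y (-(m : ℤ) - 1) * (mode k X (-(n + 1 : ℤ) - 1) * mode k X (n + 1 : ℤ)) +
        (if X = Y ∧ n = m then kappa k Y * (m + 1) else 0 : ℂ) • mode k X (-(n + 1 : ℤ) - 1) := by
    intro n
    rw [mul_assoc, mode_mul_mode_neg, mul_add, ← mul_assoc, mode_mul_mode k X Y,
      if_neg (by omega), zero_smul, add_zero, mul_smul_comm, mul_one, mul_assoc]
  have h2 : ∀ n : ℕ, n ≠ m → (if X = Y ∧ n = m then kappa k Y * (m + 1) else 0 : ℂ) •
      mode k X (-(n + 1 : ℤ) - 1) = 0 := by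
    intro n hn
    rw [if_neg (fun h => hn h.2), zero_smul]
  rw [dBoson, add_mul, mul_add, (locFin_dBoson k X).locSum_mul, (locFin_dBoson k X).mul_locSum]
  simp only [h1]
  rw [((locFin_dBoson k X).mul_left _).locSum_add (locFin_of_ne h2), locSum_of_ne h2, mul_assoc,
    momentum_mul_mode, ← mul_assoc, mode_mul_mode k X Y, if_neg (by omega), zero_smul, add_zero,
    mul_assoc, add_assoc]
  congr 3
  by_cases h : X = Y
  · rw [if_pos ⟨h, rfl⟩, if_pos h, h]
  · rw [if_neg (fun h' => h h'.1), if_neg h]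

lemma mode_mul_dBoson (k : ℂ) (X Y : Boson) (m : ℕ) :
    mode k Y (m + 1) * dBoson k X = dBoson k X * mode k Y (m + 1) +
      (if X = Y then kappa k X * (m + 1) else 0 : ℂ) • mode k X m := by
  have h1 : ∀ n : ℕ, mode k Y (m + 1) * (mode k X (-(n + 1 : ℤ) - 1) * mode k X (n + 1 : ℤ)) =
      mode k X (-(n + 1 : ℤ) - 1) * mode k X (n + 1 : ℤ) * mode k Y (m + 1) +
        (if X = Y ∧ m = n + 1 then kappa k X * (m + 1) else 0 : ℂ) • mode k X (n + 1 : ℤ) := by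
    intro n
    rw [← mul_assoc, mode_mul_mode k Y X, add_mul, mul_assoc, mode_mul_mode k Y X,
      if_neg (by omega), zero_smul, add_zero, mul_assoc, smul_mul_assoc, one_mul]
    congr 2
    by_cases h : X = Y ∧ m = n + 1
    · rw [if_pos h, if_pos ⟨h.1.symm, by omega⟩, h.1]
      push_cast
      rfl
    · rw [if_neg h, if_neg (fun h2 => h ⟨h2.1.symm, by omega⟩)]
  have h2 : ∀ n : ℕ, n ≠ m - 1 → (if X = Y ∧ m = n + 1 then kappa k X * (m + 1) else 0 : ℂ) •
      mode k X (n + 1 : ℤ) = 0 := by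
    intro n hn
    rw [if_neg (fun h => hn (by omega)), zero_smul]
  rw [dBoson, add_mul, mul_add, (locFin_dBoson k X).locSum_mul, (locFin_dBoson k X).mul_locSum]
  simp only [h1]
  rw [((locFin_dBoson k X).mul_right _).locSum_add (locFin_of_ne h2), locSum_of_ne h2, ← mul_assoc,
    mode_mul_mode k Y X, add_mul, mul_assoc, ← momentum_mul_mode, ← mul_assoc, smul_mul_assoc,
    one_mul, add_add_add_comm, ← mode_zero k]
  congr 1
  rcases m with _ | m
  · rw [if_neg (c := X = Y ∧ 0 = 0 - 1 + 1) (by omega), zero_smul, add_zero]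
    congr 1
    by_cases h : X = Y
    · rw [if_pos h, if_pos ⟨h.symm, by omega⟩, h]
      push_cast
      ring
    · rw [if_neg h, if_neg (fun h2 => h h2.1.symm)]
  · rw [if_neg (by omega), zero_smul, zero_add, Nat.add_sub_cancel]
    by_cases h : X = Y
    · rw [if_pos h, if_pos ⟨h, rfl⟩]
      rfl
    · rw [if_neg h, if_neg (fun h2 => h h2.1), zero_smul, zero_smul]

/-- The coefficients `2/(k+2)`, `-2/k`, `2/k` of the translation operator are the `κ_X⁻¹`. -/
lemma dOp_eq (k : ℂ) : dOp k = (kappa k Boson.alpha)⁻¹ • dBoson k Boson.alpha +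
    (kappa k Boson.beta)⁻¹ • dBoson k Boson.beta +
      (kappa k Boson.gamma)⁻¹ • dBoson k Boson.gamma := by
  simp only [dOp, kappa, inv_div]
  rw [sub_eq_add_neg, ← neg_smul, div_neg]

lemma dOp_mul_mode_neg (hk : ∀ X, kappa k X ≠ 0) (Y : Boson) (m : ℕ) :
    dOp k * mode k Y (-(m : ℤ) - 1) = mode k Y (-(m : ℤ) - 1) * dOp k +
      (m + 1 : ℂ) • mode k Y (-((m + 1 : ℕ) : ℤ) - 1) := by
  have h := hk Y
  simp only [dOp_eq, add_mul _ _ (mode k Y _), mul_add (mode k Y _), smul_mul_assoc,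
    mul_smul_comm, dBoson_mul_mode_neg, smul_add, smul_smul]
  generalize (m : ℂ) + 1 = z
  cases Y <;> simp only [reduceCtorEq, if_true, if_false, mul_zero, zero_smul, add_zero] <;>
    rw [inv_mul_cancel_left₀ h] <;> abel

lemma mode_mul_dOp (hk : ∀ X, kappa k X ≠ 0) (Y : Boson) (m : ℕ) :
    mode k Y (m + 1) * dOp k = dOp k * mode k Y (m + 1) + (m + 1 : ℂ) • mode k Y m := by
  have h := hk Y
  simp only [dOp_eq, add_mul _ _ (mode k Y _), mul_add (mode k Y _), smul_mul_assoc,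
    mul_smul_comm, mode_mul_dBoson, smul_add, smul_smul]
  generalize (m : ℂ) + 1 = z
  cases Y <;> simp only [reduceCtorEq, if_true, if_false, mul_zero, zero_smul, add_zero] <;>
    rw [inv_mul_cancel_left₀ h] <;> abel

end Translation

/-! ### Translation covariance of vertex operators -/

section Deriv

variable {W : Type} [AddCommGroup W] [Module ℂ W]

/-- The derivative with respect to `u`. -/
def Dist.deriv : Dist ℂ W →+ Dist ℂ W :=
  Dist.orderwise
    { toFun := fun g i => (i + 1) • g (i + 1)
      map_zero' := funext fun _ => smul_zero _
      map_add' := fun _ _ => funext fun _ => smul_add _ _ _ }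

lemma Dist.deriv_apply (G : Dist ℂ W) (N : ℕ) (i : ℂ) :
    Dist.deriv G N i = (i + 1) • G N (i + 1) := rfl

/-- The multiplier `κ'` is the derivative of `κ` with respect to `u`, as far as distributions with
values in `W` are concerned. -/
def HasDeriv (W : Type) [AddCommGroup W] [Module ℂ W] (κ κ' : Mult ℂ ℂ) : Prop :=
  ∀ G : Dist ℂ W, Dist.deriv (κ • G) = κ' • G + κ • Dist.deriv G

lemma HasDeriv.add {κ κ' μ μ' : Mult ℂ ℂ} (h : HasDeriv W κ κ') (h' : HasDeriv W μ μ') :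
    HasDeriv W (κ + μ) (κ' + μ') := fun G => by
  rw [add_smul, map_add, h, h', add_smul, add_smul]
  abel

lemma HasDeriv.mul {κ κ' μ μ' : Mult ℂ ℂ} (h : HasDeriv W κ κ') (h' : HasDeriv W μ μ') :
    HasDeriv W (κ * μ) (κ' * μ + κ * μ') := fun G => by
  rw [mul_smul, h, h', smul_add, add_smul, mul_smul, mul_smul, mul_smul]
  abel

lemma hasDeriv_zero : HasDeriv W 0 0 := fun G => by simp

lemma hasDeriv_one : HasDeriv W 1 0 := fun G => by simp

lemma hasDeriv_cst (z : ℂ) : HasDeriv W (cst ℂ z) 0 := fun G => by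
  ext1 N i
  rw [Dist.deriv_apply, cst_smul_apply, zero_smul, zero_add, cst_smul_apply, Dist.deriv_apply,
    smul_comm]

lemma pw_smul_apply (x B : ℂ) (G : Dist ℂ W) (N : ℕ) (i : ℂ) :
    (pw ℂ (1 : ℂ) x B • G) N i =
      ∑ n ∈ antidiagonal N, (B ^ n.1 * Ring.choose x n.1) • G n.2 (i - x + n.1) := by
  rw [Dist.smul_apply, Finset.sum_apply]
  refine Finset.sum_congr rfl fun n _ => ?_
  rw [coeff_pw, conv_single, smul_eq_mul, mul_one, Algebra.algebraMap_self, RingHom.id_apply,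
    sub_sub_eq_add_sub, add_sub_right_comm]

lemma hasDeriv_pw (x B : ℂ) : HasDeriv W (pw ℂ (1 : ℂ) x B)
    (cst ℂ x * pw ℂ (1 : ℂ) (x - 1) B) := fun G => by
  ext1 N i
  rw [Dist.deriv_apply, Dist.add_apply, Pi.add_apply, mul_smul, cst_smul_apply, pw_smul_apply,
    pw_smul_apply, pw_smul_apply, Finset.smul_sum, Finset.smul_sum, ← Finset.sum_add_distrib]
  refine Finset.sum_congr rfl fun n _ => ?_
  rw [Dist.deriv_apply, show i - (x - 1) + (n.1 : ℂ) = i + 1 - x + n.1 by ring,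
    show i - x + (n.1 : ℂ) + 1 = i + 1 - x + n.1 by ring, smul_smul, smul_smul, smul_smul,
    ← add_smul]
  congr 1
  have h := (succ_mul_choose_succ x n.1).symm.trans (succ_mul_choose_succ' x n.1)
  linear_combination B ^ n.1 * h

lemma hasDeriv_pwSum (k : ℂ) (L : List Term) (X : Boson) (x : ℂ) :
    HasDeriv W (pwSum ℂ (1 : ℂ) k L X x) (cst ℂ x * pwSum ℂ (1 : ℂ) k L X (x - 1)) := by
  rw [pwSum, pwSum]
  induction L with
  | nil =>
    rw [List.map_nil, List.map_nil, List.sum_nil, mul_zero]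
    exact hasDeriv_zero
  | cons t L ih =>
    rw [List.map_cons, List.map_cons, List.sum_cons, List.sum_cons, mul_add]
    refine HasDeriv.add ?_ ih
    split_ifs
    · rw [algebraMap_eq_cst]
      have h := (hasDeriv_cst (W := W) (t.1 * kappa k X)).mul (hasDeriv_pw x t.2.2)
      rw [zero_mul, zero_add, mul_left_comm] at h
      exact h
    · rw [mul_zero]
      exact hasDeriv_zero

/-- The logarithmic derivative of `∏ (u + Bħ)^{c p_X}`. -/
def logDeriv (L : List Term) (p : Boson → ℂ) : Mult ℂ ℂ :=
  (L.map fun t => cst ℂ (t.1 * p t.2.1) * pw ℂ (1 : ℂ) (-1) t.2.2).sum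

lemma hasDeriv_pref (L : List Term) (p : Boson → ℂ) :
    HasDeriv W (pref ℂ (1 : ℂ) L p) (logDeriv L p * pref ℂ (1 : ℂ) L p) := by
  rw [logDeriv]
  induction L with
  | nil =>
    rw [List.map_nil, List.sum_nil, zero_mul, pref_nil]
    exact hasDeriv_one
  | cons t L ih =>
    rw [List.map_cons, List.sum_cons, pref_cons]
    have h := (hasDeriv_pw (W := W) (t.1 * p t.2.1) t.2.2).mul ih
    rw [sub_eq_neg_add, pw_add] at h
    convert h using 1
    ring

/-- The logarithmic derivative of the vacuum matrix coefficients equals the contribution of the term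
`X_{-1} P_X` of the translation operator, since `d = ∑_X κ_X⁻¹ d_X`. -/
lemma logDeriv_eq {k : ℂ} (hk : ∀ X, kappa k X ≠ 0) (L : List Term) (p : Boson → ℂ) :
    cst ℂ ((kappa k Boson.alpha)⁻¹ * p Boson.alpha) * pwSum ℂ (1 : ℂ) k L Boson.alpha (-1) +
      cst ℂ ((kappa k Boson.beta)⁻¹ * p Boson.beta) * pwSum ℂ (1 : ℂ) k L Boson.beta (-1) +
      cst ℂ ((kappa k Boson.gamma)⁻¹ * p Boson.gamma) * pwSum ℂ (1 : ℂ) k L Boson.gamma (-1) =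
      logDeriv L p := by
  have hc : ∀ (X : Boson) (c B : ℂ), cst ℂ ((kappa k X)⁻¹ * p X) *
      (cst ℂ (c * kappa k X) * pw ℂ (1 : ℂ) (-1) B) = cst ℂ (c * p X) * pw ℂ (1 : ℂ) (-1) B := by
    intro X c B
    rw [← mul_assoc, ← map_mul, AddMonoidAlgebra.single_mul_single, add_zero,
      show (kappa k X)⁻¹ * p X * (c * kappa k X) = c * p X * ((kappa k X)⁻¹ * kappa k X) by ring,
      inv_mul_cancel₀ (hk X), mul_one]
  rw [pwSum, pwSum, pwSum, logDeriv]
  induction L with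
  | nil => simp
  | cons t L ih =>
    obtain ⟨c, X, B⟩ := t
    simp only [List.map_cons, List.sum_cons]
    rw [← ih, mul_add, mul_add, mul_add]
    simp only [algebraMap_eq_cst]
    cases X <;> simp only [reduceCtorEq, if_true, if_false, mul_zero, zero_add] <;>
      rw [hc] <;> ring

end Deriv

section FieldTranslation

variable {k : ℂ}

lemma Dist.deriv_lmul (T : Op) (G : Dist ℂ Op) :
    Dist.deriv (Dist.lmul T G) = Dist.lmul T (Dist.deriv G) := by
  ext1 N i
  rw [Dist.deriv_apply, Dist.lmul_apply, Dist.lmul_apply, Dist.deriv_apply, mul_smul_comm]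

lemma Dist.deriv_rmul (T : Op) (G : Dist ℂ Op) :
    Dist.deriv (Dist.rmul T G) = Dist.rmul T (Dist.deriv G) := by
  ext1 N i
  rw [Dist.deriv_apply, Dist.rmul_apply, Dist.rmul_apply, Dist.deriv_apply, smul_mul_assoc]

lemma Dist.deriv_post (φ : Op →ₗ[ℂ] ℂ) (G : Dist ℂ Op) :
    Dist.deriv (Dist.post φ G) = Dist.post φ (Dist.deriv G) := by
  ext1 N i
  rw [Dist.deriv_apply, Dist.post_apply, Dist.post_apply, Dist.deriv_apply, map_smul]

lemma Dist.lmul_add_smul_op (S T : Op) (z : ℂ) (G : Dist ℂ Op) :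
    Dist.lmul (S + z • T) G = Dist.lmul S G + cst ℂ z • Dist.lmul T G := by
  ext1 N x
  rw [Dist.add_apply, Pi.add_apply, cst_smul_apply, Dist.lmul_apply, Dist.lmul_apply,
    Dist.lmul_apply, add_mul, smul_mul_assoc]

lemma Dist.rmul_add_smul_op (S T : Op) (z : ℂ) (G : Dist ℂ Op) :
    Dist.rmul (S + z • T) G = Dist.rmul S G + cst ℂ z • Dist.rmul T G := by
  ext1 N x
  rw [Dist.add_apply, Pi.add_apply, cst_smul_apply, Dist.rmul_apply, Dist.rmul_apply,
    Dist.rmul_apply, mul_add, mul_smul_comm]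

lemma momentum_mul_ord (k : ℂ) {d : VertexData} (hd : d.Neutral) (X : Boson) (N : ℕ) (i : ℂ) :
    momentum X * d.ord k N i = d.ord k N i * momentum X + (kappa k X * d.r X) • d.ord k N i := by
  refine op_ext fun p f => ?_
  obtain ⟨g, hg⟩ := field_single_eq k hd N i p f
  rw [← VertexData.ord] at hg
  rw [LinearMap.add_apply, LinearMap.smul_apply, Module.End.mul_apply, Module.End.mul_apply,
    momentum_single, ← Finsupp.smul_single, map_smul, hg, momentum_single, Finsupp.smul_single,
    Finsupp.smul_single, ← Finsupp.single_add, ← add_smul]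
  rfl

lemma pwSum_zero (k : ℂ) (L : List Term) (X : Boson) :
    pwSum ℂ (1 : ℂ) k L X 0 = cst ℂ (kappa k X * charge L X) := by
  rw [pwSum, charge]
  induction L with
  | nil =>
    rw [List.map_nil, List.map_nil, List.sum_nil, List.sum_nil, mul_zero, cst,
      AddMonoidAlgebra.single_zero, map_zero]
  | cons t L ih =>
    rw [List.map_cons, List.map_cons, List.sum_cons, List.sum_cons, ih, mul_add, cst, cst,
      AddMonoidAlgebra.single_add, map_add]
    congr 1
    split_ifs
    · rw [pw_zero, mul_one, algebraMap_eq_cst, mul_comm]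
    · simp

/-- The commutator of a vertex operator with the modes `X_n`, `n ≥ 0`. -/
lemma field_mode (k : ℂ) {d : VertexData} (hd : d.Neutral) (X : Boson) (n : ℕ) :
    Dist.lmul (mode k X n) (toDist (d.field k)) = Dist.rmul (mode k X n) (toDist (d.field k)) +
      pwSum ℂ (1 : ℂ) k d.lc X n • toDist (d.field k) := by
  rcases n with _ | n
  · rw [Nat.cast_zero, Nat.cast_zero, pwSum_zero, hd.lc]
    ext1 N i
    rw [Dist.add_apply, Pi.add_apply, cst_smul_apply, Dist.lmul_apply, Dist.rmul_apply, mode_zero]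
    exact momentum_mul_ord k hd X N i
  · have := (field_covariant k hd).annihilation X n
    push_cast
    exact this

/-- The commutator with the translation operator minus the derivative. -/
def transDefect (k : ℂ) (G : Dist ℂ Op) : Dist ℂ Op :=
  Dist.lmul (dOp k) G - Dist.rmul (dOp k) G - Dist.deriv G

lemma transDefect_covariant (hk : ∀ X, kappa k X ≠ 0) {d : VertexData} (hd : d.Neutral) :
    Covariant k (fun X n => -pwSum ℂ (1 : ℂ) k d.la X (-(n + 1 : ℂ)))
      (fun X n => pwSum ℂ (1 : ℂ) k d.lc X (n + 1))
        (transDefect k (toDist (d.field k))) where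
  creation X n := by
    have h := (field_covariant k hd).creation X n
    have h' := (field_covariant k hd).creation X (n + 1)
    have hD : HasDeriv Op (-pwSum ℂ (1 : ℂ) k d.la X (-(n + 1 : ℂ)))
        (-(cst ℂ (n + 1) * -pwSum ℂ (1 : ℂ) k d.la X (-((n + 1 : ℕ) + 1 : ℂ)))) := by
      have := (hasDeriv_cst (W := Op) (-1)).mul (hasDeriv_pwSum k d.la X (-(n + 1 : ℂ)))
      have h1 : cst ℂ (-1) = -1 := by
        rw [cst, AddMonoidAlgebra.single_neg, map_neg]
        rfl
      have h2 : cst ℂ (-(n + 1 : ℂ)) = -cst ℂ (n + 1) := by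
        rw [cst, AddMonoidAlgebra.single_neg, map_neg]
      rw [zero_mul, zero_add, h1, h2, neg_one_mul, neg_one_mul, neg_mul, neg_neg] at this
      rw [mul_neg, neg_neg, show (-((n + 1 : ℕ) + 1 : ℂ)) = -(n + 1 : ℂ) - 1 by push_cast; ring]
      exact this
    have hd1 := dOp_mul_mode_neg hk X n
    rw [transDefect]
    generalize toDist (d.field k) = V at *
    generalize -pwSum ℂ (1 : ℂ) k d.la X (-(n + 1 : ℂ)) = c at *
    generalize -pwSum ℂ (1 : ℂ) k d.la X (-((n + 1 : ℕ) + 1 : ℂ)) = c' at *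
    rw [map_sub, map_sub, map_sub, map_sub, Dist.rmul_lmul, h, Dist.rmul_rmul, hd1,
      Dist.rmul_add_smul_op, ← Dist.rmul_rmul, h, h', ← Dist.deriv_rmul, h, map_add, map_add,
      map_add, hD, Dist.lmul_lmul, hd1, Dist.lmul_add_smul_op, ← Dist.lmul_lmul, map_smul, map_smul,
      Dist.rmul_lmul, Dist.deriv_lmul, smul_add, smul_sub, smul_sub, neg_smul, mul_smul]
    abel
  annihilation X n := by
    have h := (field_covariant k hd).annihilation X n
    have h' := field_mode k hd X n
    have hD := hasDeriv_pwSum (W := Op) k d.lc X (n + 1)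
    rw [add_sub_cancel_right] at hD
    have hd1 := mode_mul_dOp hk X n
    rw [transDefect]
    generalize toDist (d.field k) = V at *
    generalize pwSum ℂ (1 : ℂ) k d.lc X (n + 1) = b at *
    generalize pwSum ℂ (1 : ℂ) k d.lc X n = b' at *
    rw [map_sub, map_sub, map_sub, map_sub, Dist.lmul_lmul, hd1, Dist.lmul_add_smul_op,
      ← Dist.lmul_lmul, h, h', ← Dist.rmul_lmul _ _ V, h, ← Dist.deriv_lmul, h, map_add, map_add,
      map_add, hD, Dist.rmul_rmul, hd1, Dist.rmul_add_smul_op, ← Dist.rmul_rmul, map_smul, map_smul,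
      Dist.rmul_lmul, Dist.deriv_rmul, smul_add, smul_sub, smul_sub, mul_smul]
    abel

lemma vev_mode_neg_mul (p q : Boson → ℂ) (X : Boson) (n : ℕ) (T : Op) :
    vev p q (mode k X (-(n : ℤ) - 1) * T) = 0 := by
  have h : ∀ x : Fk, MvPolynomial.constantCoeff (mulOp (MvPolynomial.X (X, n)) x q) = 0 := by
    intro x
    change MvPolynomial.constantCoeff (MvPolynomial.X (X, n) * x q) = 0
    rw [map_mul, MvPolynomial.constantCoeff_X, zero_mul]
  rw [vev_apply, mode_neg_succ, Module.End.mul_apply, h]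

lemma vev_dBoson_mul (p q : Boson → ℂ) (X : Boson) (T : Op) : vev p q (dBoson k X * T) = 0 := by
  rw [dBoson, add_mul, map_add, mul_assoc, show (-1 : ℤ) = -((0 : ℕ) : ℤ) - 1 by simp,
    vev_mode_neg_mul, zero_add, (locFin_dBoson k X).locSum_mul, vev_apply,
    locSum_apply ((locFin_dBoson k X).mul_right T)]
  have h : ∀ (x : Fk), (MvPolynomial.constantCoeff (x q) : ℂ) =
      ((MvPolynomial.constantCoeff (R := ℂ) (σ := Boson × ℕ)).toAddMonoidHom.comp
        (Finsupp.applyAddHom q)) x := fun x => rfl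
  rw [h, AddMonoidHom.map_finsum _ ((locFin_dBoson k X).mul_right T _)]
  refine finsum_eq_zero_of_forall_eq_zero fun n => ?_
  have := vev_mode_neg_mul (k := k) p q X (n + 1) (mode k X (n + 1) * T)
  rw [vev_apply, h, ← mul_assoc] at this
  push_cast at this
  exact this

lemma dBoson_vac (p : Boson → ℂ) (X : Boson) : dBoson k X (Finsupp.single p 1) =
    p X • mode k X (-((0 : ℕ) : ℤ) - 1) (Finsupp.single p 1) := by
  rw [dBoson, LinearMap.add_apply, locSum_apply (locFin_dBoson k X),
    finsum_eq_zero_of_forall_eq_zero, add_zero, Module.End.mul_apply, momentum_single,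
    ← Finsupp.smul_single, map_smul]
  · rfl
  · intro n
    rw [Module.End.mul_apply, mode_succ, LinearMap.smul_apply, derOp_single,
      MvPolynomial.pderiv_one, Finsupp.single_zero, smul_zero, map_zero]

lemma post_vev_rmul_mode (k : ℂ) {d : VertexData} (hd : d.Neutral) (p q : Boson → ℂ) (X : Boson) :
    Dist.post (vev p q) (Dist.rmul (mode k X (-((0 : ℕ) : ℤ) - 1)) (toDist (d.field k))) =
      (-pwSum ℂ (1 : ℂ) k d.la X (-1)) • Dist.post (vev p q) (toDist (d.field k)) := by
  rw [field_creation k hd, map_add, map_smul, show (-(((0 : ℕ) : ℂ) + 1)) = -1 by simp]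
  refine add_eq_right.2 ?_
  ext1 N i
  exact vev_mode_neg_mul (k := k) p q X 0 _

lemma post_vev_transDefect (hk : ∀ X, kappa k X ≠ 0) {d : VertexData} (hd : d.Neutral)
    (p q : Boson → ℂ) : Dist.post (vev p q) (transDefect k (toDist (d.field k))) = 0 := by
  have h1 : Dist.post (vev p q) (Dist.lmul (dOp k) (toDist (d.field k))) = 0 := by
    ext1 N i
    rw [Dist.post_apply, Dist.lmul_apply, dOp_eq, add_mul, add_mul, map_add, map_add,
      smul_mul_assoc, smul_mul_assoc, smul_mul_assoc, map_smul, map_smul, map_smul, vev_dBoson_mul,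
      vev_dBoson_mul, vev_dBoson_mul]
    simp
  have h2 : ∀ X, Dist.post (vev p q) (Dist.rmul (dBoson k X) (toDist (d.field k))) =
      cst ℂ (p X) • (-pwSum ℂ (1 : ℂ) k d.la X (-1)) •
        Dist.post (vev p q) (toDist (d.field k)) := by
    intro X
    rw [← post_vev_rmul_mode k hd]
    ext1 N i
    rw [cst_smul_apply, Dist.post_apply, Dist.post_apply, Dist.rmul_apply, Dist.rmul_apply,
      vev_apply, vev_apply, Module.End.mul_apply, Module.End.mul_apply, dBoson_vac, map_smul,
      Finsupp.smul_apply, MvPolynomial.constantCoeff_smul]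
  have h3 : Dist.post (vev p q) (Dist.rmul (dOp k) (toDist (d.field k))) =
      -(logDeriv d.la p • Dist.post (vev p q) (toDist (d.field k))) := by
    have hr : Dist.rmul (dOp k) (toDist (d.field k)) =
        cst ℂ (kappa k Boson.alpha)⁻¹ • Dist.rmul (dBoson k Boson.alpha) (toDist (d.field k)) +
        cst ℂ (kappa k Boson.beta)⁻¹ • Dist.rmul (dBoson k Boson.beta) (toDist (d.field k)) +
        cst ℂ (kappa k Boson.gamma)⁻¹ • Dist.rmul (dBoson k Boson.gamma) (toDist (d.field k)) := by
      ext1 N i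
      simp only [Dist.add_apply, Pi.add_apply, cst_smul_apply, Dist.rmul_apply, dOp_eq, mul_add,
        mul_smul_comm]
    have hc : ∀ X, cst ℂ (kappa k X)⁻¹ * cst ℂ (p X) = cst ℂ ((kappa k X)⁻¹ * p X) := by
      intro X
      rw [← map_mul, AddMonoidAlgebra.single_mul_single, add_zero]
    rw [hr, map_add, map_add, map_smul, map_smul, map_smul, h2, h2, h2, ← logDeriv_eq hk, add_smul,
      add_smul, ← hc, ← hc, ← hc]
    simp only [neg_smul, smul_neg, mul_smul]
    abel
  rw [transDefect, map_sub, map_sub, h1, h3, ← Dist.deriv_post, zero_sub, neg_neg, sub_eq_zero]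
  by_cases hq : q = d.shift k p
  · rw [hq, post_vev_field k hd, hasDeriv_pref, mul_smul]
    have h4 : Dist.deriv (ofSer (1 : MvPowerSeries (Fin 2) ℂ)) = 0 := by
      ext1 N i
      rw [Dist.deriv_apply, ← one_smul (Mult ℂ ℂ) (ofSer (1 : MvPowerSeries (Fin 2) ℂ)),
        smul_ofSer_one, PowerSeries.coeff_one]
      by_cases hN : N = 0
      · rw [if_pos hN, AddMonoidAlgebra.one_def, AddMonoidAlgebra.coeff_single]
        by_cases hi : i + 1 = 0
        · rw [hi, zero_smul]
          rfl
        · rw [Finsupp.single_eq_of_ne hi, smul_zero]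
          rfl
      · rw [if_neg hN]
        exact smul_zero _
    rw [h4, smul_zero, add_zero]
  · rw [post_vev_field_of_ne k hd p q hq, smul_zero, map_zero]

/-- Vertex operators are translation covariant. -/
theorem translation_field (hk : ∀ X, kappa k X ≠ 0) {d : VertexData} (hd : d.Neutral) (N : ℕ)
    (i : ℂ) : dOp k * d.ord k N i - d.ord k N i * dOp k = (i + 1) • d.ord k N (i + 1) := by
  refine sub_eq_zero.1 (op_ext fun p f => ?_)
  exact (transDefect_covariant hk hd).eq_zero hk p
    (fun q => post_vev_transDefect hk hd p q) N i f

variable {V : Submodule ℂ Fk}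

lemma commutator_neg_sub {R : Type} [Ring R] (a b c : R) :
    a * -(b - c) - -(b - c) * a = -(a * b - b * a - (a * c - c * a)) := by
  noncomm_ring

lemma translation_currentE (hk0 : k ≠ 0) (hk2 : k ≠ -2) :
    TranslationOn V (dOp k) (currentE k) := fun i N x _ => by
  have h₁ := translation_field (kappa_ne_zero hk0 hk2) (neutral_E₁ k) (N + 1) i
  have h₂ := translation_field (kappa_ne_zero hk0 hk2) (neutral_E₂ k) (N + 1) i
  rw [← LinearMap.smul_apply]
  refine congrArg (fun T : Op => T x) ?_
  rw [coeff_currentE, coeff_currentE, smul_neg, smul_sub, ← h₁, ← h₂]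
  exact commutator_neg_sub _ _ _

lemma translation_currentF (hk0 : k ≠ 0) (hk2 : k ≠ -2) :
    TranslationOn V (dOp k) (currentF k) := fun i N x _ => by
  have h₁ := translation_field (kappa_ne_zero hk0 hk2) (neutral_F₁ k) (N + 1) i
  have h₂ := translation_field (kappa_ne_zero hk0 hk2) (neutral_F₂ k) (N + 1) i
  rw [← LinearMap.smul_apply]
  refine congrArg (fun T : Op => T x) ?_
  rw [coeff_currentF, coeff_currentF, smul_sub, ← h₁, ← h₂, mul_sub, sub_mul]
  abel

lemma translation_hPlus (hk0 : k ≠ 0) (hk2 : k ≠ -2) :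
    TranslationOn V (dOp k) (hPlus k) := fun i N x _ => by
  rw [← LinearMap.smul_apply, coeff_hPlus, coeff_hPlus]
  exact congrArg (fun T : Op => T x)
    (translation_field (kappa_ne_zero hk0 hk2) (neutral_HP k) N i)

lemma translation_hMinus (hk0 : k ≠ 0) (hk2 : k ≠ -2) :
    TranslationOn V (dOp k) (hMinus k) := fun i N x _ => by
  rw [← LinearMap.smul_apply, coeff_hMinus, coeff_hMinus]
  exact congrArg (fun T : Op => T x)
    (translation_field (kappa_ne_zero hk0 hk2) (neutral_HM k) N i)

end FieldTranslation

/-! ### The delta function -/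

section Delta

variable {W : Type} [AddCommGroup W] [Module ℂ W]

open Classical in
/-- The indicator function of the exponents of `v` in `δ(u - (v + rħ))`, at order `ħ⁰` and up to
integers. -/
def deltaSupp (lam j : ℂ) : ℂ := if ∃ n : ℤ, -j - 1 = lam + n then 1 else 0

open Classical in
lemma deltaSupp_congr {lam lam' j j' : ℂ} (m : ℤ) (h : lam' + j' = lam + j + m) :
    deltaSupp lam' j' = deltaSupp lam j :=
  if_congr ⟨fun ⟨n, hn⟩ => ⟨n + m, by push_cast; linear_combination hn + h⟩,
    fun ⟨n, hn⟩ => ⟨n - m, by push_cast; linear_combination hn - h⟩⟩ rfl rfl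

/-- The product `δ(u - (v + rħ)) G(u)`, the exponents of `v` in `-lam + ℤ`. -/
def deltaU (lam r : ℂ) : Dist ℂ W →+ Dist (ℂ × ℂ) W :=
  AddMonoidHom.mk' (fun G N x => ∑ n ∈ antidiagonal N,
    (deltaSupp lam x.2 * (Ring.choose (x.2 + n.1) n.1 * r ^ n.1)) •
      G n.2 (x.1 + x.2 + 1 + n.1)) fun G H => by
    ext1 N x
    change ∑ n ∈ antidiagonal N, (deltaSupp lam x.2 * (Ring.choose (x.2 + n.1) n.1 * r ^ n.1)) •
      (G n.2 (x.1 + x.2 + 1 + n.1) + H n.2 (x.1 + x.2 + 1 + n.1)) = _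
    simp only [smul_add, Finset.sum_add_distrib]
    rfl

lemma deltaU_apply (lam r : ℂ) (G : Dist ℂ W) (N : ℕ) (x : ℂ × ℂ) :
    deltaU lam r G N x = ∑ n ∈ antidiagonal N,
      (deltaSupp lam x.2 * (Ring.choose (x.2 + n.1) n.1 * r ^ n.1)) •
        G n.2 (x.1 + x.2 + 1 + n.1) := rfl

lemma deltaU_add_int (lam r : ℂ) (m : ℤ) (G : Dist ℂ W) : deltaU (lam + m) r G = deltaU lam r G := by
  ext1 N x
  rw [deltaU_apply, deltaU_apply, deltaSupp_congr (lam := lam) (j := x.2) m (by ring)]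

lemma post_deltaU {W' : Type} [AddCommGroup W'] [Module ℂ W'] (φ : W →ₗ[ℂ] W') (lam r : ℂ)
    (G : Dist ℂ W) : Dist.post φ (deltaU lam r G) = deltaU lam r (Dist.post φ G) := by
  ext1 N x
  rw [Dist.post_apply, deltaU_apply, deltaU_apply, map_sum]
  exact Finset.sum_congr rfl fun n _ => map_smul φ _ _

lemma deltaU_smul (lam r : ℂ) (κ : Mult ℂ ℂ) (G : Dist ℂ W) :
    deltaU lam r (κ • G) = inU κ • deltaU lam r G := by
  have key : ∀ (a : AddMonoidAlgebra ℂ ℂ) (m : ℕ) (x : ℂ × ℂ),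
      conv ℂ (AddMonoidAlgebra.mapDomainRingHom ℂ (AddMonoidHom.inl ℂ ℂ) a)
        (deltaU lam r G m) x = ∑ n ∈ antidiagonal m,
      (deltaSupp lam x.2 * (Ring.choose (x.2 + n.1) n.1 * r ^ n.1)) •
        conv ℂ a (G n.2) (x.1 + x.2 + 1 + n.1) := by
    intro a m x
    induction a using AddMonoidAlgebra.induction_linear with
    | zero => simp
    | add a b ha hb =>
      rw [map_add, map_add, LinearMap.add_apply, Pi.add_apply, ha, hb, ← Finset.sum_add_distrib]
      simp only [map_add, LinearMap.add_apply, Pi.add_apply, smul_add]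
    | single s z =>
      rw [AddMonoidAlgebra.mapDomainRingHom_apply, AddMonoidAlgebra.mapDomain_single, conv_single,
        deltaU_apply, AddMonoidHom.inl_apply, Prod.snd_sub, Prod.fst_sub, sub_zero,
        Finset.smul_sum]
      refine Finset.sum_congr rfl fun n _ => ?_
      rw [conv_single, smul_comm, show x.1 - s + x.2 + 1 + (n.1 : ℂ) =
        x.1 + x.2 + 1 + n.1 - s by ring]
  ext1 N x
  rw [Dist.smul_apply, Finset.sum_apply, deltaU_apply]
  simp only [mapVar, PowerSeries.coeff_map, key]
  simp only [Dist.smul_apply, Finset.sum_apply, Finset.smul_sum]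
  rw [← sum_antidiagonal_assoc (fun a b c =>
      (deltaSupp lam x.2 * (Ring.choose (x.2 + a) a * r ^ a)) •
      conv ℂ (PowerSeries.coeff b κ) (G c) (x.1 + x.2 + 1 + a)),
    ← sum_antidiagonal_assoc (fun a b c =>
      (deltaSupp lam x.2 * (Ring.choose (x.2 + b) b * r ^ b)) •
      conv ℂ (PowerSeries.coeff a κ) (G c) (x.1 + x.2 + 1 + b))]
  refine Finset.sum_congr rfl fun n _ => ?_
  rw [← Finset.Nat.sum_antidiagonal_swap]
  rfl

/-- The coefficients of the identity `(v + Bħ)^x δ(u - (v + rħ)) = (u + (B - r)ħ)^x δ(u - (v + rħ))`,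
which follow from the Chu–Vandermonde identity. -/
lemma sum_choose_shift (x j B r : ℂ) (M : ℕ) :
    ∑ n ∈ antidiagonal M, B ^ n.1 * Ring.choose x n.1 *
      (Ring.choose (j - x + n.1 + n.2) n.2 * r ^ n.2) =
    ∑ n ∈ antidiagonal M, (B - r) ^ n.1 * Ring.choose x n.1 *
      (Ring.choose (j + n.2) n.2 * r ^ n.2) := by
  have h1 : ∀ n ∈ antidiagonal M, B ^ n.1 * Ring.choose x n.1 *
      (Ring.choose (j - x + n.1 + n.2) n.2 * r ^ n.2) =
      ∑ m ∈ antidiagonal n.1, (B - r) ^ m.1 * Ring.choose x m.1 *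
        (r ^ m.2 * Ring.choose (x - m.1) m.2 * (Ring.choose (j - x + M) n.2 * r ^ n.2)) := by
    intro n hn
    rw [mem_antidiagonal] at hn
    have hB : B ^ n.1 = ∑ m ∈ antidiagonal n.1, (B - r) ^ m.1 * r ^ m.2 * (n.1.choose m.1 : ℂ) := by
      conv_lhs => rw [← sub_add_cancel B r]
      rw [add_pow, Finset.Nat.sum_antidiagonal_eq_sum_range_succ_mk]
    rw [hB, add_assoc, ← Nat.cast_add, hn, Finset.sum_mul, Finset.sum_mul]
    refine Finset.sum_congr rfl fun m hm => ?_
    rw [mem_antidiagonal] at hm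
    have hc := Ring.choose_smul_choose x (show m.1 ≤ n.1 by omega)
    rw [nsmul_eq_mul, show n.1 - m.1 = m.2 by omega] at hc
    linear_combination (B - r) ^ m.1 * r ^ m.2 * (Ring.choose (j - x + M) n.2 * r ^ n.2) * hc
  rw [Finset.sum_congr rfl h1, sum_antidiagonal_assoc (fun a b c => (B - r) ^ a * Ring.choose x a *
        (r ^ b * Ring.choose (x - a) b * (Ring.choose (j - x + M) c * r ^ c)))]
  refine Finset.sum_congr rfl fun n hn => ?_
  rw [mem_antidiagonal] at hn
  rw [← Finset.mul_sum]
  congr 1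
  have hM : (M : ℂ) = n.1 + n.2 := by rw [← hn, Nat.cast_add]
  rw [show j + n.2 = (x - n.1) + (j - x + M) by rw [hM]; ring,
    Ring.add_choose_eq _ (Commute.all _ _), Finset.sum_mul]
  refine Finset.sum_congr rfl fun m hm => ?_
  rw [mem_antidiagonal] at hm
  rw [← hm, pow_add]
  ring

lemma inU_pw_smul_apply (x B : ℂ) (G : Dist (ℂ × ℂ) W) (N : ℕ) (y : ℂ × ℂ) :
    (inU (pw ℂ (1 : ℂ) x B) • G) N y =
      ∑ n ∈ antidiagonal N, (B ^ n.1 * Ring.choose x n.1) • G n.2 (y.1 - x + n.1, y.2) := by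
  rw [inU_pw, Dist.smul_apply, Finset.sum_apply]
  refine Finset.sum_congr rfl fun n _ => ?_
  rw [coeff_pw, conv_single, Algebra.algebraMap_self, RingHom.id_apply]
  congr 2
  ext
  · simp [sub_sub_eq_add_sub, add_sub_right_comm]
  · simp

lemma inV_pw_smul_apply (x B : ℂ) (G : Dist (ℂ × ℂ) W) (N : ℕ) (y : ℂ × ℂ) :
    (inV (pw ℂ (1 : ℂ) x B) • G) N y =
      ∑ n ∈ antidiagonal N, (B ^ n.1 * Ring.choose x n.1) • G n.2 (y.1, y.2 - x + n.1) := by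
  rw [inV_pw, Dist.smul_apply, Finset.sum_apply]
  refine Finset.sum_congr rfl fun n _ => ?_
  rw [coeff_pw, conv_single, Algebra.algebraMap_self, RingHom.id_apply]
  congr 2
  ext
  · simp
  · simp [sub_sub_eq_add_sub, add_sub_right_comm]

/-- On the support of the delta function `v + Bħ` equals `u + (B - r)ħ`. -/
theorem inV_pw_smul_deltaU (lam r x B : ℂ) (G : Dist ℂ W) :
    inV (pw ℂ (1 : ℂ) x B) • deltaU lam r G =
      inU (pw ℂ (1 : ℂ) x (B - r)) • deltaU (lam - x) r G := by
  ext1 N y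
  rw [inU_pw_smul_apply, inV_pw_smul_apply]
  have hc : ∀ n : ℕ, deltaSupp lam (y.2 - x + n) = deltaSupp (lam - x) y.2 := fun n =>
    deltaSupp_congr n (by push_cast; ring)
  simp only [deltaU_apply, hc, Finset.smul_sum, smul_smul]
  rw [← sum_antidiagonal_assoc (fun a b c => (B ^ a * Ring.choose x a * (deltaSupp (lam - x) y.2 *
        (Ring.choose (y.2 - x + a + b) b * r ^ b))) • G c (y.1 + (y.2 - x + a) + 1 + b)),
      ← sum_antidiagonal_assoc (fun a b c => ((B - r) ^ a * Ring.choose x a *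
        (deltaSupp (lam - x) y.2 * (Ring.choose (y.2 + b) b * r ^ b))) •
          G c (y.1 - x + a + y.2 + 1 + b))]
  refine Finset.sum_congr rfl fun n _ => ?_
  have h1 : ∀ m ∈ antidiagonal n.1, y.1 + (y.2 - x + (m.1 : ℂ)) + 1 + m.2 =
      y.1 + y.2 - x + 1 + n.1 := by
    intro m hm
    rw [mem_antidiagonal] at hm
    rw [← hm]
    push_cast
    ring
  have h2 : ∀ m ∈ antidiagonal n.1, y.1 - x + (m.1 : ℂ) + y.2 + 1 + m.2 =
      y.1 + y.2 - x + 1 + n.1 := by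
    intro m hm
    rw [mem_antidiagonal] at hm
    rw [← hm]
    push_cast
    ring
  have h3 : ∀ (c z : ℕ × ℕ → ℂ) (z₀ : ℂ), (∀ m ∈ antidiagonal n.1, z m = z₀) →
      ∑ m ∈ antidiagonal n.1, c m • G n.2 (z m) = (∑ m ∈ antidiagonal n.1, c m) • G n.2 z₀ :=
    fun c z z₀ h => by
      rw [Finset.sum_smul]
      exact Finset.sum_congr rfl fun m hm => by rw [h m hm]
  refine (h3 _ _ _ h1).trans (Eq.trans ?_ (h3 _ _ _ h2).symm)
  simp only [mul_left_comm _ (deltaSupp _ _)]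
  rw [← Finset.mul_sum, ← Finset.mul_sum, sum_choose_shift]

open Classical in
lemma ofSer_one_apply (n : ℕ) (y : ℂ) : ofSer (1 : MvPowerSeries (Fin 2) ℂ) n y =
    if n = 0 ∧ y = 0 then 1 else 0 := by
  rw [← one_smul (Mult ℂ ℂ) (ofSer (1 : MvPowerSeries (Fin 2) ℂ)), smul_ofSer_one,
    PowerSeries.coeff_one]
  by_cases hn : n = 0
  · rw [if_pos hn, AddMonoidAlgebra.one_def, AddMonoidAlgebra.coeff_single, Finsupp.single_apply]
    simp [hn, eq_comm]
  · rw [if_neg hn, if_neg fun h => hn h.1]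
    rfl

open Classical in
lemma ofLaurent_linInv_apply (r : ℂ) (N : ℕ) (x : ℂ × ℂ) : ofLaurent (linInv r) N x =
    if (∃ l : ℕ, x.2 = l) ∧ x.1 + x.2 + 1 + N = 0 then
      Ring.choose (-x.2 - 1) N * r ^ N else 0 := by
  rw [ofLaurent_apply]
  by_cases h : ∃ l : ℕ, x.2 = l
  · obtain ⟨l, hl⟩ := h
    rw [hl, ofSer_nat, coeff_linInv, coeff_pw, AddMonoidAlgebra.coeff_single, Finsupp.single_apply]
    have : (-(l : ℂ) - 1 - N) • (1 : ℂ) = x.1 ↔ (∃ l' : ℕ, (l : ℂ) = l') ∧ x.1 + l + 1 + N = 0 := by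
      rw [smul_eq_mul, mul_one]
      exact ⟨fun h => ⟨⟨l, rfl⟩, by rw [← h]; ring⟩, fun h => by linear_combination -h.2⟩
    simp only [this, Algebra.algebraMap_self, RingHom.id_apply, mul_comm]
  · rw [ofSer_eq_zero _ _ h, if_neg fun h' => h h'.1]
    rfl

/-- The difference of the two expansions of `1 / (u - v - rħ)` is the delta function. -/
theorem ofLaurent_add_swap (r : ℂ) :
    ofLaurent (linInv (-r)) + Dist.swap (ofLaurent (linInv r)) =
      deltaU 0 r (ofSer (1 : MvPowerSeries (Fin 2) ℂ)) := by
  classical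
  ext1 N ⟨i, j⟩
  rw [Dist.add_apply, Pi.add_apply, Dist.swap_apply, ofLaurent_linInv_apply,
    ofLaurent_linInv_apply, deltaU_apply]
  simp only [Prod.fst_swap, Prod.snd_swap]
  have hs : ∑ n ∈ antidiagonal N,
      (deltaSupp 0 j * (Ring.choose (j + n.1) n.1 * r ^ n.1)) •
      ofSer (1 : MvPowerSeries (Fin 2) ℂ) n.2 (i + j + 1 + n.1) =
        if i + j + 1 + N = 0 then deltaSupp 0 j * (Ring.choose (j + N) N * r ^ N) else 0 := by
    rw [Finset.sum_eq_single (N, 0)]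
    · rw [ofSer_one_apply]
      simp
    · rintro ⟨a, b⟩ hab hne
      rw [ofSer_one_apply, if_neg, smul_zero]
      rintro ⟨rfl, -⟩
      rw [mem_antidiagonal] at hab
      simp only [add_zero] at hab
      exact hne (by rw [hab])
    · intro h
      exact absurd (by rw [mem_antidiagonal, add_zero]) h
  rw [hs]
  -- At order `ħ^N` all three terms are supported on the line `i + j + 1 + N = 0`.
  by_cases h0 : i + j + 1 + N = 0
  swap
  · rw [if_neg fun h => h0 h.2, if_neg fun h => h0 (by linear_combination h.2), if_neg h0, add_zero]
  have hch : Ring.choose (-j - 1) N * (-r) ^ N = Ring.choose (j + N) N * r ^ N := by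
    have h' := Ring.choose_neg (j + 1) N
    rw [show -(j + 1) = -j - 1 by ring, show j + 1 + N - 1 = j + N by ring] at h'
    rw [h', neg_pow, Units.smul_def, zsmul_eq_mul, Int.negOnePow_def, zpow_natCast]
    push_cast
    have : (-1 : ℂ) ^ N * (-1) ^ N = 1 := by rw [← mul_pow]; simp
    linear_combination Ring.choose (j + N) N * r ^ N * this
  have hi : i = -(j + N) - 1 := by linear_combination h0
  have hii : -i - 1 = j + N := by rw [hi]; ring
  rw [if_pos h0, hch, hii]
  rw [deltaSupp]
  by_cases hj : ∃ m : ℤ, -j - 1 = 0 + (m : ℂ)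
  · obtain ⟨m, hm⟩ := hj
    have hjm : j = ((-m - 1 : ℤ) : ℂ) := by push_cast; linear_combination -hm
    have him : i = ((m - N : ℤ) : ℂ) := by rw [hi, hjm]; push_cast; ring
    rw [if_pos (⟨m, hm⟩ : ∃ m : ℤ, -j - 1 = 0 + (m : ℂ)), one_mul]
    have c1 : (∃ l : ℕ, j = l) ↔ m < 0 := by
      constructor
      · rintro ⟨l, hl⟩
        have : (-m - 1 : ℤ) = l := by exact_mod_cast hjm.symm.trans hl
        omega
      · intro h
        refine ⟨(-m - 1).toNat, ?_⟩
        rw [hjm]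
        have : (-m - 1 : ℤ) = ((-m - 1).toNat : ℤ) := by omega
        exact_mod_cast this
    have c2 : (∃ l : ℕ, i = l) ↔ (N : ℤ) ≤ m := by
      constructor
      · rintro ⟨l, hl⟩
        have : (m - N : ℤ) = l := by exact_mod_cast him.symm.trans hl
        omega
      · intro h
        refine ⟨(m - N).toNat, ?_⟩
        rw [him]
        have : (m - N : ℤ) = ((m - N).toNat : ℤ) := by omega
        exact_mod_cast this
    -- The expansions account for `m < 0` and for `m ≥ N`, and between these the binomial coefficient
    -- vanishes.
    rcases lt_or_ge m 0 with hm0 | hm0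
    · rw [if_pos ⟨c1.2 hm0, h0⟩, if_neg (fun h => absurd (c2.1 h.1) (by omega)), add_zero]
    · rw [if_neg (fun h => absurd (c1.1 h.1) (by omega)), zero_add]
      by_cases hN : (N : ℤ) ≤ m
      · rw [if_pos ⟨c2.2 hN, by linear_combination h0⟩]
      · rw [if_neg fun h => hN (c2.1 h.1)]
        have : j + N = ((N - 1 - m.toNat : ℕ) : ℂ) := by
          have h : ((N - 1 - m.toNat : ℕ) : ℤ) = -m - 1 + N := by omega
          rw [hjm, ← Int.cast_natCast (N - 1 - m.toNat), h, Int.cast_add, Int.cast_natCast]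
        rw [this, Ring.choose_natCast, Nat.choose_eq_zero_of_lt (by omega), Nat.cast_zero,
          zero_mul]
  · rw [if_neg hj, zero_mul, if_neg, if_neg, add_zero]
    · rintro ⟨⟨l, hl⟩, -⟩
      exact hj ⟨l + N, by push_cast; linear_combination -h0 + hl⟩
    · rintro ⟨⟨l, hl⟩, -⟩
      exact hj ⟨-l - 1, by push_cast; linear_combination -hl⟩

end Delta

/-! ### The commutator of `e(u)` and `f(v)` -/

section Lists

/-- Two lists of terms describe the same linear combination of the bosons `X(u + Bħ)`. -/
def SameSum (L L' : List Term) : Prop :=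
  ∀ (X : Boson) (f : ℂ → ℂ), (L.map fun t => if t.2.1 = X then t.1 * f t.2.2 else 0).sum =
    (L'.map fun t => if t.2.1 = X then t.1 * f t.2.2 else 0).sum

/-- The terms after the substitution of `u - rħ` for `u`. -/
def shiftTerms (r : ℂ) (L : List Term) : List Term := L.map fun t => (t.1, t.2.1, t.2.2 - r)

lemma pwSum_append (k : ℂ) (L L' : List Term) (X : Boson) (x : ℂ) :
    pwSum ℂ (1 : ℂ) k (L ++ L') X x = pwSum ℂ (1 : ℂ) k L X x + pwSum ℂ (1 : ℂ) k L' X x := by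
  simp only [pwSum, List.map_append, List.sum_append]

lemma pref_append (L L' : List Term) (p : Boson → ℂ) :
    pref ℂ (1 : ℂ) (L ++ L') p = pref ℂ (1 : ℂ) L p * pref ℂ (1 : ℂ) L' p := by
  simp only [pref, List.map_append, List.prod_append]

lemma coeff_pwSum (k : ℂ) (L : List Term) (X : Boson) (x : ℂ) (n : ℕ) (y : ℂ) :
    (PowerSeries.coeff n (pwSum ℂ (1 : ℂ) k L X x)).coeff y = kappa k X *
      (L.map fun t => if t.2.1 = X then
        t.1 * (PowerSeries.coeff n (pw ℂ (1 : ℂ) x t.2.2)).coeff y else 0).sum := by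
  rw [pwSum]
  induction L with
  | nil => simp
  | cons t L ih =>
    rw [List.map_cons, List.map_cons, List.sum_cons, List.sum_cons, map_add,
      AddMonoidAlgebra.coeff_add, Finsupp.add_apply, ih, mul_add]
    congr 1
    split_ifs
    · rw [PowerSeries.algebraMap_apply, PowerSeries.coeff_C_mul, algebraMap_eq_single,
        AddMonoidAlgebra.coeff_single_mul_apply, neg_zero, zero_add, Algebra.algebraMap_self,
        RingHom.id_apply]
      ring
    · simp

lemma SameSum.pwSum_eq {L L' : List Term} (h : SameSum L L') (k : ℂ) (X : Boson) (x : ℂ) :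
    pwSum ℂ (1 : ℂ) k L X x = pwSum ℂ (1 : ℂ) k L' X x := by
  ext n y
  rw [coeff_pwSum, coeff_pwSum, h X fun B => (PowerSeries.coeff n (pw ℂ (1 : ℂ) x B)).coeff y]

open Classical in
lemma pref_eq_prod (p : Boson → ℂ) (S : Finset ℂ) (L : List Term) (hS : ∀ t ∈ L, t.2.2 ∈ S) :
    pref ℂ (1 : ℂ) L p = ∏ B ∈ S,
      pw ℂ (1 : ℂ) (L.map fun t => t.1 * p t.2.1 * if t.2.2 = B then 1 else 0).sum B := by
  induction L with
  | nil =>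
    rw [pref_nil]
    refine (Finset.prod_eq_one fun B _ => ?_).symm
    rw [List.map_nil, List.sum_nil, pw_zero]
  | cons t L ih =>
    rw [pref_cons, ih fun s hs => hS s (List.mem_cons_of_mem t hs)]
    simp only [List.map_cons, List.sum_cons, pw_add]
    rw [Finset.prod_mul_distrib]
    refine congrArg (· * _) ?_
    rw [Finset.prod_eq_single t.2.2]
    · rw [if_pos rfl, mul_one]
    · intro B _ hB
      rw [if_neg hB.symm, mul_zero, pw_zero]
    · intro h
      exact absurd (hS t List.mem_cons_self) h

lemma sum_mul_eq (L : List Term) (p : Boson → ℂ) (f : ℂ → ℂ) :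
    (L.map fun t => t.1 * p t.2.1 * f t.2.2).sum =
      p Boson.alpha * (L.map fun t => if t.2.1 = Boson.alpha then t.1 * f t.2.2 else 0).sum +
      p Boson.beta * (L.map fun t => if t.2.1 = Boson.beta then t.1 * f t.2.2 else 0).sum +
      p Boson.gamma * (L.map fun t => if t.2.1 = Boson.gamma then t.1 * f t.2.2 else 0).sum := by
  induction L with
  | nil => simp
  | cons t L ih =>
    obtain ⟨c, X, B⟩ := t
    simp only [List.map_cons, List.sum_cons, ih]
    cases X <;> simp <;> ring

lemma SameSum.pref_eq {L L' : List Term} (h : SameSum L L') (p : Boson → ℂ) :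
    pref ℂ (1 : ℂ) L p = pref ℂ (1 : ℂ) L' p := by
  classical
  have hm : ∀ (L₀ : List Term), ∀ t ∈ L₀, t.2.2 ∈ (L₀.map fun t => t.2.2).toFinset := by
    intro L₀ t ht
    rw [List.mem_toFinset, List.mem_map]
    exact ⟨t, ht, rfl⟩
  rw [pref_eq_prod p ((L.map fun t => t.2.2).toFinset ∪ (L'.map fun t => t.2.2).toFinset) L
      fun t ht => Finset.mem_union_left _ (hm L t ht),
    pref_eq_prod p ((L.map fun t => t.2.2).toFinset ∪ (L'.map fun t => t.2.2).toFinset) L'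
      fun t ht => Finset.mem_union_right _ (hm L' t ht)]
  refine Finset.prod_congr rfl fun B _ => ?_
  have hB := fun L₀ => sum_mul_eq L₀ p fun C => if C = B then 1 else 0
  rw [hB, hB, h _ fun C => if C = B then 1 else 0, h _ fun C => if C = B then 1 else 0,
    h _ fun C => if C = B then 1 else 0]

variable {W : Type} [AddCommGroup W] [Module ℂ W]

/-- Powers of `v + Bħ` become powers of `u + (B - r)ħ` on the support of the delta function. -/
lemma inV_pref_smul_deltaU (lam r : ℂ) (L : List Term) (p : Boson → ℂ) (G : Dist ℂ W) :
    inV (pref ℂ (1 : ℂ) L p) • deltaU lam r G =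
      inU (pref ℂ (1 : ℂ) (shiftTerms r L) p) • deltaU (lam - nu L p) r G := by
  induction L generalizing lam with
  | nil =>
    rw [shiftTerms, List.map_nil, pref_nil, nu, List.map_nil, List.sum_nil, map_one, map_one,
      sub_zero]
  | cons t L ih =>
    rw [shiftTerms, List.map_cons, pref_cons, pref_cons, map_mul, map_mul, mul_comm, mul_smul,
      inV_pw_smul_deltaU, smul_comm, ih, mul_smul, sub_sub]
    rfl

lemma inV_pwSum_smul_deltaU (lam r k : ℂ) (L : List Term) (X : Boson) (m : ℤ) (G : Dist ℂ W) :
    inV (pwSum ℂ (1 : ℂ) k L X m) • deltaU lam r G =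
      inU (pwSum ℂ (1 : ℂ) k (shiftTerms r L) X m) • deltaU lam r G := by
  rw [shiftTerms, pwSum, pwSum, List.map_map]
  induction L with
  | nil => simp
  | cons t L ih =>
    rw [List.map_cons, List.map_cons, List.sum_cons, List.sum_cons, map_add, map_add, add_smul,
      add_smul, ih]
    refine congrArg (· + _) ?_
    rw [Function.comp_apply]
    split_ifs
    · rw [algebraMap_eq_cst, map_mul inV, map_mul inU, mapVar_cst, mapVar_cst, mul_smul, mul_smul,
        inV_pw_smul_deltaU, show lam - (m : ℂ) = lam + ((-m : ℤ) : ℂ) by push_cast; ring,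
        deltaU_add_int]
    · rw [map_zero, map_zero]

lemma deltaU_lmul (lam r : ℂ) (T : Op) (G : Dist ℂ Op) :
    Dist.lmul T (deltaU lam r G) = deltaU lam r (Dist.lmul T G) := post_deltaU _ lam r G

lemma deltaU_rmul (lam r : ℂ) (T : Op) (G : Dist ℂ Op) :
    Dist.rmul T (deltaU lam r G) = deltaU lam r (Dist.rmul T G) := post_deltaU _ lam r G

end Lists

section Commutator

lemma linSer_add (r z : ℂ) :
    linSer (r + z) = linSer r + inHbar _ (cst ℂ z * PowerSeries.X) := by
  rw [linSer, linSer, pw_one, pw_one, map_add (algebraMap ℂ (Mult ℂ ℂ)), add_mul, ← add_assoc,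
    map_add (inHbar _) _ (algebraMap ℂ (Mult ℂ ℂ) z * _), algebraMap_eq_cst z]
  ring

/-- The partial fraction `(u - v + (r + z)ħ) / (u - v + rħ) = 1 + zħ / (u - v + rħ)`. -/
lemma ofLaurent_of_mul_linSer {F : MvPowerSeries (Fin 2) Lau} {r z : ℂ}
    (h : F * linSer r = linSer (r + z)) :
    ofLaurent F = ofLaurent 1 + (cst (ℂ × ℂ) z * PowerSeries.X) • ofLaurent (linInv r) := by
  have hF : F = 1 + inHbar _ (cst ℂ z * PowerSeries.X) * linInv r := by
    refine linSer_mul_cancel (r := r) ?_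
    rw [mul_comm, h, linSer_add, mul_add, mul_one, mul_left_comm, linSer_mul_linInv, mul_one]
  rw [hF, map_add, ofLaurent_inHbar_mul, map_mul, mapVar_cst, mapVar_X]

/-- The commutator `[G(u), H(v)]`. -/
def Dist.comm (G H : Dist ℂ Op) : Dist (ℂ × ℂ) Op :=
  Dist.opProd G H - Dist.swap (Dist.opProd H G)

/-- If the contraction `(u - v - (r + z)ħ) / (u - v - rħ)` of two vertex operators has a single pole,
and if the product of the operators at this pole `v = u - rħ` is the vertex operator `h`, then the
commutator is the residue `-zħ` times `h` times a delta function. -/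
theorem comm_field {k : ℂ} (hk : ∀ X, kappa k X ≠ 0) {a b h : VertexData} (ha : a.Neutral)
    (hb : b.Neutral) (hh : h.Neutral) (hab : ∀ X, a.r X + b.r X = 0) (hr : h.r = 0) (r z : ℂ)
    (h1 : ∀ f : ℂ → ℂ, pairing k a.la b.lc f = f (-r - z) - f (-r))
    (h2 : ∀ f : ℂ → ℂ, pairing k b.la a.lc f = f (r + z) - f r)
    (hla : SameSum (a.la ++ shiftTerms r b.la) h.la)
    (hlc : SameSum (a.lc ++ shiftTerms r b.lc) h.lc) (p : Boson → ℂ) (N : ℕ) (x : ℂ × ℂ)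
    (f : Osc) :
    Dist.comm (toDist (a.field k)) (toDist (b.field k)) N x (Finsupp.single p f) =
      (-(cst (ℂ × ℂ) z * PowerSeries.X) • deltaU (-nu b.la p) r (toDist (h.field k))) N x
        (Finsupp.single p f) := by
  have hs : ∀ p, a.shift k (b.shift k p) = p := by
    intro p
    funext X
    simp only [VertexData.shift]
    linear_combination kappa k X * hab X
  have hs' : ∀ p, b.shift k (a.shift k p) = p := fun p => by rw [VertexData.shift_comm, hs]
  -- Both sides have the commutators of `a(u) b(v)` with the modes: on the support of the delta
  -- function these agree with the commutators of `h(u)`.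
  refine Covariant.eq_on hk (((field_covariant k ha).opProd (field_covariant k hb)).sub
    (covariant_swap_opProd k (field_covariant k ha) (field_covariant k hb)))
    (Covariant.smul ⟨fun X n => ?_, fun X n => ?_⟩ _) p (fun q => ?_) N x f
  · rw [deltaU_rmul, (field_covariant k hh).creation, map_add, ← deltaU_lmul, deltaU_smul,
      ← hla.pwSum_eq, pwSum_append, neg_add, map_add, add_smul, add_smul, map_neg, map_neg, map_neg,
      neg_smul (inV _), show (-((n : ℂ) + 1)) = ((-(n + 1) : ℤ) : ℂ) by push_cast; ring,
      inV_pwSum_smul_deltaU, neg_smul (inU (pwSum ℂ (1 : ℂ) k (shiftTerms r b.la) X _))]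
  · rw [deltaU_lmul, (field_covariant k hh).annihilation, map_add, ← deltaU_rmul, deltaU_smul,
      ← hlc.pwSum_eq, pwSum_append, map_add, add_smul, add_smul,
      show (n : ℂ) + 1 = ((n + 1 : ℤ) : ℂ) by push_cast; ring, inV_pwSum_smul_deltaU]
  · rw [map_smul, post_deltaU, map_sub]
    have hsw : Dist.post (vev p q)
        (Dist.swap (Dist.opProd (toDist (b.field k)) (toDist (a.field k)))) =
        Dist.swap (Dist.post (vev p q) (Dist.opProd (toDist (b.field k)) (toDist (a.field k)))) :=
      rfl
    rw [hsw]
    by_cases hq : q = p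
    · have hv := post_vev_opProd_field k hb ha p
      have hv' := post_vev_opProd_field k ha hb p
      have hv'' := post_vev_field k hh p
      rw [hs'] at hv
      rw [hs] at hv'
      rw [shift_zero k p hr] at hv''
      have hc1 := contraction_mul_prod k a hb [-r - z] [-r] (fun f => by simp [h1])
      have hc2 := contraction_mul_prod k b ha [r + z] [r] (fun f => by simp [h2])
      rw [List.map_singleton, List.map_singleton, List.prod_singleton, List.prod_singleton] at hc1 hc2
      rw [sub_eq_add_neg] at hc1
      have hz : cst (ℂ × ℂ) (-z) = -cst (ℂ × ℂ) z := by
        rw [cst, AddMonoidAlgebra.single_neg, map_neg]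
      -- The two contractions are expansions of the same rational function, so that their difference
      -- is a multiple of the delta function.
      rw [hq, hv, hv', hv'', Dist.swap_smul, map_mul swapVar, swapVar_inU, swapVar_inV,
        mul_comm (inV _), ← smul_sub, ofLaurent_of_mul_linSer hc1, ofLaurent_of_mul_linSer hc2,
        map_add Dist.swap, ofLaurent_one_swap, Dist.swap_smul, map_mul swapVar, mapVar_cst,
        mapVar_X, add_sub_add_left_eq_sub, hz, neg_mul, neg_smul, ← neg_add', ← smul_add,
        ofLaurent_add_swap, deltaU_smul, ← hla.pref_eq, pref_append, map_mul inU, ← neg_smul,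
        smul_comm _ (-_), mul_smul, inV_pref_smul_deltaU, zero_sub, mul_smul]
    · rw [post_vev_opProd_field_of_ne k ha hb p q (by rwa [hs]),
        post_vev_opProd_field_of_ne k hb ha p q (by rwa [hs']),
        post_vev_field_of_ne k hh p q (by rwa [shift_zero k p hr]), map_zero, map_zero, smul_zero,
        sub_zero]

lemma comm_eq_zero {G H : Dist ℂ Op} (h : Commutes [] [] G H) : Dist.comm G H = 0 := by
  rw [Commutes, List.map_nil, List.prod_nil, one_smul, one_smul] at h
  rw [Dist.comm, h, sub_self]

lemma comm_sub_left (G G' H : Dist ℂ Op) :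
    Dist.comm (G - G') H = Dist.comm G H - Dist.comm G' H := by
  have h : G = (G - G') + G' := (sub_add_cancel G G').symm
  have h' : Dist.comm G H = Dist.comm (G - G') H + Dist.comm G' H := by
    conv_lhs => rw [h]
    rw [Dist.comm, Dist.opProd_add_left, Dist.opProd_add_right, map_add, Dist.comm, Dist.comm]
    abel
  rw [h', add_sub_cancel_right]

lemma comm_sub_right (G H H' : Dist ℂ Op) :
    Dist.comm G (H - H') = Dist.comm G H - Dist.comm G H' := by
  have h : H = (H - H') + H' := (sub_add_cancel H H').symm
  have h' : Dist.comm G H = Dist.comm G (H - H') + Dist.comm G H' := by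
    conv_lhs => rw [h]
    rw [Dist.comm, Dist.opProd_add_left, Dist.opProd_add_right, map_add, Dist.comm, Dist.comm]
    abel
  rw [h', add_sub_cancel_right]

lemma comm_X_smul (G H : Dist ℂ Op) :
    Dist.comm ((PowerSeries.X : Mult ℂ ℂ) • G) ((PowerSeries.X : Mult ℂ ℂ) • H) =
      (PowerSeries.X : Mult ℂ (ℂ × ℂ)) • (PowerSeries.X : Mult ℂ (ℂ × ℂ)) • Dist.comm G H := by
  rw [Dist.comm, Dist.opProd_smul_left, Dist.opProd_smul_right, Dist.opProd_smul_left,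
    Dist.opProd_smul_right, mapVar_X, mapVar_X, Dist.swap_smul, Dist.swap_smul, mapVar_X,
    ← smul_sub, ← smul_sub]
  rfl

lemma comm_neg_left (G H : Dist ℂ Op) : Dist.comm (-G) H = -Dist.comm G H := by
  have := comm_sub_left 0 G H
  rw [zero_sub] at this
  rw [this, Dist.comm]
  have h1 : Dist.opProd 0 H = 0 := by
    have := Dist.opProd_add_left 0 0 H
    rwa [add_zero, left_eq_add] at this
  have h2 : Dist.opProd H 0 = 0 := by
    have := Dist.opProd_add_right H 0 0
    rwa [add_zero, left_eq_add] at this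
  rw [h1, h2, map_zero, sub_zero, zero_sub]

variable {k : ℂ}

/-- At `v = u - kħ` the exponents of the first terms of `e(u)` and `f(v)` add up to that of `h⁺(u)`. -/
lemma sameSum_E₁_F₁ (k : ℂ) :
    SameSum ((dataE₁ k).la ++ shiftTerms k (dataF₁ k).la) (dataHP k).la ∧
    SameSum ((dataE₁ k).lc ++ shiftTerms k (dataF₁ k).lc) (dataHP k).lc := by
  constructor <;> intro X f <;> cases X <;> simp [dataE₁, dataF₁, dataHP, shiftTerms] <;> ring_nf

/-- At `v = u` the exponents of the second terms of `e(u)` and `f(v)` add up to that of `h⁻(u)`. -/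
lemma sameSum_E₂_F₂ (k : ℂ) :
    SameSum ((dataE₂ k).la ++ shiftTerms 0 (dataF₂ k).la) (dataHM k).la ∧
    SameSum ((dataE₂ k).lc ++ shiftTerms 0 (dataF₂ k).lc) (dataHM k).lc := by
  constructor <;> intro X f <;> cases X <;> simp [dataE₂, dataF₂, dataHM, shiftTerms] <;> ring_nf

/-- The exponents of `f(v)` on `F_{l,s,t}` lie in `-(s + t)/k + ℤ`. -/
lemma nu_F (hk0 : k ≠ 0) (l s t : ℂ) {d : VertexData} (hd : d.Neutral)
    (hr : d.r = zeroBG (-(2 / k))) : -nu d.la (fockCharge l s t) = (s + t) / k := by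
  rw [nu_eq_lowest hd, VertexData.lowest, hr]
  simp only [zeroBG, fockCharge]
  field_simp
  ring

lemma zeroBG_add_neg (X : Boson) (c : ℂ) : zeroBG c X + zeroBG (-c) X = 0 := by
  cases X <;> simp [zeroBG]

/-- The product `δ(u - (v + rħ)) a(u)` as a distribution. -/
lemma toDist₂_deltaMulU (lam r : ℂ) (a : Field1 Fk) :
    toDist₂ (deltaMulU lam r a) = deltaU lam r (toDist a) := by
  ext1 N x
  rw [deltaU_apply]
  change PowerSeries.coeff N (deltaMulU lam r a x.1 x.2) = _
  rw [deltaMulU, PowerSeries.coeff_mk]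
  refine Finset.sum_congr rfl fun n _ => ?_
  rw [finsum_eq_single _ (x.1 + x.2 + 1 + n.1)]
  · refine congrArg₂ (· • ·) ?_ rfl
    have h : x.1 - (x.1 + x.2 + 1 + n.1) = -x.2 - 1 - n.1 := by ring
    rw [deltaCoeff, h, show -(-x.2 - 1 - (n.1 : ℂ)) - 1 = x.2 + n.1 by ring, add_sub_cancel_right,
      deltaSupp]
    by_cases h' : ∃ m : ℤ, -x.2 - 1 = lam + m
    · rw [if_pos h', one_mul, if_pos]
      obtain ⟨m, hm⟩ := h'
      exact ⟨⟨m - n.1, by rw [hm]; push_cast; ring⟩, rfl⟩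
    · rw [if_neg h', zero_mul, if_neg]
      rintro ⟨⟨m, hm⟩, -⟩
      exact h' ⟨m + n.1, by push_cast; linear_combination hm⟩
  · intro p hp
    rw [deltaCoeff, if_neg, zero_smul]
    rintro ⟨-, h⟩
    exact hp (by linear_combination -h)

/-- For fields with integral exponents, `δ(u - v) a(v) = δ(u - v) a(u)`. -/
lemma deltaMulV_apply (lam : ℂ) {a : Field1 Fk} (ha : ∀ (i : ℂ) (N : ℕ), (¬ ∃ m : ℤ, i = m) →
    PowerSeries.coeff N (a i) = 0) (N : ℕ) (x : ℂ × ℂ) :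
    toDist₂ (deltaMulV lam 0 a) N x = deltaU lam 0 (toDist a) N x := by
  rw [deltaU_apply]
  change PowerSeries.coeff N (deltaMulV lam 0 a x.1 x.2) = _
  rw [deltaMulV, PowerSeries.coeff_mk]
  refine Finset.sum_congr rfl fun n _ => ?_
  by_cases hn : n.1 = 0
  swap
  · rw [zero_pow hn, mul_zero, mul_zero, zero_smul]
    refine finsum_eq_zero_of_forall_eq_zero fun p => ?_
    rw [deltaCoeff, zero_pow hn, mul_zero, ite_self, zero_smul]
  rw [hn, Nat.cast_zero, add_zero, add_zero, Ring.choose_zero_right, pow_zero, mul_one, mul_one,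
    finsum_eq_single _ (x.1 + x.2 + 1)]
  · change _ = deltaSupp lam x.2 • PowerSeries.coeff n.2 (a (x.1 + x.2 + 1))
    by_cases hi : ∃ m : ℤ, x.1 + x.2 + 1 = m
    swap
    · rw [ha _ _ hi, smul_zero, smul_zero]
    refine congrArg₂ (· • ·) ?_ rfl
    obtain ⟨m, hm⟩ := hi
    rw [deltaCoeff, deltaSupp, Ring.choose_zero_right, pow_zero, mul_one]
    by_cases hx : ∃ n : ℤ, -x.2 - 1 = lam + n
    · rw [if_pos hx, if_pos]
      obtain ⟨n, hn⟩ := hx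
      exact ⟨⟨n + m, by push_cast; linear_combination hn + hm⟩, by push_cast; ring⟩
    · rw [if_neg hx, if_neg]
      rintro ⟨⟨n, hn⟩, -⟩
      exact hx ⟨n - m, by push_cast; linear_combination hn - hm⟩
  · intro p hp
    rw [deltaCoeff, if_neg, zero_smul]
    rintro ⟨-, h⟩
    exact hp (by push_cast at h; linear_combination -h)

/-- The commutator of `e(u)` and `f(v)`: the first terms of `e(u)` and `f(v)` contribute `h⁺`, the
second ones `h⁻`, and the mixed commutators vanish. -/
theorem comm_currentE_currentF (hk0 : k ≠ 0) (hk2 : k ≠ -2) (l s t : ℂ) :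
    EqOn2 (fock k l s t) (fun i j => PowerSeries.X *
        (prodUV (currentE k) (currentF k) i j - prodVU (currentE k) (currentF k) i j))
      (fun i j => deltaMulU ((s + t) / k) k (hPlus k) i j -
        deltaMulV ((s + t) / k) 0 (hMinus k) i j) := by
  intro i j N x hx
  obtain ⟨f, rfl⟩ := (mem_fock_iff hk0 hk2).1 hx
  have hk := kappa_ne_zero hk0 hk2
  -- The contraction of the first terms is `(u - v - (k + 1)ħ) / (u - v - kħ)`, with a pole at
  -- `v = u - kħ`, and that of the second terms is `(u - v + ħ) / (u - v)`, with a pole at `v = u`.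
  have h11 := comm_field hk (neutral_E₁ k) (neutral_F₁ k) (neutral_HP k)
    (fun X => zeroBG_add_neg X (2 / k)) rfl k 1 (fun f => (pairing_E_F hk0 hk2 f).1)
    (fun f => (pairing_F_E hk0 hk2 f).1) (sameSum_E₁_F₁ k).1 (sameSum_E₁_F₁ k).2
    (fockCharge l s t) (N + 1) (i, j) f
  have h22 := comm_field hk (neutral_E₂ k) (neutral_F₂ k) (neutral_HM k)
    (fun X => zeroBG_add_neg X (2 / k)) rfl 0 (-1)
    (fun f => by
      rw [(pairing_E_F hk0 hk2 f).2.2.2, show (-0 - -1 : ℂ) = 1 by ring, neg_zero])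
    (fun f => by rw [(pairing_F_E hk0 hk2 f).2.2.2, zero_add])
    (sameSum_E₂_F₂ k).1 (sameSum_E₂_F₂ k).2
    (fockCharge l s t) (N + 1) (i, j) f
  have h12 : Dist.comm (distE₁ k) (distF₂ k) = 0 := comm_eq_zero
    (commutes_field hk (neutral_E₁ k) (neutral_F₂ k) [] [] [] rfl
      (fun f => by simp [(pairing_E_F hk0 hk2 f).2.1])
      (fun f => by simp [(pairing_F_E hk0 hk2 f).2.2.1]))
  have h21 : Dist.comm (distE₂ k) (distF₁ k) = 0 := comm_eq_zero
    (commutes_field hk (neutral_E₂ k) (neutral_F₁ k) [] [] [] rfl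
      (fun f => by simp [(pairing_E_F hk0 hk2 f).2.2.1])
      (fun f => by simp [(pairing_F_E hk0 hk2 f).2.1]))
  have hD : (PowerSeries.X : Mult ℂ (ℂ × ℂ)) • (PowerSeries.X : Mult ℂ (ℂ × ℂ)) •
      Dist.comm (toDist (currentE k)) (toDist (currentF k)) =
        -(Dist.comm (distE₁ k) (distF₁ k)) - Dist.comm (distE₂ k) (distF₂ k) := by
    rw [← comm_X_smul, X_smul_toDist_currentE hk0 hk2, X_smul_toDist_currentF hk0 hk2,
      comm_neg_left, comm_sub_left, comm_sub_right, comm_sub_right, h12, h21]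
    abel
  rw [nu_F hk0 l s t (neutral_F₁ k) rfl, neg_smul, mul_smul, Dist.neg_apply, Pi.neg_apply,
    cst_smul_apply, one_smul, Dist.X_smul_succ] at h11
  rw [nu_F hk0 l s t (neutral_F₂ k) rfl, neg_smul, mul_smul, Dist.neg_apply, Pi.neg_apply,
    cst_smul_apply, neg_one_smul, neg_neg, Dist.X_smul_succ] at h22
  -- The orders are shifted by two powers of `ħ`, one from each of the brackets in `e` and `f`.
  have hl : PowerSeries.coeff N (PowerSeries.X *
      (prodUV (currentE k) (currentF k) i j - prodVU (currentE k) (currentF k) i j)) =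
      ((PowerSeries.X : Mult ℂ (ℂ × ℂ)) • (PowerSeries.X : Mult ℂ (ℂ × ℂ)) •
      Dist.comm (toDist (currentE k)) (toDist (currentF k))) (N + 1) (i, j) := by
    rw [Dist.X_smul_succ]
    rcases N with _ | N
    · rw [PowerSeries.coeff_zero_X_mul, Dist.X_smul_zero]
      rfl
    · rw [PowerSeries.coeff_succ_X_mul, Dist.X_smul_succ, Dist.comm, ← toDist₂_prodUV,
        ← toDist₂_prodVU, map_sub]
      rfl
  have hU : PowerSeries.coeff N (deltaMulU ((s + t) / k) k (hPlus k) i j) =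
      deltaU ((s + t) / k) k (distHP k) N (i, j) := by
    rw [← toDist_hPlus, ← toDist₂_deltaMulU]
    rfl
  have hV : PowerSeries.coeff N (deltaMulV ((s + t) / k) 0 (hMinus k) i j) =
      deltaU ((s + t) / k) 0 (distHM k) N (i, j) := by
    rw [← toDist_hMinus, ← deltaMulV_apply]
    · rfl
    · intro i N hi
      refine LinearMap.ext fun x => ?_
      rw [modes_hMinus hk0 hk2 (Or.inl fun ⟨m, hm⟩ => hi ⟨m, by rw [hm, Int.cast_natCast]⟩),
        if_neg fun h => hi ⟨0, by rw [h.1, Int.cast_zero]⟩]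
      rfl
  rw [hl, hD, map_sub, hU, hV, Dist.sub_apply, Pi.sub_apply, Dist.neg_apply, Pi.neg_apply]
  rw [LinearMap.sub_apply, LinearMap.sub_apply, LinearMap.neg_apply]
  refine (congrArg₂ (fun a b => -a - b) h11 h22).trans ?_
  rw [LinearMap.neg_apply, neg_neg]
  rfl

end Commutator

/-! ### The limit `ħ → 0` -/

section Limit

variable {k : ℂ}

/-- The field `g(u)` has the commutators of `: ∑_X a_X ∂X(u) exp(∑_X r_X X(u)) :` with the modes,
where `V(u)` is the exponential. -/
structure Descendant (k : ℂ) (r a : Boson → ℂ) (V g : ℂ → Op) : Prop where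
  creation : ∀ X (n : ℕ) (i : ℂ), g i * mode k X (-(n : ℤ) - 1) =
    mode k X (-(n : ℤ) - 1) * g i + (-(kappa k X * r X)) • g (i + n + 1) +
      (kappa k X * (n + 1) * a X) • V (i + n + 2)
  annihilation : ∀ X (n : ℕ) (i : ℂ), mode k X (n + 1) * g i =
    g i * mode k X (n + 1) + (kappa k X * r X) • g (i - n - 1) +
      (kappa k X * (n + 1) * a X) • V (i - n)

/-- A descendant is determined by its vacuum matrix coefficients, since the difference of two of them is
primary. -/
theorem Descendant.eq (hk : ∀ X, kappa k X ≠ 0) {r a : Boson → ℂ} {V g h : ℂ → Op}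
    (hg : Descendant k r a V g) (hh : Descendant k r a V h)
    (h0 : ∀ p q i, vev p q (g i) = vev p q (h i)) (i : ℂ) : g i = h i := by
  have hp : Primary k r fun i => g i - h i := by
    constructor
    · intro X n i
      rw [sub_mul, mul_sub, hg.creation, hh.creation, smul_sub]; abel
    · intro X n i
      rw [sub_mul, mul_sub, hg.annihilation, hh.annihilation, smul_sub]; abel
  exact sub_eq_zero.1 (hp.eq_zero hk (fun p q i => by rw [map_sub, h0, sub_self]) i)

/-- The difference of two vertex operators with the same charges is divisible by `ħ`, and the
leading term of the quotient is a descendant. -/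
lemma descendant_sub {d d' : VertexData} (hd : d.Neutral) (hd' : d'.Neutral) (h : d.r = d'.r)
    {V : ℂ → Op} (hV : ∀ i, d.ord k 0 i = V i) (hV' : ∀ i, d'.ord k 0 i = V i) {a : Boson → ℂ}
    (ha : ∀ X, moment d.la X - moment d'.la X = a X)
    (hc : ∀ X, moment d.lc X - moment d'.lc X = a X) :
    Descendant k d.r a V fun i => d.ord k 1 i - d'.ord k 1 i := by
  constructor
  · intro X n i
    rw [sub_mul, mul_sub, ord_one_creation k hd, ord_one_creation k hd', ← h, smul_sub, hV, hV',
      ← ha, mul_sub, sub_smul]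
    abel
  · intro X n i
    rw [sub_mul, mul_sub, ord_one_annihilation k hd, ord_one_annihilation k hd', ← h, smul_sub, hV,
      hV', ← hc, mul_sub, sub_smul]
    abel

/-- The coefficients of `∂α + σ ∂β`. -/
def derivCharge (σ : ℂ) : Boson → ℂ
  | Boson.alpha => 1
  | Boson.beta => σ
  | Boson.gamma => 0

/-- The modes of `∂(α + σβ)`. -/
def derivMode (k σ : ℂ) (n : ℤ) : Op := mode k Boson.alpha n + σ • mode k Boson.beta n

lemma mode_mul_derivMode (k σ : ℂ) (X : Boson) (a b : ℤ) :
    mode k X a * derivMode k σ b = derivMode k σ b * mode k X a +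
      (if a + b = 0 then kappa k X * a * derivCharge σ X else 0 : ℂ) • (1 : Op) := by
  rw [derivMode, mul_add, add_mul, mul_smul_comm, smul_mul_assoc, mode_mul_mode k X _ a b,
    mode_mul_mode k X _ a b, smul_add, smul_smul, add_add_add_comm, ← add_smul]
  congr 2
  by_cases h : a + b = 0
  · cases X <;> simp [h, derivCharge, mul_comm]
  · simp [h]

lemma locFin_derivMode (k σ : ℂ) : LocFin fun n : ℕ => derivMode k σ n := by
  intro x
  have h := (((locFin_mode k Boson.alpha).add ((locFin_mode k Boson.beta).smul σ)) x).image
    Nat.succ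
  refine (h.union (Set.finite_singleton 0)).subset fun n hn => ?_
  rcases n with _ | n
  · exact Or.inr rfl
  · exact Or.inl ⟨n, fun h0 => hn h0, rfl⟩

/-- The data of `: exp{r (β + γ)(u)} :`. -/
def data0 (r : ℂ) : VertexData where
  lc := [(r, Boson.beta, 0), (r, Boson.gamma, 0)]
  la := [(r, Boson.beta, 0), (r, Boson.gamma, 0)]
  r := zeroBG r

lemma neutral_data0 (r : ℂ) : (data0 r).Neutral := by
  constructor <;> intro X <;> cases X <;> simp [data0, charge, zeroBG]

lemma vertex0_eq (k r : ℂ) : vertex0 k r = (data0 r).ord k 0 := by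
  have h : vertex k (r • pos2 k Boson.beta Boson.gamma 0) (zeroBG r)
      (r • neg2 k Boson.beta Boson.gamma 0) = (data0 r).field k := by
    rw [VertexData.field]
    congr 1 <;> simp only [data0, crea, anni, pos2, neg2, List.map_cons, List.map_nil,
      List.sum_cons, List.sum_nil] <;> module
  funext i
  rw [vertex0, h]
  rfl

lemma primary_vertex0 (k r : ℂ) : Primary k (zeroBG r) (vertex0 k r) := by
  rw [vertex0_eq]
  exact primary_ord_zero k (neutral_data0 r)

lemma locFin_vertex0 (k r i : ℂ) : LocFin fun n : ℕ => vertex0 k r (i - n) := by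
  refine finite_support_of_single fun p f => ?_
  obtain ⟨B, hB⟩ := field_bounded k (neutral_data0 r) p f 0
  obtain ⟨m, hm⟩ := exists_nat_gt (i.re - B)
  refine (Finset.range m).finite_toSet.subset fun n hn => ?_
  by_contra h
  rw [Finset.mem_coe, Finset.mem_range, not_lt] at h
  refine hn ?_
  have hmn : (m : ℝ) ≤ n := by exact_mod_cast h
  have := hB (i - n) (by
    rw [Complex.sub_re, Complex.natCast_re]
    linarith)
  rw [vertex0_eq]
  exact this

/-- The part of `:∂(α + σβ)(u) exp{r (β+γ)(u)}:` with creation operators of `∂(α + σβ)`. -/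
def ffCrea (k σ r i : ℂ) : Op :=
  locSum fun n : ℕ => derivMode k σ (-(n : ℤ) - 1) * vertex0 k r (i - n)

/-- The part of `:∂(α + σβ)(u) exp{r (β+γ)(u)}:` with the other modes of `∂(α + σβ)`. -/
def ffAnni (k σ r i : ℂ) : Op :=
  locSum fun n : ℕ => vertex0 k r (i + n + 1) * derivMode k σ n

lemma locFin_ffCrea (k σ r i : ℂ) :
    LocFin fun n : ℕ => derivMode k σ (-(n : ℤ) - 1) * vertex0 k r (i - n) :=
  (locFin_vertex0 k r i).mul_left _

lemma locFin_ffAnni (k σ r i : ℂ) :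
    LocFin fun n : ℕ => vertex0 k r (i + n + 1) * derivMode k σ n :=
  (locFin_derivMode k σ).mul_left _

lemma ffCurrent_eq (k σ r i : ℂ) : ffCurrent k σ r i = ffCrea k σ r i + ffAnni k σ r i :=
  (locFin_ffCrea k σ r i).locSum_add (locFin_ffAnni k σ r i)

lemma ffCrea_mul_mode (k σ r : ℂ) (X : Boson) (m : ℕ) (i : ℂ) :
    ffCrea k σ r i * mode k X (-(m : ℤ) - 1) = mode k X (-(m : ℤ) - 1) * ffCrea k σ r i +
      (-(kappa k X * zeroBG r X)) • ffCrea k σ r (i + m + 1) := by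
  have h : ∀ n : ℕ, derivMode k σ (-(n : ℤ) - 1) * vertex0 k r (i - n) * mode k X (-(m : ℤ) - 1) =
      mode k X (-(m : ℤ) - 1) * (derivMode k σ (-(n : ℤ) - 1) * vertex0 k r (i - n)) +
        (-(kappa k X * zeroBG r X)) •
          (derivMode k σ (-(n : ℤ) - 1) * vertex0 k r (i + m + 1 - n)) := by
    intro n
    rw [mul_assoc, (primary_vertex0 k r).creation, mul_add, ← mul_assoc, ← mul_assoc,
      mode_mul_derivMode, if_neg (by omega), zero_smul, add_zero, mul_smul_comm,
      show i - n + m + 1 = i + m + 1 - n by ring]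
  rw [ffCrea, (locFin_ffCrea k σ r i).locSum_mul, (locFin_ffCrea k σ r i).mul_locSum, funext h,
    ((locFin_ffCrea k σ r i).mul_left _).locSum_add
      ((locFin_ffCrea k σ r _).smul _), (locFin_ffCrea k σ r _).locSum_smul]
  rfl

lemma ffAnni_mul_mode (k σ r : ℂ) (X : Boson) (m : ℕ) (i : ℂ) :
    ffAnni k σ r i * mode k X (-(m : ℤ) - 1) = mode k X (-(m : ℤ) - 1) * ffAnni k σ r i +
      (-(kappa k X * zeroBG r X)) • ffAnni k σ r (i + m + 1) +
        (kappa k X * (m + 1) * derivCharge σ X) • vertex0 k r (i + m + 2) := by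
  have h : ∀ n : ℕ, vertex0 k r (i + n + 1) * derivMode k σ n * mode k X (-(m : ℤ) - 1) =
      mode k X (-(m : ℤ) - 1) * (vertex0 k r (i + n + 1) * derivMode k σ n) +
        (-(kappa k X * zeroBG r X)) • (vertex0 k r (i + m + 1 + n + 1) * derivMode k σ n) +
        (if n = m + 1 then kappa k X * (m + 1) * derivCharge σ X else 0 : ℂ) •
          vertex0 k r (i + n + 1) := by
    intro n
    have hc : derivMode k σ n * mode k X (-(m : ℤ) - 1) = mode k X (-(m : ℤ) - 1) *
        derivMode k σ n +
          (if n = m + 1 then kappa k X * (m + 1) * derivCharge σ X else 0 : ℂ) • (1 : Op) := by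
      rw [mode_mul_derivMode, add_assoc, ← add_smul]
      have : (if -(m : ℤ) - 1 + n = 0 then kappa k X * ((-(m : ℤ) - 1 : ℤ) : ℂ) * derivCharge σ X
          else 0 : ℂ) + (if n = m + 1 then kappa k X * (m + 1) * derivCharge σ X else 0 : ℂ) =
          0 := by
        by_cases h : n = m + 1
        · rw [if_pos h, if_pos (by omega)]
          push_cast
          ring
        · rw [if_neg h, if_neg (by omega), add_zero]
      rw [this, zero_smul, add_zero]
    rw [mul_assoc, hc, mul_add, ← mul_assoc, (primary_vertex0 k r).creation, add_mul,
      mul_smul_comm, mul_one, mul_assoc, smul_mul_assoc,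
      show i + n + 1 + m + 1 = i + m + 1 + n + 1 by ring]
  have h2 : ∀ n : ℕ, n ≠ m + 1 →
      (if n = m + 1 then kappa k X * (m + 1) * derivCharge σ X else 0 : ℂ) •
          vertex0 k r (i + n + 1) = 0 := by
    intro n hn
    rw [if_neg hn, zero_smul]
  rw [ffAnni, (locFin_ffAnni k σ r i).locSum_mul, (locFin_ffAnni k σ r i).mul_locSum, funext h,
    (((locFin_ffAnni k σ r i).mul_left _).add ((locFin_ffAnni k σ r _).smul _)).locSum_add
      (locFin_of_ne h2), ((locFin_ffAnni k σ r i).mul_left _).locSum_add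
      ((locFin_ffAnni k σ r _).smul _), (locFin_ffAnni k σ r _).locSum_smul, locSum_of_ne h2,
    if_pos rfl, show i + ((m + 1 : ℕ) : ℂ) + 1 = i + m + 2 by push_cast; ring]
  rfl

lemma mode_mul_ffCrea (k σ r : ℂ) (X : Boson) (m : ℕ) (i : ℂ) :
    mode k X (m + 1) * ffCrea k σ r i = ffCrea k σ r i * mode k X (m + 1) +
      (kappa k X * zeroBG r X) • ffCrea k σ r (i - m - 1) +
        (kappa k X * (m + 1) * derivCharge σ X) • vertex0 k r (i - m) := by
  have h : ∀ n : ℕ, mode k X (m + 1) * (derivMode k σ (-(n : ℤ) - 1) * vertex0 k r (i - n)) =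
      derivMode k σ (-(n : ℤ) - 1) * vertex0 k r (i - n) * mode k X (m + 1) +
        (kappa k X * zeroBG r X) •
          (derivMode k σ (-(n : ℤ) - 1) * vertex0 k r (i - m - 1 - n)) +
        (if n = m then kappa k X * (m + 1) * derivCharge σ X else 0 : ℂ) •
          vertex0 k r (i - n) := by
    intro n
    rw [← mul_assoc, mode_mul_derivMode, add_mul, mul_assoc, (primary_vertex0 k r).annihilation,
      mul_add, mul_smul_comm, smul_mul_assoc, one_mul, ← mul_assoc,
      show i - n - m - 1 = i - m - 1 - n by ring]
    congr 2
    by_cases h : n = m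
    · rw [if_pos h, if_pos (by omega)]
      push_cast
      ring
    · rw [if_neg h, if_neg (by omega)]
  have h2 : ∀ n : ℕ, n ≠ m →
      (if n = m then kappa k X * (m + 1) * derivCharge σ X else 0 : ℂ) •
          vertex0 k r (i - n) = 0 := by
    intro n hn
    rw [if_neg hn, zero_smul]
  rw [ffCrea, (locFin_ffCrea k σ r i).locSum_mul, (locFin_ffCrea k σ r i).mul_locSum, funext h,
    (((locFin_ffCrea k σ r i).mul_right _).add ((locFin_ffCrea k σ r _).smul _)).locSum_add
      (locFin_of_ne h2), ((locFin_ffCrea k σ r i).mul_right _).locSum_add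
      ((locFin_ffCrea k σ r _).smul _), (locFin_ffCrea k σ r _).locSum_smul, locSum_of_ne h2,
    if_pos rfl]
  rfl

lemma mode_mul_ffAnni (k σ r : ℂ) (X : Boson) (m : ℕ) (i : ℂ) :
    mode k X (m + 1) * ffAnni k σ r i = ffAnni k σ r i * mode k X (m + 1) +
      (kappa k X * zeroBG r X) • ffAnni k σ r (i - m - 1) := by
  have h : ∀ n : ℕ, mode k X (m + 1) * (vertex0 k r (i + n + 1) * derivMode k σ n) =
      vertex0 k r (i + n + 1) * derivMode k σ n * mode k X (m + 1) +
        (kappa k X * zeroBG r X) • (vertex0 k r (i - m - 1 + n + 1) * derivMode k σ n) := by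
    intro n
    rw [← mul_assoc, (primary_vertex0 k r).annihilation, add_mul, mul_assoc, mode_mul_derivMode,
      if_neg (by omega), zero_smul, add_zero, smul_mul_assoc, mul_assoc,
      show i + n + 1 - m - 1 = i - m - 1 + n + 1 by ring]
  rw [ffAnni, (locFin_ffAnni k σ r i).locSum_mul, (locFin_ffAnni k σ r i).mul_locSum, funext h,
    ((locFin_ffAnni k σ r i).mul_right _).locSum_add
      ((locFin_ffAnni k σ r _).smul _), (locFin_ffAnni k σ r _).locSum_smul]
  rfl

/-- The Feigin–Fuchs currents are descendants of the undeformed vertex operators. -/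
theorem descendant_ffCurrent (k σ r : ℂ) :
    Descendant k (zeroBG r) (derivCharge σ) (vertex0 k r) (ffCurrent k σ r) := by
  constructor
  · intro X n i
    rw [ffCurrent_eq, ffCurrent_eq, add_mul, mul_add, ffCrea_mul_mode, ffAnni_mul_mode, smul_add]
    abel
  · intro X n i
    rw [ffCurrent_eq, ffCurrent_eq, add_mul, mul_add, mode_mul_ffCrea, mode_mul_ffAnni, smul_add]
    abel

lemma vev_locSum {ι : Type} {T : ι → Op} (hT : LocFin T) (p q : Boson → ℂ) :
    vev p q (locSum T) = ∑ᶠ i, vev p q (T i) := by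
  have h : ∀ x : Fk, (MvPolynomial.constantCoeff (x q) : ℂ) =
      ((MvPolynomial.constantCoeff (R := ℂ) (σ := Boson × ℕ)).toAddMonoidHom.comp
        (Finsupp.applyAddHom q)) x := fun x => rfl
  simp only [vev_apply, h]
  rw [locSum_apply hT, AddMonoidHom.map_finsum _ (hT _)]

lemma vev_mul_mode_succ (p q : Boson → ℂ) (X : Boson) (n : ℕ) (T : Op) :
    vev p q (T * mode k X (n + 1)) = 0 := by
  rw [vev_apply, Module.End.mul_apply, mode_succ, LinearMap.smul_apply, derOp_single,
    MvPolynomial.pderiv_one, Finsupp.single_zero, smul_zero, map_zero]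
  exact map_zero _

lemma vev_mul_momentum (p q : Boson → ℂ) (X : Boson) (T : Op) :
    vev p q (T * momentum X) = p X * vev p q T := by
  rw [vev_apply, vev_apply, Module.End.mul_apply, momentum_single, ← Finsupp.smul_single, map_smul,
    Finsupp.smul_apply, MvPolynomial.constantCoeff_smul, smul_eq_mul]

/-- Only the zero mode of `∂(α + σβ)` contributes to the vacuum matrix coefficients. -/
lemma vev_ffCurrent (k σ r : ℂ) (p q : Boson → ℂ) (i : ℂ) : vev p q (ffCurrent k σ r i) =
    (p Boson.alpha + σ * p Boson.beta) * vev p q (vertex0 k r (i + 1)) := by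
  rw [ffCurrent_eq, map_add, ffCrea, ffAnni, vev_locSum (locFin_ffCrea k σ r i),
    vev_locSum (locFin_ffAnni k σ r i), finsum_eq_zero_of_forall_eq_zero, zero_add,
    finsum_eq_single _ 0]
  · rw [derivMode, Nat.cast_zero, Nat.cast_zero, mode_zero, mode_zero, mul_add, map_add,
      mul_smul_comm, map_smul, vev_mul_momentum, vev_mul_momentum, add_zero, smul_eq_mul]
    ring
  · intro n hn
    obtain ⟨n, rfl⟩ := Nat.exists_eq_succ_of_ne_zero hn
    rw [derivMode, mul_add, map_add, mul_smul_comm, map_smul]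
    have h := fun X => vev_mul_mode_succ (k := k) p q X n (vertex0 k r (i + (n.succ : ℕ) + 1))
    push_cast at h ⊢
    rw [h, h, smul_zero, add_zero]
  · intro n
    rw [derivMode, add_mul, map_add, smul_mul_assoc, map_smul, vev_mode_neg_mul, vev_mode_neg_mul,
      smul_zero, add_zero]

/-- The limit of `e(u)` is the current `E(u)`. -/
theorem coeff_zero_currentE (hk0 : k ≠ 0) (hk2 : k ≠ -2) (i : ℂ) :
    PowerSeries.coeff 0 (currentE k i) = ffCurrent k 1 (2 / k) i := by
  rw [coeff_currentE, neg_sub]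
  have hk := kappa_ne_zero hk0 hk2
  have h₁ : ∀ i, (dataE₁ k).ord k 0 i = vertex0 k (2 / k) i := fun i => by
    rw [vertex0_eq, ord_zero_eq hk (neutral_E₁ k) (neutral_data0 _) rfl]
  have h₂ : ∀ i, (dataE₂ k).ord k 0 i = vertex0 k (2 / k) i := fun i => by
    rw [vertex0_eq, ord_zero_eq hk (neutral_E₂ k) (neutral_data0 _) rfl]
  refine Descendant.eq hk (descendant_sub (neutral_E₂ k) (neutral_E₁ k) rfl h₂ h₁ ?_ ?_)
    (descendant_ffCurrent k 1 (2 / k)) (fun p q i => ?_) i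
  · intro X
    cases X <;> simp [moment, dataE₁, dataE₂, derivCharge] <;> ring
  · intro X
    cases X <;> simp [moment, dataE₁, dataE₂, derivCharge] <;> ring
  · rw [vev_ffCurrent, map_sub, vev_ord_one k (neutral_E₁ k), vev_ord_one k (neutral_E₂ k), h₁, h₂,
      ← sub_mul]
    congr 1
    simp [moment, dataE₁, dataE₂]
    ring

/-- The limit of `f(u)` is the current `F(u)`. -/
theorem coeff_zero_currentF (hk0 : k ≠ 0) (hk2 : k ≠ -2) (i : ℂ) :
    PowerSeries.coeff 0 (currentF k i) = ffCurrent k (-1) (-(2 / k)) i := by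
  rw [coeff_currentF]
  have hk := kappa_ne_zero hk0 hk2
  have hk2' : k + 2 ≠ 0 := fun h => hk2 (eq_neg_of_add_eq_zero_left h)
  have h₁ : ∀ i, (dataF₁ k).ord k 0 i = vertex0 k (-(2 / k)) i := fun i => by
    rw [vertex0_eq, ord_zero_eq hk (neutral_F₁ k) (neutral_data0 _) rfl]
  have h₂ : ∀ i, (dataF₂ k).ord k 0 i = vertex0 k (-(2 / k)) i := fun i => by
    rw [vertex0_eq, ord_zero_eq hk (neutral_F₂ k) (neutral_data0 _) rfl]
  refine Descendant.eq hk (descendant_sub (neutral_F₁ k) (neutral_F₂ k) rfl h₁ h₂ ?_ ?_)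
    (descendant_ffCurrent k (-1) (-(2 / k))) (fun p q i => ?_) i
  · intro X
    cases X <;> simp [moment, dataF₁, dataF₂, derivCharge] <;> field_simp <;> ring
  · intro X
    cases X <;> simp [moment, dataF₁, dataF₂, derivCharge] <;> field_simp <;> ring
  · rw [vev_ffCurrent, map_sub, vev_ord_one k (neutral_F₁ k), vev_ord_one k (neutral_F₂ k), h₁, h₂,
      ← sub_mul]
    congr 1
    simp [moment, dataF₁, dataF₂]
    field_simp
    ring

lemma vev_mode_gamma (p q : Boson → ℂ) (n : ℤ) : vev p q (mode k Boson.gamma (-n - 1)) =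
    if n = -1 then p Boson.gamma * vev p q 1 else 0 := by
  rcases int_cases (-n - 1) with ⟨m, hm⟩ | hm | ⟨m, hm⟩
  · rw [hm, if_neg (by omega)]
    simpa using vev_mode_neg_mul (k := k) p q Boson.gamma m 1
  · rw [hm, if_pos (by omega), mode_zero]
    simpa using vev_mul_momentum p q Boson.gamma 1
  · rw [hm, if_neg (by omega)]
    simpa using vev_mul_mode_succ (k := k) p q Boson.gamma m 1

lemma sub_sub_mul_comm {R : Type} [Ring R] {P M G a x y z : R} (hP : P * a = a * P + x)
    (hM : M * a = a * M + y) (hG : a * G = G * a + z) (h : x - y + z = 0) :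
    (P - M - G) * a = a * (P - M - G) := by
  rw [sub_mul, sub_mul, mul_sub, mul_sub, hP, hM, hG, eq_neg_of_add_eq_zero_right h]
  abel

lemma mul_sub_sub_comm {R : Type} [Ring R] {P M G a x y z : R} (hP : a * P = P * a + x)
    (hM : a * M = M * a + y) (hG : a * G = G * a + z) (h : x - y = z) :
    a * (P - M - G) = (P - M - G) * a := by
  rw [sub_mul, sub_mul, mul_sub, mul_sub, hP, hM, hG, ← h]
  abel

/-- The limit of `(h⁺(u) - h⁻(u)) / ħ` is `2 ∂γ(u)`. -/
theorem coeff_one_hPlus_sub_hMinus (hk0 : k ≠ 0) (hk2 : k ≠ -2) (n : ℤ) :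
    PowerSeries.coeff 1 (hPlus k n - hMinus k n) = (2 : ℂ) • mode k Boson.gamma (-n - 1) := by
  have hk := kappa_ne_zero hk0 hk2
  have hk2' : k + 2 ≠ 0 := fun h => hk2 (eq_neg_of_add_eq_zero_left h)
  have hP : ∀ i, (dataHP k).ord k 0 i = if i = 0 then 1 else 0 := fun i =>
    ord_zero_eq_one hk (neutral_HP k) rfl i
  have hM : ∀ i, (dataHM k).ord k 0 i = if i = 0 then 1 else 0 := fun i =>
    ord_zero_eq_one hk (neutral_HM k) rfl i
  have hla : ∀ X, moment (dataHP k).la X - moment (dataHM k).la X =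
      if X = Boson.gamma then 2 else 0 := by
    intro X
    cases X <;> simp [moment, dataHP, dataHM]
  have hlc : ∀ X, moment (dataHP k).lc X - moment (dataHM k).lc X =
      if X = Boson.gamma then 2 else 0 := by
    intro X
    cases X <;> simp [moment, dataHP, dataHM] <;> field_simp <;> ring
  rw [map_sub, coeff_hPlus, coeff_hMinus]
  have hcomm : ∀ (X : Boson) (a : ℤ), mode k X a * ((2 : ℂ) • mode k Boson.gamma (-n - 1)) =
      (2 : ℂ) • mode k Boson.gamma (-n - 1) * mode k X a +
        (kappa k X * a * (if X = Boson.gamma then 2 else 0)) •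
          (if a - n - 1 = 0 then (1 : Op) else 0) := by
    intro X a
    rw [mul_smul_comm, smul_mul_assoc, mode_mul_mode, smul_add, smul_smul]
    congr 1
    by_cases h1 : X = Boson.gamma
    · by_cases h2 : a - n - 1 = 0
      · rw [if_pos ⟨h1, by omega⟩, if_pos h1, if_pos h2, mul_comm]
      · rw [if_neg (fun h => h2 (by omega)), if_neg h2, mul_zero, zero_smul, smul_zero]
    · rw [if_neg (fun h => h1 h.1), if_neg h1, mul_zero, mul_zero, zero_smul, zero_smul]
  -- The difference of the two sides commutes with all modes.
  have key : Primary k (0 : Boson → ℂ) fun _ : ℂ => (dataHP k).ord k 1 n - (dataHM k).ord k 1 n -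
      (2 : ℂ) • mode k Boson.gamma (-n - 1) := by
    have hr : ∀ X, kappa k X * (dataHP k).r X = 0 := fun X => mul_zero _
    have hr' : ∀ X, kappa k X * (dataHM k).r X = 0 := fun X => mul_zero _
    constructor
    · intro X m i
      have h₁ := ord_one_creation k (neutral_HP k) X m n
      have h₂ := ord_one_creation k (neutral_HM k) X m n
      rw [hr, neg_zero, zero_smul, add_zero, hP] at h₁
      rw [hr', neg_zero, zero_smul, add_zero, hM] at h₂
      rw [Pi.zero_apply, mul_zero, neg_zero, zero_smul, add_zero]
      refine sub_sub_mul_comm h₁ h₂ (hcomm X _) ?_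
      rw [← sub_smul, ← mul_sub, hla]
      have : (n : ℂ) + m + 2 = 0 ↔ -(m : ℤ) - 1 - n - 1 = 0 := by
        rw [show (n : ℂ) + m + 2 = ((n + m + 2 : ℤ) : ℂ) by push_cast; ring, Int.cast_eq_zero]
        omega
      simp only [this]
      rw [← add_smul]
      push_cast
      ring_nf
      exact zero_smul _ _
    · intro X m i
      have h₁ := ord_one_annihilation k (neutral_HP k) X m n
      have h₂ := ord_one_annihilation k (neutral_HM k) X m n
      rw [hr, zero_smul, add_zero, hP] at h₁
      rw [hr', zero_smul, add_zero, hM] at h₂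
      rw [Pi.zero_apply, mul_zero, zero_smul, add_zero]
      refine mul_sub_sub_comm h₁ h₂ (hcomm X _) ?_
      rw [← sub_smul, ← mul_sub, hlc]
      have : (n : ℂ) - m = 0 ↔ (m : ℤ) + 1 - n - 1 = 0 := by
        rw [show (n : ℂ) - m = ((n - m : ℤ) : ℂ) by push_cast; ring, Int.cast_eq_zero]
        omega
      simp only [this]
      push_cast
      rfl
  refine sub_eq_zero.1 (key.eq_zero hk (fun p q i => ?_) 0)
  rw [map_sub, map_sub, vev_ord_one k (neutral_HP k), vev_ord_one k (neutral_HM k), hP, map_smul,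
    vev_mode_gamma]
  have h1 : ((n : ℂ) + 1 = 0) ↔ n = -1 := by
    rw [show (n : ℂ) + 1 = ((n + 1 : ℤ) : ℂ) by push_cast; ring, Int.cast_eq_zero]
    omega
  simp only [h1]
  have h2 : ∀ X, moment (dataHM k).la X = 0 := fun X => rfl
  have h3 : moment (dataHP k).la Boson.alpha = 0 ∧ moment (dataHP k).la Boson.beta = 0 ∧
      moment (dataHP k).la Boson.gamma = 2 := by simp [moment, dataHP]
  rw [h2, h2, h2, h3.1, h3.2.1, h3.2.2]
  split_ifs
  · simp [mul_assoc]
  · simp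

end Limit

/-! ### The affine Lie algebra at `ħ = 0` -/

section Affine

lemma coeff_zero_mul {R : Type} [Ring R] (a b : PowerSeries R) :
    PowerSeries.coeff 0 (a * b) = PowerSeries.coeff 0 a * PowerSeries.coeff 0 b := by
  rw [PowerSeries.coeff_mul, Finset.Nat.antidiagonal_zero, Finset.sum_singleton]

section Commutator

variable {M : Type} [AddCommGroup M] [Module ℂ M] {V : Submodule ℂ M} {a : Field1 M}

lemma coeff_zero_mulLin (r : ℂ) (G : Field2 M) (i j : ℂ) :
    PowerSeries.coeff 0 (mulLin r G i j) =
      PowerSeries.coeff 0 (G (i - 1) j) - PowerSeries.coeff 0 (G i (j - 1)) := by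
  have h : PowerSeries.coeff 0 (r • (PowerSeries.X * G i j)) =
      r • PowerSeries.coeff 0 (PowerSeries.X * G i j) := rfl
  rw [mulLin, map_add, map_sub, h, PowerSeries.coeff_zero_X_mul, smul_zero, add_zero]

/-- At `ħ = 0` the exchange relation of a field with itself says that the commutator of `a_i` and
`a_j` depends only on `i + j`. -/
lemma commutator_shift {p q : ℂ} (h : EqOn2 V (mulLins [q] (prodUV a a)) (mulLins [p] (prodVU a a)))
    (i j : ℂ) {x : M} (hx : x ∈ V) :
    (PowerSeries.coeff 0 (a i) * PowerSeries.coeff 0 (a (j + 1)) -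
      PowerSeries.coeff 0 (a (j + 1)) * PowerSeries.coeff 0 (a i)) x =
    (PowerSeries.coeff 0 (a (i + 1)) * PowerSeries.coeff 0 (a j) -
      PowerSeries.coeff 0 (a j) * PowerSeries.coeff 0 (a (i + 1))) x := by
  have := h (i + 1) (j + 1) 0 x hx
  change PowerSeries.coeff 0 (mulLin q (prodUV a a) (i + 1) (j + 1)) x =
    PowerSeries.coeff 0 (mulLin p (prodVU a a) (i + 1) (j + 1)) x at this
  rw [coeff_zero_mulLin, coeff_zero_mulLin, prodUV, prodUV, prodVU, prodVU, coeff_zero_mul,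
    coeff_zero_mul, coeff_zero_mul, coeff_zero_mul, add_sub_cancel_right, add_sub_cancel_right,
    LinearMap.sub_apply, LinearMap.sub_apply] at this
  rw [LinearMap.sub_apply, LinearMap.sub_apply, sub_eq_sub_iff_sub_eq_sub]
  exact this

lemma commutator_shift_int {p q : ℂ}
    (h : EqOn2 V (mulLins [q] (prodUV a a)) (mulLins [p] (prodVU a a)))
    (n : ℤ) (i j : ℂ) {x : M} (hx : x ∈ V) :
    (PowerSeries.coeff 0 (a i) * PowerSeries.coeff 0 (a j) -
      PowerSeries.coeff 0 (a j) * PowerSeries.coeff 0 (a i)) x =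
    (PowerSeries.coeff 0 (a (i + n)) * PowerSeries.coeff 0 (a (j - n)) -
      PowerSeries.coeff 0 (a (j - n)) * PowerSeries.coeff 0 (a (i + n))) x := by
  induction n using Int.induction_on with
  | zero => rw [Int.cast_zero, add_zero, sub_zero]
  | succ n ih =>
    have := commutator_shift h (i + n) (j - n - 1) hx
    rw [sub_add_cancel] at this
    push_cast at ih ⊢
    rw [ih, this, sub_sub, add_assoc]
  | pred n ih =>
    have := commutator_shift h (i - n - 1) (j + n) hx
    rw [sub_add_cancel] at this
    push_cast at ih ⊢
    rw [ih, sub_neg_eq_add, ← sub_eq_add_neg, ← this, show i + (-(n : ℂ) - 1) = i - n - 1 by ring,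
      show j - (-(n : ℂ) - 1) = j + n + 1 by ring]

/-- The commutators vanish at `ħ = 0`: as functions of the sum of the two indices they are symmetric,
but they are also antisymmetric. -/
lemma commutator_eq_zero {p q : ℂ}
    (h : EqOn2 V (mulLins [q] (prodUV a a)) (mulLins [p] (prodVU a a)))
    (n : ℤ) (j : ℂ) {x : M} (hx : x ∈ V) :
    (PowerSeries.coeff 0 (a (j + n)) * PowerSeries.coeff 0 (a j) -
      PowerSeries.coeff 0 (a j) * PowerSeries.coeff 0 (a (j + n))) x = 0 := by
  have := commutator_shift_int h n j (j + n) hx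
  rw [add_sub_cancel_right, ← neg_sub, LinearMap.neg_apply] at this
  have h2 : (2 : ℂ) • ((PowerSeries.coeff 0 (a (j + n)) * PowerSeries.coeff 0 (a j) -
      PowerSeries.coeff 0 (a j) * PowerSeries.coeff 0 (a (j + n))) x) = 0 := by
    rw [two_smul]
    nth_rewrite 1 [← this]
    exact neg_add_cancel _
  exact (smul_eq_zero.1 h2).resolve_left two_ne_zero

end Commutator

variable {k : ℂ}

lemma commutator_currentE (hk0 : k ≠ 0) (hk2 : k ≠ -2) (l s t i j : ℂ) {x : Fk}
    (hx : x ∈ fock k l s t)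
    (h : EqOn2 (fock k l s t) (mulLins [-1] (prodUV (currentE k) (currentE k)))
      (mulLins [1] (prodVU (currentE k) (currentE k)))) :
    (PowerSeries.coeff 0 (currentE k i) * PowerSeries.coeff 0 (currentE k j) -
      PowerSeries.coeff 0 (currentE k j) * PowerSeries.coeff 0 (currentE k i)) x = 0 := by
  have hm : ∀ i : ℂ, (¬ ∃ n : ℤ, i = (s + t) / k + n) → ∀ j : ℂ,
      PowerSeries.coeff 0 (currentE k i) x = 0 ∧
      PowerSeries.coeff 0 (currentE k i) (PowerSeries.coeff 0 (currentE k j) x) = 0 := by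
    intro i hi j
    refine ⟨modes_currentE hk0 hk2 0 hi hx, modes_currentE hk0 hk2 0 (s := s - 2) (t := t + 2) ?_
      (currentE_mem hk0 hk2 0 j hx)⟩
    rwa [show s - 2 + (t + 2) = s + t by ring]
  rw [LinearMap.sub_apply, Module.End.mul_apply, Module.End.mul_apply]
  by_cases hi : ∃ n : ℤ, i = (s + t) / k + n
  · by_cases hj : ∃ n : ℤ, j = (s + t) / k + n
    · obtain ⟨n, rfl⟩ := hi
      obtain ⟨m, rfl⟩ := hj
      have := commutator_eq_zero h (n - m) ((s + t) / k + m) hx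
      rw [show (s + t) / k + (m : ℂ) + ((n - m : ℤ) : ℂ) = (s + t) / k + n by push_cast; ring]
        at this
      exact this
    · rw [(hm j hj i).1, (hm j hj i).2, map_zero, sub_zero]
  · rw [(hm i hi j).1, (hm i hi j).2, map_zero, sub_zero]

lemma commutator_currentF (hk0 : k ≠ 0) (hk2 : k ≠ -2) (l s t i j : ℂ) {x : Fk}
    (hx : x ∈ fock k l s t)
    (h : EqOn2 (fock k l s t) (mulLins [1] (prodUV (currentF k) (currentF k)))
      (mulLins [-1] (prodVU (currentF k) (currentF k)))) :
    (PowerSeries.coeff 0 (currentF k i) * PowerSeries.coeff 0 (currentF k j) -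
      PowerSeries.coeff 0 (currentF k j) * PowerSeries.coeff 0 (currentF k i)) x = 0 := by
  have hm : ∀ i : ℂ, (¬ ∃ n : ℤ, i = -((s + t) / k) + n) → ∀ j : ℂ,
      PowerSeries.coeff 0 (currentF k i) x = 0 ∧
      PowerSeries.coeff 0 (currentF k i) (PowerSeries.coeff 0 (currentF k j) x) = 0 := by
    intro i hi j
    refine ⟨modes_currentF hk0 hk2 0 hi hx, modes_currentF hk0 hk2 0 (s := s + 2) (t := t - 2) ?_
      (currentF_mem hk0 hk2 0 j hx)⟩
    rwa [show s + 2 + (t - 2) = s + t by ring]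
  rw [LinearMap.sub_apply, Module.End.mul_apply, Module.End.mul_apply]
  by_cases hi : ∃ n : ℤ, i = -((s + t) / k) + n
  · by_cases hj : ∃ n : ℤ, j = -((s + t) / k) + n
    · obtain ⟨n, rfl⟩ := hi
      obtain ⟨m, rfl⟩ := hj
      have := commutator_eq_zero h (n - m) (-((s + t) / k) + m) hx
      rw [show -((s + t) / k) + (m : ℂ) + ((n - m : ℤ) : ℂ) = -((s + t) / k) + n by
        push_cast; ring] at this
      exact this
    · rw [(hm j hj i).1, (hm j hj i).2, map_zero, sub_zero]
  · rw [(hm i hi j).1, (hm i hi j).2, map_zero, sub_zero]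

lemma momentum_mul_currentE (k : ℂ) (X : Boson) (N : ℕ) (i : ℂ) :
    momentum X * PowerSeries.coeff N (currentE k i) =
      PowerSeries.coeff N (currentE k i) * momentum X +
        (kappa k X * zeroBG (2 / k) X) • PowerSeries.coeff N (currentE k i) := by
  rw [coeff_currentE, neg_sub, mul_sub, sub_mul, momentum_mul_ord k (neutral_E₁ k),
    momentum_mul_ord k (neutral_E₂ k), smul_sub]
  exact add_sub_add_comm _ _ _ _

lemma momentum_mul_currentF (k : ℂ) (X : Boson) (N : ℕ) (i : ℂ) :
    momentum X * PowerSeries.coeff N (currentF k i) =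
      PowerSeries.coeff N (currentF k i) * momentum X +
        (kappa k X * zeroBG (-(2 / k)) X) • PowerSeries.coeff N (currentF k i) := by
  rw [coeff_currentF, mul_sub, sub_mul, momentum_mul_ord k (neutral_F₁ k),
    momentum_mul_ord k (neutral_F₂ k), smul_sub]
  exact add_sub_add_comm _ _ _ _

/-- The modes of `∂γ` see only the charge of `: ∂(α + σβ)(u) exp{r (β+γ)(u)} :`. -/
lemma mode_gamma_mul_ffCurrent {k σ r : ℂ} (h : ∀ i, momentum Boson.gamma * ffCurrent k σ r i =
      ffCurrent k σ r i * momentum Boson.gamma + (kappa k Boson.gamma * r) • ffCurrent k σ r i)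
    (m : ℤ) (i : ℂ) : mode k Boson.gamma m * ffCurrent k σ r i =
      ffCurrent k σ r i * mode k Boson.gamma m +
        (kappa k Boson.gamma * r) • ffCurrent k σ r (i - m) := by
  rcases int_cases m with ⟨n, rfl⟩ | rfl | ⟨n, rfl⟩
  · have := (descendant_ffCurrent k σ r).creation Boson.gamma n i
    rw [derivCharge, mul_zero, zero_smul, add_zero] at this
    rw [this, add_assoc, neg_smul]
    push_cast
    rw [show i - (-(n : ℂ) - 1) = i + n + 1 by ring]
    rw [zeroBG, neg_add_cancel, add_zero]
  · rw [mode_zero, h, Int.cast_zero, sub_zero]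
  · have := (descendant_ffCurrent k σ r).annihilation Boson.gamma n i
    rw [derivCharge, mul_zero, zero_smul, add_zero] at this
    rw [this]
    push_cast
    rw [sub_sub, zeroBG]

/-- The order `ħ` of the relation for `[e(u), f(v)]` at `ħ = 0`. -/
lemma coeff_one_delta (hk0 : k ≠ 0) (hk2 : k ≠ -2) (lam : ℂ) (i j : ℤ) :
    PowerSeries.coeff 1 (deltaMulU lam k (hPlus k) (lam + i) (-lam + j) -
      deltaMulV lam 0 (hMinus k) (lam + i) (-lam + j)) =
    (2 : ℂ) • mode k Boson.gamma (-i - j - 2) +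
      (if i + j = -2 then k * (-(lam + i) - 1) else 0) • (1 : Op) := by
  have hk := kappa_ne_zero hk0 hk2
  have hP : ∀ i, PowerSeries.coeff 0 (hPlus k i) = if i = 0 then 1 else 0 := fun i => by
    rw [coeff_hPlus, ord_zero_eq_one hk (neutral_HP k) rfl]
  have hlim := coeff_one_hPlus_sub_hMinus hk0 hk2 (i + j + 1)
  rw [map_sub, show (-(i + j + 1) - 1 : ℤ) = -i - j - 2 by ring] at hlim
  have hij : ∀ p : ℂ, -lam + j = -(lam + i - p) - 1 - ((0 : ℕ) : ℂ) ↔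
      p = ((i + j + 1 : ℤ) : ℂ) := by
    intro p
    push_cast
    constructor <;> intro h
    · linear_combination -h
    · rw [h]; ring
  have hij' : ∀ p : ℂ, -lam + j - p = -(lam + i) - 1 - ((0 : ℕ) : ℂ) ↔
      p = ((i + j + 1 : ℤ) : ℂ) := by
    intro p
    push_cast
    constructor <;> intro h
    · linear_combination -h
    · rw [h]; ring
  have s1 : ∑ᶠ p : ℂ, deltaCoeff lam k (lam + i - p) (-lam + j) 0 •
      PowerSeries.coeff 1 (hPlus k p) = PowerSeries.coeff 1 (hPlus k ((i + j + 1 : ℤ) : ℂ)) := by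
    rw [finsum_eq_single _ ((i + j + 1 : ℤ) : ℂ)]
    · rw [deltaCoeff, if_pos ⟨⟨-j - 1, by push_cast; ring⟩, (hij _).2 rfl⟩,
        Ring.choose_zero_right, pow_zero, mul_one, one_smul]
    · intro p hp
      rw [deltaCoeff, if_neg (fun h => hp ((hij p).1 h.2)), zero_smul]
  have s2 : ∑ᶠ p : ℂ, deltaCoeff lam k (lam + i - p) (-lam + j) 1 •
      PowerSeries.coeff 0 (hPlus k p) =
      (if i + j = -2 then k * (-(lam + i) - 1) else 0) • (1 : Op) := by
    rw [finsum_eq_single _ 0]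
    · rw [hP, if_pos rfl, sub_zero, deltaCoeff]
      congr 1
      have : -lam + (j : ℂ) = -(lam + i) - 1 - ((1 : ℕ) : ℂ) ↔ i + j = -2 := by
        rw [← sub_eq_zero, show -lam + (j : ℂ) - (-(lam + i) - 1 - ((1 : ℕ) : ℂ)) =
          ((i + j + 2 : ℤ) : ℂ) by push_cast; ring, Int.cast_eq_zero]
        omega
      by_cases h : i + j = -2
      · rw [if_pos h, if_pos ⟨⟨i, rfl⟩, this.2 h⟩, Ring.choose_one_right, pow_one, mul_comm]
      · rw [if_neg h, if_neg (fun h' => h (this.1 h'.2))]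
    · intro p hp
      rw [hP, if_neg hp, smul_zero]
  have s3 : ∑ᶠ p : ℂ, deltaCoeff lam 0 (lam + i) (-lam + j - p) 0 •
      PowerSeries.coeff 1 (hMinus k p) = PowerSeries.coeff 1 (hMinus k ((i + j + 1 : ℤ) : ℂ)) := by
    rw [finsum_eq_single _ ((i + j + 1 : ℤ) : ℂ)]
    · rw [deltaCoeff, if_pos ⟨⟨i, rfl⟩, (hij' _).2 rfl⟩,
        Ring.choose_zero_right, pow_zero, mul_one, one_smul]
    · intro p hp
      rw [deltaCoeff, if_neg (fun h => hp ((hij' p).1 h.2)), zero_smul]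
  have s4 : ∑ᶠ p : ℂ, deltaCoeff lam 0 (lam + i) (-lam + j - p) 1 •
      PowerSeries.coeff 0 (hMinus k p) = 0 := by
    refine finsum_eq_zero_of_forall_eq_zero fun p => ?_
    rw [deltaCoeff, pow_one, mul_zero, ite_self, zero_smul]
  rw [map_sub, deltaMulU, deltaMulV, PowerSeries.coeff_mk, PowerSeries.coeff_mk,
    Finset.Nat.antidiagonal_succ, Finset.sum_cons, Finset.sum_cons, Finset.Nat.antidiagonal_zero,
    Finset.map_singleton, Finset.sum_singleton, Finset.sum_singleton, ← hlim]
  change (∑ᶠ p : ℂ, deltaCoeff lam k (lam + i - p) (-lam + j) 0 •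
      PowerSeries.coeff 1 (hPlus k p)) + (∑ᶠ p : ℂ, deltaCoeff lam k (lam + i - p) (-lam + j) 1 •
      PowerSeries.coeff 0 (hPlus k p)) - ((∑ᶠ p : ℂ, deltaCoeff lam 0 (lam + i) (-lam + j - p) 0 •
      PowerSeries.coeff 1 (hMinus k p)) +
        ∑ᶠ p : ℂ, deltaCoeff lam 0 (lam + i) (-lam + j - p) 1 •
      PowerSeries.coeff 0 (hMinus k p)) = _
  rw [s1, s2, s3, s4, add_zero]
  abel

/-- The Feigin–Fuchs currents satisfy the relations of the affine Lie algebra, as the leading terms of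
the relations of the Yangian double. -/
theorem isAffineSl2_ffCurrent (hk0 : k ≠ 0) (hk2 : k ≠ -2) (l s t : ℂ)
    (hE : EqOn2 (fock k l s t) (mulLins [-1] (prodUV (currentE k) (currentE k)))
      (mulLins [1] (prodVU (currentE k) (currentE k))))
    (hF : EqOn2 (fock k l s t) (mulLins [1] (prodUV (currentF k) (currentF k)))
      (mulLins [-1] (prodVU (currentF k) (currentF k)))) :
    IsAffineSl2 k ((s + t) / k) (fock k l s t)
      (ffCurrent k 1 (2 / k)) (ffCurrent k (-1) (-(2 / k)))
      (fun n => (2 : ℂ) • mode k Boson.gamma n) where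
  modes_E i hi x hx := by
    rw [← coeff_zero_currentE hk0 hk2]
    exact modes_currentE hk0 hk2 0 hi hx
  modes_F i hi x hx := by
    rw [← coeff_zero_currentF hk0 hk2]
    exact modes_currentF hk0 hk2 0 hi hx
  H_H m n x _ := by
    rw [smul_mul_smul_comm, smul_mul_smul_comm, mode_mul_mode, ← smul_sub, add_sub_cancel_left]
    by_cases h : m + n = 0
    · rw [if_pos ⟨rfl, h⟩, if_pos h, smul_smul, kappa, LinearMap.smul_apply]
      refine congrArg (· • x) ?_
      ring
    · rw [if_neg (fun h' => h h'.2), if_neg h, zero_smul, smul_zero, LinearMap.zero_apply]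
  H_E m i x _ := by
    rw [smul_mul_assoc, mul_smul_comm, ← smul_sub, mode_gamma_mul_ffCurrent (fun i => by
      rw [← coeff_zero_currentE hk0 hk2]
      exact momentum_mul_currentE k Boson.gamma 0 i), add_sub_cancel_left, smul_smul, kappa,
      show (2 : ℂ) * (k / 2 * (2 / k)) = 2 by field_simp]
    rfl
  H_F m i x _ := by
    rw [smul_mul_assoc, mul_smul_comm, ← smul_sub, mode_gamma_mul_ffCurrent (fun i => by
      rw [← coeff_zero_currentF hk0 hk2]
      exact momentum_mul_currentF k Boson.gamma 0 i), add_sub_cancel_left, smul_smul, kappa,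
      show (2 : ℂ) * (k / 2 * -(2 / k)) = -2 by field_simp]
    rfl
  E_E i j x hx := by
    rw [← coeff_zero_currentE hk0 hk2, ← coeff_zero_currentE hk0 hk2]
    exact commutator_currentE hk0 hk2 l s t i j hx hE
  F_F i j x hx := by
    rw [← coeff_zero_currentF hk0 hk2, ← coeff_zero_currentF hk0 hk2]
    exact commutator_currentF hk0 hk2 l s t i j hx hF
  E_F i j x hx := by
    have h := comm_currentE_currentF hk0 hk2 l s t ((s + t) / k + i) (-((s + t) / k) + j) 1 x hx
    rw [coeff_one_delta hk0 hk2, PowerSeries.coeff_succ_X_mul, map_sub, prodUV, prodVU,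
      coeff_zero_mul, coeff_zero_mul, coeff_zero_currentE hk0 hk2, coeff_zero_currentF hk0 hk2,
      LinearMap.add_apply] at h
    rw [h]
    refine congrArg _ ?_
    split_ifs
    · rfl
    · rw [zero_smul, LinearMap.zero_apply]

end Affine

end

end YangianFF

open YangianFF in
theorem mainTheorem1 (k : ℂ) (hk0 : k ≠ 0) (hk2 : k ≠ -2) :
    -- the divisions by `ħ` in the definitions of `e(u)` and `f(u)` are exact
    (∀ i : ℂ, PowerSeries.X * currentE k i = -(eFirst k i - eSecond k i)) ∧
    (∀ i : ℂ, PowerSeries.X * currentF k i = fFirst k i - fSecond k i) ∧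
    -- the operators act between the Fock spaces `F_{l,s,t}`
    (∀ (l s t i : ℂ) (N : ℕ), ∀ x ∈ fock k l s t,
      PowerSeries.coeff N (currentE k i) x ∈ fock k l (s - 2) (t + 2) ∧
      PowerSeries.coeff N (currentF k i) x ∈ fock k l (s + 2) (t - 2) ∧
      PowerSeries.coeff N (hPlus k i) x ∈ fock k l s t ∧
      PowerSeries.coeff N (hMinus k i) x ∈ fock k l s t ∧
      dOp k x ∈ fock k l s t) ∧
    -- the defining relations of the Yangian double with central charge `c = k`
    (∀ l s t : ℂ, IsYangianDouble k ((s + t) / k) (fock k l s t)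
      (currentE k) (currentF k) (hPlus k) (hMinus k) (dOp k)) ∧
    -- the limit `ħ → 0` of `e(u)`, `f(u)` and `(h⁺(u) - h⁻(u)) / ħ`
    (∀ i : ℂ, PowerSeries.coeff 0 (currentE k i) = ffCurrent k 1 (2 / k) i) ∧
    (∀ i : ℂ, PowerSeries.coeff 0 (currentF k i) = ffCurrent k (-1) (-(2 / k)) i) ∧
    (∀ n : ℤ, PowerSeries.coeff 1 (hPlus k n - hMinus k n) =
      (2 : ℂ) • mode k Boson.gamma (-n - 1)) ∧
    -- the limit currents form the affine Lie algebra of `sl₂` at level `k`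
    (∀ l s t : ℂ, IsAffineSl2 k ((s + t) / k) (fock k l s t)
      (ffCurrent k 1 (2 / k)) (ffCurrent k (-1) (-(2 / k)))
      (fun n => (2 : ℂ) • mode k Boson.gamma n)) := by
  have hee := fun l s t : ℂ => (commutes_currentE hk0 hk2).exchange (field_currentE hk0 hk2 l s t)
    (field_currentE hk0 hk2 l s t)
  have hff := fun l s t : ℂ => (commutes_currentF hk0 hk2).exchange (field_currentF hk0 hk2 l s t)
    (field_currentF hk0 hk2 l s t)
  refine ⟨X_mul_currentE hk0 hk2, X_mul_currentF hk0 hk2,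
    fun l s t i N x hx => ⟨currentE_mem hk0 hk2 N i hx, currentF_mem hk0 hk2 N i hx,
      hPlus_mem hk0 hk2 N i hx, hMinus_mem hk0 hk2 N i hx, dOp_mem hk0 hk2 hx⟩,
    fun l s t => ?_, coeff_zero_currentE hk0 hk2, coeff_zero_currentF hk0 hk2,
    coeff_one_hPlus_sub_hMinus hk0 hk2,
    fun l s t => isAffineSl2_ffCurrent hk0 hk2 l s t (hee l s t).1 (hff l s t).1⟩
  have he := field_currentE hk0 hk2 l s t
  have hf := field_currentF hk0 hk2 l s t
  have hp := field_hPlus hk0 hk2 l s t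
  have hm := field_hMinus hk0 hk2 l s t
  exact
    { field_e := he
      field_f := hf
      field_hp := hp
      field_hm := hm
      modes_e := fun i N hi x hx => modes_currentE hk0 hk2 N hi hx
      modes_f := fun i N hi x hx => modes_currentF hk0 hk2 N hi hx
      modes_hp := fun i N hi x _ => modes_hPlus hk0 hk2 hi x
      modes_hm := fun i N hi x _ => modes_hMinus hk0 hk2 hi x
      d_e := translation_currentE hk0 hk2
      d_f := translation_currentF hk0 hk2
      d_hp := translation_hPlus hk0 hk2
      d_hm := translation_hMinus hk0 hk2
      e_e := hee l s t
      f_f := hff l s t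
      hp_e := (commutes_hPlus_currentE hk0 hk2).exchange hp he
      hm_e := (commutes_hMinus_currentE hk0 hk2).exchange hm he
      hp_f := (commutes_hPlus_currentF hk0 hk2).exchange hp hf
      hm_f := (commutes_hMinus_currentF hk0 hk2).exchange hm hf
      hp_hp := Commutes.exchange (by
        rw [toDist_hPlus]
        exact commutes_HP_HP hk0 hk2) hp hp
      hm_hm := Commutes.exchange (by
        rw [toDist_hMinus]
        exact commutes_HM_HM hk0 hk2) hm hm
      hp_hm := Commutes.exchange (by
        rw [toDist_hPlus, toDist_hMinus]
        exact commutes_HP_HM hk0 hk2) hp hm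
      e_f := comm_currentE_currentF hk0 hk2 l s t }
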